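/- Let $\mathbb{F}$ be a field of characteristic two, $Q$ a finite group and $V$ a finite-dimensional $\mathbb{F}$-vector space with a linear left $Q$-action; let $Q$ act on $V^*$ by $(qf)(v)=f(q^{-1}v)$. Let $\Lambda=\Lambda(V)$ be the exterior algebra, concentrated in degree $0$, and let $S=\mathrm{Sym}(V^*)$ be the symmetric algebra, graded with $V^*$ in degree $1$, both with the induced $Q$-actions. Let $\Lambda\ast Q$ and $S\ast Q$ be the skew group algebras, where $(aq)(bp)=a\,q(b)\,qp$; here $S\ast Q$ is a differential graded (dg) algebra with zero differential and with $Q$ in degree $0$. All modules are right modules, dg modules and complexes are graded cohomologically, and $D(-)$ denotes the derived category (the localization at quasi-isomorphisms) with its usual shift and distinguished triangles. For a basis $y_1,\dots,y_n$ of $V$ with dual basis $x_1,\dots,x_n$, let $\Lambda\tilde\otimes_{\mathbb{F}} S$ be the complex of left $\Lambda\ast Q$-modules $\Lambda\otimes_{\mathbb{F}} S$ with $d(c\otimes f)=\sum_i c y_i\otimes x_i f$ and diagonal $Q$-action. Let $\varepsilon^*=\mathrm{Hom}_{\Lambda^{\mathrm{op}}}(\Lambda\tilde\otimes_{\mathbb{F}}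 S,\Lambda)$ be the hom complex of left $\Lambda$-linear maps, with differential $f\mapsto f\circ d$, right $\Lambda$-action $(fa)(x)=f(x)a$, $S$-action $(sf)(x)=f(sx)$ and right $Q$-action $(fq)(x)=q^{-1}f(qx)$. For a dg $S\ast Q$-module $M$, the tensor product $M\otimes_S\varepsilon^*$ is a complex of $\Lambda\ast Q$-modules through the $\Lambda$-action on $\varepsilon^*$ and the diagonal $Q$-action. For a complex $C^*$ of $\Lambda\ast Q$-modules, the hom complex $\mathrm{Hom}_\Lambda(\varepsilon^*,C^*)$ is a dg $S\ast Q$-module through $(fs)(e)=f(se)$ and $(fq)(e)=f(eq^{-1})q$. Let $D_{S\text{-perf}}(S\ast Q)\subset D(S\ast Q)$ be the full subcategory of the objects isomorphic to dg modules whose underlying graded $S$-module is free and finitely generated, and let $D^{hf}_{S\text{-perf}}(S\ast Q)$ be the full subcategory of those of them with finite-dimensional total homology over $\mathbb{F}$. Let $D^b(\mathrm{mod}\,\Lambda\ast Q)$, $D_{\Lambda\text{-perf}}(\Lambda\ast Q)$ and $D_{\mathrm{perf}}(\Lambda\ast Q)$ be the full subcategories of $D(\Lambda\ast Q)$ of the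 objects isomorphic to bounded complexes of, respectively, finitely generated $\Lambda\ast Q$-modules, $\Lambda\ast Q$-modules whose underlying $\Lambda$-modules are finitely generated and projective, and finitely generated projective $\Lambda\ast Q$-modules. Then the left derived functor $-\otimes^L_S\varepsilon^*\colon D(S\ast Q)\to D(\Lambda\ast Q)$ and the right derived functor $R\mathrm{Hom}_\Lambda(\varepsilon^*,-)\colon D(\Lambda\ast Q)\to D(S\ast Q)$ exist and are exact; they form an adjunction $(-\otimes^L_S\varepsilon^*,\,R\mathrm{Hom}_\Lambda(\varepsilon^*,-))$, compatible with shifts, whose counit is induced by the evaluation $f\otimes e\mapsto f(e)$; the subcategories below are triangulated; and this adjunction restricts to equivalences of triangulated categories $$D_{S\text{-perf}}(S\ast Q)\rightleftarrows D^b(\mathrm{mod}\,\Lambda\ast Q)\qquad\text{and}\qquad D^{hf}_{S\text{-perf}}(S\ast Q)\rightleftarrows D_{\Lambda\text{-perf}}(\Lambda\ast Q).$$ If $|Q|$ is odd, it also restricts to an equivalence of triangulated categories $$D^{hf}_{S\text{-perf}}(S\ast Q)\rightleftarrows D_{\mathrm{perf}}(\Lambda\ast Q).$$ -/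

import Mathlib

open CategoryTheory MulOpposite TensorProduct DirectSum

universe w u

noncomputable section

/-! ## Differential graded modules over a graded ring

`R` is a ring with a family `𝒜` of additive subgroups (its homogeneous parts), viewed as a dg ring
with zero differential. -/

/-- A right dg module over a graded ring `(R, 𝒜)` with zero differential: a right `R`-module
which is the internal direct sum of its homogeneous parts `deg i`, with
`deg i · 𝒜 j ⊆ deg (i + j)`, and a differential `d` of degree `1`.  The Leibniz rule
`d (m r) = d m · r + (-1)^|m| m · d r` says that `d` is right `R`-linear, as `d r = 0`. -/
structure DGModule (R : Type u) [Ring R] (𝒜 : ℤ → AddSubgroup R) where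
  /-- the underlying right `R`-module -/
  carrier : Type u
  [addCommGroup : AddCommGroup carrier]
  [module : Module Rᵐᵒᵖ carrier]
  /-- the homogeneous parts -/
  deg : ℤ → AddSubgroup carrier
  isInternal : DirectSum.IsInternal deg
  smul_mem : ∀ {i j : ℤ} {m : carrier} {r : R}, m ∈ deg i → r ∈ 𝒜 j → op r • m ∈ deg (i + j)
  /-- the differential -/
  d : carrier →ₗ[Rᵐᵒᵖ] carrier
  d_mem : ∀ {i : ℤ} {m : carrier}, m ∈ deg i → d m ∈ deg (i + 1)
  d_d : ∀ m : carrier, d (d m) = 0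

namespace DGModule

attribute [instance] DGModule.addCommGroup DGModule.module

variable {R : Type u} [Ring R] {𝒜 : ℤ → AddSubgroup R}

/-- A morphism of dg modules: an `R`-linear map of degree `0` commuting with the differentials. -/
@[ext]
structure Hom (M N : DGModule R 𝒜) where
  /-- the underlying linear map -/
  toLin : M.carrier →ₗ[Rᵐᵒᵖ] N.carrier
  map_mem : ∀ {i : ℤ} {m : M.carrier}, m ∈ M.deg i → toLin m ∈ N.deg i
  comm : ∀ m : M.carrier, toLin (M.d m) = N.d (toLin m)

instance : Category (DGModule R 𝒜) where
  Hom M N := Hom M N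
  id M := { toLin := LinearMap.id, map_mem := fun h => h, comm := fun _ => rfl }
  comp f g :=
    { toLin := g.toLin ∘ₗ f.toLin
      map_mem := fun h => g.map_mem (f.map_mem h)
      comm := fun m => by simp [f.comm, g.comm] }

@[ext]
lemma hom_ext {M N : DGModule R 𝒜} {f g : M ⟶ N} (h : ∀ m, f.toLin m = g.toLin m) : f = g :=
  Hom.ext (LinearMap.ext h)

@[simp] lemma id_toLin (M : DGModule R 𝒜) (m : M.carrier) : Hom.toLin (𝟙 M) m = m := rfl

@[simp] lemma comp_toLin {M N P : DGModule R 𝒜} (f : M ⟶ N) (g : N ⟶ P) (m : M.carrier) :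
    Hom.toLin (f ≫ g) m = g.toLin (f.toLin m) := rfl

/-! ### Shift -/

lemma isInternal_comp {M : Type u} [AddCommGroup M] {A : ℤ → AddSubgroup M}
    (h : DirectSum.IsInternal A) (e : ℤ ≃ ℤ) : DirectSum.IsInternal fun i => A (e i) := by
  have key : (DirectSum.coeAddMonoidHom fun i => A (e i)) =
      (DirectSum.coeAddMonoidHom A).comp
        (DirectSum.equivCongrLeft (β := fun i => A i) e.symm).symm.toAddMonoidHom := by
    ext i x
    have : (DirectSum.equivCongrLeft (β := fun i => A i) e.symm).symm
        (DirectSum.of (fun i => A (e i)) i x) = DirectSum.of (fun i => A i) (e i) x := by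
      rw [AddEquiv.symm_apply_eq]
      exact (DirectSum.equivCongrLeft_of (β := fun i => A i) e.symm i x).symm
    simp [this]
  unfold DirectSum.IsInternal
  rw [key]
  exact h.comp (AddEquiv.bijective _)

/-- The shift `M[n]`: `M[n]^i = M^(i+n)`, with differential `(-1)^n d`. -/
@[simps]
def shift (M : DGModule R 𝒜) (n : ℤ) : DGModule R 𝒜 where
  carrier := M.carrier
  deg i := M.deg (i + n)
  isInternal := isInternal_comp M.isInternal (Equiv.addRight n)
  smul_mem {i j} _ _ hm hr := by
    have := M.smul_mem hm hr
    rwa [show i + n + j = i + j + n by ring] at this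
  d := n.negOnePow • M.d
  d_mem {i} m hm := by
    have := M.d_mem hm
    rw [show i + n + 1 = i + 1 + n by ring] at this
    exact (M.deg _).zsmul_mem this (n.negOnePow : ℤ)
  d_d m := by
    have h : ∀ m, (n.negOnePow • M.d) m = n.negOnePow • M.d m := fun _ => rfl
    have h' : ∀ m, M.d (n.negOnePow • m) = n.negOnePow • M.d m :=
      fun m => map_zsmul M.d (n.negOnePow : ℤ) m
    rw [h, h, h', M.d_d, smul_zero, smul_zero]

/-- The shift functor `M ↦ M[n]`. -/
@[simps]
def shiftFunctor' (n : ℤ) : DGModule R 𝒜 ⥤ DGModule R 𝒜 where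
  obj M := M.shift n
  map {M N} f :=
    { toLin := f.toLin
      map_mem := fun h => f.map_mem h
      comm := fun (m : M.carrier) => by
        change f.toLin (n.negOnePow • M.d m) = n.negOnePow • N.d (f.toLin m)
        rw [← f.comm]
        exact map_zsmul f.toLin (n.negOnePow : ℤ) _ }

/-- The identity of the underlying modules, as an isomorphism of dg modules. -/
@[simps]
def shiftIsoOfEq (M : DGModule R 𝒜) {a b c : ℤ} (h : a = b + c) :
    M.shift a ≅ (M.shift b).shift c where
  hom :=
    { toLin := LinearMap.id
      map_mem := fun {i m} hm => by
        subst h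
        have : m ∈ M.deg (i + (b + c)) := hm
        rw [show i + (b + c) = i + c + b by ring] at this
        exact this
      comm := fun m => by
        subst h
        change (b + c).negOnePow • M.d m = c.negOnePow • b.negOnePow • M.d m
        rw [smul_smul, Int.negOnePow_add, mul_comm] }
  inv :=
    { toLin := LinearMap.id
      map_mem := fun {i m} hm => by
        subst h
        have : m ∈ M.deg (i + c + b) := hm
        rw [show i + c + b = i + (b + c) by ring] at this
        exact this
      comm := fun m => by
        subst h
        change c.negOnePow • b.negOnePow • M.d m = (b + c).negOnePow • M.d m
        rw [smul_smul, Int.negOnePow_add, mul_comm] }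
  hom_inv_id := rfl
  inv_hom_id := rfl

/-- The identity of the underlying modules, as an isomorphism `M[0] ≅ M`. -/
@[simps]
def shiftZeroIso (M : DGModule R 𝒜) : M.shift 0 ≅ M where
  hom :=
    { toLin := LinearMap.id
      map_mem := fun {i m} hm => by
        have : m ∈ M.deg (i + 0) := hm
        rwa [add_zero] at this
      comm := fun m => by
        change (0 : ℤ).negOnePow • M.d m = M.d m
        simp }
  inv :=
    { toLin := LinearMap.id
      map_mem := fun {i m} hm => by
        change m ∈ M.deg (i + 0)
        rwa [add_zero]
      comm := fun m => by
        change M.d m = (0 : ℤ).negOnePow • M.d m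
        simp }
  hom_inv_id := rfl
  inv_hom_id := rfl

lemma eqToHom_shift (M : DGModule R 𝒜) {a b : ℤ} (h : a = b) (h' : M.shift a = M.shift b)
    (m : M.carrier) : Hom.toLin (eqToHom h') m = m := by
  subst h
  rfl

instance : HasShift (DGModule R 𝒜) ℤ := hasShiftMk _ _
  { F := shiftFunctor'
    zero := NatIso.ofComponents (fun M => M.shiftZeroIso) (fun _ => rfl)
    add := fun a b => NatIso.ofComponents (fun M => M.shiftIsoOfEq (a := a + b) rfl) (fun _ => rfl)
    assoc_hom_app := fun a b c M => by
      ext m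
      exact (eqToHom_shift M (add_assoc a b c) _ m).symm
    zero_add_hom_app := fun n M => by
      ext m
      exact (eqToHom_shift M (zero_add n) _ m).symm
    add_zero_hom_app := fun n M => by
      ext m
      exact (eqToHom_shift M (add_zero n) _ m).symm }

/-! ### Homology and the derived category -/

/-- The total homology `ker d / im d` of a dg module (a right `R`-module). -/
abbrev homology (M : DGModule R 𝒜) : Type u :=
  LinearMap.ker M.d ⧸ (LinearMap.range M.d).submoduleOf (LinearMap.ker M.d)

/-- The map induced on total homology by a morphism of dg modules. -/
def homologyMap {M N : DGModule R 𝒜} (f : M ⟶ N) : M.homology →ₗ[Rᵐᵒᵖ] N.homology :=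
  Submodule.mapQ _ _
    (f.toLin.restrict (p := LinearMap.ker M.d) (q := LinearMap.ker N.d) (fun x hx => by
      rw [LinearMap.mem_ker] at hx ⊢
      rw [← f.comm, hx, map_zero]))
    (by
      rintro ⟨x, hx⟩ ⟨y, hy⟩
      exact ⟨f.toLin y, by rw [← f.comm, hy]; rfl⟩)

variable (R 𝒜) in
/-- The quasi-isomorphisms of dg modules. -/
def quasiIso : MorphismProperty (DGModule R 𝒜) :=
  fun _ _ f => Function.Bijective (homologyMap f)

lemma quasiIso_iff {M N : DGModule R 𝒜} (f : M ⟶ N) :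
    quasiIso R 𝒜 f ↔
      (∀ x, M.d x = 0 → (∃ y, N.d y = f.toLin x) → ∃ y, M.d y = x) ∧
      (∀ z, N.d z = 0 → ∃ x, M.d x = 0 ∧ ∃ y, N.d y = f.toLin x - z) := by
  unfold quasiIso Function.Bijective
  rw [injective_iff_map_eq_zero]
  refine and_congr ⟨fun h x hx ⟨y, hy⟩ => ?_, fun h x hx => ?_⟩
    ⟨fun h z hz => ?_, fun h z => ?_⟩
  · have := h (Submodule.Quotient.mk ⟨x, hx⟩) ((Submodule.Quotient.mk_eq_zero _).2 ⟨y, hy⟩)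
    exact (Submodule.Quotient.mk_eq_zero _).1 this
  · obtain ⟨⟨x, hx'⟩, rfl⟩ := Submodule.Quotient.mk_surjective _ x
    exact (Submodule.Quotient.mk_eq_zero _).2
      (h x hx' ((Submodule.Quotient.mk_eq_zero _).1 hx))
  · obtain ⟨x, hx⟩ := h (Submodule.Quotient.mk ⟨z, hz⟩)
    obtain ⟨⟨x, hx'⟩, rfl⟩ := Submodule.Quotient.mk_surjective _ x
    exact ⟨x, hx', (Submodule.Quotient.eq _).1 hx⟩
  · obtain ⟨⟨z, hz⟩, rfl⟩ := Submodule.Quotient.mk_surjective _ z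
    obtain ⟨x, hx, y, hy⟩ := h z hz
    exact ⟨Submodule.Quotient.mk ⟨x, hx⟩, (Submodule.Quotient.eq _).2 ⟨y, hy⟩⟩

instance : (quasiIso R 𝒜).IsCompatibleWithShift ℤ where
  condition n := by
    have hu : ∀ (M : DGModule R 𝒜) (x : M.carrier), n.negOnePow • n.negOnePow • x = x :=
      fun M x => by rw [smul_smul, ← Int.negOnePow_add, Int.negOnePow_even _ ⟨n, rfl⟩, one_smul]
    have hn : ∀ (M : DGModule R 𝒜) (x : M.carrier),
        M.d (n.negOnePow • x) = n.negOnePow • M.d x :=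
      fun M x => map_zsmul M.d (n.negOnePow : ℤ) x
    have h0 : ∀ (M : DGModule R 𝒜) (z : M.carrier),
        (∃ y, n.negOnePow • M.d y = z) ↔ ∃ y, M.d y = z := fun M z => by
      constructor
      · rintro ⟨y, hy⟩
        exact ⟨n.negOnePow • y, by rw [hn, hy]⟩
      · rintro ⟨y, hy⟩
        exact ⟨n.negOnePow • y, by rw [hn, hu, hy]⟩
    have h1 : ∀ (M : DGModule R 𝒜) (x : M.carrier), n.negOnePow • M.d x = 0 ↔ M.d x = 0 :=
      fun M x => smul_eq_zero_iff_eq _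
    ext M N f
    change quasiIso R 𝒜 ((shiftFunctor' n).map f) ↔ quasiIso R 𝒜 f
    rw [quasiIso_iff, quasiIso_iff]
    change ((∀ x : M.carrier, n.negOnePow • M.d x = 0 →
        (∃ y : N.carrier, n.negOnePow • N.d y = f.toLin x) →
        ∃ y : M.carrier, n.negOnePow • M.d y = x) ∧
        (∀ z : N.carrier, n.negOnePow • N.d z = 0 →
        ∃ x : M.carrier, n.negOnePow • M.d x = 0 ∧
          ∃ y : N.carrier, n.negOnePow • N.d y = f.toLin x - z)) ↔ _
    simp only [h0, h1]

variable (R 𝒜) in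
/-- The derived category `D(R)` of right dg modules over `R`: the localization of the category of
dg modules with respect to quasi-isomorphisms (homotopic maps become equal in it, so that it is also
the localization of the homotopy category). -/
abbrev Derived := (quasiIso R 𝒜).Localization

/-! ### Mapping cones and distinguished triangles -/

lemma isInternal_prod {M N : Type u} [AddCommGroup M] [AddCommGroup N]
    {A : ℤ → AddSubgroup M} {B : ℤ → AddSubgroup N}
    (hA : DirectSum.IsInternal A) (hB : DirectSum.IsInternal B) :
    DirectSum.IsInternal fun i => (A i).prod (B i) := by
  constructor
  · rw [injective_iff_map_eq_zero]
    intro x hx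
    let f₁ : (⨁ i, (A i).prod (B i)) →+ ⨁ i, A i :=
      DirectSum.map fun i => AddMonoidHom.mk' (fun y => ⟨y.1.1, y.2.1⟩) (fun _ _ => rfl)
    let f₂ : (⨁ i, (A i).prod (B i)) →+ ⨁ i, B i :=
      DirectSum.map fun i => AddMonoidHom.mk' (fun y => ⟨y.1.2, y.2.2⟩) (fun _ _ => rfl)
    have e₁ : (DirectSum.coeAddMonoidHom A).comp f₁ =
        (AddMonoidHom.fst M N).comp (DirectSum.coeAddMonoidHom fun i => (A i).prod (B i)) := by
      ext i y
      simp [f₁]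
    have e₂ : (DirectSum.coeAddMonoidHom B).comp f₂ =
        (AddMonoidHom.snd M N).comp (DirectSum.coeAddMonoidHom fun i => (A i).prod (B i)) := by
      ext i y
      simp [f₂]
    have h₁ : f₁ x = 0 := hA.1 (by
      have := DFunLike.congr_fun e₁ x
      simp only [AddMonoidHom.comp_apply, hx, map_zero] at this
      rw [this, map_zero])
    have h₂ : f₂ x = 0 := hB.1 (by
      have := DFunLike.congr_fun e₂ x
      simp only [AddMonoidHom.comp_apply, hx, map_zero] at this
      rw [this, map_zero])
    ext i : 1
    have a := congrArg (fun z => (z i : M)) h₁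
    have b := congrArg (fun z => (z i : N)) h₂
    exact Subtype.ext (Prod.ext (by simpa [f₁] using a) (by simpa [f₂] using b))
  · rintro ⟨m, n⟩
    have hm : ∀ x : ⨁ i, A i, ∃ y : ⨁ i, (A i).prod (B i),
        DirectSum.coeAddMonoidHom (fun i => (A i).prod (B i)) y =
          (AddMonoidHom.inl M N) (DirectSum.coeAddMonoidHom A x) := by
      intro x
      induction x using DirectSum.induction_on with
      | zero => exact ⟨0, by simp only [map_zero]⟩
      | of i x => exact ⟨DirectSum.of _ i ⟨(x, 0), x.2, (B i).zero_mem⟩, by simp⟩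
      | add x y hx hy =>
        obtain ⟨a, ha⟩ := hx
        obtain ⟨b, hb⟩ := hy
        exact ⟨a + b, by simp [ha, hb]⟩
    have hn : ∀ x : ⨁ i, B i, ∃ y : ⨁ i, (A i).prod (B i),
        DirectSum.coeAddMonoidHom (fun i => (A i).prod (B i)) y =
          (AddMonoidHom.inr M N) (DirectSum.coeAddMonoidHom B x) := by
      intro x
      induction x using DirectSum.induction_on with
      | zero => exact ⟨0, by simp only [map_zero]⟩
      | of i x => exact ⟨DirectSum.of _ i ⟨(0, x), (A i).zero_mem, x.2⟩, by simp⟩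
      | add x y hx hy =>
        obtain ⟨a, ha⟩ := hx
        obtain ⟨b, hb⟩ := hy
        exact ⟨a + b, by simp [ha, hb]⟩
    obtain ⟨x, rfl⟩ := hA.2 m
    obtain ⟨y, rfl⟩ := hB.2 n
    obtain ⟨a, ha⟩ := hm x
    obtain ⟨b, hb⟩ := hn y
    exact ⟨a + b, by simp [ha, hb]⟩

/-- The mapping cone of `f : M ⟶ N`: the graded module `N ⊕ M[1]` with differential
`d (n, m) = (d n + f m, - d m)`. -/
@[simps]
def cone {M N : DGModule R 𝒜} (f : M ⟶ N) : DGModule R 𝒜 where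
  carrier := N.carrier × M.carrier
  deg i := (N.deg i).prod (M.deg (i + 1))
  isInternal := isInternal_prod N.isInternal (M.shift 1).isInternal
  smul_mem hm hr := ⟨N.smul_mem hm.1 hr, (M.shift 1).smul_mem hm.2 hr⟩
  d := (N.d.coprod f.toLin).prod (-(M.d ∘ₗ LinearMap.snd _ _ _))
  d_mem {i x} hx := ⟨(N.deg _).add_mem (N.d_mem hx.1) (f.map_mem hx.2),
    (M.deg _).neg_mem (M.d_mem hx.2)⟩
  d_d := fun ⟨n, m⟩ => by simp [N.d_d, M.d_d, f.comm]

/-- The triangle `M ⟶ N ⟶ cone f ⟶ M[1]` of a morphism `f` (the last map is minus the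
projection). -/
def coneTriangle {M N : DGModule R 𝒜} (f : M ⟶ N) : Pretriangulated.Triangle (DGModule R 𝒜) where
  obj₁ := M
  obj₂ := N
  obj₃ := cone f
  mor₁ := f
  mor₂ :=
    { toLin := LinearMap.inl Rᵐᵒᵖ N.carrier M.carrier
      map_mem := fun {i _} h => ⟨h, (M.deg (i + 1)).zero_mem⟩
      comm := fun m => by
        change (N.d m, (0 : M.carrier)) = (N.d m + f.toLin 0, -M.d 0)
        simp }
  mor₃ :=
    { toLin := (-LinearMap.snd Rᵐᵒᵖ N.carrier M.carrier :
        N.carrier × M.carrier →ₗ[Rᵐᵒᵖ] M.carrier)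
      map_mem := fun {i _} h => (M.deg (i + 1)).neg_mem h.2
      comm := fun ⟨n, m⟩ => by
        change -(-(M.d m)) = (1 : ℤ).negOnePow • M.d (-m)
        simp }

variable (R 𝒜) in
/-- The distinguished triangles of `D(R)`: those isomorphic to the image of the mapping cone
triangle of a morphism of dg modules. -/
def distinguished : Set (Pretriangulated.Triangle (Derived R 𝒜)) :=
  { T | ∃ (M N : DGModule R 𝒜) (f : M ⟶ N),
      Nonempty (T ≅ (quasiIso R 𝒜).Q.mapTriangle.obj (coneTriangle f)) }

end DGModule

/-! ## Right modules over skew group rings -/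

namespace SkewMonoidAlgebra

variable {A G M : Type*} [Ring A] [Group G] [MulSemiringAction G A] [AddCommGroup M]

/-- A right `A`-action `m ↦ m · a` and a right `G`-action `m ↦ m · g` on an abelian group `M`, with
`(m · (g • a)) · g = (m · g) · a`, define a right module over the skew group ring `A ∗ G` through
`m · (a g) = (m · a) · g`. -/
@[reducible]
def rightModule (α : A →+* (AddMonoid.End M)ᵐᵒᵖ) (γ : G →* (AddMonoid.End M)ᵐᵒᵖ)
    (h : ∀ (a : A) (g : G), α (g • a) * γ g = γ g * α a) : Module (SkewMonoidAlgebra A G)ᵐᵒᵖ M :=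
  letI φ : (SkewMonoidAlgebra A G) →+* (AddMonoid.End M)ᵐᵒᵖ :=
    liftNCRingHom α γ (fun {a g} => h a g)
  { smul := fun r m => (φ r.unop).unop m
    one_smul := fun m => by
      change (φ (1 : (SkewMonoidAlgebra A G)ᵐᵒᵖ).unop).unop m = m
      simp
    mul_smul := fun r s m => by
      change (φ (r * s).unop).unop m = (φ r.unop).unop ((φ s.unop).unop m)
      simp
    smul_zero := fun r => map_zero (φ r.unop).unop
    smul_add := fun r => map_add (φ r.unop).unop
    add_smul := fun r s m => by
      change (φ (r + s).unop).unop m = (φ r.unop).unop m + (φ s.unop).unop m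
      rw [MulOpposite.unop_add, map_add, MulOpposite.unop_add]; rfl
    zero_smul := fun m => by
      change (φ (0 : (SkewMonoidAlgebra A G)ᵐᵒᵖ).unop).unop m = 0
      simp }

lemma rightModule_smul (α : A →+* (AddMonoid.End M)ᵐᵒᵖ) (γ : G →* (AddMonoid.End M)ᵐᵒᵖ)
    (h : ∀ (a : A) (g : G), α (g • a) * γ g = γ g * α a) (a : A) (g : G) (m : M) :
    letI := rightModule α γ h
    op (single g a) • m = (γ g).unop ((α a).unop m) := by
  change (liftNCRingHom α γ (fun {a g} => h a g) (single g a)).unop m = _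
  have : liftNCRingHom α γ (fun {a g} => h a g) (single g a) = α a * γ g :=
    liftNC_single _ _ _ _
  rw [this]
  rfl

/-- The canonical map `Aᵒᵖ → (A ∗ G)ᵒᵖ`; right `A ∗ G`-modules are right `A`-modules along it. -/
abbrev opSingleOne (A G : Type*) [Ring A] [Group G] [MulSemiringAction G A] :
    Aᵐᵒᵖ →+* (SkewMonoidAlgebra A G)ᵐᵒᵖ :=
  RingHom.op singleOneRingHom

lemma op_single_eq (a : A) (g : G) :
    op (single g a) = op (single g (1 : A)) * op (single (1 : G) a) := by
  rw [← op_mul, single_mul_single]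
  simp

/-- Additive subgroups stable under all `a g` are submodules. -/
lemma smul_mem_of_single [Module (SkewMonoidAlgebra A G)ᵐᵒᵖ M] (N : AddSubgroup M)
    (h : ∀ (a : A) (g : G), ∀ m ∈ N, op (single g a) • m ∈ N)
    (r : (SkewMonoidAlgebra A G)ᵐᵒᵖ) {m : M} (hm : m ∈ N) : r • m ∈ N := by
  induction r using MulOpposite.rec' with
  | h r =>
    induction r using SkewMonoidAlgebra.induction_on with
    | zero => simp
    | single g a => exact h a g m hm
    | add x y hx hy => rw [MulOpposite.op_add, add_smul]; exact N.add_mem hx hy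

/-- Additive maps compatible with all `a g` are linear. -/
def linearMapOfSingle {N : Type*} [AddCommGroup N] [Module (SkewMonoidAlgebra A G)ᵐᵒᵖ M]
    [Module (SkewMonoidAlgebra A G)ᵐᵒᵖ N] (f : M →+ N)
    (h : ∀ (a : A) (g : G) (m : M), f (op (single g a) • m) = op (single g a) • f m) :
    M →ₗ[(SkewMonoidAlgebra A G)ᵐᵒᵖ] N where
  __ := f
  map_smul' r m := by
    change f (r • m) = r • f m
    induction r using MulOpposite.rec' with
    | h r =>
      induction r using SkewMonoidAlgebra.induction_on with
      | zero => simp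
      | single g a => exact h a g m
      | add x y hx hy => rw [MulOpposite.op_add, add_smul, add_smul, map_add, hx, hy]

@[simp] lemma linearMapOfSingle_apply {N : Type*} [AddCommGroup N]
    [Module (SkewMonoidAlgebra A G)ᵐᵒᵖ M] [Module (SkewMonoidAlgebra A G)ᵐᵒᵖ N] (f : M →+ N)
    (h : ∀ (a : A) (g : G) (m : M), f (op (single g a) • m) = op (single g a) • f m) (m : M) :
    linearMapOfSingle f h m = f m := rfl

end SkewMonoidAlgebra

/-! ## The exterior algebra `Λ` on `V`, the symmetric algebra `S` on `V*`, skew group algebras -/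

namespace BGG

open SkewMonoidAlgebra (single rightModule rightModule_smul opSingleOne op_single_eq
  smul_mem_of_single linearMapOfSingle linearMapOfSingle_apply)

variable {F V Q : Type u} [Field F] [AddCommGroup V] [Module F V] [Group Q]

/-- The exterior algebra `Λ = Λ(V)` of a representation `V` of `Q` (an ungraded algebra). -/
def Lam (_ρ : Representation F Q V) : Type u := ExteriorAlgebra F V

/-- The symmetric algebra `S = Sym(V*)` on the dual of a representation `V` of `Q`. -/
def Sym (_ρ : Representation F Q V) : Type u := SymmetricAlgebra F (Module.Dual F V)

variable (ρ : Representation F Q V)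

instance : Ring (Lam ρ) := inferInstanceAs (Ring (ExteriorAlgebra F V))
instance : Algebra F (Lam ρ) := inferInstanceAs (Algebra F (ExteriorAlgebra F V))
instance : CommRing (Sym ρ) := inferInstanceAs (CommRing (SymmetricAlgebra F (Module.Dual F V)))
instance : Algebra F (Sym ρ) := inferInstanceAs (Algebra F (SymmetricAlgebra F (Module.Dual F V)))

/-- The inclusion `V → Λ`. -/
def ιLam : V →ₗ[F] Lam ρ := ExteriorAlgebra.ι F

/-- The inclusion `V* → S`. -/
def ιSym : Module.Dual F V →ₗ[F] Sym ρ := SymmetricAlgebra.ι F (Module.Dual F V)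

/-- The automorphism of `Λ` induced by the action of `q` on `V`. -/
def Lam.act (q : Q) : Lam ρ →ₐ[F] Lam ρ := ExteriorAlgebra.map (ρ q)

/-- The automorphism of `S` induced by the action `(q f)(v) = f (q⁻¹ v)` of `q` on `V*`. -/
def Sym.act (q : Q) : Sym ρ →ₐ[F] Sym ρ := SymmetricAlgebra.lift (ιSym ρ ∘ₗ ρ.dual q)

@[simp] lemma Lam.act_ι (q : Q) (v : V) : Lam.act ρ q (ιLam ρ v) = ιLam ρ (ρ q v) :=
  ExteriorAlgebra.map_apply_ι _ _

@[simp] lemma Sym.act_ι (q : Q) (f : Module.Dual F V) :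
    Sym.act ρ q (ιSym ρ f) = ιSym ρ (ρ.dual q f) :=
  SymmetricAlgebra.lift_ι_apply _ _

lemma Lam.algHom_ext {B : Type*} [Ring B] [Algebra F B] {f g : Lam ρ →ₐ[F] B}
    (h : ∀ v, f (ιLam ρ v) = g (ιLam ρ v)) : f = g :=
  ExteriorAlgebra.hom_ext (LinearMap.ext h)

lemma Sym.algHom_ext {B : Type*} [CommRing B] [Algebra F B] {f g : Sym ρ →ₐ[F] B}
    (h : ∀ v, f (ιSym ρ v) = g (ιSym ρ v)) : f = g :=
  SymmetricAlgebra.algHom_ext (LinearMap.ext h)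

lemma Sym.induction {ρ : Representation F Q V} {p : Sym ρ → Prop}
    (algebraMap : ∀ r, p (algebraMap F (Sym ρ) r)) (ι : ∀ f, p (ιSym ρ f))
    (mul : ∀ a b, p a → p b → p (a * b)) (add : ∀ a b, p a → p b → p (a + b)) (s : Sym ρ) : p s :=
  @SymmetricAlgebra.induction F (Module.Dual F V) _ _ _ p algebraMap ι mul add s

lemma Lam.act_one : Lam.act ρ 1 = AlgHom.id F _ := Lam.algHom_ext ρ fun v => by simp

lemma Lam.act_mul (p q : Q) : Lam.act ρ (p * q) = (Lam.act ρ p).comp (Lam.act ρ q) :=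
  Lam.algHom_ext ρ fun v => by simp

lemma Sym.act_one : Sym.act ρ 1 = AlgHom.id F _ := Sym.algHom_ext ρ fun v => by
  rw [Sym.act_ι, map_one]; rfl

lemma Sym.act_mul (p q : Q) : Sym.act ρ (p * q) = (Sym.act ρ p).comp (Sym.act ρ q) :=
  Sym.algHom_ext ρ fun v => by
    rw [AlgHom.comp_apply, Sym.act_ι, Sym.act_ι, Sym.act_ι, map_mul]; rfl

instance : MulSemiringAction Q (Lam ρ) where
  smul q x := Lam.act ρ q x
  one_smul x := DFunLike.congr_fun (Lam.act_one ρ) x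
  mul_smul p q x := DFunLike.congr_fun (Lam.act_mul ρ p q) x
  smul_zero q := map_zero (Lam.act ρ q)
  smul_add q := map_add (Lam.act ρ q)
  smul_one q := map_one (Lam.act ρ q)
  smul_mul q := map_mul (Lam.act ρ q)

instance : MulSemiringAction Q (Sym ρ) where
  smul q x := Sym.act ρ q x
  one_smul x := DFunLike.congr_fun (Sym.act_one ρ) x
  mul_smul p q x := DFunLike.congr_fun (Sym.act_mul ρ p q) x
  smul_zero q := map_zero (Sym.act ρ q)
  smul_add q := map_add (Sym.act ρ q)
  smul_one q := map_one (Sym.act ρ q)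
  smul_mul q := map_mul (Sym.act ρ q)

lemma Lam.smul_def (q : Q) (x : Lam ρ) : q • x = Lam.act ρ q x := rfl
lemma Sym.smul_def (q : Q) (x : Sym ρ) : q • x = Sym.act ρ q x := rfl

/-- The skew group algebra `Λ ∗ Q`. -/
abbrev LamQ : Type u := SkewMonoidAlgebra (Lam ρ) Q

/-- The skew group algebra `S ∗ Q`. -/
abbrev SymQ : Type u := SkewMonoidAlgebra (Sym ρ) Q

/-- The grading of `S` with `V*` in degree `1`: the part of degree `j` is spanned by the products of
`j` elements of `V*`. -/
def symDeg (j : ℤ) : Submodule F (Sym ρ) :=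
  if 0 ≤ j then (LinearMap.range (ιSym ρ)) ^ j.toNat else ⊥

/-- The grading of `S ∗ Q` with `Q` in degree `0` and `V*` in degree `1`. -/
def symQDeg (j : ℤ) : AddSubgroup (SymQ ρ) where
  carrier := { r | ∀ q, r.coeff q ∈ symDeg ρ j }
  zero_mem' q := (symDeg ρ j).zero_mem
  add_mem' {x y} hx hy q := by
    rw [SkewMonoidAlgebra.coeff_add]; exact (symDeg ρ j).add_mem (hx q) (hy q)
  neg_mem' {x} hx q := by
    rw [SkewMonoidAlgebra.coeff_neg]; exact (symDeg ρ j).neg_mem (hx q)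

lemma one_mem_symDeg : (1 : Sym ρ) ∈ symDeg ρ 0 := by
  simp only [symDeg, le_refl, ↓reduceIte, Int.toNat_zero, pow_zero]
  exact Submodule.one_le.1 le_rfl

lemma ι_mem_symDeg (f : Module.Dual F V) : ιSym ρ f ∈ symDeg ρ 1 := by
  simp [symDeg]

lemma mul_mem_symDeg {i j : ℤ} {s t : Sym ρ} (hs : s ∈ symDeg ρ i) (ht : t ∈ symDeg ρ j) :
    s * t ∈ symDeg ρ (i + j) := by
  unfold symDeg at *
  split_ifs at hs ht with hi hj
  · rw [if_pos (by lia), Int.toNat_add hi hj, pow_add]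
    exact Submodule.mul_mem_mul hs ht
  all_goals simp_all

lemma act_mem_symDeg (q : Q) {j : ℤ} {s : Sym ρ} (hs : s ∈ symDeg ρ j) :
    Sym.act ρ q s ∈ symDeg ρ j := by
  unfold symDeg at *
  split_ifs at hs ⊢ with hj
  · have h := Submodule.mem_map_of_mem (f := (Sym.act ρ q).toLinearMap) hs
    rw [Submodule.map_pow] at h
    have hle : (LinearMap.range (ιSym ρ)).map (Sym.act ρ q).toLinearMap ≤
        LinearMap.range (ιSym ρ) := by
      rintro _ ⟨_, ⟨f, rfl⟩, rfl⟩
      exact ⟨ρ.dual q f, (Sym.act_ι ρ q f).symm⟩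
    exact pow_le_pow_left' hle _ h
  · simp_all

/-! ## The twisted tensor product `Λ ⊗ S` -/

/-- The tensor product `Λ ⊗ S`; the differential below makes it the complex of left
`Λ ∗ Q`-modules with `Λ ⊗ S_j` in degree `j`. -/
abbrev Tw : Type u := Lam ρ ⊗[F] Sym ρ

/-- The differential `c ⊗ f ↦ ∑ i, c y_i ⊗ x_i f` of `Λ ⊗ S`, for a basis `y_i` of `V` with dual
basis `x_i` (the choice of basis does not matter). -/
def twD [Module.Finite F V] : Tw ρ →ₗ[Lam ρ] Tw ρ :=
  ∑ i, TensorProduct.AlgebraTensorModule.map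
    (LinearMap.toSpanSingleton (Lam ρ) (Lam ρ) (ιLam ρ (Module.finBasis F V i)))
    (LinearMap.mulLeft F (ιSym ρ ((Module.finBasis F V).coord i)))

/-- The diagonal left action of `q` on `Λ ⊗ S`. -/
def twAct (q : Q) : Tw ρ →ₗ[F] Tw ρ :=
  TensorProduct.map (Lam.act ρ q).toLinearMap (Sym.act ρ q).toLinearMap

/-- Multiplication by `s` on the factor `S` of `Λ ⊗ S`. -/
def twMul (s : Sym ρ) : Tw ρ →ₗ[Lam ρ] Tw ρ :=
  TensorProduct.AlgebraTensorModule.map LinearMap.id (LinearMap.mulLeft F s)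

@[simp] lemma twD_tmul [Module.Finite F V] (c : Lam ρ) (s : Sym ρ) :
    twD ρ (c ⊗ₜ s) = ∑ i, (c * ιLam ρ (Module.finBasis F V i)) ⊗ₜ
      (ιSym ρ ((Module.finBasis F V).coord i) * s) := by
  simp [twD, LinearMap.sum_apply]

@[simp] lemma twAct_tmul (q : Q) (c : Lam ρ) (s : Sym ρ) :
    twAct ρ q (c ⊗ₜ s) = Lam.act ρ q c ⊗ₜ Sym.act ρ q s := rfl

@[simp] lemma twMul_tmul (t : Sym ρ) (c : Lam ρ) (s : Sym ρ) :
    twMul ρ t (c ⊗ₜ s) = c ⊗ₜ (t * s) := rfl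

lemma twAct_smul (q : Q) (c : Lam ρ) (x : Tw ρ) :
    twAct ρ q (c • x) = Lam.act ρ q c • twAct ρ q x := by
  induction x using TensorProduct.induction_on with
  | zero => simp
  | tmul a s => simp [TensorProduct.smul_tmul']
  | add x y hx hy => rw [smul_add, map_add, hx, hy, map_add, smul_add]

lemma twD_twD [Module.Finite F V] (x : Tw ρ) : twD ρ (twD ρ x) = 0 := by
  have hsq : ∀ v : V, ιLam ρ v * ιLam ρ v = 0 := fun v => ExteriorAlgebra.ι_sq_zero v
  have hanti : ∀ v w : V, ιLam ρ v * ιLam ρ w = -(ιLam ρ w * ιLam ρ v) := fun v w =>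
    eq_neg_of_add_eq_zero_left (ExteriorAlgebra.ι_add_mul_swap v w)
  induction x using TensorProduct.induction_on with
  | zero => simp
  | add x y hx hy => simp [hx, hy]
  | tmul c s =>
    simp only [twD_tmul, map_sum]
    rw [← Finset.sum_product']
    refine Finset.sum_involution (fun p _ => (p.2, p.1)) ?_ ?_ ?_ ?_
    · rintro ⟨i, j⟩ -
      dsimp only
      rw [mul_assoc c, mul_assoc c, hanti, mul_neg, TensorProduct.neg_tmul, ← mul_assoc,
        mul_left_comm (ιSym ρ _) (ιSym ρ _) s, neg_add_cancel]
    · rintro ⟨i, j⟩ - hne hij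
      apply hne
      have : i = j := (Prod.ext_iff.1 hij).2
      subst this
      dsimp only
      rw [mul_assoc c, hsq, mul_zero, TensorProduct.zero_tmul]
    · simp
    · simp

lemma sum_dual_invariant [Module.Finite F V] {W : Type*} [AddCommGroup W] [Module F W]
    (B : V →ₗ[F] Module.Dual F V →ₗ[F] W) (q : Q) :
    ∑ i, B (ρ q (Module.finBasis F V i)) (ρ.dual q ((Module.finBasis F V).coord i)) =
      ∑ i, B (Module.finBasis F V i) ((Module.finBasis F V).coord i) := by
  set b := Module.finBasis F V
  have h1 : ∀ i, ρ q (b i) = ∑ j, b.coord j (ρ q (b i)) • b j := fun i =>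
    (b.sum_repr (ρ q (b i))).symm
  have h2 : ∀ j, ∑ i, b.coord j (ρ q (b i)) • ρ.dual q (b.coord i) = b.coord j := by
    intro j
    ext v
    have hv : b.coord j v = b.coord j (ρ q (∑ i, b.repr (ρ q⁻¹ v) i • b i)) := by
      rw [b.sum_repr, ← Module.End.mul_apply, ← map_mul, mul_inv_cancel, map_one]
      rfl
    refine Eq.trans ?_ hv.symm
    simp only [map_sum, map_smul]
    simp [Representation.dual_apply, Module.Dual.transpose_apply, mul_comm]
  calc _ = ∑ i, ∑ j, B (b j) (b.coord j (ρ q (b i)) • ρ.dual q (b.coord i)) := by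
        refine Finset.sum_congr rfl fun i _ => ?_
        conv_lhs => rw [h1 i]
        simp only [map_sum, LinearMap.sum_apply, map_smul, LinearMap.smul_apply]
    _ = _ := by
        rw [Finset.sum_comm]
        refine Finset.sum_congr rfl fun j _ => ?_
        rw [← map_sum, h2]

lemma twAct_twD [Module.Finite F V] (q : Q) (x : Tw ρ) :
    twAct ρ q (twD ρ x) = twD ρ (twAct ρ q x) := by
  induction x using TensorProduct.induction_on with
  | zero => simp
  | add x y hx hy => simp [hx, hy]
  | tmul c s =>
    simp only [twD_tmul, map_sum, twAct_tmul, map_mul, Lam.act_ι, Sym.act_ι]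
    let B : V →ₗ[F] Module.Dual F V →ₗ[F] Tw ρ :=
      LinearMap.mk₂ F (fun v f => (Lam.act ρ q c * ιLam ρ v) ⊗ₜ (ιSym ρ f * Sym.act ρ q s))
        (by intros; simp [mul_add, TensorProduct.add_tmul])
        (by intros; simp [TensorProduct.smul_tmul'])
        (by intros; simp [add_mul, TensorProduct.tmul_add])
        (by intros; simp)
    exact sum_dual_invariant ρ B q

lemma twD_twMul [Module.Finite F V] (t : Sym ρ) (x : Tw ρ) :
    twD ρ (twMul ρ t x) = twMul ρ t (twD ρ x) := by
  induction x using TensorProduct.induction_on with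
  | zero => simp
  | add x y hx hy => simp [hx, hy]
  | tmul c s => simp [mul_left_comm]

lemma twAct_twMul (q : Q) (t : Sym ρ) (x : Tw ρ) :
    twAct ρ q (twMul ρ t x) = twMul ρ (Sym.act ρ q t) (twAct ρ q x) := by
  induction x using TensorProduct.induction_on with
  | zero => simp
  | add x y hx hy => simp [hx, hy]
  | tmul c s => simp

lemma twMul_one : twMul ρ 1 = LinearMap.id := by
  ext x; simp [twMul]

lemma twMul_mul (s t : Sym ρ) (x : Tw ρ) : twMul ρ (s * t) x = twMul ρ s (twMul ρ t x) := by
  induction x using TensorProduct.induction_on with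
  | zero => simp
  | add x y hx hy => simp [hx, hy]
  | tmul c r => simp [mul_assoc]

lemma twMul_add (s t : Sym ρ) (x : Tw ρ) : twMul ρ (s + t) x = twMul ρ s x + twMul ρ t x := by
  induction x using TensorProduct.induction_on with
  | zero => simp
  | add x y hx hy => rw [map_add, map_add, map_add, hx, hy]; abel
  | tmul c r => simp [add_mul, TensorProduct.tmul_add]

lemma twMul_zero (x : Tw ρ) : twMul ρ 0 x = 0 := by
  have := twMul_add ρ 0 0 x
  simpa using this

lemma twAct_one (x : Tw ρ) : twAct ρ 1 x = x := by
  simp [twAct, Lam.act_one, Sym.act_one]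

lemma twAct_mul (p q : Q) (x : Tw ρ) : twAct ρ (p * q) x = twAct ρ p (twAct ρ q x) := by
  induction x using TensorProduct.induction_on with
  | zero => simp
  | add x y hx hy => simp [hx, hy]
  | tmul c s => simp [Lam.act_mul, Sym.act_mul]

/-! ## The resolution `ε = Hom_{Λᵒᵖ}(Λ ⊗ S, Λ)` -/

/-- The left `Λ`-linear maps `Λ ⊗ S → Λ` of degree `i`, where `Λ` is concentrated in degree `0`:
those which vanish on `Λ ⊗ S_j` for `j ≠ -i`. -/
def epsDeg (i : ℤ) : AddSubgroup (Tw ρ →ₗ[Lam ρ] Lam ρ) where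
  carrier := { f | ∀ j : ℤ, j ≠ -i → ∀ (c : Lam ρ) (s : Sym ρ), s ∈ symDeg ρ j → f (c ⊗ₜ s) = 0 }
  zero_mem' _ _ _ _ _ := rfl
  add_mem' hf hg j hj c s hs := by simp [hf j hj c s hs, hg j hj c s hs]
  neg_mem' hf j hj c s hs := by simp [hf j hj c s hs]

/-- The (total) hom complex `ε = Hom_{Λᵒᵖ}(Λ ⊗ S, Λ)` of left `Λ`-linear maps: the direct sum of
its homogeneous parts. -/
def epsTotal : AddSubgroup (Tw ρ →ₗ[Lam ρ] Lam ρ) := ⨆ i, epsDeg ρ i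

/-- The type of elements of `ε`. -/
def Eps : Type u := epsTotal ρ

instance : AddCommGroup (Eps ρ) := inferInstanceAs (AddCommGroup (epsTotal ρ))

namespace Eps

variable {ρ}

/-- An element of `ε` as a linear map `Λ ⊗ S → Λ`. -/
def val : Eps ρ →+ (Tw ρ →ₗ[Lam ρ] Lam ρ) := (epsTotal ρ).subtype

@[ext]
lemma ext {e e' : Eps ρ} (h : ∀ x, e.val x = e'.val x) : e = e' :=
  Subtype.ext (LinearMap.ext h)

/-- An additive map preserving `ε`, restricted to `ε`. -/
def restrict (φ : (Tw ρ →ₗ[Lam ρ] Lam ρ) →+ (Tw ρ →ₗ[Lam ρ] Lam ρ))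
    (h : ∀ i, ∀ f ∈ epsDeg ρ i, φ f ∈ epsTotal ρ) : Eps ρ →+ Eps ρ :=
  (φ.comp (epsTotal ρ).subtype).codRestrict (epsTotal ρ) (fun e => by
    have : epsTotal ρ ≤ (epsTotal ρ).comap φ := iSup_le fun i f hf => h i f hf
    exact this e.2)

@[simp] lemma val_restrict (φ : (Tw ρ →ₗ[Lam ρ] Lam ρ) →+ (Tw ρ →ₗ[Lam ρ] Lam ρ))
    (h : ∀ i, ∀ f ∈ epsDeg ρ i, φ f ∈ epsTotal ρ) (e : Eps ρ) :
    (restrict φ h e).val = φ e.val := rfl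

lemma mem_total {i : ℤ} {f : Tw ρ →ₗ[Lam ρ] Lam ρ} (hf : f ∈ epsDeg ρ i) : f ∈ epsTotal ρ :=
  AddSubgroup.mem_iSup_of_mem i hf

variable (ρ) in
/-- The part of `ε` of degree `i`. -/
def deg (i : ℤ) : AddSubgroup (Eps ρ) := (epsDeg ρ i).comap val

lemma mem_deg {i : ℤ} {e : Eps ρ} : e ∈ deg ρ i ↔ e.val ∈ epsDeg ρ i := Iff.rfl

/-- `ε` is generated by its homogeneous elements. -/
lemma induction {p : Eps ρ → Prop} (hom : ∀ i, ∀ e ∈ deg ρ i, p e) (zero : p 0)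
    (add : ∀ e e', p e → p e' → p (e + e')) (e : Eps ρ) : p e := by
  obtain ⟨f, hf⟩ := e
  refine AddSubgroup.iSup_induction' (S := epsDeg ρ) (C := fun f hf => p ⟨f, hf⟩)
    ?_ zero ?_ hf
  · intro i f hf
    exact hom i ⟨f, mem_total hf⟩ hf
  · intro f g hf hg h1 h2
    exact add _ _ h1 h2

/-! ### Right `Λ`-action: `(f a)(x) = f(x) a` -/

instance : Module (Lam ρ)ᵐᵒᵖ (Eps ρ) where
  smul a := restrict (DistribSMul.toAddMonoidHom _ a) (fun i f hf => mem_total (i := i)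
    fun j hj c s hs => by simp [hf j hj c s hs])
  one_smul e := by ext x; exact mul_one _
  mul_smul a b e := by ext x; exact mul_smul a b (e.val x)
  smul_zero a := map_zero _
  smul_add a e e' := map_add _ e e'
  add_smul a b e := by ext x; exact add_smul a b (e.val x)
  zero_smul e := by ext x; exact mul_zero (e.val x)

@[simp] lemma val_op_smul (a : (Lam ρ)ᵐᵒᵖ) (e : Eps ρ) (x : Tw ρ) :
    (a • e).val x = e.val x * a.unop := rfl

/-! ### `S`-action: `(s f)(x) = f(s x)` -/

/-- Precomposition with multiplication by `s`. -/
def preMul (s : Sym ρ) : (Tw ρ →ₗ[Lam ρ] Lam ρ) →+ (Tw ρ →ₗ[Lam ρ] Lam ρ) where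
  toFun f := f ∘ₗ twMul ρ s
  map_zero' := rfl
  map_add' _ _ := rfl

lemma preMul_mem_deg {i j : ℤ} {s : Sym ρ} (hs : s ∈ symDeg ρ j) {f : Tw ρ →ₗ[Lam ρ] Lam ρ}
    (hf : f ∈ epsDeg ρ i) : preMul s f ∈ epsDeg ρ (i + j) := by
  intro k hk c t ht
  exact hf (j + k) (by lia) c (s * t) (mul_mem_symDeg ρ hs ht)

lemma preMul_mem (s : Sym ρ) {f : Tw ρ →ₗ[Lam ρ] Lam ρ} (hf : f ∈ epsTotal ρ) :
    preMul s f ∈ epsTotal ρ := by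
  induction s using Sym.induction generalizing f with
  | algebraMap r =>
    have h : algebraMap F (Sym ρ) r ∈ symDeg ρ 0 := by
      rw [Algebra.algebraMap_eq_smul_one]
      exact (symDeg ρ 0).smul_mem r (one_mem_symDeg ρ)
    have : epsTotal ρ ≤ (epsTotal ρ).comap (preMul (algebraMap F (Sym ρ) r)) :=
      iSup_le fun i f hf => mem_total (preMul_mem_deg h hf)
    exact this hf
  | ι v =>
    have : epsTotal ρ ≤ (epsTotal ρ).comap (preMul (ιSym ρ v)) :=
      iSup_le fun i f hf => mem_total (preMul_mem_deg (ι_mem_symDeg ρ v) hf)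
    exact this hf
  | mul a b ha hb =>
    have : preMul (ρ := ρ) (a * b) f = preMul b (preMul a f) := by
      refine LinearMap.ext fun x => ?_
      exact congrArg f (twMul_mul ρ a b x)
    rw [this]
    exact hb (ha hf)
  | add a b ha hb =>
    have : preMul (ρ := ρ) (a + b) f = preMul a f + preMul b f := by
      refine LinearMap.ext fun x => ?_
      exact (congrArg f (twMul_add ρ a b x)).trans (map_add f _ _)
    rw [this]
    exact (epsTotal ρ).add_mem (ha hf) (hb hf)

instance : Module (Sym ρ) (Eps ρ) where
  smul s := restrict (preMul s) (fun i f hf => preMul_mem s (mem_total hf))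
  one_smul e := by
    ext x
    change e.val (twMul ρ 1 x) = e.val x
    rw [twMul_one]; rfl
  mul_smul s t e := by
    ext x
    change e.val (twMul ρ (s * t) x) = e.val (twMul ρ t (twMul ρ s x))
    rw [mul_comm, twMul_mul]
  smul_zero s := map_zero _
  smul_add s e e' := map_add _ e e'
  add_smul s t e := by
    ext x
    change e.val (twMul ρ (s + t) x) = e.val (twMul ρ s x) + e.val (twMul ρ t x)
    rw [twMul_add, map_add]
  zero_smul e := by
    ext x
    change e.val (twMul ρ 0 x) = 0
    rw [twMul_zero, map_zero]

@[simp] lemma val_smul (s : Sym ρ) (e : Eps ρ) (x : Tw ρ) :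
    (s • e).val x = e.val (twMul ρ s x) := rfl

lemma smul_mem_deg {i j : ℤ} {s : Sym ρ} (hs : s ∈ symDeg ρ j) {e : Eps ρ} (he : e ∈ deg ρ i) :
    s • e ∈ deg ρ (i + j) := preMul_mem_deg hs he

lemma op_smul_mem_deg {i : ℤ} (a : (Lam ρ)ᵐᵒᵖ) {e : Eps ρ} (he : e ∈ deg ρ i) :
    a • e ∈ deg ρ i := fun j hj c s hs => by
  rw [val_op_smul, he j hj c s hs, zero_mul]

instance : SMulCommClass (Sym ρ) (Lam ρ)ᵐᵒᵖ (Eps ρ) where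
  smul_comm s a e := by ext x; rfl

/-! ### Right `Q`-action: `(f q)(x) = q⁻¹ f(q x)` -/

/-- The right action of `q` on left `Λ`-linear maps `Λ ⊗ S → Λ`. -/
def conj (q : Q) : (Tw ρ →ₗ[Lam ρ] Lam ρ) →+ (Tw ρ →ₗ[Lam ρ] Lam ρ) where
  toFun f :=
    { toFun := fun x => q⁻¹ • f (twAct ρ q x)
      map_add' := fun x y => by simp
      map_smul' := fun c x => by
        rw [twAct_smul, ← Lam.smul_def, map_smul, smul_eq_mul, smul_mul', inv_smul_smul]
        rfl }
  map_zero' := by ext x; simp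
  map_add' f g := by ext x; simp

/-- The right action of `q` on `ε`. -/
def act (q : Q) : Eps ρ →+ Eps ρ :=
  restrict (conj q) (fun i f hf => mem_total (i := i) fun j hj c s hs => by
    change q⁻¹ • f (twAct ρ q (c ⊗ₜ s)) = 0
    rw [twAct_tmul, hf j hj _ _ (act_mem_symDeg ρ q hs), smul_zero])

@[simp] lemma val_act (q : Q) (e : Eps ρ) (x : Tw ρ) :
    (act q e).val x = q⁻¹ • e.val (twAct ρ q x) := rfl

lemma act_mem_deg {i : ℤ} (q : Q) {e : Eps ρ} (he : e ∈ deg ρ i) : act q e ∈ deg ρ i :=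
  fun j hj c s hs => by
    rw [val_act, twAct_tmul, he j hj _ _ (act_mem_symDeg ρ q hs), smul_zero]

lemma act_one (e : Eps ρ) : act 1 e = e := by
  ext x; simp [twAct_one]

lemma act_mul (p q : Q) (e : Eps ρ) : act (p * q) e = act q (act p e) := by
  ext x; simp [twAct_mul, mul_smul]

lemma act_smul (q : Q) (s : Sym ρ) (e : Eps ρ) : act q (s • e) = (q⁻¹ • s) • act q e := by
  ext x
  simp only [val_act, val_smul, twAct_twMul]
  rw [← Sym.smul_def, smul_inv_smul]

lemma act_op_smul (q : Q) (a : Lam ρ) (e : Eps ρ) :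
    act q (op (q • a) • e) = op a • act q e := by
  ext x
  simp [smul_mul']

/-! ### Differential: `d f = f ∘ d` (up to a sign, which disappears in characteristic two) -/

variable [Module.Finite F V]

/-- The differential of `ε`. -/
def d : Eps ρ →+ Eps ρ :=
  restrict (AddMonoidHom.mk' (fun f => f ∘ₗ twD ρ) (fun _ _ => rfl))
    (fun i f hf => mem_total (i := i + 1) fun j hj c s hs => by
      change f (twD ρ (c ⊗ₜ s)) = 0
      rw [twD_tmul, map_sum]
      exact Finset.sum_eq_zero fun k _ => hf (1 + j) (by lia) _ _
        (mul_mem_symDeg ρ (ι_mem_symDeg ρ _) hs))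

@[simp] lemma val_d (e : Eps ρ) (x : Tw ρ) : (d e).val x = e.val (twD ρ x) := rfl

lemma d_mem_deg {i : ℤ} {e : Eps ρ} (he : e ∈ deg ρ i) : d e ∈ deg ρ (i + 1) :=
  fun j hj c s hs => by
    rw [val_d, twD_tmul, map_sum]
    exact Finset.sum_eq_zero fun k _ => he (1 + j) (by lia) _ _
      (mul_mem_symDeg ρ (ι_mem_symDeg ρ _) hs)

lemma d_d (e : Eps ρ) : d (d e) = 0 := by
  ext x
  simp [twD_twD]

lemma d_smul (s : Sym ρ) (e : Eps ρ) : d (s • e) = s • d e := by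
  ext x
  simp [twD_twMul]

lemma d_op_smul (a : (Lam ρ)ᵐᵒᵖ) (e : Eps ρ) : d (a • e) = a • d e := by
  ext x
  simp

lemma d_act (q : Q) (e : Eps ρ) : d (act q e) = act q (d e) := by
  ext x
  simp [twAct_twD]

end Eps

/-! ## dg modules over `S ∗ Q` -/

/-- Right dg modules over the graded algebra `S ∗ Q` (with zero differential). -/
abbrev DGSymQ := DGModule (SymQ ρ) (symQDeg ρ)

/-- The ring homomorphism `S → (S ∗ Q)ᵒᵖ`, through which right `S ∗ Q`-modules are `S`-modules. -/
abbrev symToSymQ : Sym ρ →+* (SymQ ρ)ᵐᵒᵖ :=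
  (opSingleOne (Sym ρ) Q).comp (RingEquiv.toOpposite (Sym ρ)).toRingHom

variable {ρ}

/-- The underlying `S`-module of a dg module over `S ∗ Q`. -/
instance (M : DGSymQ ρ) : Module (Sym ρ) M.carrier :=
  Module.compHom M.carrier (symToSymQ ρ)

lemma sym_smul_def (M : DGSymQ ρ) (s : Sym ρ) (m : M.carrier) :
    s • m = op (single (1 : Q) s) • m := rfl

/-- The right action of `q` on a dg module over `S ∗ Q`. -/
def actR (M : DGSymQ ρ) (q : Q) : M.carrier →+ M.carrier :=
  DistribSMul.toAddMonoidHom _ (op (single q (1 : Sym ρ)))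

lemma actR_apply (M : DGSymQ ρ) (q : Q) (m : M.carrier) :
    actR M q m = op (single q (1 : Sym ρ)) • m := rfl

lemma actR_one (M : DGSymQ ρ) (m : M.carrier) : actR M 1 m = m := one_smul _ m

lemma actR_mul (M : DGSymQ ρ) (p q : Q) (m : M.carrier) :
    actR M (p * q) m = actR M q (actR M p m) := by
  rw [actR_apply, actR_apply, actR_apply, ← mul_smul, ← op_mul,
    SkewMonoidAlgebra.single_mul_single]
  simp

lemma actR_smul (M : DGSymQ ρ) (q : Q) (s : Sym ρ) (m : M.carrier) :
    actR M q (s • m) = (q⁻¹ • s) • actR M q m := by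
  rw [actR_apply, actR_apply, sym_smul_def, sym_smul_def, ← mul_smul, ← mul_smul, ← op_mul,
    ← op_mul, SkewMonoidAlgebra.single_mul_single, SkewMonoidAlgebra.single_mul_single]
  simp

lemma actR_mem (M : DGSymQ ρ) (q : Q) {i : ℤ} {m : M.carrier} (hm : m ∈ M.deg i) :
    actR M q m ∈ M.deg i := by
  have h : single q (1 : Sym ρ) ∈ symQDeg ρ 0 := fun p => by
    classical
    rw [SkewMonoidAlgebra.coeff_single_apply]
    split_ifs
    · exact one_mem_symDeg ρ
    · exact (symDeg ρ 0).zero_mem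
  have := M.smul_mem hm h
  rwa [add_zero] at this

lemma map_sym_smul {M N : DGSymQ ρ} (f : M.carrier →ₗ[(SymQ ρ)ᵐᵒᵖ] N.carrier) (s : Sym ρ)
    (m : M.carrier) : f.toAddMonoidHom (s • m) = s • f.toAddMonoidHom m :=
  map_smul f _ m

/-! ## The functor `- ⊗_S ε` -/

/-- The tensor product `M ⊗_S ε`. -/
def TensorEps (M : DGSymQ ρ) : Type u := M.carrier ⊗[Sym ρ] Eps ρ

namespace TensorEps

variable (M : DGSymQ ρ)

instance : AddCommGroup (TensorEps M) := inferInstanceAs (AddCommGroup (M.carrier ⊗[Sym ρ] Eps ρ))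

/-- The pure tensor `m ⊗ e`. -/
def tmul (m : M.carrier) (e : Eps ρ) : TensorEps M := m ⊗ₜ[Sym ρ] e

variable {M}

/-- Additive maps out of `M ⊗_S ε` from balanced biadditive maps. -/
def lift {P : Type*} [AddCommGroup P] (f : M.carrier →+ Eps ρ →+ P)
    (h : ∀ (s : Sym ρ) m e, f (s • m) e = f m (s • e)) : TensorEps M →+ P :=
  TensorProduct.liftAddHom f h

@[simp] lemma lift_tmul {P : Type*} [AddCommGroup P] (f : M.carrier →+ Eps ρ →+ P)
    (h : ∀ (s : Sym ρ) m e, f (s • m) e = f m (s • e)) (m : M.carrier) (e : Eps ρ) :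
    lift f h (tmul M m e) = f m e := rfl

lemma tmul_add (m : M.carrier) (e e' : Eps ρ) : tmul M m (e + e') = tmul M m e + tmul M m e' :=
  TensorProduct.tmul_add _ _ _

lemma add_tmul (m m' : M.carrier) (e : Eps ρ) : tmul M (m + m') e = tmul M m e + tmul M m' e :=
  TensorProduct.add_tmul _ _ _

lemma smul_tmul (s : Sym ρ) (m : M.carrier) (e : Eps ρ) :
    tmul M (s • m) e = tmul M m (s • e) :=
  TensorProduct.smul_tmul _ _ _

lemma hom_ext {P : Type*} [AddCommGroup P] {f g : TensorEps M →+ P}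
    (h : ∀ m e, f (tmul M m e) = g (tmul M m e)) : f = g :=
  AddMonoidHom.ext fun t => by
    induction t using TensorProduct.induction_on with
    | zero => exact (map_zero f).trans (map_zero g).symm
    | tmul m e => exact h m e
    | add x y hx hy =>
      exact (map_add f x y).trans ((congrArg₂ (· + ·) hx hy).trans (map_add g x y).symm)

variable (M) in
/-- The additive map `m ⊗ e ↦ φ m ⊗ ψ e`. -/
def map {N : DGSymQ ρ} (φ : M.carrier →+ N.carrier) (ψ : Eps ρ →+ Eps ρ) (σ : Sym ρ → Sym ρ)
    (hφ : ∀ s m, φ (s • m) = σ s • φ m) (hψ : ∀ s e, ψ (s • e) = σ s • ψ e) :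
    TensorEps M →+ TensorEps N :=
  lift (AddMonoidHom.mk' (fun m => AddMonoidHom.mk' (fun e => tmul N (φ m) (ψ e))
    (fun e e' => by rw [map_add, tmul_add])) (fun m m' => by
      ext e
      change tmul N (φ (m + m')) (ψ e) = tmul N (φ m) (ψ e) + tmul N (φ m') (ψ e)
      rw [map_add, add_tmul])) (fun s m e => by
      change tmul N (φ (s • m)) (ψ e) = tmul N (φ m) (ψ (s • e))
      rw [hφ, hψ, smul_tmul])

@[simp] lemma map_tmul {N : DGSymQ ρ} (φ : M.carrier →+ N.carrier) (ψ : Eps ρ →+ Eps ρ)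
    (σ : Sym ρ → Sym ρ) (hφ : ∀ s m, φ (s • m) = σ s • φ m) (hψ : ∀ s e, ψ (s • e) = σ s • ψ e)
    (m : M.carrier) (e : Eps ρ) :
    map M φ ψ σ hφ hψ (tmul M m e) = tmul N (φ m) (ψ e) := rfl

variable (M)

/-- The right action `(m ⊗ e) a = m ⊗ (e a)` of `Λ`. -/
def actL : Lam ρ →+* (AddMonoid.End (TensorEps M))ᵐᵒᵖ where
  toFun a := op (map M (AddMonoidHom.id _) (DistribSMul.toAddMonoidHom _ (op a)) id
    (fun _ _ => rfl) (fun s e => (smul_comm s (op a) e).symm))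
  map_one' := congrArg op (hom_ext fun m e => by
    change tmul M m (op (1 : Lam ρ) • e) = tmul M m e
    rw [op_one, one_smul])
  map_mul' a b := congrArg op (hom_ext fun m e => by
    change tmul M m (op (a * b) • e) = tmul M m (op b • op a • e)
    rw [op_mul, mul_smul])
  map_zero' := congrArg op (hom_ext fun m e => by
    change tmul M m (op (0 : Lam ρ) • e) = 0
    rw [op_zero, zero_smul]
    exact TensorProduct.tmul_zero _ _)
  map_add' a b := congrArg op (hom_ext fun m e => by
    change tmul M m (op (a + b) • e) = tmul M m (op a • e) + tmul M m (op b • e)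
    rw [MulOpposite.op_add, add_smul, tmul_add])

/-- The diagonal right action `(m ⊗ e) q = m q ⊗ e q` of `Q`. -/
def actQ : Q →* (AddMonoid.End (TensorEps M))ᵐᵒᵖ where
  toFun q := op (map M (actR M q) (Eps.act q) (fun s => q⁻¹ • s) (actR_smul M q) (Eps.act_smul q))
  map_one' := congrArg op (hom_ext fun m e => by
    change tmul M (actR M 1 m) (Eps.act 1 e) = tmul M m e
    rw [actR_one, Eps.act_one])
  map_mul' p q := congrArg op (hom_ext fun m e => by
    change tmul M (actR M (p * q) m) (Eps.act (p * q) e) =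
      tmul M (actR M q (actR M p m)) (Eps.act q (Eps.act p e))
    rw [actR_mul, Eps.act_mul])

lemma actL_actQ (a : Lam ρ) (q : Q) : actL M (q • a) * actQ M q = actQ M q * actL M a :=
  congrArg op (hom_ext fun m e => by
    change tmul M (actR M q m) (Eps.act q (op (q • a) • e)) =
      tmul M (actR M q m) (op a • Eps.act q e)
    rw [Eps.act_op_smul])

/-- The right `Λ ∗ Q`-module structure on `M ⊗_S ε`. -/
instance : Module (LamQ ρ)ᵐᵒᵖ (TensorEps M) := rightModule (actL M) (actQ M) (actL_actQ M)

lemma smul_tmul' (a : Lam ρ) (q : Q) (m : M.carrier) (e : Eps ρ) :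
    op (single q a) • tmul M m e = tmul M (actR M q m) (Eps.act q (op a • e)) :=
  rightModule_smul (actL M) (actQ M) (actL_actQ M) a q (tmul M m e)

variable {M}

/-- Additive maps compatible with the action of `Λ ∗ Q` on pure tensors are linear. -/
def linear {P : Type u} [AddCommGroup P] [Module (LamQ ρ)ᵐᵒᵖ P] (f : TensorEps M →+ P)
    (h : ∀ (a : Lam ρ) (q : Q) (m : M.carrier) (e : Eps ρ),
      f (tmul M (actR M q m) (Eps.act q (op a • e))) = op (single q a) • f (tmul M m e)) :
    TensorEps M →ₗ[(LamQ ρ)ᵐᵒᵖ] P :=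
  linearMapOfSingle f fun a q t => by
    have : f.comp (DistribSMul.toAddMonoidHom _ (op (single q a))) =
        (DistribSMul.toAddMonoidHom P (op (single q a))).comp f := hom_ext fun m e => by
      simp only [AddMonoidHom.comp_apply, DistribSMul.toAddMonoidHom_apply, smul_tmul', h]
    exact DFunLike.congr_fun this t

/-- The map `f ⊗ ε` induced by a morphism `f` of dg modules. -/
def mapHom {M N : DGSymQ ρ} (f : M ⟶ N) : TensorEps M →ₗ[(LamQ ρ)ᵐᵒᵖ] TensorEps N :=
  linear (map M f.toLin.toAddMonoidHom (AddMonoidHom.id _) id (map_sym_smul f.toLin)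
    (fun _ _ => rfl)) (fun a q m e => by
      rw [map_tmul, map_tmul, smul_tmul']
      exact congrArg (fun x => tmul N x _) (map_smul f.toLin _ m))

lemma mapHom_tmul {M N : DGSymQ ρ} (f : M ⟶ N) (m : M.carrier) (e : Eps ρ) :
    mapHom f (tmul M m e) = tmul N (f.toLin m) e := rfl

variable (M) in
/-- The part of degree `n` of `M ⊗_S ε`, generated by the `m ⊗ e` with `|m| + |e| = n`. -/
def deg (n : ℤ) : Submodule (LamQ ρ)ᵐᵒᵖ (TensorEps M) where
  __ := AddSubgroup.closure
    { t | ∃ (i j : ℤ) (m : M.carrier) (e : Eps ρ), i + j = n ∧ m ∈ M.deg i ∧ e ∈ Eps.deg ρ j ∧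
      t = tmul M m e }
  smul_mem' r t ht := by
    refine smul_mem_of_single (AddSubgroup.closure _) (fun a q t ht => ?_) r ht
    induction ht using AddSubgroup.closure_induction with
    | mem t ht =>
      obtain ⟨i, j, m, e, hij, hm, he, rfl⟩ := ht
      rw [smul_tmul']
      exact AddSubgroup.subset_closure ⟨i, j, _, _, hij, actR_mem M q hm,
        Eps.act_mem_deg q (Eps.op_smul_mem_deg _ he), rfl⟩
    | zero => rw [smul_zero]; exact zero_mem _
    | add x y _ _ hx hy => rw [smul_add]; exact add_mem hx hy
    | neg x _ hx => rw [smul_neg]; exact neg_mem hx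

lemma tmul_mem_deg {i j n : ℤ} (h : i + j = n) {m : M.carrier} {e : Eps ρ} (hm : m ∈ M.deg i)
    (he : e ∈ Eps.deg ρ j) : tmul M m e ∈ deg M n :=
  AddSubgroup.subset_closure ⟨i, j, m, e, h, hm, he, rfl⟩

lemma deg_induction {n : ℤ} {p : TensorEps M → Prop}
    (hom : ∀ i j, i + j = n → ∀ m ∈ M.deg i, ∀ e ∈ Eps.deg ρ j, p (tmul M m e)) (zero : p 0)
    (add : ∀ x y, p x → p y → p (x + y)) (neg : ∀ x, p x → p (-x))
    {t : TensorEps M} (ht : t ∈ deg M n) : p t := by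
  have ht' : t ∈ AddSubgroup.closure
    { t | ∃ (i j : ℤ) (m : M.carrier) (e : Eps ρ), i + j = n ∧ m ∈ M.deg i ∧ e ∈ Eps.deg ρ j ∧
      t = tmul M m e } := ht
  induction ht' using AddSubgroup.closure_induction with
  | mem t hx =>
    obtain ⟨i, j, m, e, hij, hm, he, rfl⟩ := hx
    exact hom i j hij m hm e he
  | zero => exact zero
  | add x y hx' hy' hx hy => exact add x y (hx hx') (hy hy')
  | neg x hx' hx => exact neg x (hx hx')

lemma mapHom_mem {M N : DGSymQ ρ} (f : M ⟶ N) {n : ℤ} {t : TensorEps M} (ht : t ∈ deg M n) :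
    mapHom f t ∈ deg N n :=
  deg_induction (p := fun t => mapHom f t ∈ deg N n)
    (fun _ _ h _ hm _ he => tmul_mem_deg h (f.map_mem hm) he)
    (by rw [map_zero]; exact zero_mem _)
    (fun x y hx hy => by rw [map_add]; exact add_mem hx hy)
    (fun x hx => by rw [map_neg]; exact neg_mem hx) ht

lemma lam_add_self [CharP F 2] (a : Lam ρ) : a + a = 0 := by
  have h : (1 : F) + 1 = 0 := by
    have := CharP.cast_eq_zero F 2
    norm_num at this ⊢
    exact this
  calc a + a = ((1 : F) + 1) • a := by rw [add_smul, one_smul]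
    _ = 0 := by rw [h, zero_smul]

lemma _root_.BGG.Eps.add_self [CharP F 2] (e : Eps ρ) : e + e = 0 := by
  ext x
  simp [lam_add_self]

variable [Module.Finite F V]

variable (M) in
/-- The differential `m ⊗ e ↦ d m ⊗ e + m ⊗ d e` of `M ⊗_S ε` (in characteristic two). -/
def d : TensorEps M →ₗ[(LamQ ρ)ᵐᵒᵖ] TensorEps M :=
  linear (map M M.d.toAddMonoidHom (AddMonoidHom.id _) id (map_sym_smul M.d)
      (fun _ _ => rfl) +
    map M (AddMonoidHom.id _) Eps.d id (fun _ _ => rfl) Eps.d_smul) (fun a q m e => by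
      simp only [AddMonoidHom.add_apply, map_tmul, smul_add, smul_tmul']
      congr 1
      · exact congrArg (fun x => tmul M x _) (map_smul M.d _ m)
      · rw [Eps.d_act, Eps.d_op_smul]
        rfl)

lemma d_tmul (m : M.carrier) (e : Eps ρ) :
    d M (tmul M m e) = tmul M (M.d m) e + tmul M m (Eps.d e) := rfl

lemma d_mem {n : ℤ} {t : TensorEps M} (ht : t ∈ deg M n) : d M t ∈ deg M (n + 1) :=
  deg_induction (p := fun t => d M t ∈ deg M (n + 1))
    (fun i j h m hm e he => by
      rw [d_tmul]
      exact add_mem (tmul_mem_deg (i := i + 1) (by lia) (M.d_mem hm) he)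
        (tmul_mem_deg (j := j + 1) (by lia) hm (Eps.d_mem_deg he)))
    (by rw [map_zero]; exact zero_mem _)
    (fun x y hx hy => by rw [map_add]; exact add_mem hx hy)
    (fun x hx => by rw [map_neg]; exact neg_mem hx) ht

lemma mapHom_d {M N : DGSymQ ρ} (f : M ⟶ N) (t : TensorEps M) :
    mapHom f (d M t) = d N (mapHom f t) := by
  have : (mapHom f).toAddMonoidHom.comp (d M).toAddMonoidHom =
      (d N).toAddMonoidHom.comp (mapHom f).toAddMonoidHom := hom_ext fun m e => by
    change mapHom f (d M (tmul M m e)) = d N (mapHom f (tmul M m e))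
    rw [d_tmul, map_add, mapHom_tmul, mapHom_tmul, mapHom_tmul, d_tmul, f.comm]
  exact DFunLike.congr_fun this t

lemma d_d [CharP F 2] (t : TensorEps M) : d M (d M t) = 0 := by
  have : (d M).toAddMonoidHom.comp (d M).toAddMonoidHom = 0 := hom_ext fun m e => by
    change d M (d M (tmul M m e)) = 0
    rw [d_tmul, map_add, d_tmul, d_tmul, M.d_d, Eps.d_d]
    have h1 : tmul M 0 e = 0 := TensorProduct.zero_tmul _ _
    have h2 : tmul M m 0 = 0 := TensorProduct.tmul_zero _ _
    rw [h1, h2, zero_add, add_zero, ← tmul_add, Eps.add_self]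
    exact TensorProduct.tmul_zero _ _
  exact DFunLike.congr_fun this t

end TensorEps

section

variable [Module.Finite F V] [CharP F 2]

/-- The cochain complex `M ⊗_S ε` of right `Λ ∗ Q`-modules. -/
def tensorEpsObj (M : DGSymQ ρ) : CochainComplex (ModuleCat.{u} (LamQ ρ)ᵐᵒᵖ) ℤ where
  X n := ModuleCat.of _ (TensorEps.deg M n)
  d i j := if h : i + 1 = j then
      ModuleCat.ofHom ((TensorEps.d M).restrict fun _ ht => h ▸ TensorEps.d_mem ht)
    else 0
  shape i j h := dif_neg h
  d_comp_d' i j k hij hjk := by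
    have hij : i + 1 = j := hij
    have hjk : j + 1 = k := hjk
    rw [dif_pos hij, dif_pos hjk]
    exact ModuleCat.hom_ext (LinearMap.ext fun t => Subtype.ext (TensorEps.d_d t.1))

lemma tensorEpsObj_d (M : DGSymQ ρ) (i : ℤ) : (tensorEpsObj M).d i (i + 1) =
    ModuleCat.ofHom ((TensorEps.d M).restrict fun _ ht => TensorEps.d_mem ht) :=
  dif_pos rfl

variable (ρ) in
/-- The functor `- ⊗_S ε` from dg modules over `S ∗ Q` to complexes of `Λ ∗ Q`-modules. -/
def tensorEps : DGSymQ ρ ⥤ CochainComplex (ModuleCat.{u} (LamQ ρ)ᵐᵒᵖ) ℤ where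
  obj := tensorEpsObj
  map f :=
    { f := fun n => ModuleCat.ofHom
        ((TensorEps.mapHom f).restrict fun _ ht => TensorEps.mapHom_mem f ht)
      comm' := fun i j h => by
        have h : i + 1 = j := h
        subst h
        rw [tensorEpsObj_d, tensorEpsObj_d]
        ext t
        exact Subtype.ext (TensorEps.mapHom_d f t.1).symm }
  map_id M := by
    ext n t
    refine Subtype.ext ?_
    have : (TensorEps.mapHom (𝟙 M)).toAddMonoidHom = AddMonoidHom.id _ :=
      TensorEps.hom_ext fun m e => rfl
    exact DFunLike.congr_fun this t.1
  map_comp f g := by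
    ext n t
    refine Subtype.ext ?_
    have : (TensorEps.mapHom (f ≫ g)).toAddMonoidHom =
        (TensorEps.mapHom g).toAddMonoidHom.comp (TensorEps.mapHom f).toAddMonoidHom :=
      TensorEps.hom_ext fun m e => rfl
    exact DFunLike.congr_fun this t.1

end

/-! ## The functor `Hom_Λ(ε, -)` -/

lemma isInternal_comap {M N : Type u} [AddCommGroup M] [AddCommGroup N] (A : ℤ → AddSubgroup M)
    (hA : Function.Injective (DirectSum.coeAddMonoidHom A)) (φ : N →+ M)
    (hφ : Function.Injective φ) (hr : φ.range = ⨆ i, A i) :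
    DirectSum.IsInternal fun i => (A i).comap φ := by
  constructor
  · rw [injective_iff_map_eq_zero]
    intro x hx
    let g : (⨁ i, (A i).comap φ) →+ ⨁ i, A i :=
      DirectSum.map fun i => AddMonoidHom.mk' (fun y => ⟨φ y.1, y.2⟩)
        (fun a b => Subtype.ext (map_add φ a.1 b.1))
    have e : (DirectSum.coeAddMonoidHom A).comp g =
        φ.comp (DirectSum.coeAddMonoidHom fun i => (A i).comap φ) := by
      ext i y
      simp [g]
    have h : g x = 0 := hA (by
      have := DFunLike.congr_fun e x
      simp only [AddMonoidHom.comp_apply, hx, map_zero] at this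
      rw [this, map_zero])
    ext i : 1
    have a := congrArg (fun z => (z i : M)) h
    exact Subtype.ext (hφ (by simpa [g] using a))
  · intro n
    have key : ∀ m ∈ ⨆ i, A i, ∀ n, φ n = m →
        ∃ x, DirectSum.coeAddMonoidHom (fun i => (A i).comap φ) x = n := by
      intro m hm
      induction hm using AddSubgroup.iSup_induction' with
      | hp i m hm =>
        intro n hn
        exact ⟨DirectSum.of (fun i => (A i).comap φ) i ⟨n, by subst hn; exact hm⟩, by simp⟩
      | h1 =>
        intro n hn
        exact ⟨0, by rw [map_zero]; exact (hφ (hn.trans (map_zero φ).symm)).symm⟩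
      | hadd x y hx hy h1 h2 =>
        intro n hn
        rw [← hr] at hx
        obtain ⟨a, ha⟩ := hx
        obtain ⟨u, hu⟩ := h1 a ha
        obtain ⟨v, hv⟩ := h2 (n - a) (by rw [map_sub, hn, ha, add_sub_cancel_left])
        exact ⟨u + v, by rw [map_add, hu, hv, add_sub_cancel]⟩
    exact key (φ n) (by rw [← hr]; exact ⟨n, rfl⟩) n rfl

variable (C D : CochainComplex (ModuleCat.{u} (LamQ ρ)ᵐᵒᵖ) ℤ)

/-- The direct sum of the terms of a cochain complex of right `Λ ∗ Q`-modules. -/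
def Tot : Type u := ⨁ i, C.X i

namespace Tot

instance : AddCommGroup (Tot C) := inferInstanceAs (AddCommGroup (⨁ i, C.X i))
instance : Module (LamQ ρ)ᵐᵒᵖ (Tot C) := inferInstanceAs (Module (LamQ ρ)ᵐᵒᵖ (⨁ i, C.X i))
instance : Module (Lam ρ)ᵐᵒᵖ (Tot C) := Module.compHom (Tot C) (opSingleOne (Lam ρ) Q)

lemma lam_smul_def (a : Lam ρ) (t : Tot C) : op a • t = op (single (1 : Q) a) • t := rfl

/-- The inclusion of the term of degree `i`. -/
def incl (i : ℤ) : C.X i →ₗ[(LamQ ρ)ᵐᵒᵖ] Tot C := DirectSum.lof _ ℤ (fun i => C.X i) i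

/-- The projection onto the term of degree `i`. -/
def proj (i : ℤ) : Tot C →ₗ[(LamQ ρ)ᵐᵒᵖ] C.X i := DirectSum.component _ ℤ (fun i => C.X i) i

/-- The part of degree `i`. -/
def deg (i : ℤ) : AddSubgroup (Tot C) := (incl C i).toAddMonoidHom.range

/-- The total differential. -/
def d : Tot C →ₗ[(LamQ ρ)ᵐᵒᵖ] Tot C :=
  DirectSum.toModule _ ℤ _ fun i => incl C (i + 1) ∘ₗ (C.d i (i + 1)).hom

variable {C D}

lemma induction {p : Tot C → Prop} (hom : ∀ i x, p (incl C i x)) (zero : p 0)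
    (add : ∀ x y, p x → p y → p (x + y)) (t : Tot C) : p t :=
  DirectSum.induction_on t zero hom add

/-- The map on direct sums of the terms induced by a morphism of complexes. -/
def map (g : C ⟶ D) : Tot C →ₗ[(LamQ ρ)ᵐᵒᵖ] Tot D :=
  DirectSum.toModule _ ℤ _ fun i => incl D i ∘ₗ (g.f i).hom

@[simp] lemma proj_incl (i : ℤ) (x : C.X i) : proj C i (incl C i x) = x :=
  DirectSum.component.lof_self ..

lemma proj_incl_ne {i j : ℤ} (h : i ≠ j) (x : C.X i) : proj C j (incl C i x) = 0 := by
  change DirectSum.of (fun i => C.X i) i x j = 0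
  exact DirectSum.of_eq_of_ne _ _ _ h.symm

@[simp] lemma d_incl (i : ℤ) (x : C.X i) : d C (incl C i x) = incl C (i + 1) (C.d i (i + 1) x) :=
  DirectSum.toModule_lof _ _ _

@[simp] lemma map_incl (g : C ⟶ D) (i : ℤ) (x : C.X i) :
    map g (incl C i x) = incl D i (g.f i x) :=
  DirectSum.toModule_lof _ _ _

lemma d_d (t : Tot C) : d C (d C t) = 0 := by
  induction t using Tot.induction with
  | hom i x =>
    rw [d_incl, d_incl]
    have : C.d (i + 1) (i + 1 + 1) (C.d i (i + 1) x) = 0 := by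
      rw [← ModuleCat.comp_apply, C.d_comp_d]
      rfl
    rw [this, map_zero]
  | zero => simp
  | add x y hx hy => simp [hx, hy]

lemma map_d (g : C ⟶ D) (t : Tot C) : map g (d C t) = d D (map g t) := by
  induction t using Tot.induction with
  | hom i x =>
    rw [d_incl, map_incl, map_incl, d_incl]
    congr 1
    rw [← ModuleCat.comp_apply, ← ModuleCat.comp_apply, g.comm]
  | zero => simp
  | add x y hx hy => simp [hx, hy]

lemma proj_d (n : ℤ) (t : Tot C) : proj C (n + 1) (d C t) = C.d n (n + 1) (proj C n t) := by
  induction t using Tot.induction with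
  | hom i x =>
    rw [d_incl]
    by_cases h : i = n
    · subst h
      simp
    · rw [proj_incl_ne (by lia), proj_incl_ne h, map_zero]
  | zero => simp
  | add x y hx hy => simp [hx, hy]

lemma d_mem {i : ℤ} {t : Tot C} (ht : t ∈ deg C i) : d C t ∈ deg C (i + 1) := by
  obtain ⟨x, rfl⟩ := ht
  exact ⟨_, (d_incl i x).symm⟩

lemma map_mem (g : C ⟶ D) {i : ℤ} {t : Tot C} (ht : t ∈ deg C i) : map g t ∈ deg D i := by
  obtain ⟨x, rfl⟩ := ht
  exact ⟨_, (map_incl g i x).symm⟩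

lemma smul_mem (r : (LamQ ρ)ᵐᵒᵖ) {i : ℤ} {t : Tot C} (ht : t ∈ deg C i) : r • t ∈ deg C i := by
  obtain ⟨x, rfl⟩ := ht
  exact ⟨r • x, map_smul (incl C i) r x⟩

/-- Change of scalars of a map, from `Λ ∗ Q` to `Λ`. -/
lemma map_lam_smul (φ : Tot C →ₗ[(LamQ ρ)ᵐᵒᵖ] Tot D) (a : (Lam ρ)ᵐᵒᵖ) (t : Tot C) :
    φ (a • t) = a • φ t := map_smul φ _ t

/-- The right action of `q`. -/
def act (q : Q) : Tot C →+ Tot C := DistribSMul.toAddMonoidHom _ (op (single q (1 : Lam ρ)))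

lemma act_apply (q : Q) (t : Tot C) : act q t = op (single q (1 : Lam ρ)) • t := rfl

lemma act_one (t : Tot C) : act 1 t = t := one_smul _ t

lemma act_mul (p q : Q) (t : Tot C) : act (p * q) t = act q (act p t) := by
  rw [act_apply, act_apply, act_apply, ← mul_smul, ← op_mul, SkewMonoidAlgebra.single_mul_single]
  simp

lemma act_op_smul (q : Q) (a : Lam ρ) (t : Tot C) :
    act q (op (q • a) • t) = op a • act q t := by
  rw [act_apply, act_apply, lam_smul_def, lam_smul_def, ← mul_smul, ← mul_smul, ← op_mul,
    ← op_mul, SkewMonoidAlgebra.single_mul_single, SkewMonoidAlgebra.single_mul_single]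
  simp

end Tot

/-- The right `Λ`-linear maps from `ε` to (the direct sum of the terms of) `C`. -/
def HomEps : Type u := Eps ρ →ₗ[(Lam ρ)ᵐᵒᵖ] Tot C

namespace HomEps

instance : AddCommGroup (HomEps C) := inferInstanceAs (AddCommGroup (Eps ρ →ₗ[(Lam ρ)ᵐᵒᵖ] Tot C))

variable {C D}

/-- The underlying linear map. -/
def lin (f : HomEps C) : Eps ρ →ₗ[(Lam ρ)ᵐᵒᵖ] Tot C := f

@[ext]
lemma ext {f g : HomEps C} (h : ∀ e, f.lin e = g.lin e) : f = g := LinearMap.ext h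

@[simp] lemma add_lin (f g : HomEps C) (e : Eps ρ) : (f + g).lin e = f.lin e + g.lin e := rfl
@[simp] lemma zero_lin (e : Eps ρ) : (0 : HomEps C).lin e = 0 := rfl
@[simp] lemma neg_lin (f : HomEps C) (e : Eps ρ) : (-f).lin e = -f.lin e := rfl

variable (C)

/-- The right action `(f s)(e) = f(s e)` of `S`. -/
def actS : Sym ρ →+* (AddMonoid.End (HomEps C))ᵐᵒᵖ where
  toFun s := op (AddMonoidHom.mk' (fun f =>
    { toFun := fun e => f.lin (s • e)
      map_add' := fun e e' => by rw [smul_add, map_add]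
      map_smul' := fun a e => by rw [smul_comm, map_smul]; rfl }) (fun _ _ => rfl))
  map_one' := congrArg op (AddMonoidHom.ext fun f => ext fun e => congrArg f.lin (one_smul _ e))
  map_mul' s t := congrArg op (AddMonoidHom.ext fun f => ext fun e =>
    congrArg f.lin (mul_smul s t e))
  map_zero' := congrArg op (AddMonoidHom.ext fun f => ext fun e =>
    (congrArg f.lin (zero_smul _ e)).trans (map_zero f.lin))
  map_add' s t := congrArg op (AddMonoidHom.ext fun f => ext fun e =>
    (congrArg f.lin (add_smul s t e)).trans (map_add f.lin _ _))

/-- The right action `(f q)(e) = f(e q⁻¹) q` of `Q`. -/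
def actQ : Q →* (AddMonoid.End (HomEps C))ᵐᵒᵖ where
  toFun q := op (AddMonoidHom.mk' (fun f =>
    { toFun := fun e => Tot.act q (f.lin (Eps.act q⁻¹ e))
      map_add' := fun e e' => by rw [map_add, map_add, map_add]
      map_smul' := fun a e => by
        have h := Eps.act_op_smul q⁻¹ (q • a.unop) e
        rw [inv_smul_smul] at h
        change Tot.act q (f.lin (Eps.act q⁻¹ (op a.unop • e))) = op a.unop • _
        rw [h, map_smul, Tot.act_op_smul] }) (fun f g => ext fun e => by
      change Tot.act q (f.lin _ + g.lin _) = _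
      rw [map_add]
      rfl))
  map_one' := congrArg op (AddMonoidHom.ext fun f => ext fun e => by
    change Tot.act 1 (f.lin (Eps.act 1⁻¹ e)) = f.lin e
    rw [inv_one, Eps.act_one, Tot.act_one])
  map_mul' p q := congrArg op (AddMonoidHom.ext fun f => ext fun e => by
    change Tot.act (p * q) (f.lin (Eps.act (p * q)⁻¹ e)) =
      Tot.act q (Tot.act p (f.lin (Eps.act p⁻¹ (Eps.act q⁻¹ e))))
    rw [mul_inv_rev, Eps.act_mul, Tot.act_mul])

lemma actS_actQ (s : Sym ρ) (q : Q) : actS C (q • s) * actQ C q = actQ C q * actS C s :=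
  congrArg op (AddMonoidHom.ext fun f => ext fun e => by
    change Tot.act q (f.lin ((q • s) • Eps.act q⁻¹ e)) = Tot.act q (f.lin (Eps.act q⁻¹ (s • e)))
    rw [Eps.act_smul, inv_inv])

/-- The right `S ∗ Q`-module structure on `Hom_Λ(ε, C)`. -/
instance : Module (SymQ ρ)ᵐᵒᵖ (HomEps C) := rightModule (actS C) (actQ C) (actS_actQ C)

variable {C}

lemma smul_lin (s : Sym ρ) (q : Q) (f : HomEps C) (e : Eps ρ) :
    (op (single q s) • f).lin e = Tot.act q (f.lin (s • Eps.act q⁻¹ e)) :=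
  congrArg (fun g : HomEps C => g.lin e)
    (rightModule_smul (actS C) (actQ C) (actS_actQ C) s q f)

variable (C) in
/-- The maps of degree `n`. -/
def homDeg (n : ℤ) : AddSubgroup (HomEps C) where
  carrier := { f | ∀ i : ℤ, ∀ e ∈ Eps.deg ρ i, f.lin e ∈ Tot.deg C (i + n) }
  zero_mem' _ _ _ := zero_mem _
  add_mem' hf hg i e he := add_mem (hf i e he) (hg i e he)
  neg_mem' hf i e he := neg_mem (hf i e he)

lemma smul_mem_homDeg {n j : ℤ} {s : Sym ρ} (hs : s ∈ symDeg ρ j) (q : Q) {f : HomEps C}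
    (hf : f ∈ homDeg C n) : op (single q s) • f ∈ homDeg C (n + j) := by
  intro i e he
  rw [smul_lin]
  have := hf _ _ (Eps.smul_mem_deg hs (Eps.act_mem_deg q⁻¹ he))
  rw [show i + j + n = i + (n + j) by ring] at this
  exact Tot.smul_mem _ this

lemma smul_mem_iSup (s : Sym ρ) (q : Q) {f : HomEps C} (hf : f ∈ ⨆ n, homDeg C n) :
    op (single q s) • f ∈ ⨆ n, homDeg C n := by
  induction s using Sym.induction generalizing f q with
  | algebraMap r =>
    have h : algebraMap F (Sym ρ) r ∈ symDeg ρ 0 := by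
      rw [Algebra.algebraMap_eq_smul_one]
      exact (symDeg ρ 0).smul_mem r (one_mem_symDeg ρ)
    have : ⨆ n, homDeg C n ≤ (⨆ n, homDeg C n).comap
        (DistribSMul.toAddMonoidHom _ (op (single q (algebraMap F (Sym ρ) r)))) :=
      iSup_le fun n f hf => AddSubgroup.mem_iSup_of_mem _ (smul_mem_homDeg h q hf)
    exact this hf
  | ι v =>
    have : ⨆ n, homDeg C n ≤ (⨆ n, homDeg C n).comap
        (DistribSMul.toAddMonoidHom _ (op (single q (ιSym ρ v)))) :=
      iSup_le fun n f hf => AddSubgroup.mem_iSup_of_mem _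
        (smul_mem_homDeg (ι_mem_symDeg ρ v) q hf)
    exact this hf
  | mul a b ha hb =>
    have : op (single q ((a : Sym ρ) * b)) • f =
        op (single q (b : Sym ρ)) • op (single (1 : Q) (a : Sym ρ)) • f := by
      rw [← mul_smul, ← op_mul, SkewMonoidAlgebra.single_mul_single, one_smul, one_mul]
    exact this ▸ hb q (ha 1 hf)
  | add a b ha hb =>
    have : op (single q ((a : Sym ρ) + b)) • f =
        op (single q (a : Sym ρ)) • f + op (single q (b : Sym ρ)) • f := by
      rw [SkewMonoidAlgebra.single_add, MulOpposite.op_add, add_smul]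
    exact this ▸ add_mem (ha q hf) (hb q hf)

variable (C) in
/-- The hom complex `Hom_Λ(ε, C)`, as the direct sum of its homogeneous parts. -/
def total : Submodule (SymQ ρ)ᵐᵒᵖ (HomEps C) where
  __ := ⨆ n, homDeg C n
  smul_mem' r _ hf :=
    smul_mem_of_single (⨆ n, homDeg C n) (fun s q _ hf => smul_mem_iSup s q hf) r hf

lemma mem_total {n : ℤ} {f : HomEps C} (hf : f ∈ homDeg C n) : f ∈ total C :=
  AddSubgroup.mem_iSup_of_mem n hf

lemma homDeg_injective : Function.Injective (DirectSum.coeAddMonoidHom (homDeg C)) := by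
  rw [injective_iff_map_eq_zero]
  intro x hx
  ext n e
  change (x n : HomEps C).lin e = 0
  induction e using Eps.induction with
  | zero => exact map_zero _
  | add e e' h h' => rw [map_add, h, h', add_zero]
  | hom i e he =>
    have key : ∀ y : ⨁ n, homDeg C n,
        Tot.proj C (i + n) ((DirectSum.coeAddMonoidHom (homDeg C) y).lin e) =
          Tot.proj C (i + n) ((y n : HomEps C).lin e) := by
      intro y
      induction y using DirectSum.induction_on with
      | zero => simp
      | add y z hy hz => rw [map_add, add_lin, map_add, hy, hz, ← map_add]; rfl
      | of m y =>
        rw [DirectSum.coeAddMonoidHom_of]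
        by_cases h : m = n
        · subst h
          rw [DirectSum.of_eq_same]
        · rw [DirectSum.of_eq_of_ne _ _ _ (Ne.symm h)]
          obtain ⟨t, ht⟩ := y.2 i e he
          rw [← ht]
          exact (Tot.proj_incl_ne (by lia) t).trans (map_zero _).symm
    have h := key x
    rw [hx, zero_lin, map_zero] at h
    obtain ⟨t, ht⟩ := (x n).2 i e he
    rw [← ht] at h ⊢
    change 0 = Tot.proj C (i + n) (Tot.incl C (i + n) t) at h
    rw [Tot.proj_incl] at h
    subst h
    exact map_zero _

/-- Postcomposition with a morphism of complexes. -/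
def map (g : C ⟶ D) : HomEps C →ₗ[(SymQ ρ)ᵐᵒᵖ] HomEps D :=
  linearMapOfSingle (AddMonoidHom.mk' (fun f =>
      ({ toFun := fun e => Tot.map g (f.lin e)
         map_add' := fun e e' => by rw [map_add, map_add]
         map_smul' := fun a e => by rw [map_smul, Tot.map_lam_smul]; rfl } : HomEps D))
      (fun f f' => ext fun e => map_add (Tot.map g) _ _))
    (fun s q f => ext fun e => by
      rw [smul_lin]
      change Tot.map g ((op (single q s) • f).lin e) = _
      rw [smul_lin]
      exact map_smul (Tot.map g) _ _)

lemma map_lin (g : C ⟶ D) (f : HomEps C) (e : Eps ρ) :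
    (map g f).lin e = Tot.map g (f.lin e) := rfl

lemma map_mem_homDeg (g : C ⟶ D) {n : ℤ} {f : HomEps C} (hf : f ∈ homDeg C n) :
    map g f ∈ homDeg D n :=
  fun i e he => Tot.map_mem g (hf i e he)

lemma map_mem_total (g : C ⟶ D) {f : HomEps C} (hf : f ∈ total C) : map g f ∈ total D := by
  have : ⨆ n, homDeg C n ≤ (⨆ n, homDeg D n).comap (map g).toAddMonoidHom :=
    iSup_le fun n f hf => mem_total (map_mem_homDeg g hf)
  exact this hf

variable [Module.Finite F V]

variable (C) in
/-- The differential `f ↦ d f + f d` (in characteristic two). -/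
def d : HomEps C →ₗ[(SymQ ρ)ᵐᵒᵖ] HomEps C :=
  linearMapOfSingle (AddMonoidHom.mk' (fun f =>
      ({ toFun := fun e => Tot.d C (f.lin e) + f.lin (Eps.d e)
         map_add' := fun e e' => by simp only [map_add]; abel
         map_smul' := fun a e => by
          rw [map_smul, Tot.map_lam_smul, Eps.d_op_smul, map_smul, ← smul_add]
          rfl } : HomEps C))
      (fun f f' => ext fun e => by
        change Tot.d C (f.lin e + f'.lin e) + (f.lin _ + f'.lin _) =
          (Tot.d C (f.lin e) + f.lin _) + (Tot.d C (f'.lin e) + f'.lin _)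
        rw [map_add]; abel))
    (fun s q f => ext fun e => by
      rw [smul_lin]
      change Tot.d C ((op (single q s) • f).lin e) + (op (single q s) • f).lin (Eps.d e) =
        Tot.act q (Tot.d C (f.lin _) + f.lin (Eps.d _))
      rw [smul_lin, smul_lin, map_add, Eps.d_smul, Eps.d_act]
      congr 1
      exact map_smul (Tot.d C) _ _)

lemma d_lin (f : HomEps C) (e : Eps ρ) :
    (d C f).lin e = Tot.d C (f.lin e) + f.lin (Eps.d e) := rfl

lemma d_mem_homDeg {n : ℤ} {f : HomEps C} (hf : f ∈ homDeg C n) : d C f ∈ homDeg C (n + 1) := by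
  intro i e he
  rw [d_lin]
  refine add_mem ?_ ?_
  · have := Tot.d_mem (hf i e he)
    rwa [add_assoc] at this
  · have := hf _ _ (Eps.d_mem_deg he)
    rwa [show i + 1 + n = i + (n + 1) by ring] at this

lemma d_mem_total {f : HomEps C} (hf : f ∈ total C) : d C f ∈ total C := by
  have : ⨆ n, homDeg C n ≤ (⨆ n, homDeg C n).comap (d C).toAddMonoidHom :=
    iSup_le fun n f hf => mem_total (d_mem_homDeg hf)
  exact this hf

lemma d_d [CharP F 2] (f : HomEps C) : d C (d C f) = 0 := by
  ext e
  have h : ∀ t : Tot C, t + t = 0 := fun t => by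
    have : t + t = op ((1 : Lam ρ) + 1) • t := by
      rw [MulOpposite.op_add, add_smul, op_one, one_smul]
    rw [this, TensorEps.lam_add_self, op_zero, zero_smul]
  rw [d_lin, d_lin, d_lin, map_add, Tot.d_d, Eps.d_d, map_zero, add_zero, zero_add, h]
  rfl

lemma map_d (g : C ⟶ D) (f : HomEps C) : map g (d C f) = d D (map g f) := by
  ext e
  rw [map_lin, d_lin, d_lin, map_add, Tot.map_d]
  rfl

end HomEps

section


variable [Module.Finite F V] [CharP F 2]

/-- The dg module `Hom_Λ(ε, C)` over `S ∗ Q`. -/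
def homEpsObj : DGSymQ ρ where
  carrier := HomEps.total C
  deg n := (HomEps.homDeg C n).comap (HomEps.total C).subtype.toAddMonoidHom
  isInternal := isInternal_comap _ HomEps.homDeg_injective _ Subtype.val_injective (by
    ext f
    exact ⟨by rintro ⟨f, rfl⟩; exact f.2, fun hf => ⟨⟨f, hf⟩, rfl⟩⟩)
  smul_mem {i j f r} hf hr := by
    change op r • f.1 ∈ HomEps.homDeg C (i + j)
    rw [← SkewMonoidAlgebra.sum_single r, SkewMonoidAlgebra.sum_def, Finsupp.sum,
      Finset.op_sum, Finset.sum_smul]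
    exact sum_mem fun q _ => HomEps.smul_mem_homDeg (hr q) q hf
  d := (HomEps.d C).restrict fun _ hf => HomEps.d_mem_total hf
  d_mem hf := HomEps.d_mem_homDeg hf
  d_d f := Subtype.ext (HomEps.d_d f.1)

variable (ρ) in
/-- The functor `Hom_Λ(ε, -)` from complexes of right `Λ ∗ Q`-modules to dg modules over `S ∗ Q`. -/
def homEps : CochainComplex (ModuleCat.{u} (LamQ ρ)ᵐᵒᵖ) ℤ ⥤ DGSymQ ρ where
  obj C := homEpsObj C
  map g :=
    { toLin := (HomEps.map g).restrict fun _ hf => HomEps.map_mem_total g hf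
      map_mem := fun hf => HomEps.map_mem_homDeg g hf
      comm := fun f => Subtype.ext (HomEps.map_d g f.1) }
  map_id C := by
    ext f
    refine Subtype.ext (HomEps.ext fun e => ?_)
    change Tot.map (𝟙 C) (f.1.lin e) = f.1.lin e
    generalize f.1.lin e = t
    induction t using Tot.induction with
    | hom i x => rw [Tot.map_incl]; rfl
    | zero => simp
    | add x y hx hy => rw [map_add, hx, hy]
  map_comp {C D E} g h := by
    ext f
    refine Subtype.ext (HomEps.ext fun e => ?_)
    change Tot.map (g ≫ h) (f.1.lin e) = Tot.map h (Tot.map g (f.1.lin e))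
    generalize f.1.lin e = t
    induction t using Tot.induction with
    | hom i x => rw [Tot.map_incl, Tot.map_incl, Tot.map_incl]; rfl
    | zero => simp
    | add x y hx hy => rw [map_add, hx, hy, map_add, map_add]

/-! ## The evaluation map -/

/-- The evaluation `Hom_Λ(ε, C) ⊗_S ε → C`, `f ⊗ e ↦ f(e)`, on direct sums of terms. -/
def evalTot : TensorEps (homEpsObj C) →ₗ[(LamQ ρ)ᵐᵒᵖ] Tot C :=
  TensorEps.linear (TensorEps.lift (AddMonoidHom.mk' (fun f => (HomEps.lin f.1).toAddMonoidHom)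
    (fun _ _ => rfl)) (fun s f e => by
      change (op (single (1 : Q) s) • f.1).lin e = f.1.lin (s • e)
      rw [HomEps.smul_lin, inv_one, Eps.act_one, Tot.act_one])) (fun a q f e => by
      change (op (single q (1 : Sym ρ)) • f.1).lin (Eps.act q (op a • e)) =
        op (single q a) • f.1.lin e
      rw [HomEps.smul_lin, ← Eps.act_mul, mul_inv_cancel, Eps.act_one, one_smul, map_smul,
        op_single_eq, mul_smul]
      rfl)

lemma evalTot_tmul (f : (homEpsObj C).carrier) (e : Eps ρ) :
    evalTot C (TensorEps.tmul _ f e) = f.1.lin e := rfl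

lemma evalTot_d (t : TensorEps (homEpsObj C)) :
    evalTot C (TensorEps.d _ t) = Tot.d C (evalTot C t) := by
  have : (evalTot C).toAddMonoidHom.comp (TensorEps.d (homEpsObj C)).toAddMonoidHom =
      (Tot.d C).toAddMonoidHom.comp (evalTot C).toAddMonoidHom := TensorEps.hom_ext fun f e => by
    change evalTot C (TensorEps.d _ (TensorEps.tmul _ f e)) =
      Tot.d C (evalTot C (TensorEps.tmul _ f e))
    rw [TensorEps.d_tmul, map_add, evalTot_tmul, evalTot_tmul, evalTot_tmul]
    change (Tot.d C (f.1.lin e) + f.1.lin (Eps.d e)) + f.1.lin (Eps.d e) = _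
    rw [add_assoc, ← map_add, Eps.add_self, map_zero, add_zero]
  exact DFunLike.congr_fun this t

/-- The evaluation morphism `Hom_Λ(ε, C) ⊗_S ε ⟶ C`, `f ⊗ e ↦ f(e)`. -/
def evalHom : (tensorEps ρ).obj ((homEps ρ).obj C) ⟶ C where
  f n := ModuleCat.ofHom
    (Tot.proj C n ∘ₗ evalTot C ∘ₗ (TensorEps.deg (homEpsObj C) n).subtype)
  comm' i j h := by
    have h : i + 1 = j := h
    subst h
    change _ = (tensorEpsObj (homEpsObj C)).d i (i + 1) ≫ _
    rw [tensorEpsObj_d]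
    refine ModuleCat.hom_ext (LinearMap.ext fun t => ?_)
    exact (Tot.proj_d i (evalTot C t.1)).symm.trans (congrArg _ (evalTot_d C t.1).symm)

end

/-! ## The derived categories and their subcategories -/

variable (ρ) in
/-- The derived category `D(S ∗ Q)` of dg modules. -/
abbrev DSymQ := DGModule.Derived (SymQ ρ) (symQDeg ρ)

variable (ρ) in
/-- The localization functor from dg modules over `S ∗ Q` to `D(S ∗ Q)`. -/
abbrev QSym : DGSymQ ρ ⥤ DSymQ ρ := (DGModule.quasiIso (SymQ ρ) (symQDeg ρ)).Q

/-- The underlying graded `S`-module of a dg module over `S ∗ Q` is free and finitely generated: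
it has a finite homogeneous basis. -/
def IsSymFree (M : DGSymQ ρ) : Prop :=
  ∃ (n : ℕ) (k : Fin n → ℤ) (b : Module.Basis (Fin n) (Sym ρ) M.carrier), ∀ i, b i ∈ M.deg (k i)

/-- The total homology of a dg module over `S ∗ Q` is finite dimensional over `F` (where `F` acts
through `F → S → (S ∗ Q)ᵒᵖ`). -/
def HasFiniteHomology (M : DGSymQ ρ) : Prop :=
  letI : Module F M.homology :=
    Module.compHom M.homology ((symToSymQ ρ).comp (algebraMap F (Sym ρ)))
  Module.Finite F M.homology

variable (ρ) in
/-- `D_{S-perf}(S ∗ Q)`: the objects of `D(S ∗ Q)` isomorphic to dg modules whose underlying graded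
`S`-module is free and finitely generated. -/
def symPerf : ObjectProperty (DSymQ ρ) := fun X =>
  ∃ M : DGSymQ ρ, IsSymFree M ∧ Nonempty ((QSym ρ).obj M ≅ X)

variable (ρ) in
/-- `D^{hf}_{S-perf}(S ∗ Q)`: the objects of `D_{S-perf}(S ∗ Q)` with finite-dimensional total
homology. -/
def symPerfHf : ObjectProperty (DSymQ ρ) := fun X =>
  ∃ M : DGSymQ ρ, IsSymFree M ∧ HasFiniteHomology M ∧ Nonempty ((QSym ρ).obj M ≅ X)

/-- A cochain complex is bounded. -/
def IsBounded (C : CochainComplex (ModuleCat.{u} (LamQ ρ)ᵐᵒᵖ) ℤ) : Prop :=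
  ∃ a b : ℤ, ∀ i, i < a ∨ b < i → Limits.IsZero (C.X i)

/-- The underlying right `Λ`-module of a right `Λ ∗ Q`-module. -/
abbrev toLam (M : ModuleCat.{u} (LamQ ρ)ᵐᵒᵖ) : ModuleCat.{u} (Lam ρ)ᵐᵒᵖ :=
  (ModuleCat.restrictScalars (opSingleOne (Lam ρ) Q)).obj M

section

variable (ρ) [HasDerivedCategory.{w} (ModuleCat.{u} (LamQ ρ)ᵐᵒᵖ)]

/-- The derived category `D(Λ ∗ Q)` of right `Λ ∗ Q`-modules. -/
abbrev DLamQ := DerivedCategory (ModuleCat.{u} (LamQ ρ)ᵐᵒᵖ)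

/-- `D^b(mod Λ ∗ Q)`: the objects of `D(Λ ∗ Q)` isomorphic to bounded complexes of finitely
generated modules. -/
def lamBounded : ObjectProperty (DLamQ ρ) := fun X =>
  ∃ C : CochainComplex (ModuleCat.{u} (LamQ ρ)ᵐᵒᵖ) ℤ, IsBounded C ∧
    (∀ i, Module.Finite (LamQ ρ)ᵐᵒᵖ (C.X i)) ∧ Nonempty (DerivedCategory.Q.obj C ≅ X)

/-- `D_{Λ-perf}(Λ ∗ Q)`: the objects of `D(Λ ∗ Q)` isomorphic to bounded complexes whose underlying
`Λ`-modules are finitely generated and projective. -/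
def lamPerf : ObjectProperty (DLamQ ρ) := fun X =>
  ∃ C : CochainComplex (ModuleCat.{u} (LamQ ρ)ᵐᵒᵖ) ℤ, IsBounded C ∧
    (∀ i, Module.Finite (Lam ρ)ᵐᵒᵖ (toLam (C.X i)) ∧
      Module.Projective (Lam ρ)ᵐᵒᵖ (toLam (C.X i))) ∧
    Nonempty (DerivedCategory.Q.obj C ≅ X)

/-- `D_perf(Λ ∗ Q)`: the objects of `D(Λ ∗ Q)` isomorphic to bounded complexes of finitely
generated projective `Λ ∗ Q`-modules. -/
def lamQPerf : ObjectProperty (DLamQ ρ) := fun X =>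
  ∃ C : CochainComplex (ModuleCat.{u} (LamQ ρ)ᵐᵒᵖ) ℤ, IsBounded C ∧
    (∀ i, Module.Finite (LamQ ρ)ᵐᵒᵖ (C.X i) ∧ Module.Projective (LamQ ρ)ᵐᵒᵖ (C.X i)) ∧
    Nonempty (DerivedCategory.Q.obj C ≅ X)

end

/-! ## Triangulated subcategories and equivalences -/

section

open Pretriangulated

variable {𝒞 𝒟 : Type*} [Category 𝒞] [Category 𝒟] [HasShift 𝒞 ℤ] [HasShift 𝒟 ℤ]

/-- `P` defines a full triangulated subcategory with respect to a class `δ` of distinguished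
triangles: it is closed under isomorphisms, contains a zero object, and is closed under shifts
and cones. -/
structure IsTriangulatedSubcategory (δ : Set (Triangle 𝒞)) (P : ObjectProperty 𝒞) : Prop where
  iso : P.IsClosedUnderIsomorphisms
  zero : ∃ Z, Limits.IsZero Z ∧ P Z
  shift : ∀ (n : ℤ) (X : 𝒞), P X → P (X⟦n⟧)
  cone : ∀ T ∈ δ, P T.obj₁ → P T.obj₂ → P T.obj₃

/-- A functor commuting with shifts is exact if it preserves distinguished triangles. -/
def IsExact (δ : Set (Triangle 𝒞)) (δ' : Set (Triangle 𝒟)) (L : 𝒞 ⥤ 𝒟) [L.CommShift ℤ] : Prop :=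
  ∀ T ∈ δ, L.mapTriangle.obj T ∈ δ'

/-- An adjunction `L ⊣ R` of exact functors restricts to an equivalence of triangulated
categories between the full subcategories `P` and `P'`: these are triangulated subcategories, `L`
and `R` restrict to functors between them, and the unit and counit are isomorphisms on them. -/
structure RestrictsToEquivalence (δ : Set (Triangle 𝒞)) (δ' : Set (Triangle 𝒟)) {L : 𝒞 ⥤ 𝒟}
    {R : 𝒟 ⥤ 𝒞} (adj : L ⊣ R) (P : ObjectProperty 𝒞) (P' : ObjectProperty 𝒟) : Prop where
  left_triangulated : IsTriangulatedSubcategory δ P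
  right_triangulated : IsTriangulatedSubcategory δ' P'
  map_left : ∀ X, P X → P' (L.obj X)
  map_right : ∀ Y, P' Y → P (R.obj Y)
  isIso_unit : ∀ X, P X → IsIso (adj.unit.app X)
  isIso_counit : ∀ Y, P' Y → IsIso (adj.counit.app Y)

end

end BGG

end

set_option linter.unusedSectionVars false

noncomputable section

open SkewMonoidAlgebra (single rightModule rightModule_smul opSingleOne op_single_eq
  smul_mem_of_single linearMapOfSingle linearMapOfSingle_apply)

variable {F V Q : Type u} [Field F] [AddCommGroup V] [Module F V] [Group Q]

/-! ## Differential groups -/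

/-- A differential on an abelian group is exact if each cycle is a boundary. -/
def ExactDiff {A : Type*} [AddCommGroup A] (d : A →+ A) : Prop := ∀ x, d x = 0 → ∃ y, d y = x

/-- The additive map `f` between differential groups is bijective on homology. -/
def QuasiIsoDiff {A B : Type*} [AddCommGroup A] [AddCommGroup B] (dA : A →+ A) (dB : B →+ B)
    (f : A →+ B) : Prop :=
  (∀ x, dA x = 0 → (∃ y, dB y = f x) → ∃ y, dA y = x) ∧
    (∀ z, dB z = 0 → ∃ x, dA x = 0 ∧ ∃ y, dB y = f x - z)

/-- An endomorphism of a differential group which is homotopic to the identity. -/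
def HomotopicToId {A : Type*} [AddCommGroup A] (d p : A →+ A) : Prop :=
  ∃ h : A →+ A, ∀ x, x = p x + d (h x) + h (d x)

section

variable {A B : Type*} [AddCommGroup A] [AddCommGroup B] {dA : A →+ A} {dB : B →+ B}

lemma HomotopicToId.comm (hd : ∀ x, dA (dA x) = 0) {p : A →+ A} (hp : HomotopicToId dA p) (x : A) :
    dA (p x) = p (dA x) := by
  obtain ⟨h, hh⟩ := hp
  have h1 := congrArg dA (hh x)
  have h2 := hh (dA x)
  rw [map_add, map_add, hd, add_zero] at h1
  rw [hd, map_zero, add_zero] at h2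
  exact add_right_cancel (h1.symm.trans h2)

lemma HomotopicToId.comp (hd : ∀ x, dA (dA x) = 0) {p q : A →+ A} (hp : HomotopicToId dA p)
    (hq : HomotopicToId dA q) : HomotopicToId dA (p.comp q) := by
  have hc := hp.comm hd
  obtain ⟨h, hh⟩ := hp
  obtain ⟨k, hk⟩ := hq
  refine ⟨h + p.comp k, fun x => ?_⟩
  have e1 := hh x
  have e2 := congrArg p (hk x)
  simp only [map_add, AddMonoidHom.add_apply, AddMonoidHom.comp_apply] at e1 e2 ⊢
  rw [← hc] at e2
  conv_lhs => rw [e1, e2]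
  abel

lemma HomotopicToId.list_prod (hd : ∀ x, dA (dA x) = 0) (l : List (AddMonoid.End A))
    (hl : ∀ p ∈ l, HomotopicToId dA p) : HomotopicToId dA l.prod := by
  induction l with
  | nil => exact ⟨0, fun x => by change x = x + dA 0 + 0; simp⟩
  | cons p l ih =>
    rw [List.prod_cons]
    exact HomotopicToId.comp hd (hl p (by simp)) (ih fun q hq => hl q (by simp [hq]))

/-- A chain map with a section `s` such that `s ∘ f` is homotopic to the identity is a
quasi-isomorphism. -/
lemma quasiIsoDiff_of_section (hd : ∀ x, dA (dA x) = 0) {f : A →+ B} (s : B →+ A)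
    (hf : ∀ x, f (dA x) = dB (f x)) (hs : ∀ z, f (s z) = z)
    (hh : HomotopicToId dA (s.comp f)) : QuasiIsoDiff dA dB f := by
  have hc : ∀ z, dA (s z) = s (dB z) := fun z => by
    have := hh.comm hd (s z)
    simpa [hs, hf] using this
  obtain ⟨h, hh⟩ := hh
  refine ⟨fun x hx ⟨y, hy⟩ => ⟨s y + h x, ?_⟩, fun z hz => ⟨s z, by rw [hc, hz, map_zero],
    0, by rw [hs, sub_self, map_zero]⟩⟩
  have := hh x
  rw [hx, map_zero, add_zero, AddMonoidHom.comp_apply, ← hy, ← hc] at this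
  rw [map_add, ← this]

lemma QuasiIsoDiff.of_bijective {f : A →+ B} (hf : ∀ x, f (dA x) = dB (f x))
    (h : Function.Bijective f) : QuasiIsoDiff dA dB f := by
  refine ⟨fun x _ ⟨y, hy⟩ => ?_, fun z hz => ?_⟩
  · obtain ⟨y, rfl⟩ := h.2 y
    exact ⟨y, h.1 (by rw [hf, hy])⟩
  · obtain ⟨x, rfl⟩ := h.2 z
    exact ⟨x, h.1 (by rw [hf, hz, map_zero]), 0, by rw [sub_self, map_zero]⟩

variable {C : Type*} [AddCommGroup C] {dC : C →+ C}

/-- Quasi-isomorphisms can be tested after bijective chain maps on both sides. -/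
lemma QuasiIsoDiff.of_comm_bijective {A' B' : Type*} [AddCommGroup A'] [AddCommGroup B']
    {dA' : A' →+ A'} {dB' : B' →+ B'} {f : A →+ B} {f' : A' →+ B'} (u : A →+ A') (v : B →+ B')
    (hu : ∀ x, u (dA x) = dA' (u x)) (hv : ∀ x, v (dB x) = dB' (v x))
    (hub : Function.Bijective u) (hvb : Function.Bijective v) (h : ∀ x, v (f x) = f' (u x))
    (hf : QuasiIsoDiff dA' dB' f') : QuasiIsoDiff dA dB f := by
  refine ⟨fun x hx ⟨y, hy⟩ => ?_, fun z hz => ?_⟩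
  · obtain ⟨w, hw⟩ := hf.1 (u x) (by rw [← hu, hx, map_zero]) ⟨v y, by rw [← hv, hy, h]⟩
    obtain ⟨w, rfl⟩ := hub.2 w
    exact ⟨w, hub.1 (by rw [hu, hw])⟩
  · obtain ⟨x, hx, y, hy⟩ := hf.2 (v z) (by rw [← hv, hz, map_zero])
    obtain ⟨x, rfl⟩ := hub.2 x
    obtain ⟨y, rfl⟩ := hvb.2 y
    exact ⟨x, hub.1 (by rw [hu, hx, map_zero]), y, hvb.1 (by rw [hv, hy, map_sub, h])⟩

/-- A perturbation argument: if `d k + k d` is bijective then `d` is exact. -/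
lemma exactDiff_of_bijective (k ν : A →+ A) (hd : ∀ x, dA (dA x) = 0)
    (hk : ∀ x, dA (k x) + k (dA x) = ν x) (hν : Function.Bijective ν) : ExactDiff dA := by
  intro z hz
  obtain ⟨u, rfl⟩ := hν.2 z
  have hc : ∀ x, dA (ν x) = ν (dA x) := fun x => by
    rw [← hk, ← hk, map_add, hd, hd, zero_add, map_zero, add_zero]
  have hu : dA u = 0 := hν.1 (by rw [← hc, hz, map_zero])
  exact ⟨k u, by rw [← hk, hu, map_zero, add_zero]⟩

/-- An exact linear differential over a field has a linear contraction. -/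
lemma ExactDiff.exists_contraction {F M : Type*} [Field F] [AddCommGroup M] [Module F M]
    (d : M →ₗ[F] M) (hd : ∀ x, d (d x) = 0) (h : ExactDiff d.toAddMonoidHom) :
    ∃ k : M →ₗ[F] M, ∀ x, d (k x) + k (d x) = x := by
  obtain ⟨g, hg⟩ := d.rangeRestrict.exists_rightInverse_of_surjective d.range_rangeRestrict
  have hg' : ∀ z : LinearMap.range d, d (g z) = z := fun z =>
    congrArg Subtype.val (LinearMap.congr_fun hg z)
  have hr : ∀ x, x - g (d.rangeRestrict x) ∈ LinearMap.range d := fun x => by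
    obtain ⟨y, hy⟩ := h (x - g (d.rangeRestrict x))
      (by change d _ = 0; rw [map_sub, hg']; exact sub_self _)
    exact ⟨y, hy⟩
  refine ⟨g ∘ₗ ((LinearMap.id - g ∘ₗ d.rangeRestrict).codRestrict _ hr), fun x => ?_⟩
  simp only [LinearMap.comp_apply]
  rw [hg']
  have : (LinearMap.id - g ∘ₗ d.rangeRestrict).codRestrict _ hr (d x) = d.rangeRestrict x := by
    refine Subtype.ext ?_
    have : d.rangeRestrict (d x) = 0 := Subtype.ext (hd x)
    simp [this]
  rw [this]
  simp

end

/-! ## Bases and operators on `Λ` and `S` -/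

namespace BGG

variable (F V) in
/-- The indices of the coordinates of `V`. -/
abbrev Idx := Fin (Module.finrank F V)

/-- Complexes of right modules over `Λ ∗ Q`. -/
abbrev LamComplex (ρ : Representation F Q V) := CochainComplex (ModuleCat.{u} (LamQ ρ)ᵐᵒᵖ) ℤ

variable (ρ : Representation F Q V)

instance : IsScalarTower F (Lam ρ) (Lam ρ) := inferInstance

lemma neg_eq_of_charTwo [CharP F 2] {M : Type*} [AddCommGroup M] [Module F M] (m : M) : -m = m := by
  have h : (1 : F) + 1 = 0 := by
    have := CharP.cast_eq_zero F 2
    norm_num at this ⊢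
    exact this
  have : m + m = 0 := by
    calc m + m = ((1 : F) + 1) • m := by rw [add_smul, one_smul]
      _ = 0 := by rw [h, zero_smul]
  exact neg_eq_of_add_eq_zero_left this

lemma add_self_of_charTwo (F : Type*) [Field F] [CharP F 2] {M : Type*} [AddCommGroup M]
    [Module F M] (m : M) : m + m = 0 := by
  have h : (1 : F) + 1 = 0 := by
    have := CharP.cast_eq_zero F 2
    norm_num at this ⊢
    exact this
  calc m + m = ((1 : F) + 1) • m := by rw [add_smul, one_smul]
    _ = 0 := by rw [h, zero_smul]

variable {ρ} in
lemma Lam.induction {p : Lam ρ → Prop} (one : ∀ r : F, p (algebraMap F (Lam ρ) r))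
    (add : ∀ a b, p a → p b → p (a + b)) (ι_mul : ∀ v a, p a → p (ιLam ρ v * a)) (a : Lam ρ) :
    p a := CliffordAlgebra.left_induction _ one add (fun x m h => ι_mul m x h) a

section
variable [CharP F 2]

lemma Lam.ι_comm (v w : V) : ιLam ρ v * ιLam ρ w = ιLam ρ w * ιLam ρ v := by
  have := eq_neg_of_add_eq_zero_left (ExteriorAlgebra.ι_add_mul_swap (R := F) v w)
  exact this.trans (neg_eq_of_charTwo (F := F) _)

lemma Lam.ι_mul_comm (v : V) (a : Lam ρ) : ιLam ρ v * a = a * ιLam ρ v := by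
  induction a using Lam.induction with
  | one r => exact (Algebra.commutes r _).symm
  | add a b ha hb => rw [mul_add, add_mul, ha, hb]
  | ι_mul w a ha => rw [← mul_assoc, Lam.ι_comm, mul_assoc, ha, mul_assoc]

lemma Lam.comm (a b : Lam ρ) : a * b = b * a := by
  induction a using Lam.induction generalizing b with
  | one r => exact Algebra.commutes r _
  | add a c ha hc => rw [mul_add, add_mul, ha, hc]
  | ι_mul w a ha => rw [mul_assoc, ha, ← mul_assoc, Lam.ι_mul_comm, mul_assoc]

end

/-- The contraction of `Λ` with an element of `V*`. -/
def Lam.contr (f : Module.Dual F V) : Lam ρ →ₗ[F] Lam ρ := CliffordAlgebra.contractLeft f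

lemma Lam.contr_ι_mul (f : Module.Dual F V) (v : V) (a : Lam ρ) :
    Lam.contr ρ f (ιLam ρ v * a) = f v • a - ιLam ρ v * Lam.contr ρ f a :=
  CliffordAlgebra.contractLeft_ι_mul f v a

lemma Lam.contr_algebraMap (f : Module.Dual F V) (r : F) :
    Lam.contr ρ f (algebraMap F (Lam ρ) r) = 0 := CliffordAlgebra.contractLeft_algebraMap _ f r

/-- The augmentation `Λ → F`. -/
def Lam.aug : Lam ρ →ₐ[F] F := ExteriorAlgebra.algebraMapInv

@[simp] lemma Lam.aug_ι (v : V) : Lam.aug ρ (ιLam ρ v) = 0 := by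
  change ExteriorAlgebra.algebraMapInv (ExteriorAlgebra.ι F v) = 0
  simp [ExteriorAlgebra.algebraMapInv]

variable [Module.Finite F V]

/-- The basis vectors `y_i` in `Λ`. -/
def yv (i : Idx F V) : Lam ρ := ιLam ρ (Module.finBasis F V i)

/-- The dual basis vectors `x_i` in `S`. -/
def xv (i : Idx F V) : Sym ρ := ιSym ρ ((Module.finBasis F V).coord i)

/-- The contractions with the `x_i`. -/
def Lam.pd (i : Idx F V) : Lam ρ →ₗ[F] Lam ρ := Lam.contr ρ ((Module.finBasis F V).coord i)

lemma Lam.pd_one (i : Idx F V) : Lam.pd ρ i 1 = 0 := by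
  have := Lam.contr_algebraMap ρ ((Module.finBasis F V).coord i) 1
  rwa [map_one] at this

lemma yv_mul_yv_mul (i : Idx F V) (a : Lam ρ) : yv ρ i * (yv ρ i * a) = 0 :=
  (mul_assoc _ _ _).symm.trans
    ((congrArg (· * a) (ExteriorAlgebra.ι_sq_zero _)).trans (zero_mul a))

variable {ρ} in
lemma Lam.induction_yv {p : Lam ρ → Prop} (one : ∀ r : F, p (algebraMap F (Lam ρ) r))
    (add : ∀ a b, p a → p b → p (a + b)) (smul : ∀ (r : F) a, p a → p (r • a))
    (yv_mul : ∀ i a, p a → p (yv ρ i * a)) (a : Lam ρ) :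
    p a := by
  induction a using Lam.induction with
  | one r => exact one r
  | add a b ha hb => exact add a b ha hb
  | ι_mul v a ha =>
    rw [← (Module.finBasis F V).sum_repr v, map_sum, Finset.sum_mul]
    refine Finset.sum_induction _ p add (by simpa using one 0) fun i _ => ?_
    rw [map_smul, smul_mul_assoc]
    exact smul _ _ (yv_mul i a ha)

section
variable [CharP F 2]

lemma Lam.pd_yv_mul (i j : Idx F V) (a : Lam ρ) :
    Lam.pd ρ i (yv ρ j * a) = (if i = j then a else 0) + yv ρ j * Lam.pd ρ i a := by
  have := Lam.contr_ι_mul ρ ((Module.finBasis F V).coord i) (Module.finBasis F V j) a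
  rw [sub_eq_add_neg, neg_eq_of_charTwo (F := F)] at this
  refine this.trans (congrArg (· + _) ?_)
  rw [Module.Basis.coord_apply, Module.Basis.repr_self, Finsupp.single_apply]
  by_cases h : i = j
  · rw [if_pos h, if_pos h.symm, one_smul]
  · rw [if_neg h, if_neg (Ne.symm h), zero_smul]

lemma yv_mul_comm (i : Idx F V) (a : Lam ρ) : yv ρ i * a = a * yv ρ i := Lam.ι_mul_comm ρ _ a

lemma Lam.pd_mul_yv (i j : Idx F V) (a : Lam ρ) :
    Lam.pd ρ i (a * yv ρ j) = (if i = j then a else 0) + Lam.pd ρ i a * yv ρ j := by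
  rw [← yv_mul_comm, Lam.pd_yv_mul, yv_mul_comm]

end

/-! ### The monomial basis of `S` -/

variable (F V) in
/-- The exponents of monomials in the `x_i`. -/
abbrev Mon : Type := Idx F V →₀ ℕ

/-- The symmetric algebra as a polynomial ring in the `x_i`. -/
def symEquiv : Sym ρ ≃ₐ[F] MvPolynomial (Idx F V) F :=
  SymmetricAlgebra.equivMvPolynomial (Module.finBasis F V).dualBasis

/-- The monomial `x^a`. -/
def xmon (a : Mon F V) : Sym ρ := (symEquiv ρ).symm (MvPolynomial.monomial a 1)

/-- The coefficient of `x^a`. -/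
def scoeff (a : Mon F V) : Sym ρ →ₗ[F] F := MvPolynomial.lcoeff F a ∘ₗ (symEquiv ρ).toLinearMap

lemma symEquiv_xv (i : Idx F V) : symEquiv ρ (xv ρ i) = MvPolynomial.X i := by
  have : (Module.finBasis F V).coord i = (Module.finBasis F V).dualBasis i := by
    rw [Module.Basis.coe_dualBasis]
  unfold xv
  rw [this]
  exact SymmetricAlgebra.equivMvPolynomial_ι_apply _ i

lemma scoeff_xmon (a b : Mon F V) : scoeff ρ a (xmon ρ b) = if b = a then 1 else 0 := by
  simp [scoeff, xmon, MvPolynomial.coeff_monomial]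

lemma xmon_zero : xmon ρ (0 : Mon F V) = 1 := by
  simp [xmon]

lemma xv_mul_xmon (i : Idx F V) (a : Mon F V) :
    xv ρ i * xmon ρ a = xmon ρ (a + Finsupp.single i 1) := by
  apply (symEquiv ρ).injective
  rw [map_mul, symEquiv_xv]
  simp [xmon, MvPolynomial.X, MvPolynomial.monomial_mul, add_comm]

lemma sum_scoeff_xmon (s : Sym ρ) : s = ∑ a ∈ (symEquiv ρ s).support, scoeff ρ a s • xmon ρ a := by
  apply (symEquiv ρ).injective
  conv_lhs => rw [(symEquiv ρ s).as_sum]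
  simp [xmon, scoeff, MvPolynomial.smul_monomial]

variable {ρ} in
lemma Sym.induction_xmon {p : Sym ρ → Prop} (mon : ∀ a, p (xmon ρ a))
    (add : ∀ a b, p a → p b → p (a + b)) (smul : ∀ (r : F) a, p a → p (r • a)) (s : Sym ρ) : p s := by
  rw [sum_scoeff_xmon ρ s]
  exact Finset.sum_induction _ p add (by simpa using smul 0 _ (mon 0)) fun a _ => smul _ _ (mon a)

lemma scoeff_xv_mul (i : Idx F V) (a : Mon F V) (s : Sym ρ) :
    scoeff ρ a (xv ρ i * s) = if a i = 0 then 0 else scoeff ρ (a - Finsupp.single i 1) s := by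
  simp only [scoeff, LinearMap.comp_apply, AlgEquiv.toLinearMap_apply, MvPolynomial.lcoeff_apply,
    map_mul, symEquiv_xv]
  rw [MvPolynomial.coeff_X_mul']
  simp only [Finsupp.mem_support_iff]
  split_ifs <;> simp_all

lemma mem_symDeg_iff (j : ℤ) (s : Sym ρ) :
    s ∈ symDeg ρ j ↔ ∀ a : Mon F V, (a.degree : ℤ) ≠ j → scoeff ρ a s = 0 := by
  constructor
  · intro hs a ha
    unfold symDeg at hs
    split_ifs at hs with hj
    · have h1 : (LinearMap.range (ιSym ρ)).map (symEquiv ρ).toLinearMap ≤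
          MvPolynomial.homogeneousSubmodule (Idx F V) F 1 := by
        rintro _ ⟨_, ⟨f, rfl⟩, rfl⟩
        rw [← (Module.finBasis F V).dualBasis.sum_repr f, map_sum, map_sum]
        refine Submodule.sum_mem _ fun i _ => ?_
        rw [map_smul, map_smul]
        refine Submodule.smul_mem _ _ ?_
        have := symEquiv_xv ρ i
        unfold xv at this
        rw [Module.Basis.coe_dualBasis]
        rw [AlgEquiv.toLinearMap_apply, this]
        exact MvPolynomial.isHomogeneous_X F i
      have h2 := Submodule.mem_map_of_mem (f := (symEquiv ρ).toAlgHom.toLinearMap) hs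
      rw [Submodule.map_pow] at h2
      have h3 : (LinearMap.range (ιSym ρ)).map (symEquiv ρ).toAlgHom.toLinearMap ^ j.toNat ≤
          MvPolynomial.homogeneousSubmodule (Idx F V) F j.toNat := by
        refine (pow_le_pow_left' h1 _).trans ?_
        induction j.toNat with
        | zero =>
          rw [pow_zero]
          exact Submodule.one_le.2 (MvPolynomial.isHomogeneous_one _ F)
        | succ n ih =>
          rw [pow_succ]
          exact (mul_le_mul' ih le_rfl).trans (MvPolynomial.homogeneousSubmodule_mul n 1)
      exact (h3 h2).coeff_eq_zero (by lia)
    · rw [(Submodule.mem_bot F).1 hs, map_zero]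
  · intro h
    rw [sum_scoeff_xmon ρ s]
    refine Submodule.sum_mem _ fun a _ => ?_
    by_cases ha : (a.degree : ℤ) = j
    · refine Submodule.smul_mem _ _ ?_
      have key : ∀ (n : ℕ) (a : Mon F V), a.degree = n → xmon ρ a ∈ symDeg ρ n := by
        intro n
        induction n with
        | zero =>
          intro a ha
          rw [(Finsupp.degree_eq_zero_iff a).1 ha, xmon_zero]
          exact one_mem_symDeg ρ
        | succ n ih =>
          intro a ha
          obtain ⟨i, hi⟩ : ∃ i, a i ≠ 0 := by
            by_contra! hc
            have : a = 0 := Finsupp.ext hc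
            simp [this] at ha
          have hle : Finsupp.single i 1 ≤ a := by
            rw [Finsupp.single_le_iff]; lia
          have hb := tsub_add_cancel_of_le hle
          have hdeg : (a - Finsupp.single i 1).degree = n := by
            have := congrArg Finsupp.degree hb
            rw [map_add, Finsupp.degree_single] at this
            lia
          rw [← hb, ← xv_mul_xmon]
          have := mul_mem_symDeg ρ (ι_mem_symDeg ρ ((Module.finBasis F V).coord i)) (ih _ hdeg)
          rw [add_comm] at this
          exact_mod_cast this
      rw [← ha]
      exact key _ a rfl
    · rw [h a ha, zero_smul]
      exact Submodule.zero_mem _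

lemma xmon_mem_symDeg (a : Mon F V) : xmon ρ a ∈ symDeg ρ a.degree := by
  rw [mem_symDeg_iff]
  intro b hb
  rw [scoeff_xmon, if_neg (by rintro rfl; exact hb rfl)]

/-! ### The basis of `ε` -/

/-- The elements `γ_a` of `ε`, dual to the monomials. -/
def gam (a : Mon F V) : Eps ρ :=
  ⟨TensorProduct.AlgebraTensorModule.lift (LinearMap.toSpanSingleton (Lam ρ) _
      ((Algebra.linearMap F (Lam ρ)) ∘ₗ scoeff ρ a)),
    Eps.mem_total (i := -(a.degree : ℤ)) fun j hj c s hs => by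
      have := (mem_symDeg_iff ρ j s).1 hs a (by lia)
      simp [this]⟩

lemma gam_val (a : Mon F V) (c : Lam ρ) (s : Sym ρ) :
    (gam ρ a).val (c ⊗ₜ s) = c * algebraMap F _ (scoeff ρ a s) := rfl

lemma gam_val_xmon (a b : Mon F V) (c : Lam ρ) :
    (gam ρ a).val (c ⊗ₜ xmon ρ b) = if b = a then c else 0 := by
  rw [gam_val, scoeff_xmon]
  split_ifs <;> simp

lemma gam_mem_deg (a : Mon F V) : gam ρ a ∈ Eps.deg ρ (-(a.degree : ℤ)) := by
  intro j hj c s hs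
  have := (mem_symDeg_iff ρ j s).1 hs a (by lia)
  rw [gam_val, this, map_zero, mul_zero]

variable {ρ} in
/-- The coordinate of an element of `ε`. -/
def Eps.coord (e : Eps ρ) (a : Mon F V) : Lam ρ := e.val (1 ⊗ₜ xmon ρ a)

variable {ρ} in
lemma Eps.ext_coord {e e' : Eps ρ} (h : ∀ a, e.coord a = e'.coord a) : e = e' := by
  ext x
  induction x using TensorProduct.induction_on with
  | zero => simp
  | add x y hx hy => rw [map_add, map_add, hx, hy]
  | tmul c s =>
    have : (c ⊗ₜ[F] s : Tw ρ) = c • (1 ⊗ₜ s) := by rw [TensorProduct.smul_tmul', smul_eq_mul, mul_one]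
    rw [this, map_smul, map_smul]
    clear this
    congr 1
    induction s using Sym.induction_xmon with
    | mon a => exact h a
    | add a b ha hb =>
      rw [TensorProduct.tmul_add, map_add, map_add, ha, hb]
    | smul r a ha =>
      rw [TensorProduct.tmul_smul]
      have : r • ((1 : Lam ρ) ⊗ₜ[F] a) = (algebraMap F (Lam ρ) r) • ((1 : Lam ρ) ⊗ₜ[F] a) := by
        rw [algebraMap_smul]
      rw [this, map_smul, map_smul, ha]

variable {ρ} in
lemma Eps.finite_coord (e : Eps ρ) : (Function.support e.coord).Finite := by
  induction e using Eps.induction with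
  | zero =>
    have : Function.support (Eps.coord (0 : Eps ρ)) = ∅ := Function.support_eq_empty_iff.2 rfl
    rw [this]; exact Set.finite_empty
  | add e e' h h' => exact (h.union h').subset (Function.support_add _ _)
  | hom i e he =>
    refine Set.Finite.subset (Finsupp.finite_of_degree_le (i.natAbs)) fun a ha => ?_
    by_contra hc
    apply ha
    exact he a.degree (by simp at hc; lia) 1 _ (xmon_mem_symDeg ρ a)

lemma coord_gam (a b : Mon F V) : (gam ρ a).coord b = if b = a then 1 else 0 := gam_val_xmon ρ a b 1

/-- The elements `γ_a` form a basis of the right `Λ`-module `ε`. -/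
def epsBasis : Module.Basis (Mon F V) (Lam ρ)ᵐᵒᵖ (Eps ρ) :=
  Module.Basis.mk (v := gam ρ)
    (by
      rw [linearIndependent_iff']
      intro s g hg a ha
      have h := congrArg (fun e : Eps ρ => e.val (1 ⊗ₜ xmon ρ a)) hg
      simp only [map_sum, LinearMap.sum_apply, Eps.val_op_smul, gam_val_xmon] at h
      rw [Finset.sum_eq_single a] at h
      · simpa using h
      · intro b _ hb; simp [hb.symm]
      · intro h'; exact absurd ha h')
    (by
      intro e _
      have : e = ∑ a ∈ e.finite_coord.toFinset, op (e.coord a) • gam ρ a := by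
        refine Eps.ext_coord fun b => ?_
        simp only [Eps.coord, map_sum, LinearMap.sum_apply, Eps.val_op_smul, gam_val_xmon]
        by_cases hb : b ∈ e.finite_coord.toFinset
        · rw [Finset.sum_eq_single b]
          · simp
          · intro c _ hc; simp [hc.symm]
          · intro h'; exact absurd hb h'
        · rw [Finset.sum_eq_zero]
          · have : b ∉ Function.support e.coord := fun h => hb (by simpa using h)
            exact Function.notMem_support.1 this
          · intro c hc
            rw [if_neg (by rintro rfl; exact hb hc), zero_mul]
      rw [this]
      exact Submodule.sum_mem _ fun a _ => Submodule.smul_mem _ _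
        (Submodule.subset_span ⟨a, rfl⟩))

@[simp] lemma epsBasis_apply (a : Mon F V) : epsBasis ρ a = gam ρ a := by
  simp [epsBasis]

lemma xv_smul_gam (i : Idx F V) (a : Mon F V) :
    xv ρ i • gam ρ a = if a i = 0 then 0 else gam ρ (a - Finsupp.single i 1) := by
  refine Eps.ext_coord fun b => ?_
  have h1 : (xv ρ i • gam ρ a).coord b = if b + Finsupp.single i 1 = a then 1 else 0 := by
    change (gam ρ a).val (twMul ρ (xv ρ i) (1 ⊗ₜ xmon ρ b)) = _
    rw [twMul_tmul, xv_mul_xmon, gam_val_xmon]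
  rw [h1]
  split_ifs with h h' h'
  · subst h; simp at h'
  · subst h; simp [coord_gam]
  · rfl
  · rw [coord_gam, if_neg]
    rintro rfl
    exact h (tsub_add_cancel_of_le (by rw [Finsupp.single_le_iff]; lia))

lemma d_gam (a : Mon F V) : Eps.d (gam ρ a) = ∑ i, op (yv ρ i) • (xv ρ i • gam ρ a) := by
  refine Eps.ext_coord fun b => ?_
  change (gam ρ a).val (twD ρ (1 ⊗ₜ xmon ρ b)) = Eps.val (∑ i, _) _
  rw [twD_tmul, map_sum, map_sum, LinearMap.sum_apply]
  refine Finset.sum_congr rfl fun i _ => ?_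
  rw [Eps.val_op_smul, Eps.val_smul, twMul_tmul, one_mul, gam_val, gam_val, one_mul]
  exact (Algebra.commutes _ _).symm

/-- The right `Λ`-linear operator `γ_a ↦ γ_{a + e_i}` of `ε`. -/
def epsRaise (i : Idx F V) : Eps ρ →ₗ[(Lam ρ)ᵐᵒᵖ] Eps ρ :=
  (epsBasis ρ).constr ℕ fun a => gam ρ (a + Finsupp.single i 1)

@[simp] lemma epsRaise_gam (i : Idx F V) (a : Mon F V) :
    epsRaise ρ i (gam ρ a) = gam ρ (a + Finsupp.single i 1) := by
  have := (epsBasis ρ).constr_basis ℕ (fun a => gam ρ (a + Finsupp.single i 1)) a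
  rwa [epsBasis_apply] at this

variable {ρ} in
lemma Eps.induction_gam {p : Eps ρ → Prop} (gam : ∀ a (c : Lam ρ), p (op c • gam ρ a))
    (add : ∀ e e', p e → p e' → p (e + e')) (e : Eps ρ) : p e := by
  rw [← (epsBasis ρ).linearCombination_repr e, Finsupp.linearCombination_apply]
  refine Finset.sum_induction _ p add ?_ fun a _ => ?_
  · have := gam 0 0
    rwa [op_zero, zero_smul] at this
  · change p (_ • epsBasis ρ a)
    rw [epsBasis_apply]
    exact gam a _

variable {ρ} in
/-- The operator of `ε` which applies an `F`-linear endomorphism of `Λ` to the coordinates. -/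
def Eps.mapCoord (φ : Lam ρ →ₗ[F] Lam ρ) : Eps ρ →+ Eps ρ :=
  Eps.restrict (AddMonoidHom.mk' (fun f => TensorProduct.AlgebraTensorModule.lift
      (LinearMap.toSpanSingleton (Lam ρ) _
        (φ ∘ₗ f.restrictScalars F ∘ₗ TensorProduct.mk F (Lam ρ) (Sym ρ) 1))) (fun f g => by
      ext; simp))
    (fun i f hf => Eps.mem_total (i := i) fun j hj c s hs => by
      simp [hf j hj 1 s hs])

variable {ρ} in
lemma Eps.mapCoord_val (φ : Lam ρ →ₗ[F] Lam ρ) (e : Eps ρ) (c : Lam ρ) (s : Sym ρ) :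
    (Eps.mapCoord φ e).val (c ⊗ₜ s) = c * φ (e.val (1 ⊗ₜ s)) := rfl

variable {ρ} in
lemma Eps.mapCoord_coord (φ : Lam ρ →ₗ[F] Lam ρ) (e : Eps ρ) (a : Mon F V) :
    (Eps.mapCoord φ e).coord a = φ (e.coord a) := by
  change (Eps.mapCoord φ e).val (1 ⊗ₜ xmon ρ a) = _
  rw [mapCoord_val, one_mul]; rfl

variable {ρ} in
lemma Eps.val_one_tmul_mul (e : Eps ρ) (s : Sym ρ) (c : Lam ρ) :
    e.val (c ⊗ₜ s) = c * e.val (1 ⊗ₜ s) := by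
  rw [← smul_eq_mul c, ← map_smul, TensorProduct.smul_tmul', smul_eq_mul, mul_one]

variable {ρ} in
lemma Eps.mapCoord_smul (φ : Lam ρ →ₗ[F] Lam ρ) (s : Sym ρ) (e : Eps ρ) :
    Eps.mapCoord φ (s • e) = s • Eps.mapCoord φ e :=
  Eps.ext_coord fun _ => by
    simp only [coord, mapCoord_val, val_smul, twMul_tmul]

variable {ρ} in
lemma Eps.mapCoord_gam (φ : Lam ρ →ₗ[F] Lam ρ) (a : Mon F V) (c : Lam ρ) :
    Eps.mapCoord φ (op c • gam ρ a) = op (φ c) • gam ρ a :=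
  Eps.ext_coord fun b => by
    simp only [coord, mapCoord_val, val_op_smul, gam_val_xmon, one_mul]
    split_ifs <;> simp

variable {ρ} in
lemma Eps.d_eq_sum (e : Eps ρ) :
    Eps.d e = ∑ i, xv ρ i • Eps.mapCoord (LinearMap.mulLeft F (yv ρ i)) e :=
  Eps.ext_coord fun a => by
    change e.val (twD ρ (1 ⊗ₜ xmon ρ a)) = Eps.val (∑ i, _) _
    rw [twD_tmul, map_sum, map_sum, LinearMap.sum_apply]
    refine Finset.sum_congr rfl fun i _ => ?_
    rw [val_smul, twMul_tmul, mapCoord_val, one_mul, one_mul, val_one_tmul_mul]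
    rfl

instance : Module F (Eps ρ) := Module.compHom (Eps ρ) (algebraMap F (Sym ρ))

instance : IsScalarTower F (Sym ρ) (Eps ρ) where
  smul_assoc r s e := by
    change (r • s) • e = algebraMap F (Sym ρ) r • s • e
    rw [Algebra.smul_def, mul_smul]

variable {ρ} in
lemma Eps.val_smul_field (r : F) (e : Eps ρ) (x : Tw ρ) : (r • e).val x = r • e.val x := by
  change (algebraMap F (Sym ρ) r • e).val x = _
  induction x using TensorProduct.induction_on with
  | zero => simp
  | add x y hx hy => rw [map_add, map_add, hx, hy, smul_add]
  | tmul c s =>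
    rw [val_smul, twMul_tmul, ← Algebra.smul_def, TensorProduct.tmul_smul,
      ← algebraMap_smul (Lam ρ) r (c ⊗ₜ[F] s), map_smul, algebraMap_smul]

/-- `mapCoord` as a linear map over `F`. -/
def epsMapCoord (φ : Lam ρ →ₗ[F] Lam ρ) : Eps ρ →ₗ[F] Eps ρ where
  __ := Eps.mapCoord φ
  map_smul' r e := Eps.ext_coord fun a => by
    change (Eps.mapCoord φ (r • e)).coord a = (r • Eps.mapCoord φ e).coord a
    simp only [Eps.coord, Eps.mapCoord_val, Eps.val_smul_field, map_smul, one_mul]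

lemma op_algebraMap_smul_eps (r : F) (e : Eps ρ) : op (algebraMap F (Lam ρ) r) • e = r • e := by
  ext x
  rw [Eps.val_op_smul, Eps.val_smul_field, MulOpposite.unop_op, Algebra.smul_def,
    Algebra.commutes]

/-- `γ_a ↦ γ_{a + e_i}` as a linear map over `F`. -/
def epsRaiseF (i : Idx F V) : Eps ρ →ₗ[F] Eps ρ where
  __ := (epsRaise ρ i).toAddMonoidHom
  map_smul' r e := by
    change epsRaise ρ i (r • e) = r • epsRaise ρ i e
    rw [← op_algebraMap_smul_eps, map_smul, op_algebraMap_smul_eps]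

lemma epsBasis_repr_of_mem {j : ℤ} {e : Eps ρ} (he : e ∈ Eps.deg ρ j) {a : Mon F V}
    (h : (a.degree : ℤ) ≠ -j) : (epsBasis ρ).repr e a = 0 := by
  have key : ∀ e : Eps ρ, (epsBasis ρ).repr e a = op (e.coord a) := by
    intro e
    induction e using Eps.induction_gam with
    | add e e' h h' => rw [map_add, Finsupp.add_apply, h, h']; rfl
    | gam b c =>
      rw [map_smul, ← epsBasis_apply, Module.Basis.repr_self, epsBasis_apply]
      change _ = op ((gam ρ b).val (1 ⊗ₜ xmon ρ a) * c)
      rw [gam_val_xmon, Finsupp.smul_apply, Finsupp.single_apply]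
      by_cases hab : b = a
      · simp [hab]
      · simp [hab, Ne.symm hab]
  rw [key, Eps.coord, he a.degree h 1 _ (xmon_mem_symDeg ρ a), op_zero]

end BGG

/-! ## Complexes of modules and their totalizations -/

/-- Quasi-isomorphisms of short complexes of modules in terms of elements. -/
lemma CategoryTheory.ShortComplex.moduleCat_quasiIso_iff {R : Type*} [Ring R]
    {S T : ShortComplex (ModuleCat.{u} R)} (φ : S ⟶ T) : ShortComplex.QuasiIso φ ↔
      (∀ x : S.X₂, S.g x = 0 → (∃ y, T.f y = φ.τ₂ x) → ∃ y, S.f y = x) ∧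
      (∀ z : T.X₂, T.g z = 0 → ∃ x, S.g x = 0 ∧ ∃ y, T.f y = φ.τ₂ x - z) := by
  obtain ⟨γ⟩ : Nonempty (ShortComplex.LeftHomologyMapData φ S.moduleCatLeftHomologyData
    T.moduleCatLeftHomologyData) := ⟨default⟩
  let cl (S : ShortComplex (ModuleCat.{u} R)) (x : S.X₂) (hx : S.g x = 0) :
    S.moduleCatLeftHomologyData.H := S.moduleCatLeftHomologyData.π ⟨x, hx⟩
  have hφ : ∀ x, S.g x = 0 → T.g (φ.τ₂ x) = 0 := fun x hx => by
    have := congr($(φ.comm₂₃) x)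
    exact this.trans ((congrArg φ.τ₃ hx).trans (map_zero _))
  have hK : ∀ k, (γ.φK k).1 = φ.τ₂ k.1 := fun k => congr($(γ.commi) k)
  have hH : ∀ x hx, γ.φH (cl S x hx) = cl T (φ.τ₂ x) (hφ x hx) := fun x hx =>
    (congr($(γ.commπ) ⟨x, hx⟩) : γ.φH (S.moduleCatLeftHomologyData.π ⟨x, hx⟩) = _).trans
      (congrArg T.moduleCatLeftHomologyData.π (Subtype.ext (hK ⟨x, hx⟩)))
  have he : ∀ (S : ShortComplex (ModuleCat.{u} R)) x y hx hy,
      cl S x hx = cl S y hy ↔ ∃ w, S.f w = x - y := fun S x y hx hy =>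
    (Submodule.Quotient.eq _).trans
      ⟨fun ⟨y, hy⟩ => ⟨y, congrArg Subtype.val hy⟩, fun ⟨y, hy⟩ => ⟨y, Subtype.ext hy⟩⟩
  have hs : ∀ (S : ShortComplex (ModuleCat.{u} R)) h, ∃ x hx, cl S x hx = h := fun S h => by
    obtain ⟨⟨x, hx⟩, rfl⟩ := Submodule.Quotient.mk_surjective _ h
    exact ⟨x, hx, rfl⟩
  rw [γ.quasiIso_iff, ConcreteCategory.isIso_iff_bijective, Function.Bijective]
  refine and_congr ⟨fun h x hx ⟨y, hy⟩ => ?_, fun h a b hab => ?_⟩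
    ⟨fun h z hz' => ?_, fun h z => ?_⟩
  · have h0 : S.g (0 : S.X₂) = 0 := map_zero _
    obtain ⟨w, hw⟩ := (he S x 0 hx h0).1 (h (by
      refine (hH x hx).trans (((he T _ _ _ _).2 ⟨y, ?_⟩).trans (hH 0 h0).symm)
      rw [map_zero, sub_zero, hy]))
    exact ⟨w, hw.trans (sub_zero x)⟩
  · obtain ⟨x, hx, rfl⟩ := hs S a
    obtain ⟨y, hy, rfl⟩ := hs S b
    obtain ⟨w, hw⟩ := (he T _ _ _ _).1 ((hH x hx).symm.trans (hab.trans (hH y hy)))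
    exact (he S _ _ _ _).2 (h (x - y) (by rw [map_sub, hx, hy, sub_zero])
      ⟨w, by rw [hw, map_sub]⟩)
  · obtain ⟨a, ha⟩ := h (cl T z hz')
    obtain ⟨x, hx, rfl⟩ := hs S a
    exact ⟨x, hx, (he T _ _ _ _).1 ((hH x hx).symm.trans ha)⟩
  · obtain ⟨z, hz, rfl⟩ := hs T z
    obtain ⟨x, hx, y, hy⟩ := h z hz
    exact ⟨cl S x hx, (hH x hx).trans ((he T _ _ _ _).2 ⟨y, hy⟩)⟩

namespace BGG

variable {ρ : Representation F Q V}

namespace Tot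

variable {C D : LamComplex ρ}

lemma ext_proj {x y : Tot C} (h : ∀ i, proj C i x = proj C i y) : x = y := DFinsupp.ext h

lemma d_incl' {i j : ℤ} (h : i + 1 = j) (x : C.X i) : d C (incl C i x) = incl C j (C.d i j x) := by
  subst h
  exact d_incl i x

lemma proj_d' {i j : ℤ} (h : i + 1 = j) (t : Tot C) : proj C j (d C t) = C.d i j (proj C i t) := by
  subst h
  exact proj_d i t

lemma proj_map (g : C ⟶ D) (i : ℤ) (t : Tot C) : proj D i (map g t) = g.f i (proj C i t) := by
  induction t using Tot.induction with
  | hom j x =>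
    rw [map_incl]
    by_cases h : j = i
    · subst h
      rw [proj_incl, proj_incl]
    · rw [proj_incl_ne h, proj_incl_ne h, map_zero]
  | zero => simp
  | add x y hx hy => simp [hx, hy]

lemma d_eq_zero_iff (t : Tot C) : d C t = 0 ↔ ∀ i, C.d i (i + 1) (proj C i t) = 0 := by
  refine ⟨fun h i => by rw [← proj_d, h, map_zero], fun h => ext_proj fun i => ?_⟩
  rw [proj_d' (i := i - 1) (by ring), map_zero]
  have := h (i - 1)
  rwa [sub_add_cancel] at this

/-- Families with the support of `t` are the components of an element. -/
lemma exists_of_proj {E : LamComplex ρ} (t : Tot C) {σ : ℤ → ℤ}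
    (hσ : Function.Injective σ) (p : ∀ i, C.X i → E.X (σ i) → Prop) (h0 : ∀ i, p i 0 0)
    (h : ∀ i, ∃ x, p i (proj C i t) x) :
    ∃ s : Tot E, ∀ i, p i (proj C i t) (proj E (σ i) s) := by
  classical
  choose x hx using h
  refine ⟨∑ i ∈ DFinsupp.support (β := fun i => C.X i) t, incl E (σ i) (x i), fun i => ?_⟩
  rw [map_sum]
  by_cases hi : i ∈ DFinsupp.support (β := fun i => C.X i) t
  · rw [Finset.sum_eq_single i]
    · rw [proj_incl]; exact hx i
    · intro j _ hj
      exact proj_incl_ne (fun h => hj (hσ h)) _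
    · intro h; exact absurd hi h
  · rw [Finset.sum_eq_zero, show proj C i t = 0 from DFinsupp.notMem_support_iff.1 hi]
    · exact h0 _
    · intro j hj
      exact proj_incl_ne (fun h => hi (by have := hσ h; subst this; exact hj)) _

lemma exists_d_eq_iff (t : Tot C) : (∃ y, d C y = t) ↔ ∀ i, ∃ y, C.d (i + -1) i y = proj C i t := by
  constructor
  · rintro ⟨y, rfl⟩ i
    exact ⟨proj C (i + -1) y, (proj_d' (by ring) y).symm⟩
  · intro h
    obtain ⟨s, hs⟩ := exists_of_proj (E := C) t (add_left_injective (-1))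
      (fun i x y => C.d (i + -1) i y = x) (fun i => map_zero _) h
    exact ⟨s, ext_proj fun i => by rw [proj_d' (i := i + -1) (by ring), hs]⟩

end Tot

lemma quasiIsoAt_iff_elements {C D : LamComplex ρ} (g : C ⟶ D) (i : ℤ) : QuasiIsoAt g i ↔
      (∀ x : C.X i, C.d i (i + 1) x = 0 → (∃ y, D.d (i + -1) i y = g.f i x) →
        ∃ y, C.d (i + -1) i y = x) ∧
      (∀ z : D.X i, D.d i (i + 1) z = 0 → ∃ x, C.d i (i + 1) x = 0 ∧
        ∃ y, D.d (i + -1) i y = g.f i x - z) := by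
  rw [quasiIsoAt_iff' g (i + -1) i (i + 1) (by simp; ring) (by simp),
    ShortComplex.moduleCat_quasiIso_iff]
  rfl

/-- Quasi-isomorphisms of complexes in terms of elements of the direct sums of the terms. -/
lemma quasiIso_iff_tot {C D : LamComplex ρ} (g : C ⟶ D) :
    QuasiIso g ↔ QuasiIsoDiff (Tot.d C).toAddMonoidHom (Tot.d D).toAddMonoidHom
      (Tot.map g).toAddMonoidHom := by
  rw [quasiIso_iff]
  simp only [quasiIsoAt_iff_elements]
  constructor
  · intro h
    refine ⟨fun x hx hy => (Tot.exists_d_eq_iff x).2 fun i => ?_, fun z hz => ?_⟩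
    · refine (h i).1 _ ((Tot.d_eq_zero_iff x).1 hx i) ?_
      obtain ⟨y, hy⟩ := (Tot.exists_d_eq_iff _).1 hy i
      exact ⟨y, hy.trans (Tot.proj_map g i x)⟩
    · obtain ⟨x, hx⟩ := Tot.exists_of_proj (C := D) (E := C) z (σ := fun i => i)
        Function.injective_id (fun i z x => C.d i (i + 1) x = 0 ∧ ∃ y, D.d (i + -1) i y =
          g.f i x - z) (fun i => ⟨map_zero _, 0, by simp⟩)
        (fun i => (h i).2 _ ((Tot.d_eq_zero_iff z).1 hz i))
      refine ⟨x, (Tot.d_eq_zero_iff x).2 fun i => (hx i).1, (Tot.exists_d_eq_iff _).2 fun i => ?_⟩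
      obtain ⟨y, hy⟩ := (hx i).2
      refine ⟨y, hy.trans ?_⟩
      rw [map_sub]
      congr 1
      exact (Tot.proj_map g i x).symm
  · intro h i
    constructor
    · intro x hx ⟨y, hy⟩
      obtain ⟨w, hw⟩ := h.1 (Tot.incl C i x)
        ((Tot.d_incl i x).trans (by rw [hx, map_zero]))
        ⟨Tot.incl D (i + -1) y, (Tot.d_incl' (by ring) y).trans (by rw [hy]; exact (Tot.map_incl g i x).symm)⟩
      refine ⟨Tot.proj C (i + -1) w, ?_⟩
      rw [← Tot.proj_d' (by ring)]
      exact (congrArg (Tot.proj C i) hw).trans (Tot.proj_incl i x)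
    · intro z hz
      obtain ⟨x, hx, y, hy⟩ := h.2 (Tot.incl D i z)
        ((Tot.d_incl i z).trans (by rw [hz, map_zero]))
      refine ⟨Tot.proj C i x, (Tot.d_eq_zero_iff x).1 hx i, Tot.proj D (i + -1) y, ?_⟩
      rw [← Tot.proj_d' (by ring)]
      refine (congrArg (Tot.proj D i) hy).trans ?_
      rw [map_sub, Tot.proj_incl]
      congr 1
      exact Tot.proj_map g i x

/-! ### Complexes from graded modules -/

section

variable {A : Type u} [AddCommGroup A] [Module (LamQ ρ)ᵐᵒᵖ A]
  (deg : ℤ → Submodule (LamQ ρ)ᵐᵒᵖ A) (d : A →ₗ[(LamQ ρ)ᵐᵒᵖ] A)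
  (hd : ∀ (i : ℤ) (x : A), x ∈ deg i → d x ∈ deg (i + 1)) (hdd : ∀ x, d (d x) = 0)

/-- The cochain complex of the homogeneous parts of a graded module with a differential. -/
def gradedComplex : LamComplex ρ where
  X n := ModuleCat.of _ (deg n)
  d i j := if h : i + 1 = j then ModuleCat.ofHom (d.restrict fun _ ht => h ▸ hd _ _ ht) else 0
  shape i j h := dif_neg h
  d_comp_d' i j k hij hjk := by
    have hij : i + 1 = j := hij
    have hjk : j + 1 = k := hjk
    rw [dif_pos hij, dif_pos hjk]
    exact ModuleCat.hom_ext (LinearMap.ext fun t => Subtype.ext (hdd t.1))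

lemma gradedComplex_d_apply {i j : ℤ} (h : i + 1 = j) (x : deg i) :
    ((show deg j from (gradedComplex deg d hd hdd).d i j x) : A) = d x := by
  have : (gradedComplex deg d hd hdd).d i j = ModuleCat.ofHom (d.restrict fun _ ht => h ▸ hd _ _ ht) :=
    dif_pos h
  rw [this]
  rfl

/-- The map from the direct sum of the terms to the graded module. -/
def gradedSum : Tot (gradedComplex deg d hd hdd) →ₗ[(LamQ ρ)ᵐᵒᵖ] A :=
  DirectSum.toModule _ ℤ _ fun i => (deg i).subtype

lemma gradedSum_incl (i : ℤ) (x : deg i) :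
    gradedSum deg d hd hdd (Tot.incl (gradedComplex deg d hd hdd) i x) = x :=
  DirectSum.toModule_lof _ _ _

lemma gradedSum_d (t : Tot (gradedComplex deg d hd hdd)) :
    gradedSum deg d hd hdd (Tot.d _ t) = d (gradedSum deg d hd hdd t) := by
  induction t using Tot.induction with
  | hom i x =>
    rw [Tot.d_incl]
    refine (gradedSum_incl deg d hd hdd (i + 1) _).trans ?_
    refine (gradedComplex_d_apply deg d hd hdd rfl x).trans ?_
    exact congrArg d (gradedSum_incl deg d hd hdd i x).symm
  | zero => simp
  | add x y hx hy => rw [map_add, map_add, hx, hy, map_add, map_add]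

end

section

variable [Module.Finite F V] [CharP F 2] (M : DGSymQ ρ)

/-- The map from the direct sum of the terms of `tensorEpsObj M` to `M ⊗_S ε`. -/
def TensorEps.sum : Tot (tensorEpsObj M) →ₗ[(LamQ ρ)ᵐᵒᵖ] TensorEps M :=
  gradedSum (TensorEps.deg M) (TensorEps.d M) (fun _ _ => TensorEps.d_mem) TensorEps.d_d

lemma TensorEps.sum_incl (i : ℤ) (t : TensorEps.deg M i) :
    TensorEps.sum M (Tot.incl (tensorEpsObj M) i t) = t.1 :=
  gradedSum_incl (TensorEps.deg M) (TensorEps.d M) (fun _ _ => TensorEps.d_mem) TensorEps.d_d i t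

lemma TensorEps.sum_d (t : Tot (tensorEpsObj M)) :
    TensorEps.sum M (Tot.d _ t) = TensorEps.d M (TensorEps.sum M t) :=
  gradedSum_d (TensorEps.deg M) (TensorEps.d M) (fun _ _ => TensorEps.d_mem) TensorEps.d_d t

end

end BGG

/-! ## The adjunction between the tensor and hom functors -/

namespace BGG

variable {ρ : Representation F Q V}

section

variable [Module.Finite F V]

lemma epsDeg_injective : Function.Injective (DirectSum.coeAddMonoidHom (epsDeg ρ)) := by
  rw [injective_iff_map_eq_zero]
  intro x hx
  have key : ∀ (y : ⨁ i, epsDeg ρ i) (a : Mon F V) (c : Lam ρ),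
      (DirectSum.coeAddMonoidHom (epsDeg ρ) y) (c ⊗ₜ xmon ρ a) =
        (y (-(a.degree : ℤ)) : Tw ρ →ₗ[Lam ρ] Lam ρ) (c ⊗ₜ xmon ρ a) := by
    intro y a c
    induction y using DirectSum.induction_on with
    | zero => simp
    | add y z hy hz => rw [map_add, LinearMap.add_apply, hy, hz]; rfl
    | of i y =>
      rw [DirectSum.coeAddMonoidHom_of]
      by_cases h : i = -(a.degree : ℤ)
      · subst h
        rw [DirectSum.of_eq_same]
      · rw [DirectSum.of_eq_of_ne _ _ _ (Ne.symm h)]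
        exact y.2 a.degree (by lia) c _ (xmon_mem_symDeg ρ a)
  ext i : 1
  have h : (⟨(x i : Tw ρ →ₗ[Lam ρ] Lam ρ), Eps.mem_total (x i).2⟩ : Eps ρ) = 0 := by
    refine Eps.ext_coord fun a => ?_
    change (x i : Tw ρ →ₗ[Lam ρ] Lam ρ) (1 ⊗ₜ xmon ρ a) = 0
    by_cases h : i = -(a.degree : ℤ)
    · rw [h, ← key x, hx]; rfl
    · exact (x i).2 a.degree (by lia) 1 _ (xmon_mem_symDeg ρ a)
  exact Subtype.ext (congrArg Eps.val h)

variable (ρ) in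
lemma Eps.isInternal : DirectSum.IsInternal (Eps.deg ρ) :=
  isInternal_comap (epsDeg ρ) epsDeg_injective (epsTotal ρ).subtype Subtype.val_injective
    (AddSubgroup.range_subtype _)

end

/-- Biadditive maps from two internal direct sums, given on the homogeneous parts. -/
def internalLift₂ {A B P : Type*} [AddCommGroup A] [AddCommGroup B] [AddCommGroup P]
    {dA : ℤ → AddSubgroup A} {dB : ℤ → AddSubgroup B} (hA : DirectSum.IsInternal dA)
    (hB : DirectSum.IsInternal dB) (f : ∀ i j, dA i →+ dB j →+ P) : A →+ B →+ P :=
  let eA : (⨁ i, dA i) ≃+ A := AddEquiv.ofBijective _ hA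
  let eB : (⨁ i, dB i) ≃+ B := AddEquiv.ofBijective _ hB
  let g : (⨁ i, dA i) →+ (⨁ i, dB i) →+ P := DirectSum.toAddMonoid fun i =>
    (DirectSum.toAddMonoid fun j => (f i j).flip).flip
  ((g.comp eA.symm.toAddMonoidHom).flip.comp eB.symm.toAddMonoidHom).flip

lemma internalLift₂_apply {A B P : Type*} [AddCommGroup A] [AddCommGroup B] [AddCommGroup P]
    {dA : ℤ → AddSubgroup A} {dB : ℤ → AddSubgroup B} (hA : DirectSum.IsInternal dA)
    (hB : DirectSum.IsInternal dB) (f : ∀ i j, dA i →+ dB j →+ P) (i j : ℤ) (a : dA i) (b : dB j) :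
    internalLift₂ hA hB f a b = f i j a b := by
  have h1 : (AddEquiv.ofBijective _ hA).symm (a : A) = DirectSum.of (fun i => dA i) i a := by
    rw [AddEquiv.symm_apply_eq]
    exact (DirectSum.coeAddMonoidHom_of dA i a).symm
  have h2 : (AddEquiv.ofBijective _ hB).symm (b : B) = DirectSum.of (fun i => dB i) j b := by
    rw [AddEquiv.symm_apply_eq]
    exact (DirectSum.coeAddMonoidHom_of dB j b).symm
  unfold internalLift₂
  simp only [AddMonoidHom.flip_apply, AddMonoidHom.comp_apply, AddEquiv.toAddMonoidHom_eq_coe,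
    AddMonoidHom.coe_coe]
  rw [h1, h2]
  simp

/-- An internal direct sum is generated by its homogeneous elements. -/
lemma internal_induction {A : Type*} [AddCommGroup A] {dA : ℤ → AddSubgroup A}
    (hA : DirectSum.IsInternal dA) {p : A → Prop} (hom : ∀ i, ∀ a ∈ dA i, p a) (zero : p 0)
    (add : ∀ a b, p a → p b → p (a + b)) (a : A) : p a := by
  obtain ⟨x, rfl⟩ := hA.2 a
  induction x using DirectSum.induction_on with
  | zero => rw [map_zero]; exact zero
  | of i x => rw [DirectSum.coeAddMonoidHom_of]; exact hom i _ x.2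
  | add x y hx hy => rw [map_add]; exact add _ _ hx hy

variable [Module.Finite F V] [CharP F 2]

lemma sym_smul_mem (M : DGSymQ ρ) {i j : ℤ} {s : Sym ρ} (hs : s ∈ symDeg ρ j) {m : M.carrier}
    (hm : m ∈ M.deg i) : s • m ∈ M.deg (i + j) :=
  M.smul_mem hm fun p => by
    classical
    change (single (1 : Q) s).coeff p ∈ _
    rw [SkewMonoidAlgebra.coeff_single_apply]
    split_ifs
    · exact hs
    · exact (symDeg ρ j).zero_mem

lemma Tot.map_comp {C D E : LamComplex ρ} (f : C ⟶ D) (g : D ⟶ E)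
    (t : Tot C) : Tot.map (f ≫ g) t = Tot.map g (Tot.map f t) := by
  induction t using Tot.induction with
  | zero => simp only [map_zero]
  | add x y hx hy => simp only [map_add, hx, hy]
  | hom i x => rw [map_incl, map_incl, map_incl]; rfl

lemma Tot.map_id {C : LamComplex ρ} (t : Tot C) : Tot.map (𝟙 C) t = t := by
  induction t using Tot.induction with
  | zero => simp only [map_zero]
  | add x y hx hy => simp only [map_add, hx, hy]
  | hom i x => rw [map_incl]; rfl

lemma Tot.hom_ext {C D : LamComplex ρ} {f g : C ⟶ D}
    (h : ∀ t, Tot.map f t = Tot.map g t) : f = g := by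
  ext i x
  have := congrArg (Tot.proj D i) (h (Tot.incl C i x))
  rwa [map_incl, map_incl, proj_incl, proj_incl] at this

namespace TensorEps

variable (M : DGSymQ ρ)

/-- The inclusion of the homogeneous part of degree `n` into the direct sum of the terms. -/
def inclDeg (n : ℤ) : deg M n →ₗ[(LamQ ρ)ᵐᵒᵖ] Tot (tensorEpsObj M) := Tot.incl (tensorEpsObj M) n

lemma sum_inclDeg (n : ℤ) (t : deg M n) : sum M (inclDeg M n t) = t.1 := sum_incl M n t

lemma incl_congr {M : DGSymQ ρ} {i j : ℤ} (h : i = j) {t t' : TensorEps M} (ht : t ∈ deg M i)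
    (ht' : t' ∈ deg M j) (htt : t = t') :
    inclDeg M i ⟨t, ht⟩ = inclDeg M j ⟨t', ht'⟩ := by
  subst h htt
  rfl

/-- The components of `m ⊗ e`, as an element of the direct sum of the terms. -/
def toTot₂ : M.carrier →+ Eps ρ →+ Tot (tensorEpsObj M) :=
  internalLift₂ M.isInternal (Eps.isInternal ρ) fun i j =>
    AddMonoidHom.mk' (fun m => AddMonoidHom.mk' (fun e => inclDeg M (i + j)
        ⟨tmul M m.1 e.1, tmul_mem_deg rfl m.2 e.2⟩)
      (fun e e' => by
        rw [← map_add]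
        exact congrArg _ (Subtype.ext (tmul_add _ _ _))))
      (fun m m' => AddMonoidHom.ext fun e => by
        change inclDeg _ _ _ = inclDeg _ _ _ + inclDeg _ _ _
        rw [← map_add]
        exact congrArg _ (Subtype.ext (add_tmul _ _ _)))

lemma toTot₂_apply {i j n : ℤ} (h : i + j = n) {m : M.carrier} {e : Eps ρ} (hm : m ∈ M.deg i)
    (he : e ∈ Eps.deg ρ j) : toTot₂ M m e = inclDeg M n
      ⟨tmul M m e, tmul_mem_deg h hm he⟩ := by
  subst h
  exact internalLift₂_apply M.isInternal (Eps.isInternal ρ) _ i j ⟨m, hm⟩ ⟨e, he⟩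

/-- Two biadditive maps on a dg module and `ε` agree if they agree on homogeneous elements. -/
lemma hom_ext₂ {M : DGSymQ ρ} {P : Type*} [AddCommGroup P] {f g : M.carrier →+ Eps ρ →+ P}
    (h : ∀ i j, ∀ m ∈ M.deg i, ∀ e ∈ Eps.deg ρ j, f m e = g m e) (m : M.carrier) (e : Eps ρ) :
    f m e = g m e := by
  induction m using internal_induction M.isInternal with
  | zero => rw [map_zero, map_zero]
  | add a b ha hb => rw [map_add, map_add, AddMonoidHom.add_apply, AddMonoidHom.add_apply, ha, hb]
  | hom i m hm =>
    induction e using Eps.induction with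
    | zero => rw [map_zero, map_zero]
    | add a b ha hb => rw [map_add, map_add, ha, hb]
    | hom j e he => exact h i j m hm e he

lemma toTot₂_smul (s : Sym ρ) (m : M.carrier) (e : Eps ρ) :
    toTot₂ M (s • m) e = toTot₂ M m (s • e) := by
  have key : ∀ (k : ℤ), ∀ s ∈ symDeg ρ k, ∀ m e, toTot₂ M (s • m) e = toTot₂ M m (s • e) := by
    intro k s hs
    refine hom_ext₂ (f := (toTot₂ M).comp (DistribSMul.toAddMonoidHom _ s))
      (g := ((toTot₂ M).flip.comp (DistribSMul.toAddMonoidHom _ s)).flip) fun i j m hm e he => ?_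
    change toTot₂ M (s • m) e = toTot₂ M m (s • e)
    rw [toTot₂_apply M rfl (sym_smul_mem M hs hm) he,
      toTot₂_apply M rfl hm (Eps.smul_mem_deg hs he)]
    exact incl_congr (by ring) _ _ (smul_tmul s m e)
  induction s using Sym.induction generalizing m e with
  | algebraMap r =>
    refine key 0 _ ?_ m e
    rw [Algebra.algebraMap_eq_smul_one]
    exact (symDeg ρ 0).smul_mem r (one_mem_symDeg ρ)
  | ι f => exact key 1 _ (ι_mem_symDeg ρ f) m e
  | mul a b ha hb => rw [mul_smul, ha, hb, mul_comm, mul_smul]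
  | add a b ha hb => rw [add_smul, add_smul, map_add, map_add, AddMonoidHom.add_apply, ha, hb]

/-- The components of the elements of `M ⊗_S ε`. -/
def toTot : TensorEps M →+ Tot (tensorEpsObj M) := lift (toTot₂ M) (toTot₂_smul M)

lemma toTot_tmul {i j n : ℤ} (h : i + j = n) {m : M.carrier} {e : Eps ρ} (hm : m ∈ M.deg i)
    (he : e ∈ Eps.deg ρ j) : toTot M (tmul M m e) = inclDeg M n
      ⟨tmul M m e, tmul_mem_deg h hm he⟩ := toTot₂_apply M h hm he

lemma toTot_of_mem {n : ℤ} {t : TensorEps M} (ht : t ∈ deg M n) :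
    toTot M t = inclDeg M n ⟨t, ht⟩ := by
  obtain ⟨_, h⟩ : ∃ ht : t ∈ deg M n, toTot M t = inclDeg M n ⟨t, ht⟩ :=
    deg_induction (p := fun t => ∃ ht : t ∈ deg M n, toTot M t = inclDeg M n ⟨t, ht⟩)
      (fun i j h m hm e he => ⟨_, toTot_tmul M h hm he⟩)
      ⟨zero_mem _, (map_zero _).trans (map_zero (inclDeg M n)).symm⟩
      (fun x y ⟨_, hx⟩ ⟨_, hy⟩ => ⟨add_mem ‹_› ‹_›, by rw [map_add, hx, hy, ← map_add]; rfl⟩)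
      (fun x ⟨_, hx⟩ => ⟨neg_mem ‹_›, by rw [map_neg, hx, ← map_neg]; rfl⟩) ht
  exact h

lemma sum_toTot (t : TensorEps M) : sum M (toTot M t) = t := by
  have : (sum M).toAddMonoidHom.comp (toTot M) = AddMonoidHom.id _ := hom_ext fun m e => by
    refine hom_ext₂ (f := ((sum M).toAddMonoidHom.compHom.comp (toTot₂ M)))
      (g := AddMonoidHom.mk' (fun m => AddMonoidHom.mk' (fun e => tmul M m e) (tmul_add m))
        (fun m m' => AddMonoidHom.ext fun e => add_tmul m m' e)) (fun i j m hm e he => ?_) m e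
    change sum M (toTot M (tmul M m e)) = tmul M m e
    rw [toTot_tmul M rfl hm he, sum_inclDeg]
  exact DFunLike.congr_fun this t

lemma toTot_sum (t : Tot (tensorEpsObj M)) : toTot M (sum M t) = t := by
  induction t using Tot.induction with
  | zero => rw [map_zero, map_zero]
  | add x y hx hy => rw [map_add, map_add, hx, hy]
  | hom i x =>
    refine (congrArg (toTot M) (sum_incl M i x)).trans ?_
    exact toTot_of_mem M (n := i) x.2

lemma sum_bijective : Function.Bijective (sum M) :=
  Function.bijective_iff_has_inverse.2 ⟨toTot M, toTot_sum M, sum_toTot M⟩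

lemma toTot_bijective : Function.Bijective (toTot M) :=
  Function.bijective_iff_has_inverse.2 ⟨sum M, sum_toTot M, toTot_sum M⟩

lemma toTot_smul (r : (LamQ ρ)ᵐᵒᵖ) (t : TensorEps M) : toTot M (r • t) = r • toTot M t :=
  (sum_bijective M).1 (by rw [map_smul (sum M), sum_toTot, sum_toTot])

lemma toTot_d (t : TensorEps M) : toTot M (d M t) = Tot.d _ (toTot M t) :=
  (sum_bijective M).1 (by rw [sum_d, sum_toTot, sum_toTot])

/-- The morphism of complexes `f ⊗ ε`. -/
abbrev tensorMap {M N : DGSymQ ρ} (f : M ⟶ N) : tensorEpsObj M ⟶ tensorEpsObj N :=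
  (tensorEps ρ).map f

lemma sum_tensorMap {M N : DGSymQ ρ} (f : M ⟶ N) (t : Tot (tensorEpsObj M)) :
    sum N (Tot.map (tensorMap f) t) = mapHom f (sum M t) := by
  induction t using Tot.induction with
  | zero => simp only [map_zero]
  | add x y hx hy => simp only [map_add, hx, hy]
  | hom i x =>
    rw [Tot.map_incl]
    refine (sum_incl N i _).trans ?_
    exact congrArg (mapHom f) (sum_incl M i x).symm

lemma toTot_mapHom {M N : DGSymQ ρ} (f : M ⟶ N) (t : TensorEps M) :
    toTot N (mapHom f t) = Tot.map (tensorMap f) (toTot M t) :=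
  (sum_bijective N).1 (by rw [sum_tensorMap, sum_toTot, sum_toTot])

end TensorEps

section

variable {C : LamComplex ρ}

lemma evalTot_mem {n : ℤ} {t : TensorEps (homEpsObj C)} (ht : t ∈ TensorEps.deg _ n) :
    evalTot C t ∈ Tot.deg C n :=
  TensorEps.deg_induction (p := fun t => evalTot C t ∈ Tot.deg C n)
    (fun i j h f hf e he => by
      rw [evalTot_tmul, ← h, add_comm]
      exact hf j e he)
    (by rw [map_zero]; exact zero_mem _)
    (fun x y hx hy => by rw [map_add]; exact add_mem hx hy)
    (fun x hx => by rw [map_neg]; exact neg_mem hx) ht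

lemma Tot.incl_proj_of_mem {n : ℤ} {t : Tot C} (ht : t ∈ Tot.deg C n) :
    Tot.incl C n (Tot.proj C n t) = t := by
  obtain ⟨x, rfl⟩ := ht
  exact congrArg _ (Tot.proj_incl n x)

variable (C) in
/-- The evaluation morphism. -/
abbrev evalMap : tensorEpsObj (homEpsObj C) ⟶ C := evalHom C

lemma map_evalMap (t : Tot (tensorEpsObj (homEpsObj C))) :
    Tot.map (evalMap C) t = evalTot C (TensorEps.sum _ t) := by
  induction t using Tot.induction with
  | zero => simp only [map_zero]
  | add x y hx hy => simp only [map_add, hx, hy]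
  | hom i x =>
    refine (Tot.map_incl (evalMap C) i x).trans ?_
    refine (Tot.incl_proj_of_mem (evalTot_mem (n := i) x.2)).trans ?_
    exact congrArg (evalTot C) (TensorEps.sum_incl _ i x).symm

/-- The map `e ↦ m ⊗ e`. -/
def unitLin (M : DGSymQ ρ) (m : M.carrier) : HomEps (tensorEpsObj M) where
  toFun e := TensorEps.toTot M (TensorEps.tmul M m e)
  map_add' e e' := by rw [TensorEps.tmul_add, map_add]
  map_smul' a e := by
    have h : TensorEps.tmul M m (a • e) = op (single (1 : Q) a.unop) • TensorEps.tmul M m e := by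
      rw [TensorEps.smul_tmul', actR_one, Eps.act_one]
      rfl
    rw [h, TensorEps.toTot_smul]
    rfl

lemma unitLin_lin (M : DGSymQ ρ) (m : M.carrier) (e : Eps ρ) :
    (unitLin M m).lin e = TensorEps.toTot M (TensorEps.tmul M m e) := rfl

lemma unitLin_mem_homDeg (M : DGSymQ ρ) {n : ℤ} {m : M.carrier} (hm : m ∈ M.deg n) :
    unitLin M m ∈ HomEps.homDeg (tensorEpsObj M) n := fun i e he => by
  rw [unitLin_lin, TensorEps.toTot_tmul M (add_comm n i) hm he]
  exact ⟨_, rfl⟩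

lemma unitLin_add (M : DGSymQ ρ) (m m' : M.carrier) :
    unitLin M (m + m') = unitLin M m + unitLin M m' := HomEps.ext fun e => by
  rw [HomEps.add_lin, unitLin_lin, unitLin_lin, unitLin_lin, TensorEps.add_tmul, map_add]

lemma unitLin_mem_total (M : DGSymQ ρ) (m : M.carrier) :
    unitLin M m ∈ HomEps.total (tensorEpsObj M) := by
  induction m using internal_induction M.isInternal with
  | zero =>
    have : unitLin M 0 = 0 := by
      have := unitLin_add M 0 0
      rwa [add_zero, left_eq_add] at this
    rw [this]
    exact zero_mem _
  | add a b ha hb => rw [unitLin_add]; exact add_mem ha hb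
  | hom n m hm => exact HomEps.mem_total (unitLin_mem_homDeg M hm)

/-- The unit `m ↦ (e ↦ m ⊗ e)` of the adjunction. -/
def unitHom (M : DGSymQ ρ) : M ⟶ (homEps ρ).obj ((tensorEps ρ).obj M) where
  toLin := linearMapOfSingle (AddMonoidHom.mk' (fun m => ⟨unitLin M m, unitLin_mem_total M m⟩)
    (fun m m' => Subtype.ext (unitLin_add M m m'))) (fun s q m => Subtype.ext <| HomEps.ext fun e => by
      change (unitLin M (op (single q s) • m)).lin e = (op (single q s) • unitLin M m).lin e
      rw [HomEps.smul_lin, unitLin_lin, unitLin_lin, Tot.act_apply, ← TensorEps.toTot_smul,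
        TensorEps.smul_tmul', op_one, one_smul, Eps.act_smul, ← Eps.act_mul, inv_mul_cancel,
        Eps.act_one, ← TensorEps.smul_tmul, sym_smul_def, actR_apply, ← mul_smul, ← op_mul,
        SkewMonoidAlgebra.single_mul_single]
      simp)
  map_mem hm := unitLin_mem_homDeg M hm
  comm m := Subtype.ext <| HomEps.ext fun e => by
    change (unitLin M (M.d m)).lin e = (HomEps.d _ (unitLin M m)).lin e
    rw [HomEps.d_lin, unitLin_lin, unitLin_lin, unitLin_lin, ← TensorEps.toTot_d, ← map_add,
      TensorEps.d_tmul, add_assoc, ← TensorEps.tmul_add, Eps.add_self]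
    have : TensorEps.tmul M m 0 = 0 := TensorProduct.tmul_zero _ _
    rw [this, add_zero]

variable (ρ) in
/-- The adjunction between `- ⊗_S ε` and `Hom_Λ(ε, -)`. -/
def tensorHomAdj : tensorEps ρ ⊣ homEps ρ :=
  Adjunction.mkOfUnitCounit
    { unit :=
        { app := unitHom
          naturality := fun M N f => by
            ext m
            refine Subtype.ext (HomEps.ext fun e => ?_)
            exact (TensorEps.toTot_mapHom f (TensorEps.tmul M m e)) }
      counit :=
        { app := fun C => evalHom C
          naturality := fun C D g => Tot.hom_ext fun t => by
            rw [Tot.map_comp, Tot.map_comp]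
            refine (map_evalMap _).trans ?_
            refine Eq.trans ?_ (congrArg (Tot.map g) (map_evalMap t)).symm
            refine (congrArg (evalTot D) (TensorEps.sum_tensorMap ((homEps ρ).map g) t)).trans ?_
            have : (evalTot D).toAddMonoidHom.comp
                (TensorEps.mapHom ((homEps ρ).map g)).toAddMonoidHom =
                (Tot.map g).toAddMonoidHom.comp (evalTot C).toAddMonoidHom :=
              TensorEps.hom_ext fun f e => rfl
            exact DFunLike.congr_fun this (TensorEps.sum _ t) }
      left_triangle := by
        ext M : 2
        refine Tot.hom_ext fun t => ?_
        obtain ⟨t, rfl⟩ := (TensorEps.toTot_bijective M).2 t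
        refine (Tot.map_comp _ _ _).trans ?_
        refine Eq.trans ?_ (Tot.map_id _).symm
        refine (map_evalMap _).trans ?_
        refine (congrArg (evalTot _) (TensorEps.sum_tensorMap (unitHom M) _)).trans ?_
        rw [TensorEps.sum_toTot]
        have : (evalTot (tensorEpsObj M)).toAddMonoidHom.comp
            (TensorEps.mapHom (unitHom M)).toAddMonoidHom = TensorEps.toTot M :=
          TensorEps.hom_ext fun f e => rfl
        exact DFunLike.congr_fun this t
      right_triangle := by
        ext C f
        refine Subtype.ext (HomEps.ext fun e => ?_)
        change Tot.map (evalMap C) (TensorEps.toTot _ (TensorEps.tmul (homEpsObj C) f e)) = f.1.lin e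
        rw [map_evalMap, TensorEps.sum_toTot]
        rfl }

end

end BGG

/-! ## The Koszul complex of a dg module -/

namespace BGG

variable {ρ : Representation F Q V}

instance (M : DGSymQ ρ) : Module F M.carrier := Module.compHom M.carrier (algebraMap F (Sym ρ))

instance (M : DGSymQ ρ) : IsScalarTower F (Sym ρ) M.carrier where
  smul_assoc r s m := by
    change (r • s) • m = algebraMap F (Sym ρ) r • s • m
    rw [Algebra.smul_def, mul_smul]

lemma field_smul_def (M : DGSymQ ρ) (r : F) (m : M.carrier) : r • m = algebraMap F (Sym ρ) r • m :=
  rfl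

lemma actR_field_smul (M : DGSymQ ρ) (q : Q) (r : F) (m : M.carrier) :
    actR M q (r • m) = r • actR M q m := by
  rw [field_smul_def, actR_smul, Sym.smul_def, AlgHom.commutes]
  rfl

lemma field_smul_mem [Module.Finite F V] [CharP F 2] (M : DGSymQ ρ) {i : ℤ} (r : F)
    {m : M.carrier} (hm : m ∈ M.deg i) : r • m ∈ M.deg i := by
  have : algebraMap F (Sym ρ) r ∈ symDeg ρ 0 := by
    rw [Algebra.algebraMap_eq_smul_one]
    exact (symDeg ρ 0).smul_mem r (one_mem_symDeg ρ)
  have := sym_smul_mem M this hm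
  rwa [add_zero] at this

/-- A morphism of dg modules as a linear map over `F`. -/
def linField {M N : DGSymQ ρ} (f : M.carrier →ₗ[(SymQ ρ)ᵐᵒᵖ] N.carrier) :
    M.carrier →ₗ[F] N.carrier where
  __ := f
  map_smul' r m := map_sym_smul f (algebraMap F (Sym ρ) r) m

@[simp] lemma linField_apply {M N : DGSymQ ρ} (f : M.carrier →ₗ[(SymQ ρ)ᵐᵒᵖ] N.carrier)
    (m : M.carrier) : linField f m = f m := rfl

/-- Multiplication by `s` on a dg module. -/
def symMul (M : DGSymQ ρ) (s : Sym ρ) : M.carrier →ₗ[F] M.carrier :=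
  (LinearMap.lsmul (Sym ρ) M.carrier s).restrictScalars F

@[simp] lemma symMul_apply (M : DGSymQ ρ) (s : Sym ρ) (m : M.carrier) : symMul M s m = s • m := rfl

lemma d_sym_smul (M : DGSymQ ρ) (s : Sym ρ) (m : M.carrier) : M.d (s • m) = s • M.d m :=
  map_sym_smul M.d s m

/-- The underlying module `Hom_F(Λ, M)` of the Koszul complex of `M`. -/
def Kos (M : DGSymQ ρ) : Type u := Lam ρ →ₗ[F] M.carrier

namespace Kos

instance (M : DGSymQ ρ) : AddCommGroup (Kos M) :=
  inferInstanceAs (AddCommGroup (Lam ρ →ₗ[F] M.carrier))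

/-- The underlying linear map. -/
def lin {M : DGSymQ ρ} (φ : Kos M) : Lam ρ →ₗ[F] M.carrier := φ

@[ext]
lemma ext {M : DGSymQ ρ} {φ ψ : Kos M} (h : ∀ μ, φ.lin μ = ψ.lin μ) : φ = ψ := LinearMap.ext h

@[simp] lemma add_lin {M : DGSymQ ρ} (φ ψ : Kos M) (μ : Lam ρ) :
    (φ + ψ).lin μ = φ.lin μ + ψ.lin μ := rfl
@[simp] lemma zero_lin {M : DGSymQ ρ} (μ : Lam ρ) : (0 : Kos M).lin μ = 0 := rfl

variable (M : DGSymQ ρ)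

/-- The right action `(φ a)(μ) = φ(a μ)` of `Λ`. -/
def actL : Lam ρ →+* (AddMonoid.End (Kos M))ᵐᵒᵖ where
  toFun a := op (AddMonoidHom.mk' (fun φ => (φ.lin ∘ₗ LinearMap.mulLeft F a : Lam ρ →ₗ[F] _))
    (fun _ _ => rfl))
  map_one' := congrArg op (AddMonoidHom.ext fun φ => ext fun μ => congrArg φ.lin (one_mul μ))
  map_mul' a b := congrArg op (AddMonoidHom.ext fun φ => ext fun μ =>
    congrArg φ.lin (mul_assoc a b μ))
  map_zero' := congrArg op (AddMonoidHom.ext fun φ => ext fun μ =>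
    (congrArg φ.lin (zero_mul μ)).trans (map_zero φ.lin))
  map_add' a b := congrArg op (AddMonoidHom.ext fun φ => ext fun μ =>
    (congrArg φ.lin (add_mul a b μ)).trans (map_add φ.lin _ _))

/-- The right action `(φ q)(μ) = φ(q μ) q` of `Q`. -/
def actQ : Q →* (AddMonoid.End (Kos M))ᵐᵒᵖ where
  toFun q := op (AddMonoidHom.mk' (fun φ =>
    ({ toFun := fun μ => actR M q (φ.lin (Lam.act ρ q μ))
       map_add' := fun μ ν => by rw [map_add, map_add, map_add]
       map_smul' := fun r μ => by
        rw [map_smul, map_smul, actR_field_smul]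
        rfl } : Lam ρ →ₗ[F] _)) (fun φ ψ => ext fun μ => map_add (actR M q) _ _))
  map_one' := congrArg op (AddMonoidHom.ext fun φ => ext fun μ => by
    change actR M 1 (φ.lin (Lam.act ρ 1 μ)) = φ.lin μ
    rw [actR_one, Lam.act_one]
    rfl)
  map_mul' p q := congrArg op (AddMonoidHom.ext fun φ => ext fun μ => by
    change actR M (p * q) (φ.lin (Lam.act ρ (p * q) μ)) =
      actR M q (actR M p (φ.lin (Lam.act ρ p (Lam.act ρ q μ))))
    rw [actR_mul, Lam.act_mul]
    rfl)

lemma actL_actQ (a : Lam ρ) (q : Q) : actL M (q • a) * actQ M q = actQ M q * actL M a :=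
  congrArg op (AddMonoidHom.ext fun φ => ext fun μ => by
    change actR M q (φ.lin (Lam.act ρ q a * Lam.act ρ q μ)) = actR M q (φ.lin (Lam.act ρ q (a * μ)))
    rw [map_mul (Lam.act ρ q)])

/-- The right `Λ ∗ Q`-module structure on `Hom_F(Λ, M)`. -/
instance : Module (LamQ ρ)ᵐᵒᵖ (Kos M) := rightModule (actL M) (actQ M) (actL_actQ M)

variable {M}

lemma smul_lin (a : Lam ρ) (q : Q) (φ : Kos M) (μ : Lam ρ) :
    (op (single q a) • φ).lin μ = actR M q (φ.lin (a * Lam.act ρ q μ)) :=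
  congrArg (fun φ : Kos M => φ.lin μ) (rightModule_smul (actL M) (actQ M) (actL_actQ M) a q φ)

variable [Module.Finite F V] [CharP F 2]

variable (M) in
/-- The part of degree `n`: the maps with values in `M^n`. -/
def deg (n : ℤ) : Submodule (LamQ ρ)ᵐᵒᵖ (Kos M) where
  carrier := { φ | ∀ μ, φ.lin μ ∈ M.deg n }
  zero_mem' _ := zero_mem _
  add_mem' hφ hψ μ := add_mem (hφ μ) (hψ μ)
  smul_mem' r φ hφ := by
    refine smul_mem_of_single
      { carrier := { φ : Kos M | ∀ μ, φ.lin μ ∈ M.deg n }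
        zero_mem' := fun _ => zero_mem _
        add_mem' := fun hφ hψ μ => add_mem (hφ μ) (hψ μ)
        neg_mem' := fun hφ μ => neg_mem (hφ μ) } (fun a q φ hφ μ => ?_) r hφ
    rw [smul_lin]
    exact actR_mem M q (hφ _)

variable (M) in
/-- The differential `(d φ)(μ) = d (φ(μ)) + ∑ x_i φ(y_i μ)`. -/
def d : Kos M →ₗ[(LamQ ρ)ᵐᵒᵖ] Kos M :=
  linearMapOfSingle (AddMonoidHom.mk' (fun φ => (linField M.d ∘ₗ φ.lin +
      ∑ i, symMul M (xv ρ i) ∘ₗ φ.lin ∘ₗ LinearMap.mulLeft F (yv ρ i) : Lam ρ →ₗ[F] M.carrier))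
      (fun φ ψ => ext fun μ => by
        change (linField M.d ∘ₗ (φ.lin + ψ.lin) + ∑ i, symMul M (xv ρ i) ∘ₗ (φ.lin + ψ.lin) ∘ₗ
          LinearMap.mulLeft F (yv ρ i) : Lam ρ →ₗ[F] M.carrier) μ =
          (linField M.d ∘ₗ φ.lin + ∑ i, symMul M (xv ρ i) ∘ₗ φ.lin ∘ₗ
            LinearMap.mulLeft F (yv ρ i) : Lam ρ →ₗ[F] M.carrier) μ +
          (linField M.d ∘ₗ ψ.lin + ∑ i, symMul M (xv ρ i) ∘ₗ ψ.lin ∘ₗ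
            LinearMap.mulLeft F (yv ρ i) : Lam ρ →ₗ[F] M.carrier) μ
        simp only [LinearMap.add_comp, LinearMap.comp_add, Finset.sum_add_distrib,
          LinearMap.add_apply]
        abel))
    (fun a q φ => ext fun μ => by
      have h : ∀ φ : Kos M, ∀ μ, (linField M.d ∘ₗ φ.lin + ∑ i, symMul M (xv ρ i) ∘ₗ φ.lin ∘ₗ
          LinearMap.mulLeft F (yv ρ i) : Lam ρ →ₗ[F] M.carrier) μ =
          M.d (φ.lin μ) + ∑ i, xv ρ i • φ.lin (yv ρ i * μ) := fun φ μ => by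
        simp [LinearMap.sum_apply]
      refine (h _ μ).trans ?_
      refine Eq.trans ?_ (smul_lin a q _ μ).symm
      refine Eq.trans ?_ (congrArg (actR M q) (h φ _)).symm
      simp only [smul_lin, map_add, map_sum, actR_smul]
      congr 1
      · exact map_smul M.d _ _
      · let B : V →ₗ[F] Module.Dual F V →ₗ[F] M.carrier :=
          LinearMap.mk₂ F (fun v f => ιSym ρ (ρ.dual q⁻¹ f) •
              actR M q (φ.lin (ιLam ρ v * (a * Lam.act ρ q μ))))
            (by intros; simp only [map_add, add_mul, smul_add])
            (by
              intro c v f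
              rw [map_smul, smul_mul_assoc, map_smul, actR_field_smul, field_smul_def,
                field_smul_def, smul_comm])
            (by intros; simp only [map_add, add_smul])
            (by intros; simp only [map_smul, smul_assoc])
        have := sum_dual_invariant ρ B q
        refine Eq.trans (Finset.sum_congr rfl fun i _ => ?_)
          (this.trans (Finset.sum_congr rfl fun i _ => ?_))
        · change _ = ιSym ρ (ρ.dual q⁻¹ (ρ.dual q _)) • actR M q (φ.lin (ιLam ρ (ρ q _) * _))
          rw [← Module.End.mul_apply, ← map_mul, inv_mul_cancel, map_one, Module.End.one_apply,
            ← Lam.act_ι, map_mul (Lam.act ρ q), ← mul_assoc, ← mul_assoc, Lam.comm ρ a]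
          rfl
        · have : q⁻¹ • xv ρ i = ιSym ρ (ρ.dual q⁻¹ ((Module.finBasis F V).coord i)) :=
            Sym.act_ι ρ q⁻¹ _
          rw [this]
          rfl)

lemma d_lin (φ : Kos M) (μ : Lam ρ) :
    (d M φ).lin μ = M.d (φ.lin μ) + ∑ i, xv ρ i • φ.lin (yv ρ i * μ) := by
  change (linField M.d ∘ₗ φ.lin + ∑ i, symMul M (xv ρ i) ∘ₗ φ.lin ∘ₗ
    LinearMap.mulLeft F (yv ρ i) : Lam ρ →ₗ[F] M.carrier) μ = _
  simp [LinearMap.sum_apply]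

lemma d_mem {n : ℤ} {φ : Kos M} (hφ : φ ∈ deg M n) : d M φ ∈ deg M (n + 1) := fun μ => by
  rw [d_lin]
  exact add_mem (M.d_mem (hφ μ)) (sum_mem fun i _ =>
    sym_smul_mem M (ι_mem_symDeg ρ _) (hφ _))

lemma d_d (φ : Kos M) : d M (d M φ) = 0 := by
  ext μ
  simp only [d_lin, map_add, M.d_d, zero_add, map_sum, d_sym_smul, smul_add, Finset.smul_sum,
    Finset.sum_add_distrib, zero_lin]
  rw [← add_assoc, add_self_of_charTwo F, zero_add, ← Finset.sum_product']
  refine Finset.sum_involution (fun p _ => (p.2, p.1)) ?_ ?_ (fun _ _ => Finset.mem_univ _)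
    (fun _ _ => rfl)
  · rintro ⟨i, j⟩ -
    dsimp only
    rw [smul_smul, smul_smul, mul_comm (xv ρ j), ← mul_assoc, ← mul_assoc, Lam.comm ρ (yv ρ j),
      add_self_of_charTwo F]
  · rintro ⟨i, j⟩ - hne hij
    apply hne
    have : j = i := congrArg Prod.fst hij
    subst this
    dsimp only
    rw [yv_mul_yv_mul, map_zero, smul_zero, smul_zero]

/-- Postcomposition with a morphism of dg modules. -/
def map {M N : DGSymQ ρ} (f : M ⟶ N) : Kos M →ₗ[(LamQ ρ)ᵐᵒᵖ] Kos N :=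
  linearMapOfSingle (AddMonoidHom.mk' (fun φ => (linField f.toLin ∘ₗ φ.lin : Lam ρ →ₗ[F] _))
    (fun φ ψ => ext fun μ => map_add f.toLin _ _)) (fun a q φ => ext fun μ => by
      refine (congrArg f.toLin (smul_lin a q φ μ)).trans ?_
      refine Eq.trans ?_ (smul_lin a q _ μ).symm
      exact map_smul f.toLin _ _)

lemma map_lin {M N : DGSymQ ρ} (f : M ⟶ N) (φ : Kos M) (μ : Lam ρ) :
    (map f φ).lin μ = f.toLin (φ.lin μ) := rfl

lemma map_mem {M N : DGSymQ ρ} (f : M ⟶ N) {n : ℤ} {φ : Kos M} (hφ : φ ∈ deg M n) :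
    map f φ ∈ deg N n := fun μ => f.map_mem (hφ μ)

lemma map_d {M N : DGSymQ ρ} (f : M ⟶ N) (φ : Kos M) : map f (d M φ) = d N (map f φ) := by
  ext μ
  rw [map_lin, d_lin, d_lin, map_add, map_sum, map_lin, f.comm]
  congr 1
  exact Finset.sum_congr rfl fun i _ => map_sym_smul f.toLin _ _

end Kos

section

variable [Module.Finite F V] [CharP F 2]

instance : Module.Finite F (Lam ρ) := by
  have key : ∀ l : List (Idx F V), ∃ W : Submodule F (Lam ρ), W.FG ∧
      1 ∈ W ∧ ∀ i ∈ l, ∀ w ∈ W, yv ρ i * w ∈ W := by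
    intro l
    induction l with
    | nil => exact ⟨F ∙ 1, Submodule.fg_span_singleton _, Submodule.mem_span_singleton_self _, by simp⟩
    | cons i l ih =>
      obtain ⟨W, hW, h1, h⟩ := ih
      refine ⟨W ⊔ W.map (LinearMap.mulLeft F (yv ρ i)), hW.sup (hW.map _),
        Submodule.mem_sup_left h1, fun j hj w hw => ?_⟩
      obtain ⟨u, hu, _, ⟨v, hv, rfl⟩, rfl⟩ := Submodule.mem_sup.1 hw
      rw [LinearMap.mulLeft_apply, mul_add]
      rcases List.mem_cons.1 hj with rfl | hj
      · rw [yv_mul_yv_mul, add_zero]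
        exact Submodule.mem_sup_right ⟨u, hu, rfl⟩
      · refine add_mem (Submodule.mem_sup_left (h j hj u hu)) (Submodule.mem_sup_right
          ⟨yv ρ j * v, h j hj v hv, ?_⟩)
        rw [LinearMap.mulLeft_apply, ← mul_assoc, ← mul_assoc, Lam.comm ρ (yv ρ i)]
  obtain ⟨W, hW, h1, h⟩ := key (List.finRange _)
  refine ⟨?_⟩
  have : W = ⊤ := by
    refine Submodule.eq_top_iff'.2 fun a => ?_
    induction a using Lam.induction_yv with
    | one r => rw [Algebra.algebraMap_eq_smul_one]; exact W.smul_mem r h1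
    | add a b ha hb => exact add_mem ha hb
    | smul r a ha => exact W.smul_mem r ha
    | yv_mul i a ha => exact h i (List.mem_finRange i) a ha
  rwa [← this]

lemma Kos.isInternal (M : DGSymQ ρ) : DirectSum.IsInternal (Kos.deg M) := by
  constructor
  · change Function.Injective (DirectSum.coeAddMonoidHom (Kos.deg M))
    rw [injective_iff_map_eq_zero]
    intro x hx
    let ev (μ : Lam ρ) : Kos M →+ M.carrier := AddMonoidHom.mk' (fun φ => φ.lin μ) fun _ _ => rfl
    let g (μ : Lam ρ) : (⨁ n, Kos.deg M n) →+ ⨁ n, M.deg n :=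
      DirectSum.map fun n => AddMonoidHom.mk' (fun φ => ⟨φ.1.lin μ, φ.2 μ⟩) (fun _ _ => rfl)
    have e : ∀ μ, (DirectSum.coeAddMonoidHom M.deg).comp (g μ) =
        (ev μ).comp (DirectSum.coeAddMonoidHom (Kos.deg M)) := fun μ => by
      ext n φ
      simp [g, ev]
      rfl
    have h : ∀ μ, g μ x = 0 := fun μ => M.isInternal.1 (by
      have := DFunLike.congr_fun (e μ) x
      simp only [AddMonoidHom.comp_apply, hx, map_zero] at this
      rw [this, map_zero])
    ext n : 1
    refine Subtype.ext (Kos.ext fun μ => ?_)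
    have := congrArg (fun z => (z n : M.carrier)) (h μ)
    simp only [g, DirectSum.map_apply] at this
    exact this
  · suffices h : ∀ φ, φ ∈ AddMonoidHom.mrange (DirectSum.coeAddMonoidHom (Kos.deg M)) from h
    let rk (c : Lam ρ →ₗ[F] F) (m : M.carrier) : Kos M :=
      (LinearMap.toSpanSingleton F _ m ∘ₗ c : Lam ρ →ₗ[F] M.carrier)
    have key : ∀ (c : Lam ρ →ₗ[F] F) (m : M.carrier), rk c m ∈
        AddMonoidHom.mrange (DirectSum.coeAddMonoidHom (Kos.deg M)) := by
      intro c m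
      induction m using internal_induction M.isInternal with
      | zero =>
        have : rk c 0 = 0 := Kos.ext fun μ => smul_zero (c μ)
        rw [this]
        exact zero_mem _
      | add a b ha hb =>
        have : rk c (a + b) = rk c a + rk c b := Kos.ext fun μ => smul_add (c μ) a b
        rw [this]
        exact add_mem ha hb
      | hom n m hm =>
        have : rk c m ∈ Kos.deg M n := fun μ => field_smul_mem M (c μ) hm
        exact ⟨DirectSum.of (fun n => Kos.deg M n) n ⟨_, this⟩,
          DirectSum.coeAddMonoidHom_of _ _ _⟩
    intro φ
    let b := Module.finBasis F (Lam ρ)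
    have : φ = ∑ i, rk (b.coord i) (φ.lin (b i)) := by
      have h : φ.lin = ∑ i, LinearMap.toSpanSingleton F _ (φ.lin (b i)) ∘ₗ b.coord i := by
        refine b.ext fun j => ?_
        simp [LinearMap.sum_apply, Finsupp.single_apply]
      exact h
    rw [this]
    exact sum_mem fun i _ => key _ _

/-- The Koszul complex of a dg module. -/
def kosObj (M : DGSymQ ρ) : LamComplex ρ :=
  gradedComplex (Kos.deg M) (Kos.d M) (fun _ _ => Kos.d_mem) Kos.d_d

/-- The map from the direct sum of the terms of `kosObj M` to `Hom_F(Λ, M)`. -/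
def Kos.sum (M : DGSymQ ρ) : Tot (kosObj M) →ₗ[(LamQ ρ)ᵐᵒᵖ] Kos M :=
  gradedSum (Kos.deg M) (Kos.d M) (fun _ _ => Kos.d_mem) Kos.d_d

/-- The inclusion of the homogeneous part of degree `n` into the direct sum of the terms. -/
def Kos.inclDeg (M : DGSymQ ρ) (n : ℤ) : Kos.deg M n →ₗ[(LamQ ρ)ᵐᵒᵖ] Tot (kosObj M) :=
  Tot.incl (kosObj M) n

lemma Kos.sum_inclDeg (M : DGSymQ ρ) (n : ℤ) (φ : Kos.deg M n) :
    Kos.sum M (Kos.inclDeg M n φ) = φ.1 :=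
  gradedSum_incl (Kos.deg M) (Kos.d M) (fun _ _ => Kos.d_mem) Kos.d_d n φ

lemma Kos.sum_d (M : DGSymQ ρ) (t : Tot (kosObj M)) :
    Kos.sum M (Tot.d _ t) = Kos.d M (Kos.sum M t) :=
  gradedSum_d (Kos.deg M) (Kos.d M) (fun _ _ => Kos.d_mem) Kos.d_d t

lemma Kos.sum_bijective (M : DGSymQ ρ) : Function.Bijective (Kos.sum M) := Kos.isInternal M

/-- The morphism of Koszul complexes induced by a morphism of dg modules. -/
def kosMap {M N : DGSymQ ρ} (f : M ⟶ N) : kosObj M ⟶ kosObj N where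
  f n := ModuleCat.ofHom ((Kos.map f).restrict fun _ hφ => Kos.map_mem f hφ)
  comm' i j h := by
    have h : i + 1 = j := h
    refine ModuleCat.hom_ext (LinearMap.ext fun φ => Subtype.ext ?_)
    refine (gradedComplex_d_apply (Kos.deg N) (Kos.d N) (fun _ _ => Kos.d_mem) Kos.d_d h _).trans ?_
    refine (Kos.map_d f φ.1).symm.trans ?_
    exact congrArg (Kos.map f) (gradedComplex_d_apply (Kos.deg M) (Kos.d M) (fun _ _ => Kos.d_mem)
      Kos.d_d h φ).symm

lemma Kos.sum_map {M N : DGSymQ ρ} (f : M ⟶ N) (t : Tot (kosObj M)) :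
    Kos.sum N (Tot.map (kosMap f) t) = Kos.map f (Kos.sum M t) := by
  induction t using Tot.induction with
  | zero => simp only [map_zero]
  | add x y hx hy => simp only [map_add, hx, hy]
  | hom n φ =>
    rw [Tot.map_incl]
    refine (Kos.sum_inclDeg N n _).trans ?_
    exact congrArg (Kos.map f) (Kos.sum_inclDeg M n φ).symm

variable (ρ) in
/-- The Koszul complex, as a functor. -/
def kos : DGSymQ ρ ⥤ LamComplex ρ where
  obj := kosObj
  map := kosMap
  map_id M := by ext n φ; rfl
  map_comp f g := by ext n φ; rfl

end

end BGG

/-! ## The finitely supported part of `Hom_Λ(ε, C)` -/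

namespace BGG

variable {ρ : Representation F Q V}

variable {C D : LamComplex ρ}

instance : Module F (Tot C) := Module.compHom (Tot C) (algebraMap F (Lam ρ)ᵐᵒᵖ)

lemma Tot.field_smul_def (r : F) (t : Tot C) : r • t = op (algebraMap F (Lam ρ) r) • t := rfl

/-- A map of complexes' totalizations as a linear map over `F`. -/
def Tot.linField (φ : Tot C →ₗ[(LamQ ρ)ᵐᵒᵖ] Tot D) : Tot C →ₗ[F] Tot D where
  __ := φ
  map_smul' r t := Tot.map_lam_smul φ (op (algebraMap F (Lam ρ) r)) t

@[simp] lemma Tot.linField_apply (φ : Tot C →ₗ[(LamQ ρ)ᵐᵒᵖ] Tot D) (t : Tot C) :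
    Tot.linField φ t = φ t := rfl

/-- The action of an element of `Λ`, as a linear map over `F`. -/
def Tot.lamMul (C : LamComplex ρ) (a : Lam ρ) : Tot C →ₗ[F] Tot C where
  toFun t := op a • t
  map_add' := smul_add _
  map_smul' r t := by
    rw [field_smul_def, RingHom.id_apply, field_smul_def, ← mul_smul, ← mul_smul, ← op_mul,
      ← op_mul, Algebra.commutes]

@[simp] lemma Tot.lamMul_apply (a : Lam ρ) (t : Tot C) : Tot.lamMul C a t = op a • t := rfl

namespace HomEps

variable (C) in
/-- The maps of degree `n` which vanish in all sufficiently small degrees. -/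
def finDeg (n : ℤ) : AddSubgroup (HomEps C) where
  carrier := { f | f ∈ homDeg C n ∧ ∃ N : ℤ, ∀ i < N, ∀ e ∈ Eps.deg ρ i, f.lin e = 0 }
  zero_mem' := ⟨zero_mem _, 0, fun _ _ _ _ => rfl⟩
  add_mem' := fun ⟨hf, N, hN⟩ ⟨hg, N', hN'⟩ => ⟨add_mem hf hg, min N N', fun i hi e he => by
    rw [add_lin, hN i (by lia) e he, hN' i (by lia) e he, add_zero]⟩
  neg_mem' := fun ⟨hf, N, hN⟩ => ⟨neg_mem hf, N, fun i hi e he => by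
    rw [neg_lin, hN i hi e he, neg_zero]⟩

lemma smul_mem_finDeg {n j : ℤ} {s : Sym ρ} (hs : s ∈ symDeg ρ j) (q : Q) {f : HomEps C}
    (hf : f ∈ finDeg C n) : op (single q s) • f ∈ finDeg C (n + j) := by
  obtain ⟨hf, N, hN⟩ := hf
  refine ⟨smul_mem_homDeg hs q hf, N - j, fun i hi e he => ?_⟩
  rw [smul_lin, hN (i + j) (by lia) _ (Eps.smul_mem_deg hs (Eps.act_mem_deg q⁻¹ he)), map_zero]

lemma smul_mem_iSup_finDeg (s : Sym ρ) (q : Q) {f : HomEps C} (hf : f ∈ ⨆ n, finDeg C n) :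
    op (single q s) • f ∈ ⨆ n, finDeg C n := by
  have key : ∀ (j : ℤ), ∀ s ∈ symDeg ρ j, ∀ (q : Q) (f : HomEps C), f ∈ ⨆ n, finDeg C n →
      op (single q s) • f ∈ ⨆ n, finDeg C n := by
    intro j s hs q f hf
    have : ⨆ n, finDeg C n ≤ (⨆ n, finDeg C n).comap
        (DistribSMul.toAddMonoidHom _ (op (single q s))) :=
      iSup_le fun n f hf => AddSubgroup.mem_iSup_of_mem _ (smul_mem_finDeg hs q hf)
    exact this hf
  induction s using Sym.induction generalizing f q with
  | algebraMap r =>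
    refine key 0 _ ?_ q f hf
    rw [Algebra.algebraMap_eq_smul_one]
    exact (symDeg ρ 0).smul_mem r (one_mem_symDeg ρ)
  | ι v => exact key 1 _ (ι_mem_symDeg ρ v) q f hf
  | mul a b ha hb =>
    have : op (single q ((a : Sym ρ) * b)) • f =
        op (single q (b : Sym ρ)) • op (single (1 : Q) (a : Sym ρ)) • f := by
      rw [← mul_smul, ← op_mul, SkewMonoidAlgebra.single_mul_single, one_smul, one_mul]
    exact this ▸ hb q (ha 1 hf)
  | add a b ha hb =>
    have : op (single q ((a : Sym ρ) + b)) • f =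
        op (single q (a : Sym ρ)) • f + op (single q (b : Sym ρ)) • f := by
      rw [SkewMonoidAlgebra.single_add, MulOpposite.op_add, add_smul]
    exact this ▸ add_mem (ha q hf) (hb q hf)

variable (C) in
/-- The direct sum of the `finDeg C n`. -/
def finTotal : Submodule (SymQ ρ)ᵐᵒᵖ (HomEps C) where
  __ := ⨆ n, finDeg C n
  smul_mem' r _ hf :=
    smul_mem_of_single (⨆ n, finDeg C n) (fun s q _ hf => smul_mem_iSup_finDeg s q hf) r hf

lemma mem_finTotal {n : ℤ} {f : HomEps C} (hf : f ∈ finDeg C n) : f ∈ finTotal C :=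
  AddSubgroup.mem_iSup_of_mem n hf

lemma finTotal_induction {p : HomEps C → Prop} (hom : ∀ n, ∀ f ∈ finDeg C n, p f) (zero : p 0)
    (add : ∀ f g, p f → p g → p (f + g)) {f : HomEps C} (hf : f ∈ finTotal C) : p f :=
  AddSubgroup.iSup_induction (S := finDeg C) (C := p) hf hom zero add

lemma finTotal_le : finTotal C ≤ total C := fun _ hf =>
  finTotal_induction (p := (· ∈ total C)) (fun _ _ hf => mem_total hf.1) (zero_mem _)
    (fun _ _ => add_mem) hf

lemma finTotal_vanish {f : HomEps C} (hf : f ∈ finTotal C) :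
    ∃ N : ℤ, ∀ i < N, ∀ e ∈ Eps.deg ρ i, f.lin e = 0 :=
  finTotal_induction (p := fun f => ∃ N : ℤ, ∀ i < N, ∀ e ∈ Eps.deg ρ i, f.lin e = 0)
    (fun _ _ hf => hf.2) ⟨0, fun _ _ _ _ => rfl⟩ (fun _ _ ⟨N, hN⟩ ⟨N', hN'⟩ =>
      ⟨min N N', fun i hi e he => by
        rw [add_lin, hN i (by lia) e he, hN' i (by lia) e he, add_zero]⟩) hf

lemma finDeg_injective : Function.Injective (DirectSum.coeAddMonoidHom (finDeg C)) := by
  rw [injective_iff_map_eq_zero]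
  intro x hx
  let g : (⨁ n, finDeg C n) →+ ⨁ n, homDeg C n :=
    DirectSum.map fun n => AddMonoidHom.mk' (fun f => ⟨f.1, f.2.1⟩) (fun _ _ => rfl)
  have e : (DirectSum.coeAddMonoidHom (homDeg C)).comp g = DirectSum.coeAddMonoidHom (finDeg C) := by
    ext n f : 2
    simp [g]
  have h : g x = 0 := homDeg_injective (by
    have := DFunLike.congr_fun e x
    rw [AddMonoidHom.comp_apply, hx] at this
    rw [this, map_zero])
  ext n : 1
  have := congrArg (fun z => (z n : HomEps C)) h
  simp only [g, DirectSum.map_apply] at this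
  exact Subtype.ext this

lemma map_mem_finDeg (g : C ⟶ D) {n : ℤ} {f : HomEps C} (hf : f ∈ finDeg C n) :
    map g f ∈ finDeg D n :=
  ⟨map_mem_homDeg g hf.1, hf.2.choose, fun i hi e he => by
    rw [map_lin, hf.2.choose_spec i hi e he, map_zero]⟩

lemma map_mem_finTotal (g : C ⟶ D) {f : HomEps C} (hf : f ∈ finTotal C) : map g f ∈ finTotal D :=
  finTotal_induction (p := fun f => map g f ∈ finTotal D)
    (fun _ _ hf => mem_finTotal (map_mem_finDeg g hf)) (by rw [map_zero]; exact zero_mem _)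
    (fun _ _ h h' => by rw [map_add]; exact add_mem h h') hf

variable [Module.Finite F V]

lemma d_mem_finDeg {n : ℤ} {f : HomEps C} (hf : f ∈ finDeg C n) : d C f ∈ finDeg C (n + 1) := by
  obtain ⟨hf, N, hN⟩ := hf
  refine ⟨d_mem_homDeg hf, N - 1, fun i hi e he => ?_⟩
  rw [d_lin, hN i (by lia) e he, hN (i + 1) (by lia) _ (Eps.d_mem_deg he), map_zero, add_zero]

lemma d_mem_finTotal {f : HomEps C} (hf : f ∈ finTotal C) : d C f ∈ finTotal C :=
  finTotal_induction (p := fun f => d C f ∈ finTotal C)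
    (fun _ _ hf => mem_finTotal (d_mem_finDeg hf)) (by rw [map_zero]; exact zero_mem _)
    (fun _ _ h h' => by rw [map_add]; exact add_mem h h') hf

lemma ext_gam {f g : HomEps C} (h : ∀ a, f.lin (gam ρ a) = g.lin (gam ρ a)) : f = g :=
  (epsBasis ρ).ext fun a => by rw [epsBasis_apply]; exact h a

/-- The map `e ↦ x · e(1 ⊗ s)`. -/
def elem (x : Tot C) (s : Sym ρ) : HomEps C where
  toFun e := op (e.val (1 ⊗ₜ s)) • x
  map_add' e e' := by rw [map_add, LinearMap.add_apply, MulOpposite.op_add, add_smul]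
  map_smul' a e := by
    rw [Eps.val_op_smul, op_mul, mul_smul]
    rfl

lemma elem_lin (x : Tot C) (s : Sym ρ) (e : Eps ρ) : (elem x s).lin e = op (e.val (1 ⊗ₜ s)) • x := rfl

lemma elem_gam (x : Tot C) (s : Sym ρ) (a : Mon F V) :
    (elem x s).lin (gam ρ a) = scoeff ρ a s • x := by
  rw [elem_lin, gam_val, one_mul]
  rfl

lemma elem_add_left (x y : Tot C) (s : Sym ρ) : elem (x + y) s = elem x s + elem y s :=
  ext fun e => smul_add _ _ _

lemma elem_add_right (x : Tot C) (s t : Sym ρ) : elem x (s + t) = elem x s + elem x t :=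
  ext fun e => by
    rw [add_lin, elem_lin, elem_lin, elem_lin, TensorProduct.tmul_add, map_add, MulOpposite.op_add,
      add_smul]

lemma elem_smul_left (r : F) (x : Tot C) (s : Sym ρ) : elem (r • x) s = elem x (r • s) :=
  ext_gam fun a => by rw [elem_gam, elem_gam, map_smul, smul_smul, smul_eq_mul, mul_comm]

lemma elem_mem_finDeg {k j : ℤ} {x : Tot C} (hx : x ∈ Tot.deg C k) {s : Sym ρ}
    (hs : s ∈ symDeg ρ j) : elem x s ∈ finDeg C (k + j) := by
  refine ⟨fun i e he => ?_, -j, fun i hi e he => ?_⟩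
  · rw [elem_lin]
    by_cases h : j = -i
    · subst h
      rw [show i + (k + -i) = k by ring]
      exact Tot.smul_mem _ hx
    · rw [he j h 1 s hs, op_zero, zero_smul]
      exact zero_mem _
  · rw [elem_lin, he j (by lia) 1 s hs, op_zero, zero_smul]

lemma elem_xmon_mem (x : Tot C) (a : Mon F V) : elem x (xmon ρ a) ∈ finTotal C := by
  induction x using Tot.induction with
  | hom i x => exact mem_finTotal (elem_mem_finDeg ⟨x, rfl⟩ (xmon_mem_symDeg ρ a))
  | zero => exact (ext fun e => smul_zero _ : elem (0 : Tot C) _ = 0) ▸ zero_mem _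
  | add x y hx hy => rw [elem_add_left]; exact add_mem hx hy

lemma elem_mem (x : Tot C) (s : Sym ρ) : elem x s ∈ finTotal C := by
  induction s using Sym.induction_xmon generalizing x with
  | mon a => exact elem_xmon_mem x a
  | add a b ha hb => rw [elem_add_right]; exact add_mem (ha x) (hb x)
  | smul r a ha => rw [← elem_smul_left]; exact ha _

lemma smul_elem (s : Sym ρ) (q : Q) (x : Tot C) (t : Sym ρ) :
    op (single q s) • elem x t = elem (Tot.act q x) (Sym.act ρ q⁻¹ (s * t)) := by
  ext e
  rw [smul_lin, elem_lin, elem_lin, Eps.val_smul, twMul_tmul, Eps.val_act, twAct_tmul, map_one,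
    inv_inv, Tot.act_op_smul]

lemma d_elem (x : Tot C) (s : Sym ρ) :
    d C (elem x s) = elem (Tot.d C x) s + ∑ i, elem (op (yv ρ i) • x) (xv ρ i * s) := by
  ext e
  have h : ∀ (ι : Type) (S : Finset ι) (g : ι → HomEps C),
      (∑ i ∈ S, g i).lin e = ∑ i ∈ S, (g i).lin e := fun ι S g =>
    map_sum (AddMonoidHom.mk' (fun f : HomEps C => f.lin e) fun _ _ => rfl) g S
  rw [d_lin, add_lin, h, elem_lin, elem_lin, elem_lin, Tot.map_lam_smul, Eps.val_d, twD_tmul,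
    map_sum, Finset.op_sum, Finset.sum_smul]
  congr 1
  refine Finset.sum_congr rfl fun i _ => ?_
  rw [Eps.val_one_tmul_mul, one_mul, op_mul, mul_smul]
  rfl

lemma map_elem (g : C ⟶ D) (x : Tot C) (s : Sym ρ) : map g (elem x s) = elem (Tot.map g x) s :=
  ext fun e => Tot.map_lam_smul (Tot.map g) (op (e.val (1 ⊗ₜ s))) x

lemma finite_support {f : HomEps C} (hf : f ∈ finTotal C) :
    (Function.support fun a => f.lin (gam ρ a)).Finite := by
  obtain ⟨N, hN⟩ := finTotal_vanish hf
  refine Set.Finite.subset (Finsupp.finite_of_degree_le (-N).toNat) fun a ha => ?_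
  by_contra hc
  exact ha (hN (-(a.degree : ℤ)) (by simp at hc; lia) _ (gam_mem_deg ρ a))

lemma eq_sum_elem {f : HomEps C} (S : Finset (Mon F V)) (hS : ∀ a, f.lin (gam ρ a) ≠ 0 → a ∈ S) :
    f = ∑ a ∈ S, elem (f.lin (gam ρ a)) (xmon ρ a) := by
  refine ext_gam fun b => ?_
  have h : ∀ (S : Finset (Mon F V)) (g : Mon F V → HomEps C),
      (∑ i ∈ S, g i).lin (gam ρ b) = ∑ i ∈ S, (g i).lin (gam ρ b) := fun S g =>
    map_sum (AddMonoidHom.mk' (fun f : HomEps C => f.lin (gam ρ b)) fun _ _ => rfl) g S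
  rw [h]
  simp only [elem_gam, scoeff_xmon]
  by_cases hb : b ∈ S
  · rw [Finset.sum_eq_single b]
    · simp
    · intro a _ ha; rw [if_neg ha, zero_smul]
    · intro h'; exact absurd hb h'
  · rw [Finset.sum_eq_zero]
    · by_contra hc; exact hb (hS b hc)
    · intro a ha
      rw [if_neg (by rintro rfl; exact hb ha), zero_smul]

end HomEps

section

variable [Module.Finite F V] [CharP F 2]

variable (C) in
/-- The dg module of the finitely supported elements of `Hom_Λ(ε, C)`, with underlying graded
module `C ⊗ S`. -/
def finEpsObj : DGSymQ ρ where
  carrier := HomEps.finTotal C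
  deg n := (HomEps.finDeg C n).comap (HomEps.finTotal C).subtype.toAddMonoidHom
  isInternal := isInternal_comap _ HomEps.finDeg_injective _ Subtype.val_injective (by
    ext f
    exact ⟨by rintro ⟨f, rfl⟩; exact f.2, fun hf => ⟨⟨f, hf⟩, rfl⟩⟩)
  smul_mem {i j f r} hf hr := by
    change op r • f.1 ∈ HomEps.finDeg C (i + j)
    rw [← SkewMonoidAlgebra.sum_single r, SkewMonoidAlgebra.sum_def, Finsupp.sum,
      Finset.op_sum, Finset.sum_smul]
    exact sum_mem fun q _ => HomEps.smul_mem_finDeg (hr q) q hf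
  d := (HomEps.d C).restrict fun _ hf => HomEps.d_mem_finTotal hf
  d_mem hf := HomEps.d_mem_finDeg hf
  d_d f := Subtype.ext (HomEps.d_d f.1)

variable (ρ) in
/-- The finitely supported part of `Hom_Λ(ε, C)`, as a functor. -/
def finEps : LamComplex ρ ⥤ DGSymQ ρ where
  obj C := finEpsObj C
  map g :=
    { toLin := (HomEps.map g).restrict fun _ hf => HomEps.map_mem_finTotal g hf
      map_mem := fun hf => HomEps.map_mem_finDeg g hf
      comm := fun f => Subtype.ext (HomEps.map_d g f.1) }
  map_id C := by
    ext f
    exact Subtype.ext (HomEps.ext fun e => Tot.map_id _)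
  map_comp {C D E} g h := by
    ext f
    exact Subtype.ext (HomEps.ext fun e => Tot.map_comp _ _ _)

variable (ρ) in
/-- The inclusion of the finitely supported part of `Hom_Λ(ε, C)`. -/
def finIncl : finEps ρ ⟶ homEps ρ where
  app C :=
    { toLin := Submodule.inclusion HomEps.finTotal_le
      map_mem := fun hf => hf.1
      comm := fun f => rfl }
  naturality C D g := rfl

variable (C) in
/-- The module of finitely supported elements. -/
abbrev FinEps := (finEpsObj C).carrier

/-- The underlying map of a finitely supported element. -/
def finVal : FinEps C →+ HomEps C := (HomEps.finTotal C).subtype.toAddMonoidHom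

lemma finVal_injective : Function.Injective (finVal (C := C)) := Subtype.val_injective

/-- The element `x ⊗ s` of `finEpsObj C`. -/
def felem (x : Tot C) (s : Sym ρ) : (finEpsObj C).carrier := ⟨HomEps.elem x s, HomEps.elem_mem x s⟩

lemma felem_add_left (x y : Tot C) (s : Sym ρ) : felem (x + y) s = felem x s + felem y s :=
  Subtype.ext (HomEps.elem_add_left x y s)

lemma felem_add_right (x : Tot C) (s t : Sym ρ) : felem x (s + t) = felem x s + felem x t :=
  Subtype.ext (HomEps.elem_add_right x s t)

lemma felem_smul_left (r : F) (x : Tot C) (s : Sym ρ) : felem (r • x) s = felem x (r • s) :=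
  Subtype.ext (HomEps.elem_smul_left r x s)

/-- `felem` as a biadditive map. -/
def felemHom : Tot C →+ Sym ρ →+ (finEpsObj C).carrier :=
  AddMonoidHom.mk' (fun x => AddMonoidHom.mk' (felem x) (felem_add_right x))
    (fun x y => AddMonoidHom.ext (felem_add_left x y))

lemma smul_felem (s : Sym ρ) (q : Q) (x : Tot C) (t : Sym ρ) :
    op (single q s) • felem x t = felem (Tot.act q x) (Sym.act ρ q⁻¹ (s * t)) :=
  Subtype.ext (HomEps.smul_elem s q x t)

lemma sym_smul_felem (s : Sym ρ) (x : Tot C) (t : Sym ρ) : s • felem x t = felem x (s * t) := by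
  rw [sym_smul_def, smul_felem, Tot.act_one, inv_one, Sym.act_one]
  rfl

lemma field_smul_felem (r : F) (x : Tot C) (t : Sym ρ) : r • felem x t = felem (r • x) t := by
  rw [felem_smul_left, field_smul_def, sym_smul_felem, Algebra.smul_def]

lemma d_felem (x : Tot C) (s : Sym ρ) : (finEpsObj C).d (felem x s) =
    felem (Tot.d C x) s + ∑ i, felem (op (yv ρ i) • x) (xv ρ i * s) := by
  refine finVal_injective ((HomEps.d_elem x s).trans ?_)
  rw [map_add, map_sum]
  rfl

lemma felem_mem {k j n : ℤ} (h : k + j = n) {x : Tot C} (hx : x ∈ Tot.deg C k) {s : Sym ρ}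
    (hs : s ∈ symDeg ρ j) : felem x s ∈ (finEpsObj C).deg n := by
  subst h
  exact HomEps.elem_mem_finDeg hx hs

variable (C) in
/-- The coordinates of a finitely supported element. -/
def finCoord : FinEps C ≃+ (Mon F V →₀ Tot C) where
  toFun f := Finsupp.ofSupportFinite (fun a => f.1.lin (gam ρ a)) (HomEps.finite_support f.2)
  invFun := Finsupp.liftAddHom fun a => felemHom.flip (xmon ρ a)
  left_inv f := by
    refine finVal_injective (Eq.trans ?_ (HomEps.eq_sum_elem (HomEps.finite_support f.2).toFinset
      (fun a h => (HomEps.finite_support f.2).mem_toFinset.2 h)).symm)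
    rw [Finsupp.liftAddHom_apply, map_finsuppSum]
    rfl
  right_inv c := by
    ext b
    change (finVal (Finsupp.liftAddHom _ c)).lin _ = _
    rw [Finsupp.liftAddHom_apply, map_finsuppSum, Finsupp.sum]
    have h : ∀ (S : Finset (Mon F V)) (g : Mon F V → HomEps C),
        (∑ i ∈ S, g i).lin (gam ρ b) = ∑ i ∈ S, (g i).lin (gam ρ b) := fun S g =>
      map_sum (AddMonoidHom.mk' (fun f : HomEps C => f.lin (gam ρ b)) fun _ _ => rfl) g S
    rw [h]
    have h2 : ∀ (a : Mon F V) (x : Tot C), (finVal (felemHom.flip (xmon ρ a) x)).lin (gam ρ b) = if a = b then x else 0 := fun a x => by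
      refine (HomEps.elem_gam x (xmon ρ a) b).trans ?_
      rw [scoeff_xmon]
      split_ifs
      exacts [one_smul _ _, zero_smul _ _]
    simp only [h2]
    rw [Finset.sum_ite_eq']
    simp only [Finsupp.mem_support_iff, ne_eq, ite_eq_left_iff, not_not]
    exact fun h => h.symm
  map_add' f g := by
    ext a
    rfl

lemma finCoord_apply (f : FinEps C) (a : Mon F V) : finCoord C f a = f.1.lin (gam ρ a) := rfl

lemma finCoord_symm_single (a : Mon F V) (x : Tot C) :
    (finCoord C).symm (Finsupp.single a x) = felem x (xmon ρ a) := by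
  change Finsupp.liftAddHom (fun a => felemHom.flip (xmon ρ a)) (Finsupp.single a x) = _
  rw [Finsupp.liftAddHom_apply_single]
  rfl

/-- The finitely supported elements are generated by the `x ⊗ x^a`. -/
lemma finEps_induction {p : FinEps C → Prop} (elem : ∀ x a, p (felem x (xmon ρ a)))
    (add : ∀ f g, p f → p g → p (f + g)) (f : FinEps C) : p f := by
  obtain ⟨c, rfl⟩ := (finCoord C).symm.surjective f
  induction c using Finsupp.induction_linear with
  | zero =>
    have := elem 0 0
    rwa [← finCoord_symm_single, Finsupp.single_zero] at this
  | add f g hf hg => rw [map_add]; exact add _ _ hf hg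
  | single a x => rw [finCoord_symm_single]; exact elem x a

/-- Additive maps out of `finEpsObj C` from balanced biadditive maps on `C` and `S`. -/
def finLift {P : Type*} [AddCommGroup P] (g : Tot C →+ Sym ρ →+ P) : FinEps C →+ P :=
  (Finsupp.liftAddHom fun a => g.flip (xmon ρ a)).comp (finCoord C).toAddMonoidHom

lemma finLift_felem {P : Type*} [AddCommGroup P] (g : Tot C →+ Sym ρ →+ P)
    (hg : ∀ (r : F) x s, g (r • x) s = g x (r • s)) (x : Tot C) (s : Sym ρ) :
    finLift g (felem x s) = g x s := by
  induction s using Sym.induction_xmon generalizing x with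
  | mon a =>
    change Finsupp.liftAddHom _ (finCoord C (felem x (xmon ρ a))) = _
    rw [← finCoord_symm_single, AddEquiv.apply_symm_apply, Finsupp.liftAddHom_apply_single]
    rfl
  | add a b ha hb => rw [felem_add_right, map_add, map_add, ha, hb]
  | smul r a ha => rw [← felem_smul_left, ha, hg]

end

end BGG

/-! ## Homotopies of Koszul type -/

section

variable {A B : Type*} [AddCommGroup A] [AddCommGroup B]

/-- Operators as on a Koszul complex with coefficients in a polynomial ring: exterior
multiplications `Y i` with contractions `pd i`, and multiplications `X i` with one-sided inverses
`q i`. -/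
structure KoszulData (A : Type*) [AddCommGroup A] (ι : Type*) [DecidableEq ι] where
  /-- the exterior multiplications -/
  Y : ι → A →+ A
  /-- the polynomial variables -/
  X : ι → A →+ A
  /-- the contractions -/
  pd : ι → A →+ A
  /-- the one-sided inverses of the `X i` -/
  q : ι → A →+ A
  two : ∀ a : A, a + a = 0
  Y_Y : ∀ i j z, Y i (Y j z) = Y j (Y i z)
  Y_self : ∀ i z, Y i (Y i z) = 0
  Y_pd : ∀ i j z, Y j (pd i z) + pd i (Y j z) = if i = j then z else 0
  X_Y : ∀ i j z, X i (Y j z) = Y j (X i z)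
  X_X : ∀ i j z, X i (X j z) = X j (X i z)
  X_pd : ∀ i j z, X i (pd j z) = pd j (X i z)
  q_Y : ∀ i j z, q i (Y j z) = Y j (q i z)
  q_pd : ∀ i j z, q i (pd j z) = pd j (q i z)
  q_q : ∀ i j z, q i (q j z) = q j (q i z)
  X_q : ∀ i j z, i ≠ j → X i (q j z) = q j (X i z)

namespace KoszulData

variable {ι : Type*} [DecidableEq ι] (K : KoszulData A ι)

/-- The projection which removes the variables with index `i`. -/
def p (i : ι) : AddMonoid.End A :=
  AddMonoidHom.id A + (K.X i).comp (K.q i) +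
    (K.pd i).comp ((K.Y i).comp ((K.X i).comp (K.q i) + (K.q i).comp (K.X i)))

lemma p_apply (i : ι) (z : A) : K.p i z = z + K.X i (K.q i z) +
    K.pd i (K.Y i (K.X i (K.q i z) + K.q i (K.X i z))) := rfl

lemma eq_of_add_eq_zero (K : KoszulData A ι) {a b : A} (h : a + b = 0) : a = b := by
  linear_combination (norm := abel) h - K.two b

lemma pd_Y_of_ne {i j : ι} (h : i ≠ j) (z : A) : K.pd i (K.Y j z) = K.Y j (K.pd i z) :=
  (K.eq_of_add_eq_zero ((K.Y_pd i j z).trans (if_neg h))).symm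

lemma p_Y {i j : ι} (h : i ≠ j) (z : A) : K.p i (K.Y j z) = K.Y j (K.p i z) := by
  simp only [p_apply, map_add, K.q_Y, K.X_Y, K.Y_Y i j, K.pd_Y_of_ne h]

lemma p_X {i j : ι} (h : i ≠ j) (z : A) : K.p i (K.X j z) = K.X j (K.p i z) := by
  simp only [p_apply, map_add, ← K.X_q j i _ (Ne.symm h), K.X_X i j, ← K.X_Y, ← K.X_pd]

lemma p_q {i j : ι} (h : i ≠ j) (z : A) : K.p i (K.q j z) = K.q j (K.p i z) := by
  have hp : K.pd i (K.Y i (K.q j (K.X i (K.q i z) + K.q i (K.X i z)))) =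
      K.q j (K.pd i (K.Y i (K.X i (K.q i z) + K.q i (K.X i z)))) := by
    rw [← K.q_Y, ← K.q_pd]
  simp only [map_add] at hp
  simp only [p_apply, map_add, K.q_q i j, K.X_q i j _ h, hp]

lemma homotopicToId [Fintype ι] (D d : A →+ A) (hD : ∀ z, D z = d z + ∑ i, K.Y i (K.X i z))
    (hpd : ∀ i z, d (K.pd i z) = K.pd i (d z)) (hq : ∀ i z, d (K.q i z) = K.q i (d z)) (i : ι) :
    HomotopicToId D (K.p i) := by
  have h1 : ∀ z, D (K.pd i z) + K.pd i (D z) = K.X i z := fun z => by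
    have : ∀ j, K.Y j (K.X j (K.pd i z)) + K.pd i (K.Y j (K.X j z)) =
        if i = j then K.X j z else 0 := fun j => by rw [K.X_pd, K.Y_pd]
    rw [hD, hD, map_add, map_sum, hpd, add_add_add_comm, K.two, zero_add,
      ← Finset.sum_add_distrib, Finset.sum_congr rfl fun j _ => this j]
    simp
  have h3 : ∀ z, D (K.q i z) + K.q i (D z) = K.Y i (K.X i (K.q i z) + K.q i (K.X i z)) := by
    intro z
    have : ∀ j, j ≠ i → K.Y j (K.X j (K.q i z)) + K.q i (K.Y j (K.X j z)) = 0 := fun j hj => by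
      rw [K.X_q j i _ hj, K.q_Y, K.two]
    rw [hD, hD, map_add, map_sum, hq, add_add_add_comm, K.two, zero_add,
      ← Finset.sum_add_distrib, Finset.sum_eq_single i (fun j _ => this j) (by simp), K.q_Y,
      map_add]
  refine ⟨(K.pd i).comp (K.q i), fun z => ?_⟩
  have e1 := h1 (K.q i z)
  have e3 := congrArg (K.pd i) (h3 z)
  rw [map_add] at e3
  change z = z + K.X i (K.q i z) + K.pd i (K.Y i (K.X i (K.q i z) + K.q i (K.X i z))) +
    D (K.pd i (K.q i z)) + K.pd i (K.q i (D z))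
  linear_combination (norm := abel) e3 - e1 - K.two (K.X i (K.q i z)) - K.two (K.pd i (K.q i (D z)))

end KoszulData

variable {ι : Type*} {p : ι → AddMonoid.End A}

lemma list_prod_kill_right {j : ι} {Y : A →+ A} (hj : ∀ z, p j (Y z) = 0)
    (h : ∀ i, i ≠ j → ∀ z, p i (Y z) = Y (p i z)) {l : List ι} (hl : j ∈ l) (z : A) :
    (l.map p).prod (Y z) = 0 := by
  have hc : ∀ l : List ι, j ∉ l → ∀ z, (l.map p).prod (Y z) = Y ((l.map p).prod z) := by
    intro l
    induction l with
    | nil => intro _ z; rfl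
    | cons i l ih =>
      intro hi z
      rw [List.mem_cons, not_or] at hi
      rw [List.map_cons, List.prod_cons]
      change p i ((l.map p).prod (Y z)) = Y (p i ((l.map p).prod z))
      rw [ih hi.2, h i (Ne.symm hi.1)]
  induction l with
  | nil => simp at hl
  | cons i l ih =>
    rw [List.map_cons, List.prod_cons]
    change p i ((l.map p).prod (Y z)) = 0
    by_cases hj' : j ∈ l
    · rw [ih hj', map_zero]
    · obtain rfl : j = i := by simpa [hj'] using hl
      rw [hc l hj', hj]

lemma list_prod_kill_left {j : ι} {Y : A →+ B} {p' : ι → AddMonoid.End B} (hj : ∀ z, Y (p j z) = 0)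
    (h : ∀ i, i ≠ j → ∀ z, Y (p i z) = p' i (Y z)) {l : List ι} (hl : j ∈ l) (z : A) :
    Y ((l.map p).prod z) = 0 := by
  induction l with
  | nil => simp at hl
  | cons i l ih =>
    rw [List.map_cons, List.prod_cons]
    change Y (p i ((l.map p).prod z)) = 0
    by_cases hi : i = j
    · rw [hi, hj]
    · rw [h i hi, ih (by simpa [Ne.symm hi] using hl), map_zero]

lemma list_prod_induction {S : A → Prop} (h : ∀ i z, S z → S (p i z)) (l : List ι) {z : A}
    (hz : S z) : S ((l.map p).prod z) := by
  induction l with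
  | nil => exact hz
  | cons i l ih =>
    rw [List.map_cons, List.prod_cons]
    exact h i _ ih

/-- A section of a quasi-isomorphism is a quasi-isomorphism. -/
lemma QuasiIsoDiff.section {dA : A →+ A} {dB : B →+ B} {f : A →+ B} {s : B →+ A}
    (hf : QuasiIsoDiff dA dB f) (hc : ∀ x, f (dA x) = dB (f x)) (hs : ∀ z, f (s z) = z)
    (hsc : ∀ z, s (dB z) = dA (s z)) : QuasiIsoDiff dB dA s := by
  refine ⟨fun z hz ⟨y, hy⟩ => ⟨f y, by rw [← hc, hy, hs]⟩, fun x hx => ⟨f x, ?_, ?_⟩⟩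
  · rw [← hc, hx, map_zero]
  · refine hf.1 _ (by rw [map_sub, hx, ← hsc, ← hc, hx, map_zero, map_zero, sub_zero]) ⟨0, ?_⟩
    rw [map_sub, hs, sub_self, map_zero]

end

namespace BGG

variable {ρ : Representation F Q V}

variable {C : LamComplex ρ}

section eps

variable (ρ) in
/-- Multiplication by `x_i` on `ε`. -/
def epsMul (s : Sym ρ) : Eps ρ →ₗ[F] Eps ρ := (LinearMap.lsmul (Sym ρ) (Eps ρ) s).restrictScalars F

@[simp] lemma epsMul_apply (s : Sym ρ) (e : Eps ρ) : epsMul ρ s e = s • e := rfl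

variable [Module.Finite F V]

lemma epsRaiseF_gam (i : Idx F V) (a : Mon F V) (c : Lam ρ) :
    epsRaiseF ρ i (op c • gam ρ a) = op c • gam ρ (a + Finsupp.single i 1) := by
  change epsRaise ρ i (op c • gam ρ a) = _
  rw [map_smul, epsRaise_gam]

lemma epsMapCoord_gam (φ : Lam ρ →ₗ[F] Lam ρ) (a : Mon F V) (c : Lam ρ) :
    epsMapCoord ρ φ (op c • gam ρ a) = op (φ c) • gam ρ a := Eps.mapCoord_gam φ a c

lemma xv_smul_op_smul_gam (i : Idx F V) (a : Mon F V) (c : Lam ρ) : xv ρ i • op c • gam ρ a =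
      if a i = 0 then 0 else op c • gam ρ (a - Finsupp.single i 1) := by
  rw [smul_comm, xv_smul_gam]
  split_ifs
  · rw [smul_zero]
  · rfl

lemma xv_smul_epsRaiseF (i : Idx F V) (e : Eps ρ) : xv ρ i • epsRaiseF ρ i e = e := by
  induction e using Eps.induction_gam with
  | add e e' h h' => rw [map_add, smul_add, h, h']
  | gam a c =>
    rw [epsRaiseF_gam, xv_smul_op_smul_gam, if_neg (by simp), add_tsub_cancel_right]

lemma xv_smul_epsRaiseF_of_ne {i j : Idx F V} (h : j ≠ i) (e : Eps ρ) :
    xv ρ j • epsRaiseF ρ i e = epsRaiseF ρ i (xv ρ j • e) := by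
  induction e using Eps.induction_gam with
  | add e e' h h' => rw [map_add, smul_add, h, h', smul_add, map_add]
  | gam a c =>
    rw [epsRaiseF_gam, xv_smul_op_smul_gam, xv_smul_op_smul_gam]
    have : (a + Finsupp.single i 1 : Mon F V) j = a j := by simp [h]
    rw [this]
    split_ifs with h0
    · rw [map_zero]
    · rw [epsRaiseF_gam]
      congr 2
      ext k
      simp only [Finsupp.coe_tsub, Finsupp.coe_add, Pi.sub_apply, Pi.add_apply]
      by_cases hk : k = j
      · subst hk; simp [h]
      · simp [Finsupp.single_apply, Ne.symm hk]

lemma epsMapCoord_epsRaiseF (φ : Lam ρ →ₗ[F] Lam ρ) (i : Idx F V) (e : Eps ρ) :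
    epsMapCoord ρ φ (epsRaiseF ρ i e) = epsRaiseF ρ i (epsMapCoord ρ φ e) := by
  induction e using Eps.induction_gam with
  | add e e' h h' => simp only [map_add, h, h']
  | gam a c => rw [epsRaiseF_gam, epsMapCoord_gam, epsMapCoord_gam, epsRaiseF_gam]

lemma epsMapCoord_smul (φ : Lam ρ →ₗ[F] Lam ρ) (s : Sym ρ) (e : Eps ρ) :
    epsMapCoord ρ φ (s • e) = s • epsMapCoord ρ φ e := Eps.mapCoord_smul φ s e

lemma epsMapCoord_epsMapCoord (φ ψ : Lam ρ →ₗ[F] Lam ρ) (e : Eps ρ) :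
    epsMapCoord ρ φ (epsMapCoord ρ ψ e) = epsMapCoord ρ (φ ∘ₗ ψ) e := by
  induction e using Eps.induction_gam with
  | add e e' h h' => simp only [map_add, h, h']
  | gam a c => simp only [epsMapCoord_gam, LinearMap.comp_apply]

lemma gam_induction_raise {p : Eps ρ → Prop} (zero : ∀ c : Lam ρ, p (op c • gam ρ 0))
    (add : ∀ e e', p e → p e' → p (e + e')) (raise : ∀ i e, p (epsRaiseF ρ i e)) (e : Eps ρ) :
    p e := by
  induction e using Eps.induction_gam with
  | add e e' h h' => exact add _ _ h h'
  | gam a c =>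
    by_cases ha : a = 0
    · subst ha; exact zero c
    · obtain ⟨i, hi⟩ := Finsupp.ne_iff.1 ha
      have : a = a - Finsupp.single i 1 + Finsupp.single i 1 := by
        rw [tsub_add_cancel_of_le]
        rw [Finsupp.single_le_iff]
        exact Nat.one_le_iff_ne_zero.2 hi
      rw [this, ← epsRaiseF_gam]
      exact raise _ _

end eps

section

variable [Module.Finite F V] [CharP F 2]

/-! ### The quasi-isomorphism `Hom_Λ(ε, C)_fin ⊗_S ε ⟶ C` -/

variable (C) in
/-- The complex `C ⊗ ε` over `F`. -/
abbrev TotEps : Type u := Tot C ⊗[F] Eps ρ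

variable (C) in
/-- The differential of `C ⊗ ε`. -/
def totEpsD : TotEps C →ₗ[F] TotEps C :=
  TensorProduct.map (Tot.linField (Tot.d C)) LinearMap.id +
    ∑ i, (TensorProduct.map (Tot.lamMul C (yv ρ i)) (epsMul ρ (xv ρ i)) +
      TensorProduct.map LinearMap.id
        (epsMul ρ (xv ρ i) ∘ₗ epsMapCoord ρ (LinearMap.mulLeft F (yv ρ i))))

lemma totEpsD_tmul (x : Tot C) (e : Eps ρ) : totEpsD C (x ⊗ₜ e) = Tot.d C x ⊗ₜ e +
    ∑ i, ((op (yv ρ i) • x) ⊗ₜ (xv ρ i • e) +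
      x ⊗ₜ (xv ρ i • epsMapCoord ρ (LinearMap.mulLeft F (yv ρ i)) e)) := by
  simp [totEpsD, LinearMap.sum_apply]

variable (C) in
/-- The map `x ↦ s ↦ e ↦ x ⊗ s e`. -/
def tmulSmul : Tot C →+ Sym ρ →+ Eps ρ →+ TotEps C :=
  AddMonoidHom.mk' (fun x => AddMonoidHom.mk' (fun s =>
    AddMonoidHom.mk' (fun e => x ⊗ₜ (s • e)) fun e e' => by rw [smul_add, TensorProduct.tmul_add])
    fun s t => AddMonoidHom.ext fun e => by
      rw [AddMonoidHom.add_apply]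
      exact (congrArg _ (add_smul s t e)).trans (TensorProduct.tmul_add _ _ _))
    fun x y => AddMonoidHom.ext fun s => AddMonoidHom.ext fun e => TensorProduct.add_tmul _ _ _

lemma tmulSmul_apply (x : Tot C) (s : Sym ρ) (e : Eps ρ) : tmulSmul C x s e = x ⊗ₜ (s • e) := rfl

lemma tmulSmul_smul (r : F) (x : Tot C) (s : Sym ρ) :
    tmulSmul C (r • x) s = tmulSmul C x (r • s) := AddMonoidHom.ext fun e => by
  rw [tmulSmul_apply, tmulSmul_apply, TensorProduct.smul_tmul, smul_assoc]

lemma finLift_tmulSmul (s : Sym ρ) (f : FinEps C) (e : Eps ρ) :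
    finLift (tmulSmul C) (s • f) e = finLift (tmulSmul C) f (s • e) := by
  induction f using finEps_induction with
  | add f g hf hg =>
    rw [smul_add, map_add, map_add, AddMonoidHom.add_apply, AddMonoidHom.add_apply, hf, hg]
  | elem x a =>
    rw [sym_smul_felem, finLift_felem _ tmulSmul_smul, finLift_felem _ tmulSmul_smul,
      tmulSmul_apply, tmulSmul_apply, smul_smul, mul_comm]

variable (C) in
/-- The map `f ⊗ e ↦ x ⊗ s e` for `f = x ⊗ s`. -/
def toTotEps : TensorEps (finEpsObj C) →+ TotEps C :=
  TensorEps.lift (finLift (tmulSmul C)) finLift_tmulSmul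

lemma toTotEps_tmul (x : Tot C) (s : Sym ρ) (e : Eps ρ) :
    toTotEps C (TensorEps.tmul _ (felem x s) e) = x ⊗ₜ (s • e) :=
  DFunLike.congr_fun (finLift_felem _ tmulSmul_smul x s) e

/-- Two additive maps out of `Hom_Λ(ε, C)_fin ⊗_S ε` agree if they do so on the `(x ⊗ s) ⊗ e`. -/
lemma finTensor_hom_ext {P : Type*} [AddCommGroup P] {f g : TensorEps (finEpsObj C) →+ P}
    (h : ∀ x s e, f (TensorEps.tmul _ (felem x s) e) = g (TensorEps.tmul _ (felem x s) e)) :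
    f = g := TensorEps.hom_ext fun m e => by
  induction m using finEps_induction with
  | add m m' hm hm' => rw [TensorEps.add_tmul, map_add, map_add, hm, hm']
  | elem x a => exact h x _ e

lemma toTotEps_bijective : Function.Bijective (toTotEps C) := by
  let g : TotEps C →+ TensorEps (finEpsObj C) := TensorProduct.liftAddHom
    (AddMonoidHom.mk' (fun x => AddMonoidHom.mk' (fun e => TensorEps.tmul _ (felem x 1) e)
      (TensorEps.tmul_add _)) (fun x y => AddMonoidHom.ext fun e => by
        change TensorEps.tmul _ (felem (x + y) 1) e = TensorEps.tmul _ (felem x 1) e +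
          TensorEps.tmul _ (felem y 1) e
        rw [felem_add_left, TensorEps.add_tmul])) (fun r x e => by
        change TensorEps.tmul _ (felem (r • x) 1) e = TensorEps.tmul _ (felem x 1) (r • e)
        rw [← field_smul_felem, field_smul_def, TensorEps.smul_tmul]
        rfl)
  have hg : ∀ x e, g (x ⊗ₜ e) = TensorEps.tmul _ (felem x 1) e := fun x e => rfl
  refine Function.bijective_iff_has_inverse.2 ⟨g, fun t => ?_, fun t => ?_⟩
  · have : g.comp (toTotEps C) = AddMonoidHom.id _ := finTensor_hom_ext fun x s e => by
      rw [AddMonoidHom.comp_apply, toTotEps_tmul, hg, ← TensorEps.smul_tmul, sym_smul_felem, mul_one]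
      rfl
    exact DFunLike.congr_fun this t
  · induction t using TensorProduct.induction_on with
    | zero => rw [map_zero, map_zero]
    | add x y hx hy => rw [map_add, map_add, hx, hy]
    | tmul x e => rw [hg, toTotEps_tmul, one_smul]

lemma toTotEps_d (t : TensorEps (finEpsObj C)) :
    toTotEps C (TensorEps.d _ t) = totEpsD C (toTotEps C t) := by
  have : (toTotEps C).comp (TensorEps.d (finEpsObj C)).toAddMonoidHom =
      (totEpsD C).toAddMonoidHom.comp (toTotEps C) := finTensor_hom_ext fun x s e => by
    change toTotEps C (TensorEps.d _ (TensorEps.tmul _ (felem x s) e)) =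
      totEpsD C (toTotEps C (TensorEps.tmul _ (felem x s) e))
    have h : ∀ (S : Finset (Idx F V)) (g : Idx F V →
        (FinEps C)), TensorEps.tmul _ (∑ i ∈ S, g i) e =
          ∑ i ∈ S, TensorEps.tmul _ (g i) e := fun S g => TensorProduct.sum_tmul _ _ _
    rw [TensorEps.d_tmul, d_felem, TensorEps.add_tmul, h, map_add, map_add, map_sum]
    simp only [toTotEps_tmul]
    rw [totEpsD_tmul, Finset.sum_add_distrib, add_assoc, Eps.d_eq_sum, Finset.smul_sum,
      TensorProduct.tmul_sum]
    congr 2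
    · simp only [mul_smul]
    · refine Finset.sum_congr rfl fun i _ => congrArg _ ?_
      rw [epsMapCoord_smul, smul_comm]
      rfl
  exact DFunLike.congr_fun this t

variable (C) in
/-- The inclusion of the finitely supported part of `Hom_Λ(ε, C)`. -/
abbrev finInclMap : finEpsObj C ⟶ homEpsObj C := (finIncl ρ).app C

variable (C) in
/-- The evaluation `x ⊗ e ↦ x · e(1)`. -/
def totEpsEval : TotEps C →+ Tot C := TensorProduct.liftAddHom
  (AddMonoidHom.mk' (fun x => AddMonoidHom.mk' (fun e : Eps ρ => op (e.val (1 ⊗ₜ 1)) • x)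
    (fun e e' => by rw [map_add, LinearMap.add_apply, MulOpposite.op_add, add_smul]))
    (fun x y => AddMonoidHom.ext fun e => smul_add _ _ _)) (fun r x e => by
      change op (e.val (1 ⊗ₜ 1)) • r • x = op ((r • e).val (1 ⊗ₜ 1)) • x
      rw [Eps.val_smul_field, Tot.field_smul_def, ← mul_smul, ← op_mul, Algebra.smul_def])

lemma totEpsEval_tmul (x : Tot C) (e : Eps ρ) :
    totEpsEval C (x ⊗ₜ e) = op (e.val (1 ⊗ₜ 1)) • x := rfl

lemma totEpsEval_toTotEps (t : TensorEps (finEpsObj C)) : totEpsEval C (toTotEps C t) =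
      evalTot C (TensorEps.mapHom (finInclMap C) t) := by
  have : (totEpsEval C).comp (toTotEps C) = (evalTot C).toAddMonoidHom.comp
      (TensorEps.mapHom (finInclMap C)).toAddMonoidHom := finTensor_hom_ext fun x s e => by
    rw [AddMonoidHom.comp_apply, toTotEps_tmul, totEpsEval_tmul, Eps.val_smul, twMul_tmul, mul_one]
    rfl
  exact DFunLike.congr_fun this t

variable (ρ) in
lemma Lam.pd_yv_add (i j : Idx F V) (a : Lam ρ) :
    yv ρ j * Lam.pd ρ i a + Lam.pd ρ i (yv ρ j * a) = if i = j then a else 0 := by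
  rw [Lam.pd_yv_mul, add_left_comm, add_self_of_charTwo F, add_zero]

/-- Two additive maps on `C ⊗ ε` agree if they agree on pure tensors. -/
lemma totEps_ext {P : Type*} [AddCommGroup P] {f g : TotEps C →+ P}
    (h : ∀ x e, f (x ⊗ₜ e) = g (x ⊗ₜ e)) (z : TotEps C) : f z = g z := by
  induction z using TensorProduct.induction_on with
  | zero => rw [map_zero, map_zero]
  | add x y hx hy => rw [map_add, map_add, hx, hy]
  | tmul x e => exact h x e

variable (C) in
/-- The map `φ ⊗ ψ` on `C ⊗ ε`. -/
def totEpsMap (φ : Tot C →ₗ[F] Tot C) (ψ : Eps ρ →ₗ[F] Eps ρ) : TotEps C →+ TotEps C :=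
  (TensorProduct.map φ ψ).toAddMonoidHom

@[simp] lemma totEpsMap_tmul (φ : Tot C →ₗ[F] Tot C) (ψ : Eps ρ →ₗ[F] Eps ρ) (x : Tot C)
    (e : Eps ρ) : totEpsMap C φ ψ (x ⊗ₜ e) = φ x ⊗ₜ ψ e := rfl

lemma totEpsMap_comm {φ φ' : Tot C →ₗ[F] Tot C} {ψ ψ' : Eps ρ →ₗ[F] Eps ρ}
    (h : ∀ x, φ (φ' x) = φ' (φ x)) (h' : ∀ e, ψ (ψ' e) = ψ' (ψ e)) (z : TotEps C) :
    totEpsMap C φ ψ (totEpsMap C φ' ψ' z) = totEpsMap C φ' ψ' (totEpsMap C φ ψ z) :=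
  totEps_ext (f := (totEpsMap C φ ψ).comp (totEpsMap C φ' ψ'))
    (g := (totEpsMap C φ' ψ').comp (totEpsMap C φ ψ)) (fun x e => by
      simp only [AddMonoidHom.comp_apply, totEpsMap_tmul, h, h']) z

lemma totEpsMap_comm_right (ψ ψ' : Eps ρ →ₗ[F] Eps ρ) (h : ∀ x, ψ (ψ' x) = ψ' (ψ x))
    (z : TotEps C) : totEpsMap C LinearMap.id ψ (totEpsMap C LinearMap.id ψ' z) =
      totEpsMap C LinearMap.id ψ' (totEpsMap C LinearMap.id ψ z) :=
  totEpsMap_comm (fun _ => rfl) h z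

lemma totEpsMap_comm_left_right (φ : Tot C →ₗ[F] Tot C) (ψ : Eps ρ →ₗ[F] Eps ρ) (z : TotEps C) :
    totEpsMap C LinearMap.id ψ (totEpsMap C φ LinearMap.id z) =
      totEpsMap C φ LinearMap.id (totEpsMap C LinearMap.id ψ z) :=
  totEpsMap_comm (φ := LinearMap.id) (φ' := φ) (ψ := ψ) (ψ' := LinearMap.id) (fun _ => rfl)
    (fun _ => rfl) z

lemma Tot.lamMul_yv_self (i : Idx F V) (x : Tot C) :
    Tot.lamMul C (yv ρ i) (Tot.lamMul C (yv ρ i) x) = 0 := by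
  have : yv ρ i * yv ρ i = 0 := by simpa using yv_mul_yv_mul ρ i 1
  rw [Tot.lamMul_apply, Tot.lamMul_apply, ← mul_smul, ← op_mul, this, op_zero, zero_smul]

lemma Tot.lamMul_comm (a b : Lam ρ) (x : Tot C) :
    Tot.lamMul C a (Tot.lamMul C b x) = Tot.lamMul C b (Tot.lamMul C a x) := by
  simp only [Tot.lamMul_apply]
  rw [← mul_smul, ← op_mul, Lam.comm, op_mul, mul_smul]

variable (C) in
/-- The Koszul operators on `C ⊗ ε`. -/
def totEpsKoszul : KoszulData (TotEps C) (Idx F V) where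
  Y i := totEpsMap C (Tot.lamMul C (yv ρ i)) LinearMap.id +
    totEpsMap C LinearMap.id (epsMapCoord ρ (LinearMap.mulLeft F (yv ρ i)))
  X i := totEpsMap C LinearMap.id (epsMul ρ (xv ρ i))
  pd i := totEpsMap C LinearMap.id (epsMapCoord ρ (Lam.pd ρ i))
  q i := totEpsMap C LinearMap.id (epsRaiseF ρ i)
  two := add_self_of_charTwo F
  Y_Y i j z := by
    simp only [AddMonoidHom.add_apply, map_add]
    rw [totEpsMap_comm (Tot.lamMul_comm (yv ρ i) (yv ρ j)) (fun _ => rfl),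
      totEpsMap_comm_right _ _ (fun e => show epsMapCoord ρ (LinearMap.mulLeft F (yv ρ i))
        (epsMapCoord ρ (LinearMap.mulLeft F (yv ρ j)) e) = _ by
          rw [epsMapCoord_epsMapCoord, epsMapCoord_epsMapCoord, ← LinearMap.mulLeft_mul,
            ← LinearMap.mulLeft_mul, Lam.comm]),
      totEpsMap_comm_left_right (Tot.lamMul C (yv ρ i)),
      totEpsMap_comm_left_right (Tot.lamMul C (yv ρ j))]
    abel
  Y_self i z := by
    rw [← AddMonoidHom.comp_apply]
    refine totEps_ext (g := 0) (fun x e => ?_) z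
    simp only [AddMonoidHom.comp_apply, AddMonoidHom.add_apply, totEpsMap_tmul, map_add,
      LinearMap.id_apply, Tot.lamMul_yv_self, TensorProduct.zero_tmul, AddMonoidHom.zero_apply]
    have : epsMapCoord ρ (LinearMap.mulLeft F (yv ρ i))
        (epsMapCoord ρ (LinearMap.mulLeft F (yv ρ i)) e) = 0 := by
      rw [epsMapCoord_epsMapCoord]
      refine Eps.ext_coord fun a => (Eps.mapCoord_coord _ e a).trans ?_
      exact yv_mul_yv_mul ρ i _
    rw [this, TensorProduct.tmul_zero, zero_add, add_zero, add_self_of_charTwo F]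
  Y_pd i j z := by
    rw [← AddMonoidHom.comp_apply, ← AddMonoidHom.comp_apply, ← AddMonoidHom.add_apply]
    refine (totEps_ext (g := if i = j then AddMonoidHom.id _ else 0) (fun x e => ?_) z).trans (by
      split_ifs <;> rfl)
    simp only [AddMonoidHom.comp_apply, AddMonoidHom.add_apply, totEpsMap_tmul, map_add,
      LinearMap.id_apply]
    rw [add_add_add_comm, add_self_of_charTwo F, zero_add, ← TensorProduct.tmul_add]
    have : epsMapCoord ρ (LinearMap.mulLeft F (yv ρ j)) (epsMapCoord ρ (Lam.pd ρ i) e) +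
        epsMapCoord ρ (Lam.pd ρ i) (epsMapCoord ρ (LinearMap.mulLeft F (yv ρ j)) e) =
        if i = j then e else 0 := by
      induction e using Eps.induction_gam with
      | add e e' h h' =>
        simp only [map_add]
        rw [add_add_add_comm, h, h']
        split_ifs <;> simp
      | gam a c =>
        simp only [epsMapCoord_gam, LinearMap.mulLeft_apply]
        rw [← add_smul, ← MulOpposite.op_add, Lam.pd_yv_add]
        split_ifs <;> simp
    rw [this]
    split_ifs <;> simp
  X_Y i j z := by
    simp only [AddMonoidHom.add_apply, map_add]
    rw [totEpsMap_comm_left_right, totEpsMap_comm_right _ _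
      (fun e => (epsMapCoord_smul (LinearMap.mulLeft F (yv ρ j)) (xv ρ i) e).symm)]
  X_X i j z := totEpsMap_comm_right _ _ (fun e => smul_comm (xv ρ i) (xv ρ j) e) z
  X_pd i j z := totEpsMap_comm_right _ _
    (fun e => (epsMapCoord_smul (Lam.pd ρ j) (xv ρ i) e).symm) z
  q_Y i j z := by
    simp only [AddMonoidHom.add_apply, map_add]
    rw [totEpsMap_comm_left_right, totEpsMap_comm_right _ _
      (fun e => (epsMapCoord_epsRaiseF (LinearMap.mulLeft F (yv ρ j)) i e).symm)]
  q_pd i j z := totEpsMap_comm_right _ _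
    (fun e => (epsMapCoord_epsRaiseF (Lam.pd ρ j) i e).symm) z
  q_q i j z := totEpsMap_comm_right _ _ (fun e => by
    induction e using Eps.induction_gam with
    | add e e' h h' => simp only [map_add, h, h']
    | gam a c => simp only [epsRaiseF_gam, add_right_comm]) z
  X_q i j z h := totEpsMap_comm_right _ _ (xv_smul_epsRaiseF_of_ne h) z

lemma totEpsKoszul_X_q (i : Idx F V) (z : TotEps C) :
    (totEpsKoszul C).X i ((totEpsKoszul C).q i z) = z :=
  totEps_ext (f := ((totEpsKoszul C).X i).comp ((totEpsKoszul C).q i)) (g := AddMonoidHom.id _)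
    (fun x e => congrArg (fun e => (x ⊗ₜ[F] e : TotEps C)) (xv_smul_epsRaiseF i e)) z

lemma totEpsKoszul_p (i : Idx F V) (z : TotEps C) :
    (totEpsKoszul C).p i z = (totEpsKoszul C).pd i ((totEpsKoszul C).Y i
      (z + (totEpsKoszul C).q i ((totEpsKoszul C).X i z))) := by
  rw [KoszulData.p_apply, totEpsKoszul_X_q, (totEpsKoszul C).two, zero_add]

lemma totEpsEval_gam_zero (x : Tot C) (c : Lam ρ) :
    totEpsEval C (x ⊗ₜ (op c • gam ρ 0)) = op c • x := by
  rw [totEpsEval_tmul, Eps.val_op_smul, ← xmon_zero ρ, gam_val_xmon, if_pos rfl]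
  simp

lemma totEpsEval_raise (x : Tot C) (i : Idx F V) (e : Eps ρ) :
    totEpsEval C (x ⊗ₜ (epsRaiseF ρ i e)) = 0 := by
  induction e using Eps.induction_gam with
  | add e e' h h' => rw [map_add, TensorProduct.tmul_add, map_add, h, h', add_zero]
  | gam a c =>
    rw [epsRaiseF_gam, totEpsEval_tmul, Eps.val_op_smul, ← xmon_zero ρ, gam_val_xmon, if_neg]
    · simp
    · intro h
      simpa using DFunLike.congr_fun h i

lemma totEpsD_eq (z : TotEps C) : (totEpsD C).toAddMonoidHom z =
    totEpsMap C (Tot.linField (Tot.d C)) LinearMap.id z +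
      ∑ i, (totEpsKoszul C).Y i ((totEpsKoszul C).X i z) := by
  have h : ∀ (g : Idx F V → TotEps C →+ TotEps C) z,
      (∑ i, g i) z = ∑ i, g i z := fun g z => by
    rw [AddMonoidHom.finsetSum_apply]
  refine (totEps_ext (g := totEpsMap C (Tot.linField (Tot.d C)) LinearMap.id +
      ∑ i, ((totEpsKoszul C).Y i).comp ((totEpsKoszul C).X i)) (fun x e => ?_) z).trans
    (by rw [AddMonoidHom.add_apply, h]; rfl)
  rw [AddMonoidHom.add_apply, h]
  refine (totEpsD_tmul x e).trans (congrArg (Tot.d C x ⊗ₜ[F] e + ·) (Finset.sum_congr rfl fun i _ => ?_))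
  change _ = ((op (yv ρ i) • x) ⊗ₜ[F] (xv ρ i • e) +
    x ⊗ₜ[F] (epsMapCoord ρ (LinearMap.mulLeft F (yv ρ i)) (xv ρ i • e)) : TotEps C)
  rw [← epsMapCoord_smul]

lemma totEpsD_d (z : TotEps C) : totEpsD C (totEpsD C z) = 0 := by
  obtain ⟨z, rfl⟩ := toTotEps_bijective.2 z
  rw [← toTotEps_d, ← toTotEps_d, TensorEps.d_d, map_zero]

variable (C) in
lemma quasiIsoDiff_totEpsEval :
    QuasiIsoDiff (totEpsD C).toAddMonoidHom (Tot.d C).toAddMonoidHom (totEpsEval C) := by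
  let s : Tot C →+ TotEps C := AddMonoidHom.mk' (fun x => x ⊗ₜ gam ρ 0)
    fun x y => TensorProduct.add_tmul _ _ _
  have hs : ∀ x, totEpsEval C (s x) = x := fun x => by
    have := totEpsEval_gam_zero x 1
    rwa [op_one, one_smul, one_smul] at this
  let K := totEpsKoszul C
  let P : TotEps C →+ TotEps C := ((List.finRange (Module.finrank F V)).map K.p).prod
  have hP : ∀ z, P z = s (totEpsEval C z) := by
    refine totEps_ext (f := P) (g := s.comp (totEpsEval C)) fun x e => ?_
    induction e using gam_induction_raise with
    | add e e' h h' => rw [TensorProduct.tmul_add, map_add, map_add, h, h']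
    | raise i e =>
      rw [AddMonoidHom.comp_apply, totEpsEval_raise, map_zero]
      refine list_prod_kill_right (Y := (totEpsKoszul C).q i) (fun z => ?_) (fun j h z => K.p_q h z)
        (List.mem_finRange i) (x ⊗ₜ e)
      rw [totEpsKoszul_p, totEpsKoszul_X_q, K.two, map_zero, map_zero]
    | zero c =>
      rw [AddMonoidHom.comp_apply, totEpsEval_gam_zero]
      change P (x ⊗ₜ (op c • gam ρ 0)) = (op c • x) ⊗ₜ gam ρ 0
      induction c using Lam.induction_yv generalizing x with
      | add a b ha hb =>
        rw [MulOpposite.op_add, add_smul, add_smul, TensorProduct.tmul_add, TensorProduct.add_tmul, map_add, ha,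
          hb]
      | smul r a ha =>
        have h1 : (op (r • a) • gam ρ 0 : Eps ρ) = r • (op a • gam ρ 0 : Eps ρ) := by
          rw [← op_algebraMap_smul_eps, ← mul_smul, ← op_mul, Algebra.smul_def, Algebra.commutes]
        have h2 : op (r • a) • x = op a • r • x := by
          rw [Tot.field_smul_def, ← mul_smul, ← op_mul, Algebra.smul_def]
        rw [h1, h2, ← TensorProduct.smul_tmul, ha]
      | yv_mul i a ha =>
        have h1 : K.Y i (x ⊗ₜ (op a • gam ρ 0)) = (op (yv ρ i) • x) ⊗ₜ (op a • gam ρ 0) +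
            x ⊗ₜ (op (yv ρ i * a) • gam ρ 0) := by
          rw [show (op (yv ρ i * a) • gam ρ 0 : Eps ρ) =
            epsMapCoord ρ (LinearMap.mulLeft F (yv ρ i)) (op a • gam ρ 0) by
              rw [epsMapCoord_gam, LinearMap.mulLeft_apply]]
          rfl
        have h2 : P (K.Y i (x ⊗ₜ (op a • gam ρ 0))) = 0 := by
          refine list_prod_kill_right (fun z => ?_) (fun j h z => K.p_Y h z)
            (List.mem_finRange i) _
          rw [totEpsKoszul_p]
          change K.pd i (K.Y i (K.Y i z + K.q i (K.X i (K.Y i z)))) = 0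
          rw [K.X_Y, K.q_Y, ← map_add, K.Y_self, map_zero]
        rw [h1, map_add, ha, ← mul_smul, ← op_mul] at h2
        exact (K.eq_of_add_eq_zero h2).symm
      | one r =>
        have h1 : ∀ i, K.p i (x ⊗ₜ (op (algebraMap F (Lam ρ) r) • gam ρ 0)) =
            x ⊗ₜ (op (algebraMap F (Lam ρ) r) • gam ρ 0) := fun i => by
          have hX : K.X i (x ⊗ₜ (op (algebraMap F (Lam ρ) r) • gam ρ 0)) = 0 := by
            change (x ⊗ₜ[F] (xv ρ i • op (algebraMap F (Lam ρ) r) • gam ρ 0) : TotEps C) = 0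
            rw [xv_smul_op_smul_gam, if_pos (show (0 : Mon F V) i = 0 from rfl), TensorProduct.tmul_zero]
          have h0 : Lam.pd ρ i (algebraMap F (Lam ρ) r) = 0 := by
            rw [Algebra.algebraMap_eq_smul_one, map_smul, Lam.pd_one, smul_zero]
          have := K.Y_pd i i (x ⊗ₜ (op (algebraMap F (Lam ρ) r) • gam ρ 0))
          rw [if_pos rfl] at this
          have hpd : K.pd i (x ⊗ₜ (op (algebraMap F (Lam ρ) r) • gam ρ 0)) = 0 := by
            change (x ⊗ₜ[F] (epsMapCoord ρ (Lam.pd ρ i) (op (algebraMap F (Lam ρ) r) • gam ρ 0)) :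
              TotEps C) = 0
            rw [epsMapCoord_gam, h0, op_zero, zero_smul, TensorProduct.tmul_zero]
          rw [hpd, map_zero, zero_add] at this
          rw [totEpsKoszul_p]
          change K.pd i (K.Y i (_ + K.q i (K.X i _))) = _
          rw [hX, map_zero, add_zero, this]
        have h2 : P (x ⊗ₜ (op (algebraMap F (Lam ρ) r) • gam ρ 0)) =
            x ⊗ₜ (op (algebraMap F (Lam ρ) r) • gam ρ 0) :=
          list_prod_induction (S := fun z => z = _) (fun i z hz => by rw [hz, h1]) _ rfl
        rw [h2, op_algebraMap_smul_eps, ← TensorProduct.smul_tmul]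
        rfl
  refine quasiIsoDiff_of_section totEpsD_d s (fun z => ?_) hs ?_
  · obtain ⟨t, rfl⟩ := toTotEps_bijective.2 z
    change totEpsEval C (totEpsD C _) = Tot.d C _
    rw [← toTotEps_d, totEpsEval_toTotEps, totEpsEval_toTotEps, TensorEps.mapHom_d, evalTot_d]
  · have : s.comp (totEpsEval C) = P := AddMonoidHom.ext fun z => (hP z).symm
    rw [this]
    refine HomotopicToId.list_prod totEpsD_d _ fun p hp => ?_
    obtain ⟨i, -, rfl⟩ := List.mem_map.1 hp
    exact K.homotopicToId _ _ totEpsD_eq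
      (fun i z => (totEpsMap_comm_left_right (Tot.linField (Tot.d C)) _ z).symm)
      (fun i z => (totEpsMap_comm_left_right (Tot.linField (Tot.d C)) _ z).symm) i

variable (C) in
/-- The evaluation on the finitely supported part of `Hom_Λ(ε, C)`. -/
def finEval : tensorEpsObj (finEpsObj C) ⟶ C := TensorEps.tensorMap (finInclMap C) ≫ evalMap C

variable (C) in
theorem quasiIso_finEval : QuasiIso (finEval C) := by
  rw [quasiIso_iff_tot]
  refine QuasiIsoDiff.of_comm_bijective
    ((toTotEps C).comp (TensorEps.sum (finEpsObj C)).toAddMonoidHom) (AddMonoidHom.id _)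
    (fun t => ?_) (fun _ => rfl) (toTotEps_bijective.comp (TensorEps.sum_bijective _))
    Function.bijective_id (fun t => ?_) (quasiIsoDiff_totEpsEval C)
  · change toTotEps C (TensorEps.sum _ (Tot.d _ t)) = totEpsD C (toTotEps C _)
    rw [TensorEps.sum_d, toTotEps_d]
    rfl
  · change Tot.map (TensorEps.tensorMap (finInclMap C) ≫ evalMap C) t =
      totEpsEval C (toTotEps C (TensorEps.sum _ t))
    refine (Tot.map_comp _ _ t).trans ?_
    rw [totEpsEval_toTotEps]
    refine (map_evalMap _).trans (congrArg (evalTot C) ?_)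
    exact TensorEps.sum_tensorMap _ t

end

end BGG

/-! ## The quasi-isomorphism `C ⟶ Kos (Hom_Λ(ε, C)_fin)` -/

namespace KoszulData

variable {A : Type*} [AddCommGroup A] {ι : Type*} [DecidableEq ι] (K : KoszulData A ι)

lemma p_eq (h : ∀ i z, K.q i (K.X i z) = z) (i : ι) (z : A) :
    K.p i z = K.Y i (K.pd i (z + K.X i (K.q i z))) := by
  have h1 := K.Y_pd i i (z + K.X i (K.q i z))
  rw [if_pos rfl] at h1
  have h2 : K.X i (K.q i z) + K.q i (K.X i z) = z + K.X i (K.q i z) := by rw [h, add_comm]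
  rw [p_apply, h2]
  nth_rewrite 1 [← h1]
  rw [add_assoc, K.two, add_zero]

/-- The composite of all the projections. -/
def proj [Fintype ι] : A →+ A := ((Finset.univ.toList.map K.p).prod : AddMonoid.End A)

variable [Fintype ι]

lemma proj_X (h : ∀ i z, K.q i (K.X i z) = z) (i : ι) (z : A) : K.proj (K.X i z) = 0 :=
  list_prod_kill_right (fun z => by rw [K.p_eq h, h, K.two, map_zero, map_zero]) (fun _ h z => K.p_X h z) (by simp) z

lemma Y_proj (h : ∀ i z, K.q i (K.X i z) = z) (i : ι) (z : A) : K.Y i (K.proj z) = 0 :=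
  list_prod_kill_left (p' := K.p) (fun z => by rw [K.p_eq h, K.Y_self])
    (fun _ h z => (K.p_Y h z).symm) (by simp) z

lemma q_proj (h : ∀ i z, K.q i (K.X i z) = z) (i : ι) (z : A) : K.q i (K.proj z) = 0 :=
  list_prod_kill_left (p' := K.p)
    (fun z => by rw [K.p_eq h, K.q_Y, K.q_pd, map_add, h, K.two, map_zero, map_zero])
    (fun _ h z => (K.p_q h z).symm) (by simp) z

lemma proj_induction {S : A → Prop} (h : ∀ i z, S z → S (K.p i z)) {z : A} (hz : S z) :
    S (K.proj z) := list_prod_induction h _ hz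

lemma homotopicToId_proj (D d : A →+ A) (hd : ∀ z, D (D z) = 0)
    (hD : ∀ z, D z = d z + ∑ i, K.Y i (K.X i z))
    (hpd : ∀ i z, d (K.pd i z) = K.pd i (d z)) (hq : ∀ i z, d (K.q i z) = K.q i (d z)) :
    HomotopicToId D K.proj := by
  refine HomotopicToId.list_prod hd _ fun p hp => ?_
  obtain ⟨i, -, rfl⟩ := List.mem_map.1 hp
  exact K.homotopicToId D d hD hpd hq i

end KoszulData

namespace BGG

variable {ρ : Representation F Q V}

variable {C D : LamComplex ρ}

section lower

variable [Module.Finite F V]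

lemma Sym.ext_scoeff {s t : Sym ρ} (h : ∀ a, scoeff ρ a s = scoeff ρ a t) : s = t :=
  (symEquiv ρ).injective (MvPolynomial.ext _ _ h)

variable (ρ) in
/-- Division of monomials by `x_i`, where the monomials without `x_i` are sent to `0`. -/
def symLower (i : Idx F V) : Sym ρ →ₗ[F] Sym ρ where
  toFun s := (symEquiv ρ).symm ((symEquiv ρ s).divMonomial (Finsupp.single i 1))
  map_add' s t := by rw [map_add, MvPolynomial.add_divMonomial, map_add]
  map_smul' r s := (symEquiv ρ).injective <| MvPolynomial.ext _ _ fun a => by simp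

lemma scoeff_symLower (i : Idx F V) (s : Sym ρ) (a : Mon F V) :
    scoeff ρ a (symLower ρ i s) = scoeff ρ (Finsupp.single i 1 + a) s := by
  change MvPolynomial.coeff a (symEquiv ρ ((symEquiv ρ).symm _)) = _
  rw [AlgEquiv.apply_symm_apply, MvPolynomial.coeff_divMonomial]
  rfl

lemma symLower_xv_mul (i : Idx F V) (s : Sym ρ) :
    symLower ρ i (xv ρ i * s) = s := Sym.ext_scoeff fun a => by
  rw [scoeff_symLower, scoeff_xv_mul, if_neg (by simp), add_tsub_cancel_left]

lemma symLower_xv_mul_of_ne {i j : Idx F V} (h : i ≠ j) (s : Sym ρ) :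
    symLower ρ i (xv ρ j * s) = xv ρ j * symLower ρ i s := Sym.ext_scoeff fun a => by
  rw [scoeff_symLower, scoeff_xv_mul, scoeff_xv_mul, scoeff_symLower]
  have : (Finsupp.single i 1 + a : Mon F V) j = a j := by simp [h]
  rw [this]
  split_ifs with h0
  · rfl
  · congr 1
    congr 1
    rw [add_tsub_assoc_of_le]
    rw [Finsupp.single_le_iff]
    exact Nat.one_le_iff_ne_zero.2 h0

lemma symLower_comm (i j : Idx F V) (s : Sym ρ) :
    symLower ρ i (symLower ρ j s) = symLower ρ j (symLower ρ i s) := Sym.ext_scoeff fun a => by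
  simp only [scoeff_symLower, add_left_comm]

lemma symLower_one (i : Idx F V) : symLower ρ i 1 = 0 :=
  Sym.ext_scoeff fun a => by
    rw [scoeff_symLower, ← xmon_zero, scoeff_xmon, if_neg, map_zero]
    intro h
    have := DFunLike.congr_fun h i
    simp at this
    lia

end lower

section

variable [Module.Finite F V] [CharP F 2]

/-- Two additive maps agree if they do so on all `x ⊗ s`. -/
lemma finEps_ext {P : Type*} [AddCommGroup P] {f g : FinEps C →+ P}
    (h : ∀ x s, f (felem x s) = g (felem x s)) (z : FinEps C) : f z = g z :=
  finEps_induction (p := fun z => f z = g z) (fun x a => h x _)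
    (fun x y hx hy => by rw [map_add, map_add, hx, hy]) z

/-- The map `φ ⊗ ψ`. -/
def finMap (φ : Tot C →ₗ[F] Tot D) (ψ : Sym ρ →ₗ[F] Sym ρ) : (FinEps C) →ₗ[F] FinEps D :=
  let g : Tot C →+ Sym ρ →+ FinEps D :=
    (felemHom.compr₂ (AddMonoidHom.id _)).compl₂ ψ.toAddMonoidHom |>.comp φ.toAddMonoidHom
  have hg : ∀ (r : F) x s, g (r • x) s = g x (r • s) := fun r x s => by
    change felem (φ (r • x)) (ψ s) = felem (φ x) (ψ (r • s))
    rw [map_smul, map_smul, felem_smul_left]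
  { finLift g with
    map_smul' := fun r f => finEps_ext
      (f := (finLift g).comp (DistribSMul.toAddMonoidHom _ r))
      (g := (DistribSMul.toAddMonoidHom _ r).comp (finLift g)) (fun x s => by
        change finLift g (r • felem x s) = r • finLift g (felem x s)
        rw [field_smul_felem, finLift_felem g hg, finLift_felem g hg]
        change felem (φ (r • x)) (ψ s) = r • felem (φ x) (ψ s)
        rw [map_smul, field_smul_felem]) f }

@[simp] lemma finMap_felem (φ : Tot C →ₗ[F] Tot D) (ψ : Sym ρ →ₗ[F] Sym ρ) (x : Tot C)
    (s : Sym ρ) : finMap φ ψ (felem x s) = felem (φ x) (ψ s) := by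
  refine finLift_felem _ (fun r x s => ?_) x s
  change felem (φ (r • x)) (ψ s) = felem (φ x) (ψ (r • s))
  rw [map_smul, map_smul, felem_smul_left]

lemma finMap_comm {φ φ' : Tot C →ₗ[F] Tot C} {ψ ψ' : Sym ρ →ₗ[F] Sym ρ}
    (h : ∀ x, φ (φ' x) = φ' (φ x)) (h' : ∀ s, ψ (ψ' s) = ψ' (ψ s)) (z : FinEps C) :
    finMap φ ψ (finMap φ' ψ' z) = finMap φ' ψ' (finMap φ ψ z) :=
  finEps_ext (f := (finMap φ ψ).toAddMonoidHom.comp (finMap φ' ψ').toAddMonoidHom)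
    (g := (finMap φ' ψ').toAddMonoidHom.comp (finMap φ ψ).toAddMonoidHom) (fun x s => by
      change finMap φ ψ (finMap φ' ψ' (felem x s)) = finMap φ' ψ' (finMap φ ψ (felem x s))
      simp only [finMap_felem, h, h']) z

/-- The map `φ ⊗ 1`. -/
abbrev finLeft (φ : Tot C →ₗ[F] Tot D) : FinEps C →ₗ[F] FinEps D := finMap φ LinearMap.id

/-- The map `1 ⊗ ψ`. -/
abbrev finRight (C : LamComplex ρ) (ψ : Sym ρ →ₗ[F] Sym ρ) :
    (FinEps C) →ₗ[F] FinEps C := finMap LinearMap.id ψ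

lemma finLeft_comm {φ φ' : Tot C →ₗ[F] Tot C} (h : ∀ x, φ (φ' x) = φ' (φ x))
    (z : FinEps C) : finLeft φ (finLeft φ' z) = finLeft φ' (finLeft φ z) :=
  finMap_comm h (fun _ => rfl) z

lemma finRight_comm {ψ ψ' : Sym ρ →ₗ[F] Sym ρ} (h : ∀ x, ψ (ψ' x) = ψ' (ψ x))
    (z : FinEps C) : finRight C ψ (finRight C ψ' z) = finRight C ψ' (finRight C ψ z) :=
  finMap_comm (fun _ => rfl) h z

lemma finLeft_finRight (φ : Tot C →ₗ[F] Tot C) (ψ : Sym ρ →ₗ[F] Sym ρ)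
    (z : FinEps C) : finRight C ψ (finLeft φ z) = finLeft φ (finRight C ψ z) :=
  finMap_comm (φ := LinearMap.id) (φ' := φ) (ψ := ψ) (ψ' := LinearMap.id) (fun _ => rfl)
    (fun _ => rfl) z

lemma finRight_mulLeft (s : Sym ρ) (z : FinEps C) : finRight C (LinearMap.mulLeft F s) z = s • z :=
  finEps_ext (f := (finRight C (LinearMap.mulLeft F s)).toAddMonoidHom)
    (g := DistribSMul.toAddMonoidHom _ s) (fun x t => by
      change finRight C (LinearMap.mulLeft F s) (felem x t) = s • felem x t
      rw [finMap_felem, sym_smul_felem]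
      rfl) z

lemma finEps_d (z : FinEps C) : (finEpsObj C).d z = finLeft (Tot.linField (Tot.d C)) z +
      ∑ i, finLeft (Tot.lamMul C (yv ρ i)) (xv ρ i • z) := by
  have h : (∑ i, finLeft (Tot.lamMul C (yv ρ i)) ∘ₗ symMul _ (xv ρ i)) z =
      ∑ i, finLeft (Tot.lamMul C (yv ρ i)) (xv ρ i • z) := by
    rw [LinearMap.sum_apply]
    rfl
  refine (finEps_ext (f := (finEpsObj C).d.toAddMonoidHom)
    (g := (finLeft (Tot.linField (Tot.d C)) + ∑ i, finLeft (Tot.lamMul C (yv ρ i)) ∘ₗ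
      symMul _ (xv ρ i)).toAddMonoidHom) (fun x s => ?_) z).trans (congrArg (_ + ·) h)
  refine (d_felem x s).trans ?_
  change _ = finLeft (Tot.linField (Tot.d C)) (felem x s) +
    (∑ i, finLeft (Tot.lamMul C (yv ρ i)) ∘ₗ symMul _ (xv ρ i)) (felem x s)
  rw [LinearMap.sum_apply]
  simp only [LinearMap.comp_apply, symMul_apply, sym_smul_felem, finMap_felem]
  rfl

/-- The coefficient of `1` of a finitely supported element. -/
def finConst : FinEps C →+ Tot C := AddMonoidHom.mk' (fun z => z.1.lin (gam ρ 0)) fun _ _ => rfl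

lemma finConst_felem (x : Tot C) (s : Sym ρ) : finConst (felem x s) = scoeff ρ 0 s • x :=
  HomEps.elem_gam x s 0

lemma finConst_felem_one (x : Tot C) : finConst (felem x 1) = x := by
  rw [finConst_felem, ← xmon_zero, scoeff_xmon, if_pos rfl, one_smul]

lemma finConst_xv_smul (i : Idx F V) (z : FinEps C) : finConst (xv ρ i • z) = 0 :=
  finEps_ext (f := finConst.comp (DistribSMul.toAddMonoidHom (FinEps C) (xv ρ i))) (g := 0) (fun x s => by
    change finConst (xv ρ i • felem x s) = 0
    rw [sym_smul_felem, finConst_felem, scoeff_xv_mul,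
      if_pos (show (0 : Mon F V) i = 0 from rfl), zero_smul]) z

lemma finConst_finLeft (φ : Tot C →ₗ[F] Tot D) (z : FinEps C) :
    finConst (finLeft φ z) = φ (finConst z) :=
  finEps_ext (f := finConst.comp (finLeft φ).toAddMonoidHom)
    (g := φ.toAddMonoidHom.comp finConst) (fun x s => by
      change finConst (finLeft φ (felem x s)) = φ (finConst (felem x s))
      rw [finMap_felem, finConst_felem, finConst_felem, map_smul]
      rfl) z

/-- A finitely supported element killed by all lowering operators is constant. -/
lemma eq_felem_of_lower {z : FinEps C}
    (h : ∀ i, finRight C (symLower ρ i) z = 0) : z = felem (finConst z) 1 := by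
  have key : ∀ i a (z : FinEps C), finCoord C (finRight C (symLower ρ i) z) a =
      finCoord C z (Finsupp.single i 1 + a) := fun i a z => by
    refine finEps_ext (f := ((Finsupp.applyAddHom a).comp (finCoord C).toAddMonoidHom).comp
      (finRight C (symLower ρ i)).toAddMonoidHom) (g := (Finsupp.applyAddHom
        (Finsupp.single i 1 + a)).comp (finCoord C).toAddMonoidHom) (fun x s => ?_) z
    change finCoord C (finRight C (symLower ρ i) (felem x s)) a = finCoord C (felem x s) _
    rw [finMap_felem, finCoord_apply, finCoord_apply]
    refine (HomEps.elem_gam _ _ _).trans (Eq.trans ?_ (HomEps.elem_gam _ _ _).symm)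
    rw [scoeff_symLower]
    rfl
  apply (finCoord C).injective
  ext a
  by_cases ha : a = 0
  · subst ha
    exact (finConst_felem_one (finConst z)).symm
  · obtain ⟨i, hi⟩ := Finsupp.ne_iff.1 ha
    have h1 : a = Finsupp.single i 1 + (a - Finsupp.single i 1) := by
      rw [add_tsub_cancel_of_le]
      rw [Finsupp.single_le_iff]
      exact Nat.one_le_iff_ne_zero.2 hi
    rw [h1, ← key, h, map_zero, ← key, finMap_felem, symLower_one]
    have : felem (LinearMap.id (R := F) (finConst z)) (0 : Sym ρ) = 0 := map_zero (felemHom _)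
    rw [this, map_zero]

/-! ### Operators on Koszul complexes -/

namespace Kos

variable {M : DGSymQ ρ}

/-- Postcomposition. -/
def post (φ : M.carrier →ₗ[F] M.carrier) : Kos M →+ Kos M :=
  AddMonoidHom.mk' (fun ψ => (φ ∘ₗ ψ.lin : Lam ρ →ₗ[F] M.carrier)) fun ψ ψ' =>
    LinearMap.comp_add ψ.lin ψ'.lin φ

/-- Precomposition. -/
def pre (M : DGSymQ ρ) (a : Lam ρ →ₗ[F] Lam ρ) : Kos M →+ Kos M :=
  AddMonoidHom.mk' (fun ψ => (ψ.lin ∘ₗ a : Lam ρ →ₗ[F] M.carrier)) fun _ _ => rfl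

@[simp] lemma post_lin (φ : M.carrier →ₗ[F] M.carrier) (ψ : Kos M) (μ : Lam ρ) :
    (post φ ψ).lin μ = φ (ψ.lin μ) := rfl

@[simp] lemma pre_lin (a : Lam ρ →ₗ[F] Lam ρ) (ψ : Kos M) (μ : Lam ρ) :
    (pre M a ψ).lin μ = ψ.lin (a μ) := rfl

lemma sum_lin {ι : Type*} (S : Finset ι) (g : ι → Kos M) (μ : Lam ρ) :
    (∑ i ∈ S, g i).lin μ = ∑ i ∈ S, (g i).lin μ :=
  map_sum (AddMonoidHom.mk' (fun φ : Kos M => φ.lin μ) fun _ _ => rfl) g S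

end Kos

variable (C) in
/-- The Koszul operators on the Koszul complex of `Hom_Λ(ε, C)_fin`. -/
def kosFinKoszul : KoszulData (Kos (finEpsObj C)) (Idx F V) where
  Y i := Kos.post (finLeft (Tot.lamMul C (yv ρ i))) + Kos.pre _ (LinearMap.mulLeft F (yv ρ i))
  X i := Kos.post (finRight C (LinearMap.mulLeft F (xv ρ i)))
  pd i := Kos.pre _ (Lam.pd ρ i)
  q i := Kos.post (finRight C (symLower ρ i))
  two φ := Kos.ext fun μ => by
    rw [Kos.add_lin, add_self_of_charTwo F, Kos.zero_lin]
  Y_Y i j φ := Kos.ext fun μ => by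
    simp only [AddMonoidHom.add_apply, Kos.add_lin, Kos.post_lin, Kos.pre_lin, map_add,
      LinearMap.mulLeft_apply]
    rw [finLeft_comm (Tot.lamMul_comm _ _), ← mul_assoc, ← mul_assoc, Lam.comm ρ (yv ρ i) (yv ρ j)]
    abel
  Y_self i φ := Kos.ext fun μ => by
    simp only [AddMonoidHom.add_apply, Kos.add_lin, Kos.post_lin, Kos.pre_lin, map_add,
      LinearMap.mulLeft_apply]
    have : ∀ z, finLeft (Tot.lamMul C (yv ρ i)) (finLeft (Tot.lamMul C (yv ρ i)) z) = 0 :=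
      finEps_ext (f := (finLeft (Tot.lamMul C (yv ρ i))).toAddMonoidHom.comp
        (finLeft (Tot.lamMul C (yv ρ i))).toAddMonoidHom) (g := 0) fun x s => by
        change finLeft _ (finLeft _ (felem x s)) = 0
        rw [finMap_felem, finMap_felem, Tot.lamMul_yv_self]
        exact map_zero (felemHom.flip s)
    rw [this, yv_mul_yv_mul, map_zero, zero_add, add_zero, add_self_of_charTwo F, Kos.zero_lin]
  Y_pd i j φ := Kos.ext fun μ => by
    simp only [AddMonoidHom.add_apply, Kos.add_lin, Kos.post_lin, Kos.pre_lin,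
      LinearMap.mulLeft_apply]
    rw [add_add_add_comm, add_self_of_charTwo F, zero_add, ← map_add, add_comm, Lam.pd_yv_add]
    split_ifs <;> simp
  X_Y i j φ := Kos.ext fun μ => by
    simp only [AddMonoidHom.add_apply, Kos.add_lin, Kos.post_lin, Kos.pre_lin, map_add,
      finLeft_finRight]
  X_X i j φ := Kos.ext fun μ => finRight_comm (fun s => mul_left_comm _ _ _) _
  X_pd i j φ := rfl
  q_Y i j φ := Kos.ext fun μ => by
    simp only [AddMonoidHom.add_apply, Kos.add_lin, Kos.post_lin, Kos.pre_lin, map_add,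
      finLeft_finRight]
  q_pd i j φ := rfl
  q_q i j φ := Kos.ext fun μ => finRight_comm (symLower_comm i j) _
  X_q i j φ h := Kos.ext fun μ =>
    finRight_comm (fun s => (symLower_xv_mul_of_ne (Ne.symm h) s).symm) _

lemma kosFinKoszul_q_X (i : Idx F V) (φ : Kos (finEpsObj C)) :
    (kosFinKoszul C).q i ((kosFinKoszul C).X i φ) = φ := Kos.ext fun μ =>
  finEps_ext (f := (finRight C (symLower ρ i)).toAddMonoidHom.comp
    (finRight C (LinearMap.mulLeft F (xv ρ i))).toAddMonoidHom) (g := AddMonoidHom.id _)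
    (fun x s => by
      change finRight C _ (finRight C _ (felem x s)) = felem x s
      rw [finMap_felem, finMap_felem, LinearMap.mulLeft_apply, symLower_xv_mul]
      rfl) (φ.lin μ)

lemma kosFin_d (φ : Kos (finEpsObj C)) : Kos.d _ φ = Kos.post (finLeft (Tot.linField (Tot.d C))) φ +
      ∑ i, (kosFinKoszul C).Y i ((kosFinKoszul C).X i φ) := Kos.ext fun μ => by
  rw [Kos.d_lin, finEps_d, Kos.add_lin, Kos.sum_lin, add_assoc, ← Finset.sum_add_distrib]
  refine congrArg (_ + ·) (Finset.sum_congr rfl fun i _ => ?_)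
  change _ = finLeft (Tot.lamMul C (yv ρ i)) (finRight C _ (φ.lin μ)) +
    finRight C _ (φ.lin (yv ρ i * μ))
  rw [finRight_mulLeft, finRight_mulLeft]

variable (C) in
/-- The map `c ↦ (μ ↦ c μ ⊗ 1)`. -/
def kosUnitLin : Tot C →ₗ[(LamQ ρ)ᵐᵒᵖ] Kos (finEpsObj C) :=
  linearMapOfSingle (AddMonoidHom.mk' (fun c =>
    ({ toFun := fun μ => felem (op μ • c) 1
       map_add' := fun μ ν => by rw [MulOpposite.op_add, add_smul, felem_add_left]
       map_smul' := fun r μ => by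
        rw [RingHom.id_apply, field_smul_felem, Tot.field_smul_def, ← mul_smul, ← op_mul,
          Algebra.smul_def, Algebra.commutes] } : Lam ρ →ₗ[F] FinEps C))
    fun c c' => Kos.ext fun μ => by
      change felem (op μ • (c + c')) 1 = felem (op μ • c) 1 + felem (op μ • c') 1
      rw [smul_add, felem_add_left]) fun a q c => Kos.ext fun μ => by
      refine Eq.trans ?_ (Kos.smul_lin a q _ μ).symm
      change felem (op μ • op (single q a) • c) 1 = op (single q (1 : Sym ρ)) •
        felem (op (a * (q • μ)) • c) 1
      rw [smul_felem, mul_one, op_mul, mul_smul, Tot.act_op_smul, op_single_eq, mul_smul,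
        ← Sym.smul_def, smul_one]
      rfl

lemma kosUnitLin_lin (c : Tot C) (μ : Lam ρ) : (kosUnitLin C c).lin μ = felem (op μ • c) 1 := rfl

lemma kosUnitLin_d (c : Tot C) : kosUnitLin C (Tot.d C c) = Kos.d _ (kosUnitLin C c) :=
  Kos.ext fun μ => by
    rw [Kos.d_lin, kosUnitLin_lin, kosUnitLin_lin, d_felem, add_assoc, ← Finset.sum_add_distrib,
      Finset.sum_eq_zero, add_zero, Tot.map_lam_smul]
    intro i _
    rw [kosUnitLin_lin, sym_smul_felem, op_mul, mul_smul, ← mul_smul (op (yv ρ i)), ← op_mul,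
      Lam.comm, op_mul, mul_smul, add_self_of_charTwo F]

lemma kosUnitLin_mem {n : ℤ} {c : Tot C} (hc : c ∈ Tot.deg C n) :
    kosUnitLin C c ∈ Kos.deg _ n := fun μ => by
  rw [kosUnitLin_lin]
  exact felem_mem (add_zero n) (Tot.smul_mem _ hc) (one_mem_symDeg ρ)

/-- The retraction `φ ↦ φ(1)_0` of `kosUnitLin`. -/
def kosConst : Kos (finEpsObj C) →+ Tot C :=
  finConst.comp (AddMonoidHom.mk' (fun φ => φ.lin 1) fun _ _ => rfl)

lemma kosConst_apply (φ : Kos (finEpsObj C)) : kosConst φ = finConst (φ.lin 1) := rfl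

lemma kosConst_unit (c : Tot C) : kosConst (kosUnitLin C c) = c := by
  rw [kosConst_apply, kosUnitLin_lin, finConst_felem_one, op_one, one_smul]

lemma kosConst_d (φ : Kos (finEpsObj C)) : kosConst (Kos.d _ φ) = Tot.d C (kosConst φ) := by
  have h : ∀ z : FinEps C, finConst ((finEpsObj C).d z) = Tot.d C (finConst z) := by
    intro z
    rw [finEps_d, map_add, map_sum, finConst_finLeft, Finset.sum_eq_zero, add_zero]
    · rfl
    · intro i _
      rw [finConst_finLeft, finConst_xv_smul, map_zero]
  rw [kosConst_apply, Kos.d_lin, map_add, map_sum, h, Finset.sum_eq_zero, add_zero, kosConst_apply]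
  exact fun i _ => finConst_xv_smul i _

lemma kosConst_p (i : Idx F V) (φ : Kos (finEpsObj C)) :
    kosConst ((kosFinKoszul C).p i φ) = kosConst φ := by
  rw [KoszulData.p_eq _ kosFinKoszul_q_X, kosConst_apply]
  have h : ∀ φ, finConst (((kosFinKoszul C).Y i ((kosFinKoszul C).pd i φ)).lin 1) = kosConst φ := by
    intro φ
    change finConst (finLeft (Tot.lamMul C (yv ρ i)) (φ.lin (Lam.pd ρ i 1)) +
      φ.lin (Lam.pd ρ i (yv ρ i * 1))) = _
    rw [Lam.pd_one, map_zero, map_zero, zero_add, Lam.pd_yv_mul, if_pos rfl, Lam.pd_one, mul_zero,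
      add_zero, kosConst_apply]
  rw [h, map_add]
  have : ∀ φ, kosConst ((kosFinKoszul C).X i φ) = 0 := fun φ => by
    change finConst (finRight C _ (φ.lin 1)) = 0
    rw [finRight_mulLeft, finConst_xv_smul]
  rw [this, add_zero]

lemma kosFinKoszul_proj (φ : Kos (finEpsObj C)) :
    (kosFinKoszul C).proj φ = kosUnitLin C (kosConst φ) := by
  have h1 : kosConst ((kosFinKoszul C).proj φ) = kosConst φ :=
    (kosFinKoszul C).proj_induction (S := fun z => kosConst z = kosConst φ)
      (fun i z hz => by rw [kosConst_p, hz]) rfl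
  rw [← h1]
  generalize hψ : (kosFinKoszul C).proj φ = ψ
  refine Kos.ext fun μ => ?_
  rw [kosUnitLin_lin]
  induction μ using Lam.induction_yv with
  | add a b ha hb => rw [map_add, ha, hb, MulOpposite.op_add, add_smul, felem_add_left]
  | smul r a ha =>
    rw [map_smul, ha, field_smul_felem, Tot.field_smul_def, ← mul_smul, ← op_mul,
      Algebra.smul_def, Algebra.commutes]
  | one r =>
    have : ψ.lin 1 = felem (kosConst ψ) 1 := eq_felem_of_lower fun i => by
      have := (kosFinKoszul C).q_proj kosFinKoszul_q_X i φ
      rw [hψ] at this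
      exact congrArg (fun φ : Kos _ => φ.lin 1) this
    rw [Algebra.algebraMap_eq_smul_one, map_smul, this, field_smul_felem,
      ← Algebra.algebraMap_eq_smul_one]
    rfl
  | yv_mul i a ha =>
    have := (kosFinKoszul C).Y_proj kosFinKoszul_q_X i φ
    rw [hψ] at this
    have h2 : finLeft (Tot.lamMul C (yv ρ i)) (ψ.lin a) + ψ.lin (yv ρ i * a) = 0 :=
      congrArg (fun φ : Kos _ => φ.lin a) this
    rw [← neg_eq_of_charTwo (F := F) (ψ.lin (yv ρ i * a)), ← eq_neg_of_add_eq_zero_left h2, ha,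
      finMap_felem, Tot.lamMul_apply, ← mul_smul, ← op_mul, Lam.comm]
    rfl

lemma quasiIsoDiff_kosUnitLin : QuasiIsoDiff (Tot.d C).toAddMonoidHom
    (Kos.d (finEpsObj C)).toAddMonoidHom (kosUnitLin C).toAddMonoidHom := by
  refine QuasiIsoDiff.section (f := kosConst) (quasiIsoDiff_of_section Kos.d_d
    (kosUnitLin C).toAddMonoidHom kosConst_d kosConst_unit ?_) kosConst_d kosConst_unit kosUnitLin_d
  have : (kosUnitLin C).toAddMonoidHom.comp kosConst = (kosFinKoszul C).proj :=
    AddMonoidHom.ext fun φ => (kosFinKoszul_proj φ).symm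
  rw [this]
  exact (kosFinKoszul C).homotopicToId_proj _ _ Kos.d_d kosFin_d (fun i φ => rfl)
    (fun i φ => Kos.ext fun μ => (finLeft_finRight _ _ _).symm)

variable (C) in
/-- The morphism `C ⟶ Kos (Hom_Λ(ε, C)_fin)`, `c ↦ (μ ↦ c μ ⊗ 1)`. -/
def kosUnit : C ⟶ kosObj (finEpsObj C) where
  f n := ModuleCat.ofHom ((kosUnitLin C ∘ₗ Tot.incl C n).codRestrict (Kos.deg _ n)
    fun c => kosUnitLin_mem ⟨c, rfl⟩)
  comm' i j h := by
    have h : i + 1 = j := h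
    refine ModuleCat.hom_ext (LinearMap.ext fun c => Subtype.ext ?_)
    refine (gradedComplex_d_apply (Kos.deg (finEpsObj C)) (Kos.d _) (fun _ _ => Kos.d_mem) Kos.d_d
      h _).trans ?_
    refine (kosUnitLin_d (Tot.incl C i c)).symm.trans ?_
    exact congrArg (kosUnitLin C) (Tot.d_incl' h c)

lemma sum_kosUnit (t : Tot C) : Kos.sum _ (Tot.map (kosUnit C) t) = kosUnitLin C t := by
  induction t using Tot.induction with
  | zero => simp only [map_zero]
  | add x y hx hy => simp only [map_add, hx, hy]
  | hom n c =>
    rw [Tot.map_incl]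
    exact Kos.sum_inclDeg _ n _

variable (C) in
theorem quasiIso_kosUnit : QuasiIso (kosUnit C) := by
  rw [quasiIso_iff_tot]
  exact QuasiIsoDiff.of_comm_bijective (AddMonoidHom.id _) (Kos.sum _).toAddMonoidHom
    (fun _ => rfl) (Kos.sum_d _) Function.bijective_id (Kos.sum_bijective _) sum_kosUnit
    quasiIsoDiff_kosUnitLin

end

end BGG

/-! ## The quasi-isomorphism `Hom_Λ(ε, Kos M)_fin ⟶ M` -/

/-- The inverse of `1 + N` for a locally nilpotent `N`, in characteristic two. -/
lemma exists_inverse_of_locallyNilpotent {A : Type*} [AddCommGroup A] (h2 : ∀ a : A, a + a = 0)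
    (N : A →+ A) (h : ∀ z, ∃ n : ℕ, N^[n] z = 0) :
    ∃ V : A →+ A, (∀ z, V (z + N z) = z) ∧ ∀ z, V z + N (V z) = z := by
  have h2' : ∀ a : A, -a = a := fun a => neg_eq_of_add_eq_zero_left (h2 a)
  have hb : Function.Bijective (AddMonoidHom.id A + N) := by
    constructor
    · rw [injective_iff_map_eq_zero]
      intro z hz
      have hN : N z = z := by rw [← h2' (N z)]; exact (eq_neg_of_add_eq_zero_left hz).symm
      obtain ⟨n, hn⟩ := h z
      rwa [Function.iterate_fixed hN] at hn
    · intro z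
      obtain ⟨n, hn⟩ := h z
      induction n generalizing z with
      | zero => exact ⟨0, by rw [map_zero]; exact hn.symm⟩
      | succ n ih =>
        obtain ⟨y, hy⟩ := ih (N z) hn
        refine ⟨z + y, ?_⟩
        have hy : y + N y = N z := hy
        change z + y + N (z + y) = z
        rw [map_add, ← hy, add_add_add_comm, add_assoc]
        linear_combination (norm := abel) h2 y + h2 (N y)
  let e : A ≃+ A := AddEquiv.ofBijective _ hb
  exact ⟨e.symm.toAddMonoidHom, e.symm_apply_apply, e.apply_symm_apply⟩

namespace DGModule

lemma quasiIso_iff_diff {R : Type u} [Ring R] {𝒜 : ℤ → AddSubgroup R} {M N : DGModule R 𝒜}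
    (f : M ⟶ N) : quasiIso R 𝒜 f ↔
      QuasiIsoDiff M.d.toAddMonoidHom N.d.toAddMonoidHom f.toLin.toAddMonoidHom := quasiIso_iff f

end DGModule

namespace BGG

variable {ρ : Representation F Q V}

variable [Module.Finite F V] [CharP F 2]

variable {C D : LamComplex ρ}

/-- Homogeneous elements of `Hom_Λ(ε, C)_fin` are sums of homogeneous `x ⊗ x^a`. -/
lemma map_mem_of_felem {P : Type*} [AddCommGroup P] (g : FinEps C →+ P) (S : AddSubgroup P) {n : ℤ}
    (h : ∀ (a : Mon F V), ∀ x ∈ Tot.deg C (n - a.degree), g (felem x (xmon ρ a)) ∈ S)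
    {f : FinEps C} (hf : f ∈ (finEpsObj C).deg n) : g f ∈ S := by
  obtain ⟨c, rfl⟩ := (finCoord C).symm.surjective f
  have hc : ∀ a, c a ∈ Tot.deg C (n - a.degree) := fun a => by
    have : c a = ((finCoord C).symm c).1.lin (gam ρ a) := by
      rw [← finCoord_apply, AddEquiv.apply_symm_apply]
    rw [this]
    have := hf.1 _ _ (gam_mem_deg ρ a)
    rwa [show -(a.degree : ℤ) + n = n - a.degree by ring] at this
  have : (finCoord C).symm c = ∑ a ∈ c.support, felem (c a) (xmon ρ a) := by
    rw [AddEquiv.symm_apply_eq, map_sum]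
    simp only [← finCoord_symm_single, AddEquiv.apply_symm_apply]
    exact c.sum_single.symm
  rw [this, map_sum]
  exact sum_mem fun a _ => h a _ (hc a)

section koszul

variable (M : DGSymQ ρ)

/-- The value at `1` of an element of the Koszul complex. -/
def kosOne : Tot (kosObj M) →+ M.carrier :=
  (AddMonoidHom.mk' (fun φ : Kos M => φ.lin 1) fun _ _ => rfl).comp (Kos.sum M).toAddMonoidHom

lemma kosOne_apply (t : Tot (kosObj M)) : kosOne M t = (Kos.sum M t).lin 1 := rfl

lemma Kos.sum_field_smul (r : F) (t : Tot (kosObj M)) (μ : Lam ρ) :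
    (Kos.sum M (r • t)).lin μ = r • (Kos.sum M t).lin μ := by
  rw [Tot.field_smul_def, Tot.lam_smul_def, map_smul]
  refine (Kos.smul_lin _ 1 _ μ).trans ?_
  rw [actR_one, Lam.act_one, ← map_smul]
  exact congrArg _ (Algebra.smul_def r μ).symm

lemma Kos.sum_op_smul (a : Lam ρ) (t : Tot (kosObj M)) (μ : Lam ρ) :
    (Kos.sum M (op a • t)).lin μ = (Kos.sum M t).lin (a * μ) := by
  rw [Tot.lam_smul_def, map_smul]
  refine (Kos.smul_lin _ 1 _ μ).trans ?_
  rw [actR_one, Lam.act_one]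
  rfl

lemma kosOne_act (q : Q) (t : Tot (kosObj M)) : kosOne M (Tot.act q t) = actR M q (kosOne M t) := by
  rw [kosOne_apply, Tot.act_apply, map_smul]
  refine (Kos.smul_lin _ q _ 1).trans ?_
  rw [one_mul, map_one]
  rfl

lemma kosOne_mem {n : ℤ} {t : Tot (kosObj M)} (ht : t ∈ Tot.deg _ n) : kosOne M t ∈ M.deg n := by
  obtain ⟨φ, rfl⟩ := ht
  rw [kosOne_apply]
  exact (congrArg (fun φ : Kos M => φ.lin 1) (Kos.sum_inclDeg M n φ)) ▸ φ.2 1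

/-- The map `t ↦ s ↦ s · t(1)`. -/
def smulKosOne : Tot (kosObj M) →+ Sym ρ →+ M.carrier :=
  AddMonoidHom.mk' (fun t => AddMonoidHom.mk' (fun s => s • kosOne M t) fun s s' => add_smul _ _ _)
    fun t t' => AddMonoidHom.ext fun s => by
      change s • kosOne M (t + t') = s • kosOne M t + s • kosOne M t'
      rw [map_add, smul_add]

/-- The map `t ⊗ s ↦ s · t(1)`. -/
def resAdd : FinEps (kosObj M) →+ M.carrier := finLift (smulKosOne M)

lemma resAdd_felem (t : Tot (kosObj M)) (s : Sym ρ) : resAdd M (felem t s) = s • kosOne M t := by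
  refine finLift_felem _ (fun r t s => ?_) t s
  change s • kosOne M (r • t) = (r • s) • kosOne M t
  rw [kosOne_apply, Kos.sum_field_smul, smul_assoc, field_smul_def, field_smul_def, smul_comm]
  rfl

/-- The map `t ⊗ s ↦ s · t(1)`, as a linear map. -/
def resLin : FinEps (kosObj M) →ₗ[(SymQ ρ)ᵐᵒᵖ] M.carrier :=
  linearMapOfSingle (resAdd M) fun s q f => by
    refine finEps_ext (f := (resAdd M).comp (DistribSMul.toAddMonoidHom _ (op (single q s))))
      (g := (DistribSMul.toAddMonoidHom _ (op (single q s))).comp (resAdd M)) (fun t s' => ?_) f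
    change resAdd M (op (single q s) • felem t s') = op (single q s) • resAdd M (felem t s')
    rw [smul_felem, resAdd_felem, resAdd_felem, kosOne_act, op_single_eq, mul_smul,
      ← sym_smul_def, smul_smul, ← actR_apply, actR_smul]
    rfl

lemma resLin_felem (t : Tot (kosObj M)) (s : Sym ρ) : resLin M (felem t s) = s • kosOne M t :=
  resAdd_felem M t s

lemma resLin_d (z : FinEps (kosObj M)) :
    resLin M ((finEpsObj (kosObj M)).d z) = M.d (resLin M z) := by
  refine finEps_ext (f := (resLin M).toAddMonoidHom.comp (finEpsObj (kosObj M)).d.toAddMonoidHom)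
    (g := M.d.toAddMonoidHom.comp (resLin M).toAddMonoidHom) (fun t s => ?_) z
  change resLin M ((finEpsObj (kosObj M)).d (felem t s)) = M.d (resLin M (felem t s))
  rw [d_felem, map_add, map_sum]
  simp only [resLin_felem, d_sym_smul, kosOne_apply]
  rw [Kos.sum_d, Kos.d_lin, smul_add, Finset.smul_sum, add_assoc, ← Finset.sum_add_distrib,
    Finset.sum_eq_zero, add_zero]
  intro i _
  rw [Kos.sum_op_smul, smul_smul, mul_comm, add_self_of_charTwo F]

/-- The resolution `Hom_Λ(ε, Kos M)_fin ⟶ M`. -/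
def resHom : finEpsObj (kosObj M) ⟶ M where
  toLin := resLin M
  map_mem {n f} hf := by
    refine map_mem_of_felem (resLin M).toAddMonoidHom (M.deg n) (fun a t ht => ?_) hf
    change resLin M _ ∈ _
    rw [resLin_felem]
    have := sym_smul_mem M (xmon_mem_symDeg ρ a) (kosOne_mem M ht)
    rwa [sub_add_cancel] at this
  comm := resLin_d M

/-! ### The homotopy -/

/-- The Koszul complex is isomorphic to the direct sum of its terms. -/
def kosEquiv : Tot (kosObj M) ≃+ Kos M :=
  AddEquiv.ofBijective (Kos.sum M).toAddMonoidHom (Kos.sum_bijective M)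

lemma kosEquiv_apply (t : Tot (kosObj M)) : kosEquiv M t = Kos.sum M t := rfl

/-- An endomorphism of the direct sum of the terms from one of `Hom_F(Λ, M)`. -/
def kosConj (φ : M.carrier →ₗ[F] M.carrier) (a : Lam ρ →ₗ[F] Lam ρ) :
    Tot (kosObj M) →ₗ[F] Tot (kosObj M) where
  toFun t := (kosEquiv M).symm (Kos.post φ (Kos.pre M a (kosEquiv M t)))
  map_add' t t' := by simp only [map_add]
  map_smul' r t := (kosEquiv M).injective <| Kos.ext fun μ => by
    rw [AddEquiv.apply_symm_apply, RingHom.id_apply]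
    refine Eq.trans ?_ (Kos.sum_field_smul M r _ μ).symm
    rw [← kosEquiv_apply M ((kosEquiv M).symm _), AddEquiv.apply_symm_apply, Kos.post_lin,
      Kos.pre_lin, Kos.post_lin, Kos.pre_lin, kosEquiv_apply, kosEquiv_apply,
      Kos.sum_field_smul, map_smul]

lemma kosConj_lin (φ : M.carrier →ₗ[F] M.carrier) (a : Lam ρ →ₗ[F] Lam ρ) (t : Tot (kosObj M))
    (μ : Lam ρ) : (Kos.sum M (kosConj M φ a t)).lin μ = φ ((Kos.sum M t).lin (a μ)) := by
  change (kosEquiv M ((kosEquiv M).symm _)).lin μ = _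
  rw [AddEquiv.apply_symm_apply]
  rfl

variable {M}

lemma kosTot_ext {t t' : Tot (kosObj M)} (h : ∀ μ, (Kos.sum M t).lin μ = (Kos.sum M t').lin μ) :
    t = t' := (Kos.sum_bijective M).1 (Kos.ext h)

lemma kosConj_comm {φ φ' : M.carrier →ₗ[F] M.carrier} {a a' : Lam ρ →ₗ[F] Lam ρ}
    (h : ∀ m, φ (φ' m) = φ' (φ m)) (h' : ∀ μ, a (a' μ) = a' (a μ)) (t : Tot (kosObj M)) :
    kosConj M φ a (kosConj M φ' a' t) = kosConj M φ' a' (kosConj M φ a t) :=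
  kosTot_ext fun μ => by simp only [kosConj_lin, h, h']

variable (M)

/-- The contraction on the Koszul complex. -/
def kosPd (i : Idx F V) : Tot (kosObj M) →ₗ[F] Tot (kosObj M) := kosConj M LinearMap.id (Lam.pd ρ i)

/-- The exterior multiplication on the Koszul complex. -/
def kosY (i : Idx F V) : Tot (kosObj M) →ₗ[F] Tot (kosObj M) :=
  kosConj M LinearMap.id (LinearMap.mulLeft F (yv ρ i))

/-- The multiplication with `x_i` on the Koszul complex. -/
def kosX (i : Idx F V) : Tot (kosObj M) →ₗ[F] Tot (kosObj M) :=
  kosConj M (symMul M (xv ρ i)) LinearMap.id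

lemma kosY_eq (i : Idx F V) : kosY M i = Tot.lamMul (kosObj M) (yv ρ i) :=
  LinearMap.ext fun t => kosTot_ext fun μ => by
    rw [kosY, kosConj_lin, Tot.lamMul_apply, Kos.sum_op_smul]
    rfl

/-- The differential of `M` on the Koszul complex. -/
def kosInner : Tot (kosObj M) →ₗ[F] Tot (kosObj M) := kosConj M (linField M.d) LinearMap.id

lemma kosTot_d (t : Tot (kosObj M)) :
    Tot.d _ t = kosInner M t + ∑ i, kosX M i (kosY M i t) := kosTot_ext fun μ => by
  rw [Kos.sum_d, Kos.d_lin, map_add, map_sum, Kos.add_lin, Kos.sum_lin, kosInner, kosConj_lin]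
  refine congrArg₂ _ rfl (Finset.sum_congr rfl fun i _ => ?_)
  rw [kosX, kosConj_lin, kosY, kosConj_lin]
  rfl

/-- The operator `x_i ⊗ q_i`. -/
def resNil (i : Idx F V) :
    (FinEps (kosObj M)) →ₗ[F] FinEps (kosObj M) := finMap (kosX M i) (symLower ρ i)

lemma resNil_nilpotent (i : Idx F V) (z : FinEps (kosObj M)) :
    ∃ n : ℕ, (resNil M i).toAddMonoidHom^[n] z = 0 := by
  have hz : ∀ n, (resNil M i).toAddMonoidHom^[n] 0 = 0 := fun n =>
    Function.iterate_fixed (map_zero _) n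
  induction z using finEps_induction with
  | add z w hz' hw =>
    obtain ⟨n, hn⟩ := hz'
    obtain ⟨m, hm⟩ := hw
    refine ⟨n + m, ?_⟩
    rw [iterate_map_add, Function.iterate_add_apply _ n m w, hm, add_comm n m,
      Function.iterate_add_apply, hn, hz, hz, add_zero]
  | elem x a =>
    obtain ⟨n, hn⟩ : ∃ n, a i = n := ⟨_, rfl⟩
    induction n generalizing x a with
    | zero =>
      refine ⟨1, ?_⟩
      change resNil M i (felem x (xmon ρ a)) = 0
      have : symLower ρ i (xmon ρ a) = 0 := Sym.ext_scoeff fun b => by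
        rw [scoeff_symLower, scoeff_xmon, if_neg, map_zero]
        rintro rfl
        simp at hn
      rw [resNil, finMap_felem, this]
      exact map_zero (felemHom _)
    | succ n ih =>
      have h1 : a = a - Finsupp.single i 1 + Finsupp.single i 1 := by
        rw [tsub_add_cancel_of_le]
        rw [Finsupp.single_le_iff]
        lia
      obtain ⟨k, hk⟩ := ih (kosX M i x) (a - Finsupp.single i 1) (by simp [hn])
      refine ⟨k + 1, ?_⟩
      rw [Function.iterate_succ_apply]
      have : (resNil M i).toAddMonoidHom (felem x (xmon ρ a)) =
          felem (kosX M i x) (xmon ρ (a - Finsupp.single i 1)) := by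
        conv_lhs => rw [h1, ← xv_mul_xmon]
        refine (finMap_felem _ _ _ _).trans ?_
        rw [symLower_xv_mul]
      rw [this, hk]

/-- The inverse of `1 + x_i ⊗ q_i`. -/
def resInv (i : Idx F V) : (FinEps (kosObj M)) →+ FinEps (kosObj M) :=
  (exists_inverse_of_locallyNilpotent (add_self_of_charTwo F) _ (resNil_nilpotent M i)).choose

lemma resInv_left (i : Idx F V) (z : FinEps (kosObj M)) : resInv M i (z + resNil M i z) = z :=
  (exists_inverse_of_locallyNilpotent (add_self_of_charTwo F) _
    (resNil_nilpotent M i)).choose_spec.1 z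

lemma resInv_right (i : Idx F V) (z : FinEps (kosObj M)) :
    resInv M i z + resNil M i (resInv M i z) = z :=
  (exists_inverse_of_locallyNilpotent (add_self_of_charTwo F) _
    (resNil_nilpotent M i)).choose_spec.2 z

variable {M}

lemma resInv_comm (i : Idx F V) {W : FinEps (kosObj M) →+ FinEps (kosObj M)}
    (hW : ∀ z, resNil M i (W z) = W (resNil M i z)) (z : FinEps (kosObj M)) :
    resInv M i (W z) = W (resInv M i z) := by
  conv_lhs => rw [← resInv_right M i z, map_add, ← hW]
  exact resInv_left M i _

variable (M) in
/-- The operator `X_i + x_i`. -/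
def resX (i : Idx F V) : (FinEps (kosObj M)) →+ FinEps (kosObj M) :=
  (finRight _ (LinearMap.mulLeft F (xv ρ i))).toAddMonoidHom + (finLeft (kosX M i)).toAddMonoidHom

variable (M) in
/-- The left inverse of `X_i + x_i`. -/
def resQ (i : Idx F V) : (FinEps (kosObj M)) →+ FinEps (kosObj M) :=
  (resInv M i).comp (finRight _ (symLower ρ i)).toAddMonoidHom

lemma resX_apply (i : Idx F V) (z : FinEps (kosObj M)) :
    resX M i z = finRight _ (LinearMap.mulLeft F (xv ρ i)) z + finLeft (kosX M i) z := rfl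

lemma resX_felem (i : Idx F V) (t : Tot (kosObj M)) (s : Sym ρ) :
    resX M i (felem t s) = felem t (xv ρ i * s) + felem (kosX M i t) s := by
  rw [resX_apply, finMap_felem, finMap_felem]
  rfl

lemma resQ_apply (i : Idx F V) (z : FinEps (kosObj M)) :
    resQ M i z = resInv M i (finRight _ (symLower ρ i) z) := rfl

lemma resQ_resX (i : Idx F V) (z : FinEps (kosObj M)) : resQ M i (resX M i z) = z := by
  have h : ∀ z, finRight _ (symLower ρ i) (resX M i z) = z + resNil M i z := fun z => by
    refine finEps_ext (f := (finRight (kosObj M) (symLower ρ i)).toAddMonoidHom.comp (resX M i))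
      (g := AddMonoidHom.id (FinEps (kosObj M)) + (resNil M i).toAddMonoidHom)
      (fun t s => ?_) z
    · change finRight _ (symLower ρ i) (resX M i (felem t s)) = felem t s + resNil M i (felem t s)
      rw [resX_felem, map_add, finMap_felem, finMap_felem, symLower_xv_mul, resNil, finMap_felem]
      rfl
  rw [resQ_apply, h, resInv_left]

lemma kosX_comm (i j : Idx F V) (t : Tot (kosObj M)) :
    kosX M i (kosX M j t) = kosX M j (kosX M i t) :=
  kosConj_comm (fun m => smul_comm (xv ρ i) (xv ρ j) m) (fun _ => rfl) t

lemma kosX_kosConj (i : Idx F V) (φ : M.carrier →ₗ[F] M.carrier)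
    (hφ : ∀ m, φ (xv ρ i • m) = xv ρ i • φ m) (a : Lam ρ →ₗ[F] Lam ρ) (t : Tot (kosObj M)) :
    kosX M i (kosConj M φ a t) = kosConj M φ a (kosX M i t) :=
  kosConj_comm (φ := symMul M (xv ρ i)) (φ' := φ) (a := LinearMap.id) (a' := a)
    (fun m => (hφ m).symm) (fun _ => rfl) t

lemma resNil_finLeft (i : Idx F V) (φ : Tot (kosObj M) →ₗ[F] Tot (kosObj M))
    (h : ∀ t, kosX M i (φ t) = φ (kosX M i t)) (z : FinEps (kosObj M)) :
    resNil M i (finLeft φ z) = finLeft φ (resNil M i z) :=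
  finMap_comm (φ := kosX M i) (φ' := φ) (ψ := symLower ρ i) (ψ' := LinearMap.id) h (fun _ => rfl) z

lemma resQ_finLeft (i : Idx F V) (φ : Tot (kosObj M) →ₗ[F] Tot (kosObj M))
    (h : ∀ t, kosX M i (φ t) = φ (kosX M i t)) (z : FinEps (kosObj M)) :
    resQ M i (finLeft φ z) = finLeft φ (resQ M i z) := by
  rw [resQ_apply, finLeft_finRight]
  exact resInv_comm i (W := (finLeft φ).toAddMonoidHom) (resNil_finLeft i φ h) _

lemma resX_finLeft (i : Idx F V) (φ : Tot (kosObj M) →ₗ[F] Tot (kosObj M))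
    (h : ∀ t, kosX M i (φ t) = φ (kosX M i t)) (z : FinEps (kosObj M)) :
    resX M i (finLeft φ z) = finLeft φ (resX M i z) := by
  rw [resX_apply, resX_apply, map_add, finLeft_finRight, finLeft_comm h]

lemma resNil_finRight (i : Idx F V) (ψ : Sym ρ →ₗ[F] Sym ρ)
    (h : ∀ s, symLower ρ i (ψ s) = ψ (symLower ρ i s)) (z : FinEps (kosObj M)) :
    resNil M i (finRight _ ψ z) = finRight _ ψ (resNil M i z) :=
  finMap_comm (φ := kosX M i) (φ' := LinearMap.id) (ψ := symLower ρ i) (ψ' := ψ) (fun _ => rfl) h z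

lemma resQ_comm (i j : Idx F V) (z : FinEps (kosObj M)) :
    resQ M i (resQ M j z) = resQ M j (resQ M i z) := by
  have h1 : ∀ i j z, finRight _ (symLower ρ i) (resInv M j z) =
      resInv M j (finRight _ (symLower ρ i) z) := fun i j z =>
    (resInv_comm j (W := (finRight (kosObj M) (symLower ρ i)).toAddMonoidHom)
      (resNil_finRight j _ (symLower_comm j i)) z).symm
  have h2 : resInv M i (resInv M j (finRight _ (symLower ρ i) (finRight _ (symLower ρ j) z))) =
      resInv M j (resInv M i (finRight _ (symLower ρ i) (finRight _ (symLower ρ j) z))) :=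
    resInv_comm i (W := resInv M j) (fun z =>
      (resInv_comm j (W := (resNil M i).toAddMonoidHom) (finMap_comm (kosX_comm j i) (symLower_comm j i)) z).symm) _
  rw [resQ_apply, resQ_apply, resQ_apply, resQ_apply, h1, h1, h2, finRight_comm (symLower_comm i j)]

lemma resX_resQ (i j : Idx F V) (h : i ≠ j) (z : FinEps (kosObj M)) :
    resX M i (resQ M j z) = resQ M j (resX M i z) := by
  have hs : ∀ s, symLower ρ j (LinearMap.mulLeft F (xv ρ i) s) =
      LinearMap.mulLeft F (xv ρ i) (symLower ρ j s) := fun s => symLower_xv_mul_of_ne (Ne.symm h) s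
  have h1 : ∀ z, resNil M j (resX M i z) = resX M i (resNil M j z) := fun z => by
    rw [resX_apply, resX_apply, map_add, resNil_finRight j _ hs, resNil_finLeft j _ (kosX_comm j i)]
  have h2 : ∀ z, finRight _ (symLower ρ j) (resX M i z) = resX M i (finRight _ (symLower ρ j) z) :=
    fun z => by
      rw [resX_apply, resX_apply, map_add, finRight_comm hs, finLeft_finRight]
  rw [resQ_apply, resQ_apply, h2, resInv_comm j h1]

variable (M) in
/-- The Koszul operators on the resolution. -/
def resKoszul : KoszulData (FinEps (kosObj M)) (Idx F V) where
  Y i := (finLeft (kosY M i)).toAddMonoidHom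
  X i := resX M i
  pd i := (finLeft (kosPd M i)).toAddMonoidHom
  q i := resQ M i
  two := add_self_of_charTwo F
  Y_Y i j z := finLeft_comm (kosConj_comm (fun _ => rfl) fun μ => by
    simp only [LinearMap.mulLeft_apply]
    rw [← mul_assoc, ← mul_assoc, Lam.comm ρ (yv ρ i)]) z
  Y_self i z := by
    have : ∀ t, kosY M i (kosY M i t) = 0 := fun t => kosTot_ext fun μ => by
      simp only [kosY, kosConj_lin, LinearMap.mulLeft_apply, LinearMap.id_apply]
      rw [yv_mul_yv_mul, map_zero, map_zero]
      rfl
    refine finEps_ext (f := (finLeft (kosY M i)).toAddMonoidHom.comp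
      (finLeft (kosY M i)).toAddMonoidHom) (g := 0) (fun x s => ?_) z
    change finLeft _ (finLeft _ (felem x s)) = 0
    rw [finMap_felem, finMap_felem, this]
    exact map_zero (felemHom.flip s)
  Y_pd i j z := by
    have : ∀ t, kosY M j (kosPd M i t) + kosPd M i (kosY M j t) = if i = j then t else 0 := by
      refine fun t => kosTot_ext fun μ => ?_
      rw [map_add, Kos.add_lin]
      simp only [kosY, kosPd, kosConj_lin, LinearMap.mulLeft_apply, LinearMap.id_apply]
      rw [← map_add, add_comm, Lam.pd_yv_add]
      split_ifs
      · rfl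
      · rw [map_zero, map_zero]
        rfl
    refine (finEps_ext (f := (finLeft (kosY M j)).toAddMonoidHom.comp
      (finLeft (kosPd M i)).toAddMonoidHom + (finLeft (kosPd M i)).toAddMonoidHom.comp
      (finLeft (kosY M j)).toAddMonoidHom) (g := if i = j then AddMonoidHom.id _ else 0)
      (fun x s => ?_) z).trans (by split_ifs <;> rfl)
    change finLeft _ (finLeft _ (felem x s)) + finLeft _ (finLeft _ (felem x s)) = _
    rw [finMap_felem, finMap_felem, finMap_felem, finMap_felem]
    refine (felem_add_left _ _ _).symm.trans ?_
    rw [this]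
    split_ifs
    · rfl
    · exact map_zero (felemHom.flip s)
  X_Y i j z := resX_finLeft i _ (kosX_kosConj i _ (fun _ => rfl) _) z
  X_X i j z := by
    rw [resX_apply, resX_apply, resX_apply, resX_apply, map_add, map_add, map_add, map_add,
      finRight_comm (fun s => mul_left_comm (xv ρ i) (xv ρ j) s), finLeft_comm (kosX_comm i j),
      finLeft_finRight (kosX M j), ← finLeft_finRight (kosX M i)]
    abel
  X_pd i j z := resX_finLeft i _ (kosX_kosConj i _ (fun _ => rfl) _) z
  q_Y i j z := resQ_finLeft i _ (kosX_kosConj i _ (fun _ => rfl) _) z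
  q_pd i j z := resQ_finLeft i _ (kosX_kosConj i _ (fun _ => rfl) _) z
  q_q i j z := resQ_comm i j z
  X_q i j z h := resX_resQ i j h z

lemma resKoszul_d (z : FinEps (kosObj M)) : (finEpsObj (kosObj M)).d z =
    finLeft (kosInner M) z + ∑ i, (resKoszul M).Y i ((resKoszul M).X i z) := by
  have h : ∀ (g : Idx F V → FinEps (kosObj M) →+
      (FinEps (kosObj M))) z, (∑ i, g i) z = ∑ i, g i z := fun g z => by
    rw [AddMonoidHom.finsetSum_apply]
  refine (finEps_ext (f := (finEpsObj (kosObj M)).d.toAddMonoidHom)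
    (g := (finLeft (kosInner M)).toAddMonoidHom +
      ∑ i, ((resKoszul M).Y i).comp ((resKoszul M).X i)) (fun t s => ?_) z).trans
    (congrArg (finLeft (kosInner M) z + ·) (h _ z))
  refine (d_felem t s).trans ?_
  rw [AddMonoidHom.add_apply, h]
  change _ = finLeft (kosInner M) (felem t s) + ∑ i, finLeft (kosY M i) (resX M i (felem t s))
  have hs : ∀ g : Idx F V → Tot (kosObj M), felem (∑ i, g i) s =
      ∑ i, felem (g i) s := fun g => map_sum (felemHom.flip s) _ _
  rw [kosTot_d, felem_add_left, hs, finMap_felem, add_assoc, ← Finset.sum_add_distrib]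
  refine congrArg₂ _ rfl (Finset.sum_congr rfl fun i _ => ?_)
  rw [resX_felem, map_add, finMap_felem, finMap_felem, add_comm, kosY_eq]
  have : Tot.lamMul (kosObj M) (yv ρ i) (kosX M i t) =
      kosX M i (Tot.lamMul (kosObj M) (yv ρ i) t) := by
    rw [← kosY_eq]
    exact (kosX_kosConj i LinearMap.id (fun _ => rfl) _ t).symm
  rw [this]
  rfl

variable (M) in
/-- The section `m ↦ (μ ↦ m · aug μ) ⊗ 1` of the resolution. -/
def resSection : M.carrier →+ FinEps (kosObj M) :=
  (felemHom.flip 1).comp ((kosEquiv M).symm.toAddMonoidHom.comp (AddMonoidHom.mk'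
    (fun m => (LinearMap.toSpanSingleton F _ m ∘ₗ (Lam.aug ρ).toLinearMap : Lam ρ →ₗ[F] M.carrier))
    fun m m' => LinearMap.ext fun μ => smul_add (Lam.aug ρ μ) m m'))

lemma resSection_apply (m : M.carrier) : ∃ t : Tot (kosObj M), resSection M m = felem t 1 ∧
    ∀ μ, (Kos.sum M t).lin μ = Lam.aug ρ μ • m := by
  refine ⟨(kosEquiv M).symm _, rfl, fun μ => ?_⟩
  rw [← kosEquiv_apply, AddEquiv.apply_symm_apply]
  rfl

lemma resLin_resSection (m : M.carrier) : resLin M (resSection M m) = m := by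
  obtain ⟨t, h, ht⟩ := resSection_apply m
  rw [h, resLin_felem, one_smul, kosOne_apply, ht, map_one, one_smul]

lemma resLin_resX (i : Idx F V) (z : FinEps (kosObj M)) : resLin M (resX M i z) = 0 := by
  refine finEps_ext (f := (resLin M).toAddMonoidHom.comp (resX M i)) (g := 0) (fun t s => ?_) z
  change resLin M (resX M i (felem t s)) = 0
  rw [resX_felem, map_add, resLin_felem, resLin_felem, kosOne_apply, kosOne_apply, kosX,
    kosConj_lin, symMul_apply, smul_smul, mul_comm]
  exact add_self_of_charTwo F _

lemma resLin_p (i : Idx F V) (z : FinEps (kosObj M)) :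
    resLin M ((resKoszul M).p i z) = resLin M z := by
  have h : ∀ z, resLin M (finLeft (kosY M i) (finLeft (kosPd M i) z)) = resLin M z :=
    finEps_ext (f := (resLin M).toAddMonoidHom.comp ((finLeft (kosY M i)).toAddMonoidHom.comp
      (finLeft (kosPd M i)).toAddMonoidHom)) (g := (resLin M).toAddMonoidHom) fun t s => by
      change resLin M (finLeft _ (finLeft _ (felem t s))) = resLin M (felem t s)
      rw [finMap_felem, finMap_felem]
      simp only [resLin_felem, kosOne_apply, kosY, kosPd, kosConj_lin, LinearMap.id_apply,
        LinearMap.mulLeft_apply]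
      rw [Lam.pd_yv_mul, if_pos rfl, Lam.pd_one, mul_zero, add_zero]
  rw [(resKoszul M).p_eq resQ_resX]
  refine (h _).trans ?_
  rw [map_add]
  refine (congrArg (_ + ·) (resLin_resX i _)).trans (add_zero _)

lemma resKoszul_proj (z : FinEps (kosObj M)) :
    (resKoszul M).proj z = resSection M (resLin M z) := by
  have h1 : ∀ z, resLin M ((resKoszul M).proj z) = resLin M z := fun z =>
    (resKoszul M).proj_induction (S := fun w => resLin M w = resLin M z)
      (fun i w hw => by rw [resLin_p, hw]) rfl
  have h2 : ∀ t, (resKoszul M).proj (felem t 1) = resSection M (resLin M (felem t 1)) := by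
    intro t
    obtain ⟨t', ht'⟩ := (resKoszul M).proj_induction (S := fun w => ∃ t' : Tot (kosObj M),
      w = felem t' 1) (z := felem t 1) (by
        rintro i _ ⟨t, rfl⟩
        have hq : (resKoszul M).q i (felem t 1) = 0 := by
          change resQ M i (felem t 1) = 0
          rw [resQ_apply, finMap_felem, symLower_one]
          refine (congrArg (resInv M i) (map_zero (felemHom _))).trans (map_zero _)
        rw [(resKoszul M).p_eq resQ_resX, hq, map_zero, add_zero]
        refine ⟨kosY M i (kosPd M i t), ?_⟩
        change finLeft _ (finLeft _ (felem t 1)) = _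
        rw [finMap_felem, finMap_felem]
        rfl) ⟨t, rfl⟩
    rw [← h1, ht']
    have hY : ∀ i, kosY M i t' = 0 := fun i => by
      have := (resKoszul M).Y_proj resQ_resX i (felem t 1)
      rw [ht'] at this
      have h0 : finLeft (kosY M i) (felem t' 1) = 0 := this
      rw [finMap_felem] at h0
      rw [← finConst_felem_one (kosY M i t')]
      exact (congrArg finConst h0).trans (map_zero _)
    obtain ⟨t'', h, hh⟩ := resSection_apply (resLin M (felem t' 1))
    rw [h]
    congr 1
    refine kosTot_ext fun μ => ?_
    rw [hh, resLin_felem, one_smul, kosOne_apply]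
    induction μ using Lam.induction_yv with
    | add a b ha hb => rw [map_add, map_add, ha, hb, add_smul]
    | smul r a ha => rw [map_smul, map_smul, ha, smul_assoc]
    | one r =>
      rw [AlgHom.commutes, Algebra.algebraMap_eq_smul_one, map_smul]
      rfl
    | yv_mul i a ha =>
      rw [map_mul (Lam.aug ρ), show Lam.aug ρ (yv ρ i) = 0 from Lam.aug_ι ρ _, zero_mul, zero_smul]
      have := congrArg (fun t => (Kos.sum M t).lin a) (hY i)
      simp only [kosY, kosConj_lin] at this
      refine this.trans ?_
      rw [map_zero]
      rfl
  refine finEps_ext (f := (resKoszul M).proj)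
    (g := (resSection M).comp (resLin M).toAddMonoidHom) (fun t s => ?_) z
  change (resKoszul M).proj (felem t s) = resSection M (resLin M (felem t s))
  induction s using Sym.induction_xmon generalizing t with
  | add a b ha hb => rw [felem_add_right, map_add, map_add, map_add, ha, hb]
  | smul r a ha => rw [← felem_smul_left, ha]
  | mon a =>
    obtain ⟨n, hn⟩ : ∃ n, a.degree = n := ⟨_, rfl⟩
    induction n generalizing a t with
    | zero =>
      rw [Finsupp.degree_eq_zero_iff] at hn
      rw [hn, xmon_zero, h2]
    | succ n ih =>
      obtain ⟨i, hi⟩ : ∃ i, a i ≠ 0 := by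
        by_contra! hc
        rw [(Finsupp.degree_eq_zero_iff a).2 (Finsupp.ext hc)] at hn
        lia
      have ha : a - Finsupp.single i 1 + Finsupp.single i 1 = a := by
        rw [tsub_add_cancel_of_le]
        rw [Finsupp.single_le_iff]
        exact Nat.one_le_iff_ne_zero.2 hi
      have hd : (a - Finsupp.single i 1).degree = n := by
        have := congrArg Finsupp.degree ha
        rw [map_add, Finsupp.degree_single, hn] at this
        lia
      have h3 : felem t (xmon ρ a) = resX M i (felem t (xmon ρ (a - Finsupp.single i 1))) +
          felem (kosX M i t) (xmon ρ (a - Finsupp.single i 1)) := by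
        rw [resX_felem, xv_mul_xmon, ha, add_assoc, add_self_of_charTwo F, add_zero]
      rw [h3, map_add, map_add, map_add, ih _ _ hd, resLin_resX, map_zero]
      exact congrArg (· + _) ((resKoszul M).proj_X resQ_resX i _)

variable (M) in
theorem quasiIso_resHom : DGModule.quasiIso _ _ (resHom M) := by
  rw [DGModule.quasiIso_iff_diff]
  refine quasiIsoDiff_of_section (finEpsObj (kosObj M)).d_d (resSection M) (resLin_d M)
    resLin_resSection ?_
  have : (resSection M).comp (resHom M).toLin.toAddMonoidHom = (resKoszul M).proj :=
    AddMonoidHom.ext fun z => (resKoszul_proj z).symm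
  rw [this]
  exact (resKoszul M).homotopicToId_proj _ (finLeft (kosInner M)).toAddMonoidHom
    (finEpsObj (kosObj M)).d_d resKoszul_d
    (fun i => finLeft_comm (kosConj_comm (fun _ => rfl) fun _ => rfl))
    (fun i z => (resQ_finLeft i _ (kosX_kosConj i (linField M.d)
      (fun m => d_sym_smul M _ m) LinearMap.id) z).symm)

end koszul

end BGG

/-! ## Mapping cones and quasi-isomorphisms -/

section

variable {A B : Type*} [AddCommGroup A] [AddCommGroup B] {dA : A →+ A} {dB : B →+ B}

/-- The differential `(b, a) ↦ (d b + f a, - d a)` of the mapping cone. -/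
def coneDiff (dA : A →+ A) (dB : B →+ B) (f : A →+ B) : B × A →+ B × A :=
  (dB.coprod f).prod (-(dA.comp (AddMonoidHom.snd B A)))

@[simp] lemma coneDiff_apply (f : A →+ B) (x : B × A) :
    coneDiff dA dB f x = (dB x.1 + f x.2, -dA x.2) := rfl

/-- A chain map is a quasi-isomorphism if and only if its cone is exact. -/
lemma quasiIsoDiff_iff_coneDiff {f : A →+ B} (hd : ∀ x, dB (dB x) = 0)
    (hf : ∀ x, f (dA x) = dB (f x)) : QuasiIsoDiff dA dB f ↔ ExactDiff (coneDiff dA dB f) := by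
  constructor
  · rintro ⟨h1, h2⟩ ⟨b, a⟩ h
    rw [coneDiff_apply, Prod.mk_eq_zero, neg_eq_zero] at h
    obtain ⟨a', rfl⟩ := h1 a h.2 ⟨-b, by rw [map_neg, neg_eq_of_add_eq_zero_right h.1]⟩
    obtain ⟨x, hx, y, hy⟩ := h2 (f a' + b) (by rw [map_add, ← hf, add_comm]; exact h.1)
    refine ⟨(-y, x - a'), Prod.ext ?_ ?_⟩
    · change dB (-y) + f (x - a') = b
      rw [map_neg, hy, map_sub]
      abel
    · change -dA (x - a') = dA a'
      rw [map_sub, hx, zero_sub, neg_neg]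
  · intro h
    refine ⟨fun x hx ⟨y, hy⟩ => ?_, fun z hz => ?_⟩
    · obtain ⟨⟨b, a⟩, hab⟩ := h (-y, x) (by simp [hx, hy])
      exact ⟨-a, by rw [map_neg]; exact congrArg Prod.snd hab⟩
    · obtain ⟨⟨b, a⟩, hab⟩ := h (z, 0) (by simp [hz])
      have h1 : dB b + f a = z := congrArg Prod.fst hab
      have h2 : -dA a = 0 := congrArg Prod.snd hab
      exact ⟨a, neg_eq_zero.1 h2, -b, by rw [map_neg, ← h1]; abel⟩

/-- The map of mapping cones induced by a commutative square with quasi-isomorphisms on two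
opposite sides is a quasi-isomorphism. -/
lemma QuasiIsoDiff.coneDiff {A' B' : Type*} [AddCommGroup A'] [AddCommGroup B']
    {dA' : A' →+ A'} {dB' : B' →+ B'} {f : A →+ B} {f' : A' →+ B'} {u : A →+ A'} {v : B →+ B'}
    (hdA' : ∀ x, dA' (dA' x) = 0) (hdB' : ∀ x, dB' (dB' x) = 0)
    (hf' : ∀ x, f' (dA' x) = dB' (f' x)) (hf : ∀ x, f (dA x) = dB (f x))
    (hdA : ∀ x, dA (dA x) = 0)
    (hu : ∀ x, u (dA x) = dA' (u x)) (hv : ∀ x, v (dB x) = dB' (v x))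
    (h : ∀ x, v (f x) = f' (u x)) (qu : QuasiIsoDiff dA dA' u) (qv : QuasiIsoDiff dB dB' v) :
    QuasiIsoDiff (coneDiff dA dB f) (coneDiff dA' dB' f') (v.prodMap u) := by
  refine (quasiIsoDiff_iff_coneDiff ?_ ?_).2 ?_
  · intro x
    refine Prod.ext ?_ ?_
    · change dB' (dB' x.1 + f' x.2) + f' (-dA' x.2) = 0
      rw [map_add, hdB', map_neg, hf']; abel
    · change -dA' (-dA' x.2) = 0
      rw [map_neg, hdA', neg_neg]
  · intro x
    refine Prod.ext ?_ ?_
    · change v (dB x.1 + f x.2) = dB' (v x.1) + f' (u x.2)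
      rw [map_add, hv, h]
    · change u (-dA x.2) = -dA' (u x.2)
      rw [map_neg, hu]
  · have eu := (quasiIsoDiff_iff_coneDiff hdA' hu).1 qu
    have ev := (quasiIsoDiff_iff_coneDiff hdB' hv).1 qv
    rintro ⟨⟨b', a'⟩, b, a⟩ hx
    have h1 : dB' b' + f' a' + v b = 0 := congrArg (fun x => x.1.1) hx
    have h2 : -dA' a' + u a = 0 := congrArg (fun x => x.1.2) hx
    have h3 : -(dB b + f a) = 0 := congrArg (fun x => x.2.1) hx
    have h4 : -(-dA a) = 0 := congrArg (fun x => x.2.2) hx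
    obtain ⟨⟨p', p⟩, hp⟩ := eu (-a', a) (Prod.ext (by change dA' (-a') + u a = 0; rwa [map_neg])
      (by change -dA a = 0; rw [← neg_neg (-dA a), h4, neg_zero]))
    have p1 : dA' p' + u p = -a' := congrArg Prod.fst hp
    have p2 : -dA p = a := congrArg Prod.snd hp
    have h3' : dB b + f a = 0 := neg_eq_zero.1 h3
    obtain ⟨⟨q', q⟩, hq⟩ := ev (b' - f' p', b - f p) (Prod.ext (by
      change dB' (b' - f' p') + v (b - f p) = 0
      rw [map_sub, map_sub, h, ← hf', ← h1]
      have := congrArg f' p1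
      rw [map_add, map_neg] at this
      linear_combination (norm := abel) -this) (by
      change -dB (b - f p) = 0
      rw [map_sub, ← hf, ← h3, ← p2, map_neg]
      abel))
    have q1 : dB' q' + v q = b' - f' p' := congrArg Prod.fst hq
    have q2 : -dB q = b - f p := congrArg Prod.snd hq
    refine ⟨((q', p'), (q, -p)), Prod.ext (Prod.ext ?_ ?_) (Prod.ext ?_ ?_)⟩
    · change dB' q' + f' p' + v q = b'
      linear_combination (norm := abel) q1
    · change -dA' p' + u (-p) = a'
      rw [map_neg]
      linear_combination (norm := abel) -p1
    · change -(dB q + f (-p)) = b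
      rw [map_neg]
      linear_combination (norm := abel) q2
    · change -(-dA (-p)) = a
      rw [map_neg, neg_neg, p2]

end

namespace BGG

variable {ρ : Representation F Q V}

variable [Module.Finite F V]

lemma degree_sub_single {a : Mon F V} {i} (h : ¬a i = 0) :
    (a - Finsupp.single i 1).degree + 1 = a.degree := by
  have := congrArg Finsupp.degree (tsub_add_cancel_of_le (b := a)
    (a := Finsupp.single i 1) (by rw [Finsupp.single_le_iff]; lia))
  rwa [map_add, Finsupp.degree_single] at this

/-- A cocycle of degree `n` on `ε` with values in an exact complex is a coboundary. -/
lemma exists_primitive {W : Type*} [AddCommGroup W] [Module (Lam ρ)ᵐᵒᵖ W]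
    (deg : ℤ → AddSubgroup W) (d : W →ₗ[(Lam ρ)ᵐᵒᵖ] W) (h2 : ∀ x : W, x + x = 0)
    (hs : ∀ {n} (a : Lam ρ) {x}, x ∈ deg n → op a • x ∈ deg n)
    (hex : ∀ {n x}, x ∈ deg n → d x = 0 → ∃ y ∈ deg (n - 1), d y = x)
    (f : Eps ρ →ₗ[(Lam ρ)ᵐᵒᵖ] W) (n : ℤ) (hf : ∀ a : Mon F V, f (gam ρ a) ∈ deg (n - a.degree))
    (hc : ∀ e, d (f e) + f (Eps.d e) = 0) :
    ∃ g : Eps ρ →ₗ[(Lam ρ)ᵐᵒᵖ] W, (∀ a : Mon F V, g (gam ρ a) ∈ deg (n - 1 - a.degree)) ∧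
      ∀ e, d (g e) + g (Eps.d e) = f e := by
  classical
  let step (a : Mon F V) (r : ∀ b : Mon F V, b.degree < a.degree → W) : W :=
    let z := f (gam ρ a) + ∑ i, if h : a i = 0 then 0 else
      op (yv ρ i) • r (a - Finsupp.single i 1) (by
        have := degree_sub_single h
        lia)
    if h : ∃ y ∈ deg (n - 1 - a.degree), d y = z then h.choose else 0
  obtain ⟨p, hp⟩ : ∃ p : Mon F V → W, ∀ a, p a = step a fun b _ => p b :=
    ⟨(measure Finsupp.degree).wf.fix step, fun a => WellFounded.fix_eq _ _ _⟩
  obtain ⟨g, hg⟩ : ∃ g : Eps ρ →ₗ[(Lam ρ)ᵐᵒᵖ] W, ∀ a, g (gam ρ a) = p a :=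
    ⟨(epsBasis ρ).constr ℕ p, fun a => by
      have := (epsBasis ρ).constr_basis ℕ p a
      rwa [epsBasis_apply] at this⟩
  have hgd : ∀ a, g (Eps.d (gam ρ a)) = ∑ i, if a i = 0 then 0 else
      op (yv ρ i) • p (a - Finsupp.single i 1) := fun a => by
    rw [d_gam, map_sum]
    refine Finset.sum_congr rfl fun i _ => ?_
    rw [map_smul, xv_smul_gam]
    split_ifs with h
    · rw [map_zero, smul_zero]
    · rw [hg]
  replace hp : ∀ a, p a = if h : ∃ y ∈ deg (n - 1 - a.degree), d y = f (gam ρ a) + g (Eps.d (gam ρ a))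
      then h.choose else 0 := fun a => by
    have h2 : f (gam ρ a) + g (Eps.d (gam ρ a)) = f (gam ρ a) + ∑ i, if h : a i = 0 then 0 else
      op (yv ρ i) • p (a - Finsupp.single i 1) := by
      rw [hgd]
      simp only [dite_eq_ite]
    rw [hp, h2]
  clear_value step
  have hlt : ∀ {k : ℕ} {a : Mon F V} {i}, ¬a i = 0 → a.degree = k →
      (a - Finsupp.single i 1).degree < k := fun h hk => by
    rw [← hk, ← degree_sub_single h]
    exact Nat.lt_succ_self _
  have key : ∀ (k : ℕ) (a : Mon F V), a.degree = k →
      g (gam ρ a) ∈ deg (n - 1 - a.degree) ∧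
        d (g (gam ρ a)) = f (gam ρ a) + g (Eps.d (gam ρ a)) := by
    intro k
    induction k using Nat.strong_induction_on with
    | _ k ih =>
    intro a ha
    have hx : ∃ y ∈ deg (n - 1 - a.degree), d y = f (gam ρ a) + g (Eps.d (gam ρ a)) := by
      have hm : f (gam ρ a) + g (Eps.d (gam ρ a)) ∈ deg (n - a.degree) := by
        refine add_mem (hf a) ?_
        rw [hgd]
        refine sum_mem fun i _ => ?_
        split_ifs with h
        · exact zero_mem _
        · refine hs _ ?_
          have hd := degree_sub_single h
          have := (ih (a - Finsupp.single i 1).degree (hlt h ha) _ rfl).1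
          rw [hg] at this
          rwa [show n - (a.degree : ℤ) = n - 1 - (a - Finsupp.single i 1).degree by
            rw [← hd]; push_cast; ring]
      obtain ⟨y, hy, hy'⟩ := hex hm (by
        have h3 : d (g (Eps.d (gam ρ a))) = f (Eps.d (gam ρ a)) + g (Eps.d (Eps.d (gam ρ a))) := by
          have hi : ∀ i, d (g (xv ρ i • gam ρ a)) = f (xv ρ i • gam ρ a) +
              g (Eps.d (xv ρ i • gam ρ a)) := fun i => by
            rw [xv_smul_gam]
            split_ifs with h
            · simp only [map_zero, add_zero]
            · exact (ih (a - Finsupp.single i 1).degree (hlt h ha) _ rfl).2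
          conv_lhs => rw [d_gam, map_sum, map_sum]
          conv_rhs => rw [d_gam, map_sum, map_sum, map_sum, ← Finset.sum_add_distrib]
          refine Finset.sum_congr rfl fun i _ => ?_
          have e1 := map_smul g (op (yv ρ i)) (xv ρ i • gam ρ a)
          have e2 := map_smul d (op (yv ρ i)) (g (xv ρ i • gam ρ a))
          have e3 := map_smul f (op (yv ρ i)) (xv ρ i • gam ρ a)
          have e4 := map_smul g (op (yv ρ i)) (Eps.d (xv ρ i • gam ρ a))
          rw [e1, e2, e3, Eps.d_op_smul, e4, hi, smul_add]
        rw [map_add, h3, Eps.d_d, map_zero, add_zero, hc])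
      exact ⟨y, by rwa [show n - 1 - (a.degree : ℤ) = n - a.degree - 1 by ring], hy'⟩
    rw [hg, hp, dif_pos hx]
    exact hx.choose_spec
  refine ⟨g, fun a => (key _ a rfl).1, fun e => ?_⟩
  induction e using Eps.induction_gam with
  | gam a c =>
    rw [map_smul, map_smul, (key _ a rfl).2, Eps.d_op_smul, map_smul, map_smul, ← smul_add,
      add_assoc, h2, add_zero]
  | add e e' h h' => rw [map_add, map_add, map_add, map_add, map_add, ← h, ← h']; abel

/-- Degrees can be tested on the basis of `ε`. -/
lemma HomEps.mem_homDeg_of_gam {C : LamComplex ρ} {f : HomEps C}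
    {n : ℤ} (h : ∀ a : Mon F V, f.lin (gam ρ a) ∈ Tot.deg C (n - a.degree)) : f ∈ homDeg C n := by
  intro j e he
  rw [← (epsBasis ρ).linearCombination_repr e, Finsupp.linearCombination_apply, Finsupp.sum,
    map_sum]
  refine sum_mem fun a ha => ?_
  rw [epsBasis_apply, map_smul]
  by_cases h' : (a.degree : ℤ) = -j
  · have := h a
    rw [h', sub_neg_eq_add, add_comm] at this
    exact Tot.smul_mem _ this
  · exact absurd (epsBasis_repr_of_mem ρ he h') (Finsupp.mem_support_iff.1 ha)

end BGG

/-- The kernel of a homogeneous map is generated by homogeneous elements. -/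
lemma internal_ker_induction {M N : Type*} [AddCommGroup M] [AddCommGroup N]
    {A : ℤ → AddSubgroup M} {B : ℤ → AddSubgroup N} (hA : DirectSum.IsInternal A)
    (hB : DirectSum.IsInternal B) {f : M →+ N} {σ : ℤ → ℤ} (hσ : Function.Injective σ)
    (hf : ∀ i, ∀ x ∈ A i, f x ∈ B (σ i)) {p : M → Prop} (zero : p 0)
    (add : ∀ x y, p x → p y → p (x + y)) (hom : ∀ i, ∀ x ∈ A i, f x = 0 → p x) {x : M}
    (hx : f x = 0) : p x := by
  classical
  obtain ⟨z, rfl⟩ := hA.2 x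
  let w : ⨁ i, B i := ∑ i ∈ DFinsupp.support z, DirectSum.of (fun i => B i) (σ i)
    ⟨f (z i), hf i _ (z i).2⟩
  have hz : DirectSum.coeAddMonoidHom A z = ∑ i ∈ DFinsupp.support z, (z i : M) :=
    DirectSum.coeAddMonoidHom_eq_dfinsuppSum A z
  have hw : w = 0 := hB.1 (by
    rw [map_sum, map_zero, ← hx, hz, map_sum]
    exact Finset.sum_congr rfl fun i _ => DirectSum.coeAddMonoidHom_of B _ _)
  rw [hz]
  refine Finset.sum_induction _ p add zero fun i hi => hom i _ (z i).2 ?_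
  have h1 := congrArg (fun w : ⨁ i, B i => (w (σ i) : N)) hw
  change ((∑ i ∈ DFinsupp.support z, DirectSum.of (fun i => B i) (σ i)
    ⟨f (z i), hf i _ (z i).2⟩ : ⨁ i, B i) (σ i) : N) = 0 at h1
  rw [DFinsupp.finsetSum_apply, Finset.sum_eq_single i] at h1
  · exact (congrArg Subtype.val (DirectSum.of_eq_same (β := fun i => B i) (σ i) _)).symm.trans h1
  · intro j _ hj
    exact DirectSum.of_eq_of_ne _ _ _ fun h => hj (hσ h).symm
  · exact fun h => absurd hi h

namespace DGModule

variable {R : Type u} [Ring R] {𝒜 : ℤ → AddSubgroup R}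

/-- Exactness of a dg module can be tested on homogeneous elements. -/
lemma exactDiff_of_homogeneous (M : DGModule R 𝒜)
    (h : ∀ n, ∀ x ∈ M.deg n, M.d x = 0 → ∃ y, M.d y = x) : ExactDiff M.d.toAddMonoidHom := by
  intro x hx
  refine internal_ker_induction M.isInternal M.isInternal (f := M.d.toAddMonoidHom)
    (σ := fun i => i + 1) (add_left_injective 1) (fun i x hx => M.d_mem hx)
    (p := fun x => ∃ y, M.d y = x) ⟨0, map_zero _⟩ ?_ h hx
  rintro _ _ ⟨a, rfl⟩ ⟨b, rfl⟩
  exact ⟨a + b, map_add _ _ _⟩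

lemma quasiIso_iff_cone {M N : DGModule R 𝒜} (f : M ⟶ N) :
    quasiIso R 𝒜 f ↔ ExactDiff (cone f).d.toAddMonoidHom := by
  rw [quasiIso_iff_diff, quasiIsoDiff_iff_coneDiff N.d_d f.comm]
  rfl

end DGModule

namespace BGG

variable {ρ : Representation F Q V}

variable [Module.Finite F V] [CharP F 2]

/-- Twisting by the `y_i` is nilpotent. -/
lemma Kos.iterate_eq_zero {M : DGSymQ ρ} (ν : Kos M →+ Kos M) (c : Idx F V → M.carrier →+ M.carrier)
    (h : ∀ φ μ, (ν φ).lin μ = ∑ i, c i (φ.lin (yv ρ i * μ))) (φ : Kos M) :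
    ν^[Module.finrank F V + 1] φ = 0 := by
  classical
  have key : ∀ (k : ℕ) (φ : Kos M) (S : Finset (Idx F V)) (μ : Lam ρ),
      Module.finrank F V + 1 ≤ k + S.card → (∀ j ∈ S, yv ρ j * μ = 0) → (ν^[k] φ).lin μ = 0 := by
    intro k
    induction k with
    | zero =>
      intro φ S μ hS _
      have := Finset.card_le_univ S
      rw [Fintype.card_fin] at this
      lia
    | succ k ih =>
      intro φ S μ hS hμ
      rw [Function.iterate_succ_apply', h]
      refine Finset.sum_eq_zero fun i _ => ?_
      by_cases hi : i ∈ S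
      · rw [hμ i hi, map_zero, map_zero]
      · rw [ih φ (insert i S) _ (by rw [Finset.card_insert_of_notMem hi]; lia), map_zero]
        intro j hj
        obtain rfl | hj := Finset.mem_insert.1 hj
        · rw [← mul_assoc]
          rw [mul_assoc, yv_mul_yv_mul]
        · rw [← mul_assoc, Lam.comm ρ (yv ρ j), mul_assoc, hμ j hj, mul_zero]
  exact Kos.ext fun μ => key _ φ ∅ μ (by simp) (by simp)

/-- The Koszul complex of an exact dg module is exact. -/
lemma Kos.exactDiff {M : DGSymQ ρ} (h : ExactDiff M.d.toAddMonoidHom) :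
    ExactDiff (Kos.d M).toAddMonoidHom := by
  obtain ⟨k, hk⟩ := ExactDiff.exists_contraction (linField M.d) M.d_d h
  let K : Kos M →+ Kos M := AddMonoidHom.mk' (fun φ => (k ∘ₗ φ.lin : Lam ρ →ₗ[F] M.carrier))
    fun φ ψ => Kos.ext fun μ => map_add k _ _
  let c (i : Idx F V) : M.carrier →ₗ[F] M.carrier :=
    symMul M (xv ρ i) ∘ₗ k + k ∘ₗ symMul M (xv ρ i)
  let ν : Kos M →+ Kos M := AddMonoidHom.mk' (fun φ =>
    (∑ i, c i ∘ₗ φ.lin ∘ₗ LinearMap.mulLeft F (yv ρ i) : Lam ρ →ₗ[F] M.carrier))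
    fun φ ψ => Kos.ext fun μ => by
      change (∑ i, c i ∘ₗ (φ + ψ).lin ∘ₗ LinearMap.mulLeft F (yv ρ i) : Lam ρ →ₗ[F] M.carrier) μ =
        (∑ i, c i ∘ₗ φ.lin ∘ₗ LinearMap.mulLeft F (yv ρ i) : Lam ρ →ₗ[F] M.carrier) μ +
        (∑ i, c i ∘ₗ ψ.lin ∘ₗ LinearMap.mulLeft F (yv ρ i) : Lam ρ →ₗ[F] M.carrier) μ
      rw [LinearMap.sum_apply, LinearMap.sum_apply, LinearMap.sum_apply, ← Finset.sum_add_distrib]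
      exact Finset.sum_congr rfl fun i _ => map_add (c i) _ _
  have hν : ∀ φ μ, (ν φ).lin μ = ∑ i, (c i).toAddMonoidHom (φ.lin (yv ρ i * μ)) :=
    fun φ μ => LinearMap.sum_apply _ _ _
  have h2 : ∀ φ : Kos M, φ + φ = 0 := fun φ => Kos.ext fun μ => add_self_of_charTwo F _
  obtain ⟨W, hW1, hW2⟩ := exists_inverse_of_locallyNilpotent h2 ν fun φ =>
    ⟨_, Kos.iterate_eq_zero ν (fun i => (c i).toAddMonoidHom) hν φ⟩
  refine exactDiff_of_bijective K (AddMonoidHom.id _ + ν) Kos.d_d (fun φ => ?_) ⟨?_, fun φ => ?_⟩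
  · refine Kos.ext fun μ => ?_
    change (Kos.d M (K φ)).lin μ + k ((Kos.d M φ).lin μ) = φ.lin μ + (ν φ).lin μ
    rw [Kos.d_lin, Kos.d_lin, map_add, map_sum, hν]
    change M.d (k _) + ∑ i, xv ρ i • k _ + (k (M.d _) + ∑ i, k _) = _
    rw [add_add_add_comm, ← Finset.sum_add_distrib]
    exact congrArg₂ _ (hk _) rfl
  · exact Function.LeftInverse.injective (g := W) hW1
  · exact ⟨W φ, hW2 φ⟩

/-- The Koszul complex preserves quasi-isomorphisms. -/
lemma quasiIso_kosMap {M N : DGSymQ ρ} (f : M ⟶ N) (hf : DGModule.quasiIso _ _ f) :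
    QuasiIso (kosMap f) := by
  rw [quasiIso_iff_tot]
  refine QuasiIsoDiff.of_comm_bijective (Kos.sum M).toAddMonoidHom (Kos.sum N).toAddMonoidHom
    (dA' := (Kos.d M).toAddMonoidHom) (dB' := (Kos.d N).toAddMonoidHom)
    (f' := (Kos.map f).toAddMonoidHom)
    (Kos.sum_d M) (Kos.sum_d N) (Kos.sum_bijective M) (Kos.sum_bijective N) (Kos.sum_map f) ?_
  refine (quasiIsoDiff_iff_coneDiff Kos.d_d (Kos.map_d f)).2 ?_
  rintro ⟨ψ, φ⟩ h
  have h1 : Kos.d N ψ + Kos.map f φ = 0 := congrArg Prod.fst h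
  have h2 : -Kos.d M φ = 0 := congrArg Prod.snd h
  let pair : Kos (DGModule.cone f) :=
    ({ toFun := fun μ => (ψ.lin μ, φ.lin μ)
       map_add' := fun μ μ' => Prod.ext (map_add _ _ _) (map_add _ _ _)
       map_smul' := fun r μ => Prod.ext (map_smul _ _ _) (map_smul _ _ _) } :
      Lam ρ →ₗ[F] N.carrier × M.carrier)
  have hd : ∀ θ : Kos (DGModule.cone f), ∀ μ, (Kos.d _ θ).lin μ =
      (N.d (θ.lin μ).1 + f.toLin (θ.lin μ).2 + ∑ i, xv ρ i • (θ.lin (yv ρ i * μ)).1,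
        -(M.d (θ.lin μ).2 + ∑ i, xv ρ i • (θ.lin (yv ρ i * μ)).2)) := fun θ μ => by
    rw [Kos.d_lin]
    refine Prod.ext ?_ ?_
    · exact congrArg (fun y => N.d (θ.lin μ).1 + f.toLin (θ.lin μ).2 + y)
        (map_sum (AddMonoidHom.fst N.carrier M.carrier)
        (fun i => xv ρ i • θ.lin (yv ρ i * μ)) Finset.univ)
    · refine (congrArg (fun y => -(M.d (θ.lin μ).2) + y)
        (map_sum (AddMonoidHom.snd N.carrier M.carrier)
        (fun i => xv ρ i • θ.lin (yv ρ i * μ)) Finset.univ)).trans ?_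
      rw [neg_add, neg_eq_of_charTwo (F := F) (∑ i, xv ρ i • (θ.lin (yv ρ i * μ)).2)]
      rfl
  obtain ⟨θ, hθ⟩ := Kos.exactDiff ((DGModule.quasiIso_iff_cone f).1 hf) pair (by
    refine Kos.ext fun μ => (hd pair μ).trans (Prod.ext ?_ ?_)
    · have := congrArg (fun φ => Kos.lin φ μ) h1
      rw [Kos.add_lin, Kos.d_lin, Kos.map_lin] at this
      exact (add_right_comm _ _ _).trans this
    · have := congrArg (fun φ => Kos.lin φ μ) (neg_eq_zero.1 h2)
      rw [Kos.d_lin] at this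
      exact neg_eq_zero.2 this)
  refine ⟨((LinearMap.fst F N.carrier M.carrier ∘ₗ θ.lin : Lam ρ →ₗ[F] N.carrier),
    (LinearMap.snd F N.carrier M.carrier ∘ₗ θ.lin : Lam ρ →ₗ[F] M.carrier)), ?_⟩
  have hθ : ∀ μ, (Kos.d _ θ).lin μ = (ψ.lin μ, φ.lin μ) := fun μ =>
    congrArg (fun φ => Kos.lin φ μ) hθ
  refine Prod.ext (Kos.ext fun μ => ?_) (Kos.ext fun μ => ?_)
  · refine Eq.trans ?_ (congrArg Prod.fst ((hd θ μ).symm.trans (hθ μ)))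
    change (Kos.d N _ + Kos.map f _).lin μ = _
    rw [Kos.add_lin, Kos.d_lin, Kos.map_lin]
    exact add_right_comm _ _ _
  · refine Eq.trans ?_ (congrArg Prod.snd ((hd θ μ).symm.trans (hθ μ)))
    exact congrArg Neg.neg (Kos.d_lin _ μ)

variable {C D : LamComplex ρ}

/-- `Hom_Λ(ε, -)` preserves quasi-isomorphisms. -/
lemma quasiIso_homEps_map (g : C ⟶ D) (hg : QuasiIso g) :
    DGModule.quasiIso _ _ ((homEps ρ).map g) := by
  have hex := (quasiIsoDiff_iff_coneDiff Tot.d_d (Tot.map_d g)).1 ((quasiIso_iff_tot g).1 hg)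
  rw [DGModule.quasiIso_iff_cone]
  refine DGModule.exactDiff_of_homogeneous _ ?_
  rintro n ⟨ψ, φ⟩ ⟨hψ, hφ⟩ h
  have hψ : ψ.1 ∈ HomEps.homDeg D n := hψ
  have hφ : φ.1 ∈ HomEps.homDeg C (n + 1) := hφ
  have h1 : HomEps.d D ψ.1 + HomEps.map g φ.1 = 0 := congrArg (fun x => x.1.1) h
  have h2 : -HomEps.d C φ.1 = 0 := congrArg (fun x => x.2.1) h
  let dW : Tot D × Tot C →ₗ[(Lam ρ)ᵐᵒᵖ] Tot D × Tot C :=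
    { toFun := fun x => (Tot.d D x.1 + Tot.map g x.2, -Tot.d C x.2)
      map_add' := fun x y => by
        refine Prod.ext ?_ ?_
        · change Tot.d D (x.1 + y.1) + Tot.map g (x.2 + y.2) =
            Tot.d D x.1 + Tot.map g x.2 + (Tot.d D y.1 + Tot.map g y.2)
          rw [map_add, map_add, add_add_add_comm]
        · change -Tot.d C (x.2 + y.2) = -Tot.d C x.2 + -Tot.d C y.2
          rw [map_add, neg_add]
      map_smul' := fun a x => by
        refine Prod.ext ?_ ?_
        · change Tot.d D (a • x.1) + Tot.map g (a • x.2) = a • (Tot.d D x.1 + Tot.map g x.2)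
          rw [Tot.map_lam_smul, Tot.map_lam_smul, smul_add]
        · change -Tot.d C (a • x.2) = a • -Tot.d C x.2
          rw [Tot.map_lam_smul, smul_neg] }
  obtain ⟨G, hG1, hG2⟩ := exists_primitive
    (fun i => (Tot.deg D i).prod (Tot.deg C (i + 1))) dW
    (fun x => Prod.ext (add_self_of_charTwo F x.1) (add_self_of_charTwo F x.2))
    (fun a x hx => ⟨Tot.smul_mem _ hx.1, Tot.smul_mem _ hx.2⟩)
    (fun {n x} hx hx' => by
      obtain ⟨y, hy⟩ := hex x hx'
      have y1 : Tot.d D y.1 + Tot.map g y.2 = x.1 := congrArg Prod.fst hy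
      have y2 : -Tot.d C y.2 = x.2 := congrArg Prod.snd hy
      refine ⟨(Tot.incl D (n - 1) (Tot.proj D (n - 1) y.1), Tot.incl C n (Tot.proj C n y.2)),
        ⟨⟨_, rfl⟩, ⟨Tot.proj C (n - 1 + 1) y.2, by rw [sub_add_cancel]; rfl⟩⟩, ?_⟩
      refine Prod.ext ?_ ?_
      · change Tot.d D _ + Tot.map g _ = _
        rw [Tot.d_incl' (sub_add_cancel n 1), ← Tot.proj_d' (sub_add_cancel n 1), Tot.map_incl,
          ← Tot.proj_map, ← map_add, ← map_add, y1]
        exact Tot.incl_proj_of_mem hx.1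
      · change -Tot.d C _ = _
        rw [Tot.d_incl, ← Tot.proj_d, ← map_neg, ← map_neg, y2]
        exact Tot.incl_proj_of_mem hx.2)
    (ψ.1.lin.prod φ.1.lin) n
    (fun a => by
      have e1 := hψ _ _ (gam_mem_deg ρ a)
      have e2 := hφ _ _ (gam_mem_deg ρ a)
      rw [neg_add_eq_sub] at e1 e2
      refine ⟨e1, ?_⟩
      rwa [← sub_add_eq_add_sub] at e2)
    (fun e => by
      refine Prod.ext ?_ ?_
      · have := congrArg (fun f => HomEps.lin f e) h1
        exact (add_right_comm _ _ _).trans this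
      · have := congrArg (fun f => HomEps.lin f e) (neg_eq_zero.1 h2)
        rw [HomEps.d_lin] at this
        change -Tot.d C (φ.1.lin e) + φ.1.lin (Eps.d e) = 0
        rwa [neg_eq_of_charTwo (F := F)])
  let G1 : HomEps D := LinearMap.fst (Lam ρ)ᵐᵒᵖ (Tot D) (Tot C) ∘ₗ G
  let G2 : HomEps C := LinearMap.snd (Lam ρ)ᵐᵒᵖ (Tot D) (Tot C) ∘ₗ G
  have m1 : G1 ∈ HomEps.homDeg D (n - 1) := HomEps.mem_homDeg_of_gam fun a => (hG1 a).1
  have m2 : G2 ∈ HomEps.homDeg C n := HomEps.mem_homDeg_of_gam fun a => by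
    have := (hG1 a).2
    rwa [show n - 1 - (a.degree : ℤ) + 1 = n - a.degree by ring] at this
  refine ⟨(⟨G1, HomEps.mem_total m1⟩, ⟨G2, HomEps.mem_total m2⟩),
    Prod.ext (Subtype.ext (HomEps.ext fun e => ?_)) (Subtype.ext (HomEps.ext fun e => ?_))⟩
  · exact (add_right_comm _ _ _).trans (congrArg Prod.fst (hG2 e))
  · refine Eq.trans ?_ (congrArg Prod.snd (hG2 e))
    change -(Tot.d C (G2.lin e) + G2.lin (Eps.d e)) = -Tot.d C (G2.lin e) + G2.lin (Eps.d e)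
    rw [neg_add, neg_eq_of_charTwo (F := F) (G2.lin (Eps.d e))]

end BGG

/-! ## The derived adjunction -/

namespace CategoryTheory

open Functor

/-- A functor with a natural transformation which is invertible on functorial resolutions is a
left derived functor. -/
lemma isLeftDerivedFunctor_of_resolution {C D E : Type*} [Category C] [Category D] [Category E]
    {S : C ⥤ D} (W : MorphismProperty C) [S.IsLocalization W] {T : C ⥤ E} {L : D ⥤ E}
    (α : S ⋙ L ⟶ T) {P : C ⥤ C} (π : P ⟶ 𝟭 C) [∀ M, IsIso (S.map (π.app M))]
    [∀ M, IsIso (α.app (P.obj M))] : L.IsLeftDerivedFunctor α W where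
  isRightKanExtension := by
    have hW := Localization.inverts S W
    have nat {G : D ⥤ E} (γ : S ⋙ G ⟶ T) (M : C) :
        G.map (S.map (π.app M)) ≫ γ.app M = γ.app (P.obj M) ≫ T.map (π.app M) :=
      γ.naturality (π.app M)
    have lift {G : D ⥤ E} (γ : S ⋙ G ⟶ T) : ∃ u : G ⟶ L, ∀ M, u.app (S.obj M) =
        inv (G.map (S.map (π.app M))) ≫ γ.app (P.obj M) ≫ inv (α.app (P.obj M)) ≫
          L.map (S.map (π.app M)) := by
      let τ : S ⋙ G ⟶ S ⋙ L :=
        { app := fun M => inv (G.map (S.map (π.app M))) ≫ γ.app (P.obj M) ≫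
            inv (α.app (P.obj M)) ≫ L.map (S.map (π.app M))
          naturality := fun M N f => by
            have h1 : P.map f ≫ π.app N = π.app M ≫ f := π.naturality f
            have h2 : G.map (S.map (P.map f)) ≫ γ.app (P.obj N) =
              γ.app (P.obj M) ≫ T.map (P.map f) := γ.naturality (P.map f)
            have h3 : L.map (S.map (P.map f)) ≫ α.app (P.obj N) =
              α.app (P.obj M) ≫ T.map (P.map f) := α.naturality (P.map f)
            have h4 : G.map (S.map f) ≫ inv (G.map (S.map (π.app N))) =
                inv (G.map (S.map (π.app M))) ≫ G.map (S.map (P.map f)) := by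
              rw [IsIso.eq_inv_comp, ← Category.assoc, IsIso.comp_inv_eq, ← Functor.map_comp,
                ← Functor.map_comp, ← Functor.map_comp, ← Functor.map_comp, h1]
            have h5 : T.map (P.map f) ≫ inv (α.app (P.obj N)) =
                inv (α.app (P.obj M)) ≫ L.map (S.map (P.map f)) := by
              rw [IsIso.eq_inv_comp, ← Category.assoc, IsIso.comp_inv_eq, h3]
            have h6 : L.map (S.map (P.map f)) ≫ L.map (S.map (π.app N)) =
                L.map (S.map (π.app M)) ≫ L.map (S.map f) := by
              rw [← Functor.map_comp, ← Functor.map_comp, ← Functor.map_comp, ← Functor.map_comp, h1]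
            change G.map (S.map f) ≫ _ = _ ≫ L.map (S.map f)
            rw [reassoc_of% h4, reassoc_of% h2, reassoc_of% h5, h6]
            simp only [Category.assoc] }
      exact ⟨(Localization.whiskeringLeftFunctor' S W E).preimage τ,
        congr_app ((Localization.whiskeringLeftFunctor' S W E).map_preimage τ)⟩
    choose u hu using @lift
    refine ⟨⟨Limits.IsTerminal.ofUniqueHom
      (fun G => CostructuredArrow.homMk (u (G := G.left) G.hom) ?_) (fun G m => ?_)⟩⟩
    · ext M
      change (u (G := G.left) G.hom).app (S.obj M) ≫ α.app M = G.hom.app M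
      rw [hu]
      simp only [Category.assoc]
      rw [IsIso.inv_comp_eq, nat α, IsIso.inv_hom_id_assoc, nat (G := G.left) G.hom]
    · ext1
      refine Localization.natTrans_ext S W fun M => ?_
      let ml : G.left ⟶ L := m.left
      change ml.app (S.obj M) = _
      have h7 : ml.app (S.obj (P.obj M)) ≫ α.app (P.obj M) = G.hom.app (P.obj M) :=
        congr_app (CostructuredArrow.w m) (P.obj M)
      refine Eq.trans ?_ (hu (G := G.left) G.hom M).symm
      have h8 : G.left.map (S.map (π.app M)) ≫ ml.app (S.obj M) =
        ml.app (S.obj (P.obj M)) ≫ L.map (S.map (π.app M)) := ml.naturality _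
      have h9 := congrArg (fun g => inv (G.left.map (S.map (π.app M))) ≫ g ≫
        inv (α.app (P.obj M)) ≫ L.map (S.map (π.app M))) h7
      refine Eq.trans ?_ h9
      have h10 : ml.app (S.obj M) = inv (G.left.map (S.map (π.app M))) ≫
          ml.app (S.obj (P.obj M)) ≫ L.map (S.map (π.app M)) := by
        rw [← h8]
        exact (IsIso.inv_hom_id_assoc _ _).symm
      have h11 : (ml.app (S.obj (P.obj M)) ≫ α.app (P.obj M)) ≫ inv (α.app (P.obj M)) ≫
          L.map (S.map (π.app M)) = ml.app (S.obj (P.obj M)) ≫ L.map (S.map (π.app M)) :=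
        (Category.assoc _ _ _).trans (congrArg _ (IsIso.hom_inv_id_assoc _ _))
      exact h10.trans (congrArg (fun g => inv (G.left.map (S.map (π.app M))) ≫ g) h11.symm)

end CategoryTheory

namespace BGG

variable {ρ : Representation F Q V}

variable [Module.Finite F V] [CharP F 2]

variable {C D : LamComplex ρ}

lemma finEps_map_felem (g : C ⟶ D) (x : Tot C) (s : Sym ρ) :
    ((finEps ρ).map g).toLin (felem x s) = felem (Tot.map g x) s :=
  Subtype.ext (HomEps.map_elem g x s)

lemma kosOne_map {M N : DGSymQ ρ} (f : M ⟶ N) (t : Tot (kosObj M)) :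
    kosOne N (Tot.map (kosMap f) t) = f.toLin (kosOne M t) :=
  congrArg (fun φ : Kos N => φ.lin 1) (Kos.sum_map f t)

variable (ρ) in
/-- The natural quasi-isomorphism `Hom_Λ(ε, Kos M)_fin ⟶ M`. -/
def res : kos ρ ⋙ finEps ρ ⟶ 𝟭 (DGSymQ ρ) where
  app M := resHom M
  naturality M N f := by
    refine DGModule.hom_ext fun z => ?_
    refine finEps_ext (f := (((finEps ρ).map (kosMap f)) ≫ resHom N).toLin.toAddMonoidHom)
      (g := (resHom M ≫ f).toLin.toAddMonoidHom) (fun t s => ?_) z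
    change resLin N (((finEps ρ).map (kosMap f)).toLin (felem t s)) =
      f.toLin (resLin M (felem t s))
    rw [finEps_map_felem, resLin_felem, resLin_felem, kosOne_map]
    exact (map_sym_smul f.toLin _ _).symm

variable (ρ) in
/-- The natural quasi-isomorphism `Hom_Λ(ε, C)_fin ⊗_S ε ⟶ C`. -/
def eval : finEps ρ ⋙ tensorEps ρ ⟶ 𝟭 (LamComplex ρ) :=
  Functor.whiskerRight (finIncl ρ) (tensorEps ρ) ≫ (tensorHomAdj ρ).counit

instance (C : LamComplex ρ) : QuasiIso ((eval ρ).app C) := quasiIso_finEval C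

/-- The quasi-isomorphism `kosUnit`, for the functors. -/
abbrev kosUnit' (C : LamComplex ρ) : C ⟶ (kos ρ).obj ((finEps ρ).obj C) := kosUnit C

lemma finEps_map_kosUnit_res (C : LamComplex ρ) :
    (finEps ρ).map (kosUnit' C) ≫ (res ρ).app ((finEps ρ).obj C) = 𝟙 _ := by
  refine DGModule.hom_ext fun z => ?_
  refine finEps_ext (f := ((finEps ρ).map (kosUnit C) ≫ resHom (finEpsObj C)).toLin.toAddMonoidHom)
    (g := AddMonoidHom.id _) (fun t s => ?_) z
  change resLin _ (((finEps ρ).map (kosUnit C)).toLin (felem t s)) = felem t s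
  rw [finEps_map_felem, resLin_felem, kosOne_apply, sum_kosUnit, kosUnitLin_lin, sym_smul_felem,
    mul_one, op_one, one_smul]

lemma kosUnit_kos_map_res (M : DGSymQ ρ) :
    kosUnit' ((kos ρ).obj M) ≫ (kos ρ).map ((res ρ).app M) = 𝟙 ((kos ρ).obj M) := by
  refine Tot.hom_ext fun (t : Tot (kosObj M)) => (Kos.sum_bijective M).1 ?_
  refine (congrArg _ (Tot.map_comp (kosUnit (kosObj M)) (kosMap (resHom M)) t)).trans ?_
  refine (Kos.sum_map _ _).trans ?_
  rw [sum_kosUnit]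
  refine Kos.ext fun μ => ?_
  rw [Kos.map_lin, kosUnitLin_lin]
  refine (resLin_felem M _ 1).trans ?_
  rw [one_smul, kosOne_apply, Kos.sum_op_smul, mul_one]
  exact congrArg (fun t => (Kos.sum M t).lin μ) (Tot.map_id t).symm

lemma quasiIso_tensorEps_map_res (C : LamComplex ρ) :
    QuasiIso ((tensorEps ρ).map ((res ρ).app ((finEps ρ).obj C))) := by
  let ι := kosUnit' C
  have hι : QuasiIso ι := quasiIso_kosUnit C
  have h0 : (finEps ρ).map ι ≫ (res ρ).app ((finEps ρ).obj C) = 𝟙 _ := finEps_map_kosUnit_res C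
  have h1 : (tensorEps ρ).map ((finEps ρ).map ι) ≫
      (tensorEps ρ).map ((res ρ).app ((finEps ρ).obj C)) = 𝟙 _ :=
    ((tensorEps ρ).map_comp _ _).symm.trans ((congrArg _ h0).trans ((tensorEps ρ).map_id _))
  have h2 : QuasiIso ((tensorEps ρ).map ((finEps ρ).map ι)) := by
    have h3 : (tensorEps ρ).map ((finEps ρ).map ι) ≫ (eval ρ).app _ = (eval ρ).app C ≫ ι :=
      (eval ρ).naturality ι
    have h4 : QuasiIso ((tensorEps ρ).map ((finEps ρ).map ι) ≫ (eval ρ).app _) := by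
      rw [h3]
      exact quasiIso_comp _ ι
    exact (quasiIso_iff_comp_right _ ((eval ρ).app _)).1 h4
  have h5 : QuasiIso ((tensorEps ρ).map ((finEps ρ).map ι) ≫
      (tensorEps ρ).map ((res ρ).app ((finEps ρ).obj C))) := by
    rw [h1]
    infer_instance
  exact (quasiIso_iff_comp_left ((tensorEps ρ).map ((finEps ρ).map ι)) _).1 h5

section

variable (ρ) [HasDerivedCategory.{w} (ModuleCat.{u} (LamQ ρ)ᵐᵒᵖ)]

lemma kos_inverts : (DGModule.quasiIso (SymQ ρ) (symQDeg ρ)).IsInvertedBy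
    (kos ρ ⋙ DerivedCategory.Q) := fun _ _ f hf => by
  have := quasiIso_kosMap f hf
  change IsIso (DerivedCategory.Q.map (kosMap f))
  infer_instance

lemma homEps_inverts : (HomologicalComplex.quasiIso (ModuleCat.{u} (LamQ ρ)ᵐᵒᵖ)
    (ComplexShape.up ℤ)).IsInvertedBy (homEps ρ ⋙ QSym ρ) := fun _ _ g hg =>
  Localization.inverts (QSym ρ) (DGModule.quasiIso (SymQ ρ) (symQDeg ρ)) _
    (quasiIso_homEps_map g hg)

/-- The left derived functor of `- ⊗_S ε`. -/
def leftDer : DSymQ ρ ⥤ DLamQ ρ := Localization.lift _ (kos_inverts ρ) (QSym ρ)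

/-- The left derived functor is computed by the Koszul complex. -/
def leftDerIso : QSym ρ ⋙ leftDer ρ ≅ kos ρ ⋙ DerivedCategory.Q :=
  Localization.fac _ (kos_inverts ρ) (QSym ρ)

/-- The right derived functor of `Hom_Λ(ε, -)`. -/
def rightDer : DLamQ ρ ⥤ DSymQ ρ := Localization.lift _ (homEps_inverts ρ) DerivedCategory.Q

/-- The right derived functor agrees with `Hom_Λ(ε, -)`. -/
def rightDerIso : homEps ρ ⋙ QSym ρ ≅ DerivedCategory.Q ⋙ rightDer ρ :=
  (Localization.fac _ (homEps_inverts ρ) DerivedCategory.Q).symm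

/-- The natural isomorphism in the derived category given by `eval`. -/
def evalIso : finEps ρ ⋙ tensorEps ρ ⋙ DerivedCategory.Q ≅ (DerivedCategory.Q : _ ⥤ DLamQ ρ) :=
  NatIso.ofComponents (fun C => asIso (DerivedCategory.Q.map ((eval ρ).app C))) fun {C D} g => by
    change DerivedCategory.Q.map _ ≫ DerivedCategory.Q.map _ = DerivedCategory.Q.map _ ≫ _
    rw [← Functor.map_comp, ← Functor.map_comp]
    exact congrArg _ ((eval ρ).naturality g)

/-- The natural transformation exhibiting the left derived functor. -/
def leftDerHom : QSym ρ ⋙ leftDer ρ ⟶ tensorEps ρ ⋙ DerivedCategory.Q :=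
  (leftDerIso ρ).hom ≫ Functor.whiskerLeft (kos ρ) (evalIso ρ).inv ≫
    (Functor.whiskerRight (res ρ) (tensorEps ρ ⋙ DerivedCategory.Q) :
      kos ρ ⋙ finEps ρ ⋙ tensorEps ρ ⋙ DerivedCategory.Q ⟶ _)

instance (M : DGSymQ ρ) : IsIso ((QSym ρ).map ((res ρ).app M)) :=
  Localization.inverts (QSym ρ) (DGModule.quasiIso (SymQ ρ) (symQDeg ρ)) _ (quasiIso_resHom M)

lemma leftDerHom_finEps (C : LamComplex ρ) :
    (leftDerHom ρ).app ((finEps ρ).obj C) ≫ (evalIso ρ).hom.app C ≫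
        DerivedCategory.Q.map (kosUnit' C) = (leftDerIso ρ).hom.app ((finEps ρ).obj C) := by
  have h1 : DerivedCategory.Q.map ((tensorEps ρ).map ((finEps ρ).map (kosUnit' C))) ≫
      (evalIso ρ).hom.app _ = (evalIso ρ).hom.app C ≫ DerivedCategory.Q.map (kosUnit' C) :=
    (evalIso ρ).hom.naturality (kosUnit' C)
  have := quasiIso_tensorEps_map_res C
  let r : DerivedCategory.Q.obj ((tensorEps ρ).obj ((kos ρ ⋙ finEps ρ).obj ((finEps ρ).obj C))) ⟶
    DerivedCategory.Q.obj ((tensorEps ρ).obj ((finEps ρ).obj C)) :=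
    DerivedCategory.Q.map ((tensorEps ρ).map ((res ρ).app ((finEps ρ).obj C)))
  have hr : IsIso r := inferInstance
  have h2 : DerivedCategory.Q.map ((tensorEps ρ).map ((finEps ρ).map (kosUnit' C))) ≫ r = 𝟙 _ := by
    have := congrArg (fun g => DerivedCategory.Q.map ((tensorEps ρ).map g))
      (finEps_map_kosUnit_res C)
    exact ((DerivedCategory.Q.map_comp _ _).symm.trans
      (congrArg _ ((tensorEps ρ).map_comp _ _).symm)).trans
      (this.trans ((congrArg _ ((tensorEps ρ).map_id _)).trans (DerivedCategory.Q.map_id _)))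
  have h3 : r ≫ DerivedCategory.Q.map ((tensorEps ρ).map ((finEps ρ).map (kosUnit' C))) = 𝟙 _ := by
    rw [← cancel_mono r, Category.assoc, h2, Category.comp_id, Category.id_comp]
  have h4 : (leftDerHom ρ).app ((finEps ρ).obj C) = (leftDerIso ρ).hom.app ((finEps ρ).obj C) ≫
    (evalIso ρ).inv.app ((kos ρ).obj ((finEps ρ).obj C)) ≫ r := rfl
  rw [h4, ← h1, Category.assoc, Category.assoc, reassoc_of% h3, Iso.inv_hom_id_app]
  exact Category.comp_id _

lemma isIso_leftDerHom_finEps (C : LamComplex ρ) :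
    IsIso ((leftDerHom ρ).app ((finEps ρ).obj C)) := by
  have : QuasiIso (kosUnit' C) := quasiIso_kosUnit C
  have h := leftDerHom_finEps ρ C
  have h' : IsIso ((leftDerHom ρ).app ((finEps ρ).obj C) ≫ (evalIso ρ).hom.app C ≫
        DerivedCategory.Q.map (kosUnit' C)) := by
    rw [h]
    infer_instance
  exact IsIso.of_isIso_comp_right _ ((evalIso ρ).hom.app C ≫ DerivedCategory.Q.map (kosUnit' C))

instance (M : DGSymQ ρ) : IsIso ((leftDerHom ρ).app ((kos ρ ⋙ finEps ρ).obj M)) :=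
  isIso_leftDerHom_finEps ρ ((kos ρ).obj M)

instance : (leftDer ρ).IsLeftDerivedFunctor (leftDerHom ρ)
    (DGModule.quasiIso (SymQ ρ) (symQDeg ρ)) := isLeftDerivedFunctor_of_resolution _ _ (res ρ)

instance : (rightDer ρ).IsRightDerivedFunctor (rightDerIso ρ).hom
    (HomologicalComplex.quasiIso _ (ComplexShape.up ℤ)) :=
  Functor.isRightDerivedFunctor_of_inverts _ _ (rightDerIso ρ).symm

instance : (leftDer ρ ⋙ rightDer ρ).IsLeftDerivedFunctor
    ((Functor.associator _ _ _).inv ≫ Functor.whiskerRight (leftDerHom ρ) (rightDer ρ))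
    (DGModule.quasiIso (SymQ ρ) (symQDeg ρ)) := by
  have (M : DGSymQ ρ) : IsIso (((Functor.associator _ _ _).inv ≫
      Functor.whiskerRight (leftDerHom ρ) (rightDer ρ)).app ((kos ρ ⋙ finEps ρ).obj M)) :=
    IsIso.comp_isIso' inferInstance (Functor.map_isIso _ _)
  exact isLeftDerivedFunctor_of_resolution _ _ (res ρ)

instance : (rightDer ρ ⋙ leftDer ρ).IsRightDerivedFunctor
    (Functor.whiskerRight (rightDerIso ρ).hom (leftDer ρ) ≫ (Functor.associator _ _ _).hom)
    (HomologicalComplex.quasiIso (ModuleCat.{u} (LamQ ρ)ᵐᵒᵖ) (ComplexShape.up ℤ)) :=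
  Functor.isRightDerivedFunctor_of_inverts _ _ (Functor.isoWhiskerRight (rightDerIso ρ)
    (leftDer ρ) ≪≫ Functor.associator _ _ _).symm

/-- The derived adjunction. -/
def derAdj : leftDer ρ ⊣ rightDer ρ :=
  (tensorHomAdj ρ).derived (DGModule.quasiIso (SymQ ρ) (symQDeg ρ))
    (HomologicalComplex.quasiIso (ModuleCat.{u} (LamQ ρ)ᵐᵒᵖ) (ComplexShape.up ℤ))
    (leftDerHom ρ) (rightDerIso ρ).hom

lemma derAdj_counit (C : LamComplex ρ) : (leftDer ρ).map ((rightDerIso ρ).hom.app C) ≫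
        (derAdj ρ).counit.app (DerivedCategory.Q.obj C) =
      (leftDerHom ρ).app ((homEps ρ).obj C) ≫ DerivedCategory.Q.map (evalHom C) :=
  Adjunction.derivedε_fac_app (tensorHomAdj ρ)
    (HomologicalComplex.quasiIso (ModuleCat.{u} (LamQ ρ)ᵐᵒᵖ) (ComplexShape.up ℤ)) (leftDerHom ρ) (rightDerIso ρ).hom C

lemma derAdj_unit (M : DGSymQ ρ) :
    (derAdj ρ).unit.app ((QSym ρ).obj M) ≫ (rightDer ρ).map ((leftDerHom ρ).app M) =
      (QSym ρ).map (unitHom M) ≫ (rightDerIso ρ).hom.app (tensorEpsObj M) :=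
  Adjunction.derivedη_fac_app (tensorHomAdj ρ)
    (DGModule.quasiIso (SymQ ρ) (symQDeg ρ)) (leftDerHom ρ) (rightDerIso ρ).hom M

/-- The unit of the derived adjunction in terms of resolutions. -/
lemma res_unit (M : DGSymQ ρ) :
    (QSym ρ).map ((res ρ).app M) ≫ (derAdj ρ).unit.app ((QSym ρ).obj M) ≫
      (rightDer ρ).map ((leftDerIso ρ).hom.app M) =
    (QSym ρ).map ((finIncl ρ).app ((kos ρ).obj M)) ≫ (rightDerIso ρ).hom.app ((kos ρ).obj M) := by
  let C := (kos ρ).obj M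
  let N := (finEps ρ).obj C
  have h1 : (QSym ρ).map ((res ρ).app M) ≫ (derAdj ρ).unit.app ((QSym ρ).obj M) =
      (derAdj ρ).unit.app ((QSym ρ).obj N) ≫
        (rightDer ρ).map ((leftDer ρ).map ((QSym ρ).map ((res ρ).app M))) :=
    (derAdj ρ).unit.naturality _
  have h2 : (leftDer ρ).map ((QSym ρ).map ((res ρ).app M)) ≫ (leftDerIso ρ).hom.app M =
      (leftDerIso ρ).hom.app N ≫ DerivedCategory.Q.map ((kos ρ).map ((res ρ).app M)) :=
    (leftDerIso ρ).hom.naturality _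
  have h3 : (leftDerIso ρ).hom.app N ≫ DerivedCategory.Q.map ((kos ρ).map ((res ρ).app M)) =
      (leftDerHom ρ).app N ≫ (evalIso ρ).hom.app C := by
    rw [← leftDerHom_finEps ρ C, Category.assoc, Category.assoc, ← Functor.map_comp,
      kosUnit_kos_map_res]
    exact congrArg (_ ≫ ·) ((congrArg (_ ≫ ·) (DerivedCategory.Q.map_id C)).trans (Category.comp_id _))
  have h4 : (rightDerIso ρ).hom.app ((tensorEps ρ).obj N) ≫
      (rightDer ρ).map ((evalIso ρ).hom.app C) =
      (QSym ρ).map ((homEps ρ).map ((eval ρ).app C)) ≫ (rightDerIso ρ).hom.app C :=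
    ((rightDerIso ρ).hom.naturality ((eval ρ).app C)).symm
  have h5 : (tensorHomAdj ρ).unit.app N ≫ (homEps ρ).map ((eval ρ).app C) =
      (finIncl ρ).app C := by
    have e1 := (tensorHomAdj ρ).unit.naturality ((finIncl ρ).app C)
    have e2 := (tensorHomAdj ρ).right_triangle_components C
    refine (congrArg _ ((homEps ρ).map_comp ((tensorEps ρ).map ((finIncl ρ).app C))
      ((tensorHomAdj ρ).counit.app C))).trans ?_
    refine ((reassoc_of% e1) _).symm.trans ?_
    refine (congrArg _ e2).trans (Category.comp_id _)
  have h6 : (derAdj ρ).unit.app ((QSym ρ).obj N) ≫ (rightDer ρ).map ((leftDerHom ρ).app N) =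
      (QSym ρ).map ((tensorHomAdj ρ).unit.app N) ≫
        (rightDerIso ρ).hom.app ((tensorEps ρ).obj N) := derAdj_unit ρ N
  rw [reassoc_of% h1, ← Functor.map_comp, h2, h3, Functor.map_comp, reassoc_of% h6, h4,
    ← Functor.map_comp_assoc, h5]

/-- The unit is invertible where finitely supported maps suffice. -/
lemma isIso_unit_iff (M : DGSymQ ρ) : IsIso ((derAdj ρ).unit.app ((QSym ρ).obj M)) ↔
    IsIso ((QSym ρ).map ((finIncl ρ).app ((kos ρ).obj M))) := by
  have h := res_unit ρ M
  constructor
  · intro h1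
    have : IsIso ((QSym ρ).map ((finIncl ρ).app ((kos ρ).obj M)) ≫
        (rightDerIso ρ).hom.app ((kos ρ).obj M)) := by
      rw [← h]
      exact IsIso.comp_isIso' inferInstance (IsIso.comp_isIso' h1 inferInstance)
    exact IsIso.of_isIso_comp_right _ ((rightDerIso ρ).hom.app ((kos ρ).obj M))
  · intro h1
    have h2 : IsIso ((QSym ρ).map ((res ρ).app M) ≫ (derAdj ρ).unit.app ((QSym ρ).obj M) ≫
        (rightDer ρ).map ((leftDerIso ρ).hom.app M)) := by
      rw [h]
      exact IsIso.comp_isIso' h1 inferInstance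
    have h3 := IsIso.of_isIso_comp_left ((QSym ρ).map ((res ρ).app M))
      ((derAdj ρ).unit.app ((QSym ρ).obj M) ≫ (rightDer ρ).map ((leftDerIso ρ).hom.app M))
    exact IsIso.of_isIso_comp_right _ ((rightDer ρ).map ((leftDerIso ρ).hom.app M))

/-- The counit is invertible where finitely supported maps suffice. -/
lemma isIso_counit (C : LamComplex ρ) (hC : IsIso ((finIncl ρ).app C)) :
    IsIso ((derAdj ρ).counit.app (DerivedCategory.Q.obj C)) := by
  have h1 : (QSym ρ ⋙ leftDer ρ).map ((finIncl ρ).app C) ≫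
      (leftDerHom ρ).app ((homEps ρ).obj C) ≫ DerivedCategory.Q.map (evalHom C) =
      (leftDerHom ρ).app ((finEps ρ).obj C) ≫ (evalIso ρ).hom.app C := by
    have e1 := (leftDerHom ρ).naturality ((finIncl ρ).app C)
    refine ((reassoc_of% e1) _).trans (congrArg _ ?_)
    exact (DerivedCategory.Q.map_comp _ _).symm
  have h2 := isIso_leftDerHom_finEps ρ C
  have h3 : IsIso ((QSym ρ ⋙ leftDer ρ).map ((finIncl ρ).app C) ≫
      (leftDerHom ρ).app ((homEps ρ).obj C) ≫ DerivedCategory.Q.map (evalHom C)) := by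
    rw [h1]
    infer_instance
  have h4 := IsIso.of_isIso_comp_left ((QSym ρ ⋙ leftDer ρ).map ((finIncl ρ).app C))
    ((leftDerHom ρ).app ((homEps ρ).obj C) ≫ DerivedCategory.Q.map (evalHom C))
  rw [← derAdj_counit] at h4
  exact IsIso.of_isIso_comp_left ((leftDer ρ).map ((rightDerIso ρ).hom.app C)) _

end

end BGG

/-! ## Compatibility with shifts -/

namespace DGModule

variable {R : Type u} [Ring R] {𝒜 : ℤ → AddSubgroup R}

/-- A bijective morphism of dg modules is an isomorphism. -/
lemma isIso_of_bijective {M N : DGModule R 𝒜} (f : M ⟶ N) (hf : Function.Bijective f.toLin) :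
    IsIso f := by
  let e := LinearEquiv.ofBijective f.toLin hf
  have he : ∀ n, f.toLin (e.symm n) = n := e.apply_symm_apply
  have hmem : ∀ {i : ℤ} {n : N.carrier}, n ∈ N.deg i → e.symm n ∈ M.deg i := by
    intro i n hn
    obtain ⟨y, hy⟩ := M.isInternal.2 (e.symm n)
    let g : (⨁ j, M.deg j) →+ ⨁ j, N.deg j :=
      DirectSum.map fun j => AddMonoidHom.mk' (fun z => ⟨f.toLin z.1, f.map_mem z.2⟩)
        fun a b => Subtype.ext (map_add f.toLin _ _)
    have hg : (DirectSum.coeAddMonoidHom N.deg).comp g =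
        f.toLin.toAddMonoidHom.comp (DirectSum.coeAddMonoidHom M.deg) := by
      ext j z
      simp [g]
    have h1 : g y = DirectSum.of (fun j => N.deg j) i ⟨n, hn⟩ := N.isInternal.1 (by
      refine (DFunLike.congr_fun hg y).trans ?_
      rw [DirectSum.coeAddMonoidHom_of]
      exact (congrArg f.toLin hy).trans (he n))
    have h2 : y = DirectSum.of (fun j => M.deg j) i (y i) := by
      ext j
      by_cases hj : j = i
      · subst hj
        rw [DirectSum.of_eq_same]
      · have h3 : f.toLin (y j) = ((g y) j : N.carrier) := by
          simp [g]
        rw [h1, DirectSum.of_eq_of_ne _ _ _ hj] at h3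
        rw [DirectSum.of_eq_of_ne _ _ _ hj]
        exact hf.1 (h3.trans (map_zero f.toLin).symm)
    rw [← hy, h2, DirectSum.coeAddMonoidHom_of]
    exact (y i).2
  let k : N ⟶ M :=
    { toLin := e.symm
      map_mem := hmem
      comm := fun n => hf.1 (by
        refine (he _).trans ?_
        rw [f.comm]
        exact congrArg N.d (he n).symm) }
  exact ⟨k, hom_ext fun m => e.symm_apply_apply m, hom_ext fun n => he n⟩

end DGModule

namespace BGG

variable {ρ : Representation F Q V}

variable [Module.Finite F V] [CharP F 2]

variable {C D : LamComplex ρ}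

lemma units_smul_of_charTwo {M : Type*} [AddCommGroup M] [Module F M] (ε : ℤˣ) (m : M) :
    ε • m = m := by
  obtain rfl | rfl := Int.units_eq_one_or ε
  · exact one_smul _ m
  · exact (neg_smul (1 : ℤ) m).trans ((congrArg _ (one_smul ℤ m)).trans
      (neg_eq_of_charTwo (F := F) m))

namespace Tot

lemma incl_injective (i : ℤ) : Function.Injective (incl C i) := fun x y h => by
  rw [← proj_incl i x, h, proj_incl]

lemma incl_XIsoOfEq {i j : ℤ} (h : i = j) (x : C.X i) :
    incl C i x = incl C j ((C.XIsoOfEq h).hom x) := by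
  subst h
  simp

variable (C) in
/-- The inclusion of a term of `C⟦n⟧` in `C`. -/
def shiftIncl (n i : ℤ) : (C⟦n⟧).X i →ₗ[(LamQ ρ)ᵐᵒᵖ] Tot C := incl C (i + n)

variable (C) in
/-- The identification of `C⟦n⟧` with `C`, with the degrees shifted. -/
def unshift (n : ℤ) : Tot (C⟦n⟧) →ₗ[(LamQ ρ)ᵐᵒᵖ] Tot C := DirectSum.toModule _ ℤ _ (shiftIncl C n)

lemma unshift_incl (n i : ℤ) (x : C.X (i + n)) : unshift C n (incl (C⟦n⟧) i x) = incl C (i + n) x :=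
  DirectSum.toModule_lof (φ := shiftIncl C n) (LamQ ρ)ᵐᵒᵖ i x

lemma proj_unshift (n i : ℤ) (s : Tot (C⟦n⟧)) :
    proj C (i + n) (unshift C n s) = (proj (C⟦n⟧) i s : (C⟦n⟧).X i) := by
  induction s using Tot.induction with
  | zero => simp only [map_zero]; rfl
  | add x y hx hy => rw [map_add, map_add, hx, hy, map_add]; rfl
  | hom j x =>
    refine (congrArg _ (unshift_incl n j x)).trans ?_
    by_cases h : j = i
    · subst h
      exact (proj_incl (C := C) _ _).trans (proj_incl (C := C⟦n⟧) j x).symm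
    · exact (proj_incl_ne (by lia) _).trans (proj_incl_ne h x).symm

variable (C) in
lemma unshift_bijective (n : ℤ) : Function.Bijective (unshift C n) := by
  constructor
  · rw [injective_iff_map_eq_zero]
    intro s hs
    refine ext_proj fun i => ?_
    have := proj_unshift n i s
    rw [hs, map_zero] at this
    exact this.symm.trans (map_zero (proj (C⟦n⟧) i)).symm
  · intro t
    induction t using Tot.induction with
    | zero => exact ⟨0, map_zero _⟩
    | add x y hx hy =>
      obtain ⟨s, rfl⟩ := hx
      obtain ⟨s', rfl⟩ := hy
      exact ⟨s + s', map_add _ _ _⟩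
    | hom j x =>
      obtain ⟨i, rfl⟩ : ∃ i, j = i + n := ⟨j - n, by lia⟩
      exact ⟨incl (C⟦n⟧) i x, unshift_incl n i x⟩

lemma unshift_d (n : ℤ) (s : Tot (C⟦n⟧)) : unshift C n (d _ s) = d C (unshift C n s) := by
  refine ext_proj fun j => ?_
  obtain ⟨i, rfl⟩ : ∃ i, j = i + 1 + n := ⟨j - 1 - n, by lia⟩
  refine (proj_unshift n (i + 1) _).trans ((proj_d i s).trans ?_)
  rw [proj_d' (show i + n + 1 = i + 1 + n by lia), proj_unshift]
  let ε := n.negOnePow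
  have h : ∀ x : C.X (i + n), (ε • C.d (i + n) (i + 1 + n)) x = C.d (i + n) (i + 1 + n) x := by
    intro x
    rcases Int.units_eq_one_or ε with h | h <;> rw [h]
    · rw [one_smul]
    · refine incl_injective (i + 1 + n) ?_
      rw [Units.neg_smul, one_smul]
      refine (map_neg (incl C (i + 1 + n)) _).trans (neg_eq_of_charTwo (F := F) _)
  exact h _

lemma unshift_mem (n : ℤ) {i : ℤ} {s : Tot (C⟦n⟧)} (hs : s ∈ deg (C⟦n⟧) i) :
    unshift C n s ∈ deg C (i + n) := by
  obtain ⟨x, rfl⟩ := hs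
  exact ⟨x, (unshift_incl n i x).symm⟩

lemma mem_of_unshift_mem (n : ℤ) {i : ℤ} {s : Tot (C⟦n⟧)} (hs : unshift C n s ∈ deg C (i + n)) :
    s ∈ deg (C⟦n⟧) i := by
  obtain ⟨x, hx⟩ := hs
  exact ⟨x, (unshift_bijective C n).1 ((unshift_incl n i x).trans hx)⟩

lemma unshift_map (n : ℤ) (g : C ⟶ D) (s : Tot (C⟦n⟧)) :
    unshift D n (map (g⟦n⟧') s) = map g (unshift C n s) := by
  refine ext_proj fun j => ?_
  obtain ⟨i, rfl⟩ : ∃ i, j = i + n := ⟨j - n, by lia⟩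
  refine (proj_unshift n i _).trans ((proj_map _ i s).trans ?_)
  rw [proj_map, proj_unshift]
  rfl

lemma unshift_zero (s : Tot (C⟦(0 : ℤ)⟧)) :
    unshift C 0 s = map ((shiftFunctorZero (CochainComplex _ ℤ) ℤ).hom.app C) s := by
  induction s using Tot.induction with
  | zero => simp only [map_zero]
  | add x y hx hy => rw [map_add, hx, hy, map_add]
  | hom i x =>
    refine (unshift_incl 0 i x).trans (Eq.trans ?_ (map_incl _ i x).symm)
    rw [CochainComplex.shiftFunctorZero_hom_app_f]
    exact incl_XIsoOfEq (add_zero i) x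

lemma unshift_add (a b : ℤ) (s : Tot (C⟦a + b⟧)) :
    unshift C (a + b) s = unshift C a (unshift (C⟦a⟧) b
      (map ((shiftFunctorAdd (CochainComplex _ ℤ) a b).hom.app C) s)) := by
  induction s using Tot.induction with
  | zero => simp only [map_zero]
  | add x y hx hy => simp only [map_add, hx, hy]
  | hom i x =>
    refine (unshift_incl (a + b) i x).trans ?_
    refine Eq.trans ?_ (congrArg (fun s => unshift C a (unshift (C⟦a⟧) b s)) (map_incl _ i x).symm)
    rw [CochainComplex.shiftFunctorAdd_hom_app_f]
    refine (incl_XIsoOfEq (show i + (a + b) = i + b + a by lia) x).trans ?_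
    exact ((congrArg (unshift C a) (unshift_incl b i _)).trans (unshift_incl a (i + b) _)).symm

end Tot

namespace HomEps

/-- Postcomposition with a linear map. -/
def postcomp (φ : Tot C →ₗ[(LamQ ρ)ᵐᵒᵖ] Tot D) : HomEps C →ₗ[(SymQ ρ)ᵐᵒᵖ] HomEps D :=
  linearMapOfSingle (AddMonoidHom.mk' (fun f =>
      ({ toFun := fun e => φ (f.lin e)
         map_add' := fun e e' => by rw [map_add, map_add]
         map_smul' := fun a e => by rw [map_smul, Tot.map_lam_smul]; rfl } : HomEps D))
      (fun f f' => ext fun e => map_add φ _ _))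
    (fun s q f => ext fun e => by
      rw [smul_lin]
      change φ ((op (single q s) • f).lin e) = _
      rw [smul_lin]
      exact map_smul φ _ _)

lemma postcomp_lin (φ : Tot C →ₗ[(LamQ ρ)ᵐᵒᵖ] Tot D) (f : HomEps C) (e : Eps ρ) :
    (postcomp φ f).lin e = φ (f.lin e) := rfl

variable {φ : Tot C →ₗ[(LamQ ρ)ᵐᵒᵖ] Tot D} {n : ℤ}

lemma postcomp_mem_homDeg (hφ : ∀ {i : ℤ} {t : Tot C}, t ∈ Tot.deg C i → φ t ∈ Tot.deg D (i + n))
    {m : ℤ} {f : HomEps C} (hf : f ∈ homDeg C m) :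
    postcomp φ f ∈ homDeg D (m + n) := fun i e he => by
  have := hφ (hf i e he)
  rwa [add_assoc] at this

lemma postcomp_mem_total (hφ : ∀ {i : ℤ} {t : Tot C}, t ∈ Tot.deg C i → φ t ∈ Tot.deg D (i + n))
    {f : HomEps C} (hf : f ∈ total C) : postcomp φ f ∈ total D := by
  have : ⨆ m, homDeg C m ≤ (⨆ m, homDeg D m).comap (postcomp φ).toAddMonoidHom :=
    iSup_le fun m f hf => mem_total (postcomp_mem_homDeg hφ hf)
  exact this hf

lemma d_postcomp (hd : ∀ t, φ (Tot.d C t) = Tot.d D (φ t)) (f : HomEps C) :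
    d D (postcomp φ f) = postcomp φ (d C f) := by
  ext e
  rw [d_lin, postcomp_lin, postcomp_lin, postcomp_lin, d_lin, map_add, hd]

end HomEps

variable (C) in
/-- `Hom_Λ(ε, C⟦n⟧)` is the shift of `Hom_Λ(ε, C)`. -/
def homEpsShift (n : ℤ) : homEpsObj (C⟦n⟧) ⟶ (homEpsObj C).shift n where
  toLin := (HomEps.postcomp (Tot.unshift C n)).restrict fun _ hf =>
    HomEps.postcomp_mem_total (Tot.unshift_mem n) hf
  map_mem hf := HomEps.postcomp_mem_homDeg (Tot.unshift_mem n) hf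
  comm f := by
    refine Eq.trans ?_ (units_smul_of_charTwo (F := F) (M := (homEpsObj C).carrier)
      n.negOnePow _).symm
    exact Subtype.ext (HomEps.d_postcomp (Tot.unshift_d n) f.1).symm

variable (C) in
lemma homEpsShift_bijective (n : ℤ) : Function.Bijective (homEpsShift C n).toLin := by
  have hb := Tot.unshift_bijective C n
  constructor
  · intro f g h
    refine Subtype.ext (HomEps.ext fun e => hb.1 ?_)
    exact congrArg (fun k : HomEps.total C => k.1.lin e) h
  · let ψ := (LinearEquiv.ofBijective _ hb).symm
    have hψ : ∀ t, Tot.unshift C n (ψ t) = t := (LinearEquiv.ofBijective _ hb).apply_symm_apply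
    rintro ⟨f, hf⟩
    refine ⟨⟨HomEps.postcomp (ψ : Tot C →ₗ[_] _) f, HomEps.postcomp_mem_total (n := -n) ?_ hf⟩,
      Subtype.ext (HomEps.ext fun e => hψ _)⟩
    intro i t ht
    refine Tot.mem_of_unshift_mem n ?_
    rw [neg_add_cancel_right]
    exact (hψ t).symm ▸ ht

instance (n : ℤ) : IsIso (homEpsShift C n) :=
  DGModule.isIso_of_bijective _ (homEpsShift_bijective C n)

variable (C) in
/-- `homEpsShift` as an isomorphism. -/
def homEpsShiftApp (n : ℤ) : homEpsObj (C⟦n⟧) ≅ (homEpsObj C).shift n := asIso (homEpsShift C n)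

variable (ρ) in
/-- The compatibility of `Hom_Λ(ε, -)` with shifts. -/
def homEpsShiftIso (n : ℤ) : shiftFunctor (LamComplex ρ) n ⋙ homEps ρ ≅
    homEps ρ ⋙ shiftFunctor (DGSymQ ρ) n :=
  NatIso.ofComponents (fun C => homEpsShiftApp C n) fun {C D} g =>
    DGModule.hom_ext fun f => Subtype.ext (HomEps.ext fun e => Tot.unshift_map n g _)

instance : (homEps ρ).CommShift ℤ where
  commShiftIso := homEpsShiftIso ρ
  commShiftIso_zero := by
    ext C f
    exact Subtype.ext (HomEps.ext fun e => Tot.unshift_zero _)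
  commShiftIso_add a b := by
    refine Iso.ext (NatTrans.ext (funext fun C => ?_))
    rw [Functor.CommShift.isoAdd_hom_app]
    exact DGModule.hom_ext fun f => Subtype.ext (HomEps.ext fun e => Tot.unshift_add a b _)

end BGG

/-! ## Mapping cones -/

namespace BGG

variable {ρ : Representation F Q V}

variable [Module.Finite F V] [CharP F 2]

variable {C D : LamComplex ρ}

namespace Tot

/-- The linear map given by maps on the terms. -/
def ofTerms {σ : ℤ → ℤ} (g : ∀ i, C.X i →ₗ[(LamQ ρ)ᵐᵒᵖ] D.X (σ i)) :
    Tot C →ₗ[(LamQ ρ)ᵐᵒᵖ] Tot D := DirectSum.toModule _ ℤ _ fun i => incl D (σ i) ∘ₗ g i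

lemma ofTerms_incl {σ : ℤ → ℤ} (g : ∀ i, C.X i →ₗ[(LamQ ρ)ᵐᵒᵖ] D.X (σ i)) (i : ℤ) (x : C.X i) :
    ofTerms g (incl C i x) = incl D (σ i) (g i x) :=
  DirectSum.toModule_lof (φ := fun i => incl D (σ i) ∘ₗ g i) (LamQ ρ)ᵐᵒᵖ i x

lemma ofTerms_mem {σ : ℤ → ℤ} (g : ∀ i, C.X i →ₗ[(LamQ ρ)ᵐᵒᵖ] D.X (σ i)) {i : ℤ} {t : Tot C}
    (ht : t ∈ deg C i) : ofTerms g t ∈ deg D (σ i) := by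
  obtain ⟨x, rfl⟩ := ht
  exact ⟨g i x, (ofTerms_incl g i x).symm⟩

open CochainComplex CochainComplex.mappingCone

variable (φ : C ⟶ D)

/-- The first projection of the mapping cone. -/
def coneFst : Tot (mappingCone φ) →ₗ[(LamQ ρ)ᵐᵒᵖ] Tot C :=
  ofTerms (σ := fun i => i + 1) fun i => ((fst φ).1.v i (i + 1) rfl).hom

/-- The second projection of the mapping cone. -/
def coneSnd : Tot (mappingCone φ) →ₗ[(LamQ ρ)ᵐᵒᵖ] Tot D :=
  ofTerms (σ := fun i => i) fun i => ((snd φ).v i i (add_zero i)).hom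

/-- The first inclusion in the mapping cone. -/
def coneInl : Tot C →ₗ[(LamQ ρ)ᵐᵒᵖ] Tot (mappingCone φ) :=
  ofTerms (σ := fun i => i + -1) fun i => ((inl φ).v i (i + -1) rfl).hom

lemma coneFst_incl {i j : ℤ} (h : i + 1 = j) (x : (mappingCone φ).X i) :
    coneFst φ (incl _ i x) = incl C j ((fst φ).1.v i j h x) := by
  subst h
  exact ofTerms_incl (σ := fun i => i + 1) (fun i => ((fst φ).1.v i (i + 1) rfl).hom) i x

lemma coneSnd_incl (i : ℤ) (x : (mappingCone φ).X i) :
    coneSnd φ (incl _ i x) = incl D i ((snd φ).v i i (add_zero i) x) :=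
  ofTerms_incl (σ := fun i => i) (fun i => ((snd φ).v i i (add_zero i)).hom) i x

lemma coneInl_incl {i j : ℤ} (h : i + -1 = j) (x : C.X i) :
    coneInl φ (incl _ i x) = incl (mappingCone φ) j ((inl φ).v i j h x) := by
  subst h
  exact ofTerms_incl (σ := fun i => i + -1) (fun i => ((inl φ).v i (i + -1) rfl).hom) i x

lemma coneFst_coneInl (x : Tot C) : coneFst φ (coneInl φ x) = x := by
  induction x using Tot.induction with
  | zero => simp only [map_zero]
  | add x y hx hy => rw [map_add, map_add, hx, hy]
  | hom i x =>
    rw [coneInl_incl φ rfl, coneFst_incl φ (by lia : i + -1 + 1 = i)]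
    exact congrArg (incl C i) (congr($(inl_v_fst_v φ i (i + -1) (by lia)) x))

lemma coneSnd_coneInl (x : Tot C) : coneSnd φ (coneInl φ x) = 0 := by
  induction x using Tot.induction with
  | zero => simp only [map_zero]
  | add x y hx hy => rw [map_add, map_add, hx, hy, add_zero]
  | hom i x =>
    rw [coneInl_incl φ rfl, coneSnd_incl]
    exact (congrArg (incl D (i + -1)) (congr($(inl_v_snd_v φ i (i + -1) rfl) x))).trans
      (map_zero (incl D (i + -1)))

lemma coneFst_inr (x : Tot D) : coneFst φ (map (inr φ) x) = 0 := by
  induction x using Tot.induction with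
  | zero => simp only [map_zero]
  | add x y hx hy => rw [map_add, map_add, hx, hy, add_zero]
  | hom i x =>
    rw [map_incl, coneFst_incl φ rfl]
    exact (congrArg (incl C (i + 1)) (congr($(inr_f_fst_v φ i (i + 1) rfl) x))).trans
      (map_zero (incl C (i + 1)))

lemma coneSnd_inr (x : Tot D) : coneSnd φ (map (inr φ) x) = x := by
  induction x using Tot.induction with
  | zero => simp only [map_zero]
  | add x y hx hy => rw [map_add, map_add, hx, hy]
  | hom i x =>
    rw [map_incl, coneSnd_incl]
    exact congrArg (incl D i) (congr($(inr_f_snd_v φ i) x))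

lemma coneInl_add_inr (t : Tot (mappingCone φ)) :
    coneInl φ (coneFst φ t) + map (inr φ) (coneSnd φ t) = t := by
  induction t using Tot.induction with
  | zero => simp only [map_zero, add_zero]
  | add x y hx hy =>
    nth_rw 3 [← hx, ← hy]
    simp only [map_add]
    abel
  | hom i x =>
    rw [coneFst_incl φ rfl, coneSnd_incl, coneInl_incl φ (by lia : i + 1 + -1 = i), map_incl]
    refine (map_add (incl _ i) _ _).symm.trans ?_
    exact congrArg (incl _ i) (congr($(id_X φ i (i + 1) rfl) x))

lemma cone_ext {s t : Tot (mappingCone φ)} (h : coneFst φ s = coneFst φ t)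
    (h' : coneSnd φ s = coneSnd φ t) : s = t := by
  rw [← coneInl_add_inr φ s, h, h', coneInl_add_inr]

lemma coneFst_d (t : Tot (mappingCone φ)) : coneFst φ (d _ t) = d C (coneFst φ t) := by
  induction t using Tot.induction with
  | zero => simp only [map_zero]
  | add x y hx hy => simp only [map_add, hx, hy]
  | hom i x =>
    rw [d_incl, coneFst_incl φ rfl, coneFst_incl φ rfl, d_incl]
    have h := congr($(d_fst_v φ i (i + 1) (i + 1 + 1) rfl rfl) x)
    refine (congrArg (incl C (i + 1 + 1)) h).trans ?_
    refine (map_neg (incl C (i + 1 + 1)) _).trans ?_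
    refine (neg_eq_of_charTwo (F := F) _).trans ?_
    rfl

lemma coneSnd_d (t : Tot (mappingCone φ)) :
    coneSnd φ (d _ t) = d D (coneSnd φ t) + map φ (coneFst φ t) := by
  induction t using Tot.induction with
  | zero => simp only [map_zero, add_zero]
  | add x y hx hy => simp only [map_add, hx, hy]; abel
  | hom i x =>
    rw [d_incl, coneSnd_incl, coneFst_incl φ rfl, coneSnd_incl, d_incl, map_incl]
    have h := congr($(d_snd_v φ i (i + 1) rfl) x)
    refine (congrArg (incl D (i + 1)) h).trans ?_
    exact (map_add (incl D (i + 1)) _ _).trans (add_comm _ _)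

/-- The connecting morphism of the mapping cone. -/
def coneδ : mappingCone φ ⟶ C⟦(1 : ℤ)⟧ := (triangle φ).mor₃

lemma unshift_coneδ (t : Tot (mappingCone φ)) : unshift C 1 (map (coneδ φ) t) = coneFst φ t := by
  rw [← coneInl_add_inr φ t]
  generalize coneFst φ t = x
  generalize coneSnd φ t = y
  rw [map_add, map_add, map_add (coneFst φ), coneFst_coneInl, coneFst_inr]
  refine congrArg₂ (· + ·) ?_ ?_
  · induction x using Tot.induction with
    | zero => simp only [map_zero]
    | add x y hx hy => simp only [map_add, hx, hy]
    | hom i x =>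
      obtain ⟨j, rfl⟩ : ∃ j, i = j + 1 := ⟨i - 1, by lia⟩
      rw [coneInl_incl φ (by lia : j + 1 + -1 = j)]
      refine (congrArg _ (map_incl _ j _)).trans ((unshift_incl 1 j _).trans ?_)
      refine (congrArg (incl C (j + 1)) (congr($(inl_v_triangle_mor₃_f φ (j + 1) j (by lia)) x))).trans ?_
      refine (map_neg (incl C (j + 1)) _).trans ((neg_eq_of_charTwo (F := F) _).trans ?_)
      simp only [CochainComplex.shiftFunctorObjXIso, HomologicalComplex.XIsoOfEq_rfl, Iso.refl_inv]
      rfl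
  · induction y using Tot.induction with
    | zero => simp only [map_zero]
    | add x y hx hy => simp only [map_add, hx, hy, add_zero]
    | hom i x =>
      refine (congrArg (fun s => unshift C 1 (map (coneδ φ) s)) (map_incl _ i x)).trans ?_
      refine (congrArg _ (map_incl _ i _)).trans ((unshift_incl 1 i _).trans ?_)
      refine (congrArg (incl C (i + 1)) (congr($(inr_f_triangle_mor₃_f φ i) x))).trans ?_
      exact map_zero (incl C (i + 1))

end Tot

end BGG

namespace BGG

variable {ρ : Representation F Q V}

variable [Module.Finite F V] [CharP F 2]

variable {C D : LamComplex ρ}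

namespace HomEps

lemma postcomp_mem_finDeg {φ : Tot C →ₗ[(LamQ ρ)ᵐᵒᵖ] Tot D} {n : ℤ}
    (hφ : ∀ {i : ℤ} {t : Tot C}, t ∈ Tot.deg C i → φ t ∈ Tot.deg D (i + n))
    {m : ℤ} {f : HomEps C} (hf : f ∈ finDeg C m) : postcomp φ f ∈ finDeg D (m + n) := by
  obtain ⟨hf, N, hN⟩ := hf
  exact ⟨postcomp_mem_homDeg hφ hf, N, fun i hi e he => by
    rw [postcomp_lin, hN i hi e he, map_zero]⟩

lemma postcomp_mem_finTotal {φ : Tot C →ₗ[(LamQ ρ)ᵐᵒᵖ] Tot D} {n : ℤ}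
    (hφ : ∀ {i : ℤ} {t : Tot C}, t ∈ Tot.deg C i → φ t ∈ Tot.deg D (i + n))
    {f : HomEps C} (hf : f ∈ finTotal C) : postcomp φ f ∈ finTotal D := by
  have : ⨆ m, finDeg C m ≤ (⨆ m, finDeg D m).comap (postcomp φ).toAddMonoidHom :=
    iSup_le fun m f hf => mem_finTotal (postcomp_mem_finDeg hφ hf)
  exact this hf

end HomEps

namespace Tot

open CochainComplex CochainComplex.mappingCone

variable (φ : C ⟶ D)

lemma coneFst_mem {i : ℤ} {t : Tot (mappingCone φ)} (ht : t ∈ deg (mappingCone φ) i) :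
    coneFst φ t ∈ deg C (i + 1) := ofTerms_mem (σ := fun i => i + 1) _ ht

lemma coneSnd_mem {i : ℤ} {t : Tot (mappingCone φ)} (ht : t ∈ deg (mappingCone φ) i) :
    coneSnd φ t ∈ deg D (i + 0) := by
  rw [add_zero]
  exact ofTerms_mem (σ := fun i => i) _ ht

lemma coneInl_mem {i : ℤ} {t : Tot C} (ht : t ∈ deg C i) :
    coneInl φ t ∈ deg (mappingCone φ) (i + -1) := ofTerms_mem (σ := fun i => i + -1) _ ht

end Tot

open CochainComplex (mappingCone)

variable (φ : C ⟶ D)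

/-- `Hom_Λ(ε, -)` commutes with mapping cones. -/
def homEpsCone : homEpsObj (mappingCone φ) ⟶ DGModule.cone ((homEps ρ).map φ) where
  toLin := LinearMap.prod
    ((HomEps.postcomp (Tot.coneSnd φ)).restrict fun _ hf =>
      HomEps.postcomp_mem_total (Tot.coneSnd_mem φ) hf)
    ((HomEps.postcomp (Tot.coneFst φ)).restrict fun _ hf =>
      HomEps.postcomp_mem_total (Tot.coneFst_mem φ) hf)
  map_mem {i f} hf := by
    have h := HomEps.postcomp_mem_homDeg (Tot.coneSnd_mem φ) hf
    rw [add_zero] at h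
    exact ⟨h, HomEps.postcomp_mem_homDeg (Tot.coneFst_mem φ) hf⟩
  comm f := by
    refine Prod.ext (Subtype.ext (HomEps.ext fun e => ?_))
      (Subtype.ext (HomEps.ext fun e => ?_))
    · change Tot.coneSnd φ (Tot.d _ (f.1.lin e) + f.1.lin (Eps.d e)) =
        (Tot.d D (Tot.coneSnd φ (f.1.lin e)) + Tot.coneSnd φ (f.1.lin (Eps.d e))) +
          Tot.map φ (Tot.coneFst φ (f.1.lin e))
      rw [map_add, Tot.coneSnd_d]
      abel
    · change Tot.coneFst φ (Tot.d _ (f.1.lin e) + f.1.lin (Eps.d e)) =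
        -(Tot.d C (Tot.coneFst φ (f.1.lin e)) + Tot.coneFst φ (f.1.lin (Eps.d e)))
      rw [map_add, Tot.coneFst_d, neg_eq_of_charTwo (F := F)]

lemma homEpsCone_bijective : Function.Bijective (homEpsCone φ).toLin := by
  constructor
  · intro f g h
    refine Subtype.ext (HomEps.ext fun e => Tot.cone_ext φ ?_ ?_)
    · exact congrArg (fun z : HomEps.total D × HomEps.total C => z.2.1.lin e) h
    · exact congrArg (fun z : HomEps.total D × HomEps.total C => z.1.1.lin e) h
  · rintro ⟨⟨f, hf⟩, ⟨g, hg⟩⟩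
    refine ⟨⟨HomEps.map (CochainComplex.mappingCone.inr φ) f + HomEps.postcomp (Tot.coneInl φ) g,
      add_mem (HomEps.map_mem_total _ hf) (HomEps.postcomp_mem_total (Tot.coneInl_mem φ) hg)⟩,
      Prod.ext (Subtype.ext (HomEps.ext fun e => ?_)) (Subtype.ext (HomEps.ext fun e => ?_))⟩
    · change Tot.coneSnd φ (Tot.map _ (f.lin e) + Tot.coneInl φ (g.lin e)) = f.lin e
      rw [map_add, Tot.coneSnd_inr, Tot.coneSnd_coneInl, add_zero]
    · change Tot.coneFst φ (Tot.map _ (f.lin e) + Tot.coneInl φ (g.lin e)) = g.lin e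
      rw [map_add, Tot.coneFst_inr, Tot.coneFst_coneInl, zero_add]

instance : IsIso (homEpsCone φ) := DGModule.isIso_of_bijective _ (homEpsCone_bijective φ)

/-- `homEpsCone` as an isomorphism. -/
def homEpsConeIso : homEpsObj (mappingCone φ) ≅ DGModule.cone ((homEps ρ).map φ) :=
  asIso (homEpsCone φ)

/-- The functor `finEps` commutes with mapping cones. -/
def finEpsCone : finEpsObj (mappingCone φ) ⟶ DGModule.cone ((finEps ρ).map φ) where
  toLin := LinearMap.prod
    ((HomEps.postcomp (Tot.coneSnd φ)).restrict fun _ hf =>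
      HomEps.postcomp_mem_finTotal (Tot.coneSnd_mem φ) hf)
    ((HomEps.postcomp (Tot.coneFst φ)).restrict fun _ hf =>
      HomEps.postcomp_mem_finTotal (Tot.coneFst_mem φ) hf)
  map_mem {i f} hf := by
    have h := HomEps.postcomp_mem_finDeg (Tot.coneSnd_mem φ) hf
    rw [add_zero] at h
    exact ⟨h, HomEps.postcomp_mem_finDeg (Tot.coneFst_mem φ) hf⟩
  comm f := by
    refine Prod.ext (Subtype.ext (HomEps.ext fun e => ?_)) (Subtype.ext (HomEps.ext fun e => ?_))
    · change Tot.coneSnd φ (Tot.d _ (f.1.lin e) + f.1.lin (Eps.d e)) =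
        (Tot.d D (Tot.coneSnd φ (f.1.lin e)) + Tot.coneSnd φ (f.1.lin (Eps.d e))) +
          Tot.map φ (Tot.coneFst φ (f.1.lin e))
      rw [map_add, Tot.coneSnd_d]
      abel
    · change Tot.coneFst φ (Tot.d _ (f.1.lin e) + f.1.lin (Eps.d e)) =
        -(Tot.d C (Tot.coneFst φ (f.1.lin e)) + Tot.coneFst φ (f.1.lin (Eps.d e)))
      rw [map_add, Tot.coneFst_d, neg_eq_of_charTwo (F := F)]

lemma finEpsCone_bijective : Function.Bijective (finEpsCone φ).toLin := by
  constructor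
  · intro f g h
    refine Subtype.ext (HomEps.ext fun e => Tot.cone_ext φ ?_ ?_)
    · exact congrArg (fun z : HomEps.finTotal D × HomEps.finTotal C => z.2.1.lin e) h
    · exact congrArg (fun z : HomEps.finTotal D × HomEps.finTotal C => z.1.1.lin e) h
  · rintro ⟨⟨f, hf⟩, ⟨g, hg⟩⟩
    refine ⟨⟨HomEps.map (CochainComplex.mappingCone.inr φ) f + HomEps.postcomp (Tot.coneInl φ) g,
      add_mem (HomEps.map_mem_finTotal _ hf) (HomEps.postcomp_mem_finTotal (Tot.coneInl_mem φ) hg)⟩,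
      Prod.ext (Subtype.ext (HomEps.ext fun e => ?_)) (Subtype.ext (HomEps.ext fun e => ?_))⟩
    · change Tot.coneSnd φ (Tot.map _ (f.lin e) + Tot.coneInl φ (g.lin e)) = f.lin e
      rw [map_add, Tot.coneSnd_inr, Tot.coneSnd_coneInl, add_zero]
    · change Tot.coneFst φ (Tot.map _ (f.lin e) + Tot.coneInl φ (g.lin e)) = g.lin e
      rw [map_add, Tot.coneFst_inr, Tot.coneFst_coneInl, zero_add]

instance : IsIso (finEpsCone φ) := DGModule.isIso_of_bijective _ (finEpsCone_bijective φ)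

open Pretriangulated

/-- The functor `Hom_Λ(ε, -)` maps mapping cone triangles to mapping cone triangles. -/
def homEpsTriangle : (homEps ρ).mapTriangle.obj (CochainComplex.mappingCone.triangle φ) ≅
    DGModule.coneTriangle ((homEps ρ).map φ) :=
  Triangle.isoMk _ _ (Iso.refl _) (Iso.refl _) (homEpsConeIso φ)
    ((Category.comp_id _).trans (Category.id_comp _).symm)
    (by
      refine DGModule.hom_ext fun (f : HomEps.total D) => ?_
      refine Prod.ext (Subtype.ext (HomEps.ext fun e => ?_))
        (Subtype.ext (HomEps.ext fun e => ?_))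
      · exact Tot.coneSnd_inr φ (f.1.lin e)
      · exact Tot.coneFst_inr φ (f.1.lin e))
    (by
      refine DGModule.hom_ext fun (f : HomEps.total (mappingCone φ)) => ?_
      refine Subtype.ext (HomEps.ext fun e => ?_)
      refine (Tot.unshift_coneδ φ (f.1.lin e)).trans ?_
      exact (neg_eq_of_charTwo (F := F) _).symm)

instance : (tensorEps ρ).CommShift ℤ := (tensorHomAdj ρ).leftAdjointCommShift ℤ

instance : (tensorHomAdj ρ).CommShift ℤ := (tensorHomAdj ρ).commShift_of_rightAdjoint ℤ

/-- The compatibility of `- ⊗_S ε` with the shift. -/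
def tensorEpsShift (M : DGSymQ ρ) : tensorEpsObj (M.shift 1) ⟶ (tensorEpsObj M)⟦(1 : ℤ)⟧ :=
  ((tensorEps ρ).commShiftIso (1 : ℤ)).hom.app M

lemma tensorEpsShift_toTot (M : DGSymQ ρ) (m : M.carrier) (e : Eps ρ) :
    Tot.unshift (tensorEpsObj M) 1 (Tot.map (tensorEpsShift M)
      (TensorEps.toTot (M.shift 1) (TensorEps.tmul (M.shift 1) m e))) =
    TensorEps.toTot M (TensorEps.tmul M m e) := by
  have h := (tensorHomAdj ρ).unit_app_commShiftIso_hom_app ℤ (1 : ℤ) M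
  rw [Functor.commShiftIso_comp_hom_app] at h
  exact congrArg (fun k : M.shift 1 ⟶ (homEpsObj (tensorEpsObj M)).shift 1 =>
    HomEps.lin (C := tensorEpsObj M) (Subtype.val (p := (· ∈ HomEps.total (tensorEpsObj M)))
      (k.toLin m)) e) h

section cone

variable {M N : DGSymQ ρ} (g : M ⟶ N)

/-- The units of the adjunction on the cone of a morphism. -/
def coneUnit : DGModule.cone g ⟶ DGModule.cone ((homEps ρ).map ((tensorEps ρ).map g)) where
  toLin := (unitHom N).toLin.prodMap (unitHom M).toLin
  map_mem h := ⟨(unitHom N).map_mem h.1, (unitHom M).map_mem h.2⟩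
  comm x := by
    have h : (unitHom N).toLin (g.toLin x.2) =
        ((homEps ρ).map ((tensorEps ρ).map g)).toLin ((unitHom M).toLin x.2) :=
      congrArg (fun k => DGModule.Hom.toLin k x.2) ((tensorHomAdj ρ).unit.naturality g)
    refine Prod.ext ?_ ?_
    · refine (map_add (unitHom N).toLin (N.d x.1) (g.toLin x.2)).trans ?_
      rw [(unitHom N).comm, h]
      rfl
    · refine (map_neg (unitHom M).toLin (M.d x.2)).trans ?_
      rw [(unitHom M).comm]
      rfl

/-- The functor `- ⊗_S ε` commutes with mapping cones. -/
def tensorEpsCone : tensorEpsObj (DGModule.cone g) ⟶ mappingCone ((tensorEps ρ).map g) :=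
  ((tensorHomAdj ρ).homEquiv _ _).symm (coneUnit g ≫ (homEpsConeIso ((tensorEps ρ).map g)).inv)

lemma tensorEpsCone_unit (x : (DGModule.cone g).carrier) (e : Eps ρ) :
    Tot.coneSnd _ (Tot.map (tensorEpsCone g) (TensorEps.toTot _ (TensorEps.tmul _ x e))) =
      TensorEps.toTot N (TensorEps.tmul N x.1 e) ∧
    Tot.coneFst _ (Tot.map (tensorEpsCone g) (TensorEps.toTot _ (TensorEps.tmul _ x e))) =
      TensorEps.toTot M (TensorEps.tmul M x.2 e) := by
  have h : (tensorHomAdj ρ).unit.app (DGModule.cone g) ≫ (homEps ρ).map (tensorEpsCone g) =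
      coneUnit g ≫ (homEpsConeIso ((tensorEps ρ).map g)).inv := by
    refine ((tensorHomAdj ρ).homEquiv_unit (f := tensorEpsCone g)).symm.trans ?_
    exact Equiv.apply_symm_apply _ _
  have h2 : ((tensorHomAdj ρ).unit.app (DGModule.cone g) ≫ (homEps ρ).map (tensorEpsCone g)) ≫
      (homEpsConeIso ((tensorEps ρ).map g)).hom = coneUnit g := by
    refine (congrArg (· ≫ (homEpsConeIso ((tensorEps ρ).map g)).hom) h).trans ?_
    refine (Category.assoc (coneUnit g) _ _).trans ?_
    exact (congrArg (coneUnit g ≫ ·) (Iso.inv_hom_id _)).trans (Category.comp_id _)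
  have h3 := congrArg (fun k : DGModule.cone g ⟶ _ => k.toLin x) h2
  exact ⟨congrArg (fun z : HomEps.total (tensorEpsObj N) × HomEps.total (tensorEpsObj M) =>
    z.1.1.lin e) h3, congrArg (fun z : HomEps.total (tensorEpsObj N) ×
      HomEps.total (tensorEpsObj M) => z.2.1.lin e) h3⟩

/-- The tensor product with `ε` of a cone. -/
lemma TensorEps.exists_cone : ∃ ξ : TensorEps (DGModule.cone g) →+ TensorEps N × TensorEps M,
    Function.Bijective ξ ∧ ∀ x e, ξ (tmul _ x e) = (tmul N x.1 e, tmul M x.2 e) := by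
  have h2 : ∀ (s : Sym ρ) (e : Eps ρ), AddMonoidHom.id _ (s • e) = s • AddMonoidHom.id _ e :=
    fun _ _ => rfl
  let p₁ : TensorEps (DGModule.cone g) →+ TensorEps N :=
    map (DGModule.cone g) (AddMonoidHom.fst N.carrier M.carrier) (AddMonoidHom.id _) id
      (fun s m => rfl) h2
  let p₂ : TensorEps (DGModule.cone g) →+ TensorEps M :=
    map (DGModule.cone g) (AddMonoidHom.snd N.carrier M.carrier) (AddMonoidHom.id _) id
      (fun s m => rfl) h2
  let i₁ : TensorEps N →+ TensorEps (DGModule.cone g) :=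
    map N (N := DGModule.cone g) (AddMonoidHom.inl N.carrier M.carrier) (AddMonoidHom.id _) id
      (fun s m => Prod.ext rfl (smul_zero s).symm) h2
  let i₂ : TensorEps M →+ TensorEps (DGModule.cone g) :=
    map M (N := DGModule.cone g) (AddMonoidHom.inr N.carrier M.carrier) (AddMonoidHom.id _) id
      (fun s m => Prod.ext (smul_zero s).symm rfl) h2
  have hz : ∀ (P : DGSymQ ρ) (e : Eps ρ), tmul P 0 e = 0 := fun P e => TensorProduct.zero_tmul _ _
  have h11 : p₁.comp i₁ = AddMonoidHom.id _ := hom_ext fun m e => rfl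
  have h22 : p₂.comp i₂ = AddMonoidHom.id _ := hom_ext fun m e => rfl
  have h12 : p₁.comp i₂ = 0 := hom_ext fun m e => hz N e
  have h21 : p₂.comp i₁ = 0 := hom_ext fun m e => hz M e
  have h3 : i₁.comp p₁ + i₂.comp p₂ = AddMonoidHom.id _ := hom_ext fun x e => by
    change tmul (DGModule.cone g) (x.1, 0) e + tmul (DGModule.cone g) (0, x.2) e = tmul _ x e
    refine (add_tmul (M := DGModule.cone g) (x.1, 0) (0, x.2) e).symm.trans ?_
    exact congrArg (fun y => tmul (DGModule.cone g) y e) (Prod.ext (add_zero _) (zero_add _))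
  refine ⟨p₁.prod p₂, ⟨fun x y h => ?_, fun ⟨a, b⟩ => ⟨i₁ a + i₂ b, Prod.ext ?_ ?_⟩⟩,
    fun x e => rfl⟩
  · have hx := DFunLike.congr_fun h3 x
    have hy := DFunLike.congr_fun h3 y
    have e1 : p₁ x = p₁ y := congrArg Prod.fst h
    have e2 : p₂ x = p₂ y := congrArg Prod.snd h
    refine hx.symm.trans (Eq.trans ?_ hy)
    change i₁ (p₁ x) + i₂ (p₂ x) = i₁ (p₁ y) + i₂ (p₂ y)
    rw [e1, e2]
  · refine (map_add p₁ _ _).trans ?_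
    exact (congrArg₂ (· + ·) (DFunLike.congr_fun h11 a) (DFunLike.congr_fun h12 b)).trans
      (add_zero a)
  · refine (map_add p₂ _ _).trans ?_
    exact (congrArg₂ (· + ·) (DFunLike.congr_fun h21 a) (DFunLike.congr_fun h22 b)).trans
      (zero_add b)

instance : QuasiIso (tensorEpsCone g) := by
  rw [quasiIso_iff_tot]
  refine QuasiIsoDiff.of_bijective (fun x => Tot.map_d _ _) ?_
  obtain ⟨ξ, hξ, hξ'⟩ := TensorEps.exists_cone g
  let θ : TensorEps (DGModule.cone g) →+ Tot (mappingCone ((tensorEps ρ).map g)) :=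
    (Tot.map (tensorEpsCone g)).toAddMonoidHom.comp (TensorEps.toTot _)
  have h1 : (Tot.coneSnd ((tensorEps ρ).map g)).toAddMonoidHom.comp θ =
      ((TensorEps.toTot N).comp (AddMonoidHom.fst _ _)).comp ξ := TensorEps.hom_ext fun x e =>
    ((tensorEpsCone_unit g x e).1).trans (congrArg (fun z => TensorEps.toTot N z.1) (hξ' x e)).symm
  have h2 : (Tot.coneFst ((tensorEps ρ).map g)).toAddMonoidHom.comp θ =
      ((TensorEps.toTot M).comp (AddMonoidHom.snd _ _)).comp ξ := TensorEps.hom_ext fun x e =>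
    ((tensorEpsCone_unit g x e).2).trans (congrArg (fun z => TensorEps.toTot M z.2) (hξ' x e)).symm
  have hθ : Function.Bijective θ := by
    constructor
    · intro x y h
      refine hξ.1 (Prod.ext ((TensorEps.toTot_bijective N).1 ?_)
        ((TensorEps.toTot_bijective M).1 ?_))
      · exact (DFunLike.congr_fun h1 x).symm.trans ((congrArg (Tot.coneSnd _) h).trans
          (DFunLike.congr_fun h1 y))
      · exact (DFunLike.congr_fun h2 x).symm.trans ((congrArg (Tot.coneFst _) h).trans
          (DFunLike.congr_fun h2 y))
    · intro t
      obtain ⟨a, ha⟩ := (TensorEps.toTot_bijective N).2 (Tot.coneSnd _ t)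
      obtain ⟨b, hb⟩ := (TensorEps.toTot_bijective M).2 (Tot.coneFst _ t)
      obtain ⟨x, hx⟩ := hξ.2 (a, b)
      refine ⟨x, Tot.cone_ext _ ?_ ?_⟩
      · exact (DFunLike.congr_fun h2 x).trans ((congrArg (fun z => TensorEps.toTot M z.2) hx).trans hb)
      · exact (DFunLike.congr_fun h1 x).trans ((congrArg (fun z => TensorEps.toTot N z.1) hx).trans ha)
  exact (Function.Bijective.of_comp_iff _ (TensorEps.toTot_bijective _)).1 hθ

lemma tensorEps_map_inl : (tensorEps ρ).map (DGModule.coneTriangle g).mor₂ ≫ tensorEpsCone g =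
    CochainComplex.mappingCone.inr ((tensorEps ρ).map g) :=
  Tot.hom_ext fun (t : Tot (tensorEpsObj N)) => by
    obtain ⟨t, rfl⟩ := (TensorEps.toTot_bijective N).2 t
    refine (Tot.map_comp _ _ _).trans ?_
    refine (congrArg _ (TensorEps.toTot_mapHom (DGModule.coneTriangle g).mor₂ t).symm).trans ?_
    let a : TensorEps N →+ _ := ((Tot.map (tensorEpsCone g)).toAddMonoidHom.comp
      (TensorEps.toTot _)).comp (TensorEps.mapHom (DGModule.coneTriangle g).mor₂).toAddMonoidHom
    let b : TensorEps N →+ _ := (Tot.map (CochainComplex.mappingCone.inr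
      ((tensorEps ρ).map g))).toAddMonoidHom.comp (TensorEps.toTot N)
    refine DFunLike.congr_fun (f := a) (g := b) (TensorEps.hom_ext fun n e => ?_) t
    have h := tensorEpsCone_unit g ((n, 0) : N.carrier × M.carrier) e
    refine Tot.cone_ext _ (h.2.trans ?_) (h.1.trans ?_)
    · refine Eq.trans ?_ (Tot.coneFst_inr _ _).symm
      exact (congrArg _ (TensorProduct.zero_tmul _ _)).trans (map_zero (TensorEps.toTot M))
    · exact (Tot.coneSnd_inr _ _).symm

lemma tensorEpsCone_mor₃ : tensorEpsCone g ≫ Tot.coneδ ((tensorEps ρ).map g) =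
    (tensorEps ρ).map (DGModule.coneTriangle g).mor₃ ≫ tensorEpsShift M :=
  Tot.hom_ext fun (t : Tot (tensorEpsObj (DGModule.cone g))) => by
    obtain ⟨t, rfl⟩ := (TensorEps.toTot_bijective (DGModule.cone g)).2 t
    refine (Tot.unshift_bijective (tensorEpsObj M) 1).1 ?_
    refine (congrArg _ (Tot.map_comp _ _ _)).trans (Eq.trans ?_ (congrArg _ (Tot.map_comp _ _ _)).symm)
    refine (Tot.unshift_coneδ _ _).trans (Eq.trans ?_ (congrArg (fun s => Tot.unshift _ 1
      (Tot.map (tensorEpsShift M) s)) (TensorEps.toTot_mapHom (DGModule.coneTriangle g).mor₃ t)))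
    let a : TensorEps (DGModule.cone g) →+ _ := (Tot.coneFst _).toAddMonoidHom.comp
      ((Tot.map (tensorEpsCone g)).toAddMonoidHom.comp (TensorEps.toTot _))
    let b : TensorEps (DGModule.cone g) →+ _ := ((Tot.unshift (tensorEpsObj M) 1).toAddMonoidHom.comp
      (Tot.map (tensorEpsShift M)).toAddMonoidHom).comp ((TensorEps.toTot (M.shift 1)).comp
        (TensorEps.mapHom (DGModule.coneTriangle g).mor₃).toAddMonoidHom)
    refine DFunLike.congr_fun (f := a) (g := b) (TensorEps.hom_ext fun x e => ?_) t
    refine (tensorEpsCone_unit g x e).2.trans ?_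
    refine Eq.trans ?_ (tensorEpsShift_toTot M (-x.2) e).symm
    rw [neg_eq_of_charTwo (F := F)]

end cone

end BGG

/-! ## Exactness of the derived functors -/

namespace CategoryTheory

open Pretriangulated

/-- The natural transformation defining a left derived functor is compatible with shifts if this
holds for the right adjoints. -/
lemma commShift_of_derived_adjunction {C₀ D₀ C D A : Type*} [Category C₀] [Category D₀] [Category C]
    [Category D] [AddMonoid A] [HasShift C₀ A] [HasShift D₀ A] [HasShift C A] [HasShift D A]
    {T : C₀ ⥤ D₀} {H : D₀ ⥤ C₀} {L : C ⥤ D} {R : D ⥤ C} (adj₀ : T ⊣ H) (adj : L ⊣ R)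
    {P : C₀ ⥤ C} {P' : D₀ ⥤ D} [T.CommShift A] [H.CommShift A] [L.CommShift A] [R.CommShift A]
    [P.CommShift A] [P'.CommShift A] [adj₀.CommShift A] [adj.CommShift A]
    (α : P ⋙ L ⟶ T ⋙ P') (β : H ⋙ P ⟶ P' ⋙ R) [NatTrans.CommShift β A]
    (h : ∀ M, adj.unit.app (P.obj M) ≫ R.map (α.app M) =
      P.map (adj₀.unit.app M) ≫ β.app (T.obj M)) : NatTrans.CommShift α A := by
  let ν : P ⟶ (T ⋙ P') ⋙ R := P.leftUnitor.symm.hom ≫ Functor.whiskerRight adj₀.unit P ≫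
    (Functor.associator _ _ _).hom ≫ Functor.whiskerLeft T β ≫ (Functor.associator _ _ _).symm.hom
  have hν : NatTrans.CommShift ν A := by
    dsimp only [ν]
    infer_instance
  let α' : P ⋙ L ⟶ T ⋙ P' := Functor.whiskerRight ν L ≫ (Functor.associator _ _ _).hom ≫
    Functor.whiskerLeft (T ⋙ P') adj.counit ≫ (T ⋙ P').rightUnitor.hom
  have hα' : NatTrans.CommShift α' A := by
    dsimp only [α']
    infer_instance
  have : α = α' := by
    ext M
    have h1 : ν.app M = P.map (adj₀.unit.app M) ≫ β.app (T.obj M) := by simp [ν]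
    have h2 : α'.app M = L.map (ν.app M) ≫ adj.counit.app (P'.obj (T.obj M)) := by simp [α']
    rw [h2, h1, ← h, L.map_comp, Category.assoc]
    have h3 : L.map (R.map (α.app M)) ≫ adj.counit.app (P'.obj (T.obj M)) =
        adj.counit.app _ ≫ α.app M := adj.counit.naturality (α.app M)
    rw [h3, Adjunction.left_triangle_components_assoc]
  rw [this]
  exact hα'

/-- A natural transformation compatible with shifts induces morphisms of triangles. -/
def mapTriangleHom {C D : Type*} [Category C] [Category D] [HasShift C ℤ]
    [HasShift D ℤ] {F G : C ⥤ D} [F.CommShift ℤ] [G.CommShift ℤ] (α : F ⟶ G)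
    [NatTrans.CommShift α ℤ] (T : Triangle C) : F.mapTriangle.obj T ⟶ G.mapTriangle.obj T where
  hom₁ := α.app T.obj₁
  hom₂ := α.app T.obj₂
  hom₃ := α.app T.obj₃
  comm₁ := α.naturality _
  comm₂ := α.naturality _
  comm₃ := by
    change (F.map T.mor₃ ≫ (F.commShiftIso (1 : ℤ)).hom.app T.obj₁) ≫ (α.app T.obj₁)⟦(1 : ℤ)⟧' =
      α.app T.obj₃ ≫ G.map T.mor₃ ≫ (G.commShiftIso (1 : ℤ)).hom.app T.obj₁
    rw [Category.assoc, NatTrans.shift_app_comm, NatTrans.naturality_assoc]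

end CategoryTheory

namespace DGModule

variable {R : Type u} [Ring R] {𝒜 : ℤ → AddSubgroup R}

/-- The morphism of mapping cone triangles of a commutative square. -/
def coneTriangleMap {M N M' N' : DGModule R 𝒜} {f : M ⟶ N} {f' : M' ⟶ N'} (a : M ⟶ M')
    (b : N ⟶ N') (h : f ≫ b = a ≫ f') : coneTriangle f ⟶ coneTriangle f' where
  hom₁ := a
  hom₂ := b
  hom₃ :=
    { toLin := b.toLin.prodMap a.toLin
      map_mem := fun h => ⟨b.map_mem h.1, a.map_mem h.2⟩
      comm := fun x => by
        have h' : b.toLin (f.toLin x.2) = f'.toLin (a.toLin x.2) :=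
          congrArg (fun k => Hom.toLin k x.2) h
        refine Prod.ext ?_ ?_
        · refine (map_add b.toLin (N.d x.1) (f.toLin x.2)).trans ?_
          rw [b.comm, h']
          rfl
        · refine (map_neg a.toLin (M.d x.2)).trans ?_
          rw [a.comm]
          rfl }
  comm₁ := h
  comm₂ := hom_ext fun n => Prod.ext rfl (map_zero a.toLin)
  comm₃ := hom_ext fun x => map_neg a.toLin x.2

lemma quasiIso_coneTriangleMap {M N M' N' : DGModule R 𝒜} {f : M ⟶ N} {f' : M' ⟶ N'} (a : M ⟶ M')
    (b : N ⟶ N') (h : f ≫ b = a ≫ f') (ha : quasiIso R 𝒜 a) (hb : quasiIso R 𝒜 b) :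
    quasiIso R 𝒜 (coneTriangleMap a b h).hom₃ := by
  rw [quasiIso_iff_diff] at ha hb ⊢
  exact QuasiIsoDiff.coneDiff (u := a.toLin.toAddMonoidHom) (v := b.toLin.toAddMonoidHom)
    (f := f.toLin.toAddMonoidHom) (f' := f'.toLin.toAddMonoidHom) M'.d_d N'.d_d f'.comm f.comm M.d_d a.comm b.comm
    (fun x => congrArg (fun k => Hom.toLin k x) h) ha hb

end DGModule

namespace BGG

variable [Module.Finite F V] [CharP F 2] (ρ : Representation F Q V)
  [HasDerivedCategory.{w} (ModuleCat.{u} (LamQ ρ)ᵐᵒᵖ)]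

open Pretriangulated

instance : Localization.Lifting DerivedCategory.Q (HomologicalComplex.quasiIso
    (ModuleCat.{u} (LamQ ρ)ᵐᵒᵖ) (ComplexShape.up ℤ)) (homEps ρ ⋙ QSym ρ) (rightDer ρ) :=
  ⟨(rightDerIso ρ).symm⟩

instance : (rightDer ρ).CommShift ℤ :=
  Functor.commShiftOfLocalization DerivedCategory.Q (HomologicalComplex.quasiIso
    (ModuleCat.{u} (LamQ ρ)ᵐᵒᵖ) (ComplexShape.up ℤ)) ℤ (homEps ρ ⋙ QSym ρ) (rightDer ρ)

instance : NatTrans.CommShift (rightDerIso ρ).symm.hom ℤ :=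
  NatTrans.commShift_iso_hom_of_localization DerivedCategory.Q (HomologicalComplex.quasiIso
    (ModuleCat.{u} (LamQ ρ)ᵐᵒᵖ) (ComplexShape.up ℤ)) ℤ (homEps ρ ⋙ QSym ρ) (rightDer ρ)

instance : NatTrans.CommShift (rightDerIso ρ).hom ℤ :=
  NatTrans.CommShift.of_iso_symm (rightDerIso ρ).symm ℤ

instance : (leftDer ρ).CommShift ℤ := (derAdj ρ).leftAdjointCommShift ℤ

instance : (derAdj ρ).CommShift ℤ := (derAdj ρ).commShift_of_rightAdjoint ℤ

instance : NatTrans.CommShift (leftDerHom ρ) ℤ :=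
  commShift_of_derived_adjunction (tensorHomAdj ρ) (derAdj ρ) (leftDerHom ρ) (rightDerIso ρ).hom
    (derAdj_unit ρ)

/-- The right derived functor is exact. -/
lemma rightDer_exact : IsExact distinguishedTriangles
    (DGModule.distinguished (SymQ ρ) (symQDeg ρ)) (rightDer ρ) := by
  intro T hT
  obtain ⟨X, Y, φ, ⟨e⟩⟩ := (DerivedCategory.mem_distTriang_iff T).1 hT
  exact ⟨homEpsObj X, homEpsObj Y, (homEps ρ).map φ, ⟨(rightDer ρ).mapTriangle.mapIso e ≪≫
    (Functor.mapTriangleCompIso _ _).symm.app _ ≪≫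
    (Functor.mapTriangleIso (rightDerIso ρ).symm).app _ ≪≫
    (Functor.mapTriangleCompIso _ _).app _ ≪≫ (QSym ρ).mapTriangle.mapIso (homEpsTriangle φ)⟩⟩

/-- The images of mapping cone triangles under `- ⊗_S ε`, up to quasi-isomorphism. -/
def tensorEpsTriangle {M N : DGSymQ ρ} (g : M ⟶ N) :
    (tensorEps ρ).mapTriangle.obj (DGModule.coneTriangle g) ⟶
      CochainComplex.mappingCone.triangle ((tensorEps ρ).map g) where
  hom₁ := 𝟙 _
  hom₂ := 𝟙 _
  hom₃ := tensorEpsCone g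
  comm₁ := (Category.comp_id _).trans (Category.id_comp _).symm
  comm₂ := (tensorEps_map_inl g).trans (Category.id_comp _).symm
  comm₃ := by
    have h : (𝟙 (tensorEpsObj M))⟦(1 : ℤ)⟧' = 𝟙 _ :=
      CategoryTheory.Functor.map_id _ _
    exact (congrArg (_ ≫ ·) h).trans ((Category.comp_id _).trans (tensorEpsCone_mor₃ g).symm)

/-- The left derived functor is exact. -/
lemma leftDer_exact : IsExact (DGModule.distinguished (SymQ ρ) (symQDeg ρ))
    distinguishedTriangles (leftDer ρ) := by
  rintro T ⟨M, N, f, ⟨e⟩⟩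
  let φ := (kos ρ).map f
  let g := (finEps ρ).map φ
  let r : DGModule.coneTriangle g ⟶ DGModule.coneTriangle f :=
    DGModule.coneTriangleMap ((res ρ).app M) ((res ρ).app N) ((res ρ).naturality f)
  have hr : IsIso ((QSym ρ).mapTriangle.map r) := Triangle.isIso_of_isIsos _
    (inferInstanceAs (IsIso ((QSym ρ).map ((res ρ).app M))))
    (inferInstanceAs (IsIso ((QSym ρ).map ((res ρ).app N))))
    (Localization.inverts (QSym ρ) (DGModule.quasiIso (SymQ ρ) (symQDeg ρ)) _
      (DGModule.quasiIso_coneTriangleMap _ _ _ (quasiIso_resHom M) (quasiIso_resHom N)))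
  have hθ : IsIso (DerivedCategory.Q.mapTriangle.map (tensorEpsTriangle ρ g)) :=
    Triangle.isIso_of_isIsos _ (inferInstanceAs (IsIso (DerivedCategory.Q.map (𝟙 _))))
      (inferInstanceAs (IsIso (DerivedCategory.Q.map (𝟙 _))))
      (inferInstanceAs (IsIso (DerivedCategory.Q.map (tensorEpsCone g))))
  have h₃ : IsIso ((leftDerHom ρ).app (DGModule.cone g)) :=
    (NatTrans.isIso_app_iff_of_iso (leftDerHom ρ) (@asIso _ _ _ _ (finEpsCone φ) inferInstance)).1
      (isIso_leftDerHom_finEps ρ _)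
  have hα : IsIso (mapTriangleHom (leftDerHom ρ) (DGModule.coneTriangle g)) :=
    Triangle.isIso_of_isIsos _ (isIso_leftDerHom_finEps ρ _) (isIso_leftDerHom_finEps ρ _) h₃
  refine (DerivedCategory.mem_distTriang_iff _).2 ⟨_, _, (tensorEps ρ).map g,
    ⟨(leftDer ρ).mapTriangle.mapIso (e ≪≫ (asIso ((QSym ρ).mapTriangle.map r)).symm) ≪≫
    (Functor.mapTriangleCompIso _ _).symm.app _ ≪≫
    asIso (mapTriangleHom (leftDerHom ρ) (DGModule.coneTriangle g)) ≪≫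
    (Functor.mapTriangleCompIso _ _).app _ ≪≫
    asIso (DerivedCategory.Q.mapTriangle.map (tensorEpsTriangle ρ g))⟩⟩

end BGG

/-! ## Homology on the derived category -/

namespace DGModule

open Pretriangulated

variable (R : Type u) [Ring R] (𝒜 : ℤ → AddSubgroup R)

/-- Total homology as a functor. -/
def homologyFunctor : DGModule R 𝒜 ⥤ ModuleCat.{u} Rᵐᵒᵖ where
  obj M := ModuleCat.of _ M.homology
  map f := ModuleCat.ofHom (homologyMap f)
  map_id M := ModuleCat.hom_ext (Submodule.linearMap_qext _ rfl)
  map_comp f g := ModuleCat.hom_ext (Submodule.linearMap_qext _ rfl)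

lemma homologyFunctor_inverts : (quasiIso R 𝒜).IsInvertedBy (homologyFunctor R 𝒜) := fun _ _ _ hf =>
  (ConcreteCategory.isIso_iff_bijective _).2 hf

/-- Total homology on the derived category. -/
def derivedHomology : Derived R 𝒜 ⥤ ModuleCat.{u} Rᵐᵒᵖ :=
  Localization.Construction.lift (homologyFunctor R 𝒜) (homologyFunctor_inverts R 𝒜)

variable {R 𝒜}

lemma derivedHomology_map {M N : DGModule R 𝒜} (f : M ⟶ N) :
    (derivedHomology R 𝒜).map ((quasiIso R 𝒜).Q.map f) = (homologyFunctor R 𝒜).map f :=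
  (Functor.congr_hom (Localization.Construction.fac (homologyFunctor R 𝒜)
    (homologyFunctor_inverts R 𝒜)) f).trans ((Category.id_comp _).trans (Category.comp_id _))

lemma isIso_Q_map_of_isIso_derivedHomology {M N : DGModule R 𝒜} {f : M ⟶ N}
    (h : IsIso ((derivedHomology R 𝒜).map ((quasiIso R 𝒜).Q.map f))) :
    IsIso ((quasiIso R 𝒜).Q.map f) := by
  rw [derivedHomology_map] at h
  exact Localization.inverts _ (quasiIso R 𝒜) f ((ConcreteCategory.isIso_iff_bijective _).1 h)

lemma exact_homologyMap {M N P : DGModule R 𝒜} {f : M ⟶ N} {g : N ⟶ P}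
    (h : ∀ m, M.d m = 0 → ∃ p, P.d p = g.toLin (f.toLin m))
    (h' : ∀ n, N.d n = 0 → (∃ p, P.d p = g.toLin n) →
      ∃ m, M.d m = 0 ∧ ∃ y, N.d y = f.toLin m - n) :
    Function.Exact (homologyMap f) (homologyMap g) := by
  intro y
  obtain ⟨⟨n, hn⟩, rfl⟩ := Submodule.Quotient.mk_surjective _ y
  constructor
  · intro hy
    obtain ⟨m, hm, y, hy⟩ := h' n hn ((Submodule.Quotient.mk_eq_zero _).1 hy)
    exact ⟨Submodule.Quotient.mk ⟨m, hm⟩, (Submodule.Quotient.eq _).2 ⟨y, hy⟩⟩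
  · rintro ⟨x, hx⟩
    obtain ⟨⟨m, hm⟩, rfl⟩ := Submodule.Quotient.mk_surjective _ x
    rw [← hx]
    exact (Submodule.Quotient.mk_eq_zero _).2 (h m hm)

section

variable {M N : DGModule R 𝒜} (f : M ⟶ N)

lemma shift_one_d (m : M.carrier) : (M.shift 1).d m = -M.d m := by
  change (1 : ℤ).negOnePow • M.d m = -M.d m
  rw [Int.negOnePow_one, Units.neg_smul, one_smul]

lemma exact_cone₂ : Function.Exact (homologyMap f) (homologyMap (coneTriangle f).mor₂) := by
  refine exact_homologyMap (fun (m : M.carrier) hm => ?_) fun (n : N.carrier) hn hp => ?_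
  · change ∃ p : N.carrier × M.carrier, (N.d p.1 + f.toLin p.2, -M.d p.2) = (f.toLin m, 0)
    exact ⟨(0, m), by simp [hm]⟩
  · obtain ⟨p, hp⟩ : ∃ p : N.carrier × M.carrier, (N.d p.1 + f.toLin p.2, -M.d p.2) = (n, 0) := hp
    rw [Prod.mk.injEq, neg_eq_zero] at hp
    exact ⟨p.2, hp.2, -p.1, by rw [map_neg, ← hp.1]; abel⟩

lemma exact_cone₃ : Function.Exact (homologyMap (coneTriangle f).mor₂)
    (homologyMap (coneTriangle f).mor₃) := by
  refine exact_homologyMap (fun (n : N.carrier) hn => ?_)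
    fun (x : N.carrier × M.carrier) hx ⟨(p : M.carrier), hp⟩ => ?_
  · exact ⟨(0 : M.carrier), (map_zero (M.shift 1).d).trans (neg_zero (G := M.carrier)).symm⟩
  · have hp : -M.d p = -x.2 := (shift_one_d p).symm.trans hp
    rw [neg_inj] at hp
    have hx : N.d x.1 + f.toLin x.2 = 0 := congrArg Prod.fst hx
    change ∃ n : N.carrier, N.d n = 0 ∧ ∃ y : N.carrier × M.carrier,
      (N.d y.1 + f.toLin y.2, -M.d y.2) = (n, 0) - x
    refine ⟨x.1 + f.toLin p, by rw [map_add, ← f.comm, hp, hx], (0, p), Prod.ext ?_ ?_⟩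
    · change N.d 0 + f.toLin p = (x.1 + f.toLin p) - x.1
      rw [map_zero]; abel
    · change -M.d p = 0 - x.2
      rw [hp, zero_sub]

lemma exact_cone₁ : Function.Exact (homologyMap (coneTriangle f).mor₃)
    (homologyMap ((shiftFunctor' 1).map f)) := by
  refine exact_homologyMap (fun (x : N.carrier × M.carrier) hx => ⟨(-x.1 : N.carrier), ?_⟩)
    fun (m : M.carrier) hm ⟨(n : N.carrier), hn⟩ => ?_
  · have hx : N.d x.1 + f.toLin x.2 = 0 := congrArg Prod.fst hx
    refine (shift_one_d (M := N) (-x.1)).trans ?_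
    change - N.d (-x.1) = f.toLin (-x.2)
    rw [map_neg, map_neg, neg_neg, eq_neg_of_add_eq_zero_left hx]
  · have hm : M.d m = 0 := neg_eq_zero.1 ((shift_one_d m).symm.trans hm)
    have hn : -N.d n = f.toLin m := (shift_one_d n).symm.trans hn
    change ∃ x : N.carrier × M.carrier, (N.d x.1 + f.toLin x.2, -M.d x.2) = 0 ∧
      ∃ y : M.carrier, (M.shift 1).d y = -x.2 - m
    refine ⟨(-n, -m), Prod.ext ?_ ?_, 0, ?_⟩
    · change N.d (-n) + f.toLin (-m) = 0
      rw [map_neg, map_neg, hn, add_neg_cancel]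
    · change -M.d (-m) = 0
      rw [map_neg, hm, neg_zero, neg_zero]
    · refine (map_zero (M.shift 1).d).trans ?_
      change 0 = - -m - m
      rw [neg_neg, sub_self]

end

section

variable {M N M' N' : DGModule R 𝒜} {f : M ⟶ N} {f' : M' ⟶ N'}

/-- The five lemma for mapping cone triangles. -/
lemma isIso_derivedHomology_map_cone {a₁ : (quasiIso R 𝒜).Q.obj M ⟶ (quasiIso R 𝒜).Q.obj M'}
    {a₂ : (quasiIso R 𝒜).Q.obj N ⟶ (quasiIso R 𝒜).Q.obj N'}
    {a₃ : (quasiIso R 𝒜).Q.obj (cone f) ⟶ (quasiIso R 𝒜).Q.obj (cone f')}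
    (h₁ : IsIso a₁) (h₂ : IsIso a₂)
    (s₁ : (quasiIso R 𝒜).Q.map f ≫ a₂ = a₁ ≫ (quasiIso R 𝒜).Q.map f')
    (s₂ : (quasiIso R 𝒜).Q.map (coneTriangle f).mor₂ ≫ a₃ =
      a₂ ≫ (quasiIso R 𝒜).Q.map (coneTriangle f').mor₂)
    (s₃ : ((quasiIso R 𝒜).Q.map (coneTriangle f).mor₃ ≫
      ((quasiIso R 𝒜).Q.commShiftIso (1 : ℤ)).hom.app M) ≫ a₁⟦(1 : ℤ)⟧' =
      a₃ ≫ (quasiIso R 𝒜).Q.map (coneTriangle f').mor₃ ≫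
        ((quasiIso R 𝒜).Q.commShiftIso (1 : ℤ)).hom.app M') :
    IsIso ((derivedHomology R 𝒜).map a₃) := by
  let Q := (quasiIso R 𝒜).Q
  let H := derivedHomology R 𝒜
  let c (P : DGModule R 𝒜) : Q.obj (P⟦(1 : ℤ)⟧) ≅ (Q.obj P)⟦(1 : ℤ)⟧ := (Q.commShiftIso (1 : ℤ)).app P
  have hc {P P' : DGModule R 𝒜} (g : P ⟶ P') : Q.map (g⟦(1 : ℤ)⟧') ≫ (c P').hom =
      (c P).hom ≫ (Q.map g)⟦(1 : ℤ)⟧' := (Q.commShiftIso (1 : ℤ)).hom.naturality g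
  let t : Q.obj (cone f) ⟶ Q.obj (M⟦(1 : ℤ)⟧) := Q.map (coneTriangle f).mor₃
  let t' : Q.obj (cone f') ⟶ Q.obj (M'⟦(1 : ℤ)⟧) := Q.map (coneTriangle f').mor₃
  let a₄ := (c M).hom ≫ a₁⟦(1 : ℤ)⟧' ≫ (c M').inv
  let a₅ := (c N).hom ≫ a₂⟦(1 : ℤ)⟧' ≫ (c N').inv
  have s₃ : t ≫ a₄ = a₃ ≫ t' := by
    have h : (t ≫ (c M).hom) ≫ a₁⟦(1 : ℤ)⟧' = a₃ ≫ t' ≫ (c M').hom := s₃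
    rw [← cancel_mono (c M').hom]
    simpa [a₄] using h
  have s₄ : Q.map (f⟦(1 : ℤ)⟧') ≫ a₅ = a₄ ≫ Q.map (f'⟦(1 : ℤ)⟧') := by
    rw [← cancel_mono (c N').hom]
    have h : (Q.map f)⟦(1 : ℤ)⟧' ≫ a₂⟦(1 : ℤ)⟧' = a₁⟦(1 : ℤ)⟧' ≫ (Q.map f')⟦(1 : ℤ)⟧' := by
      rw [← Functor.map_comp, s₁, Functor.map_comp]
    simp only [a₅, a₄, Category.assoc, Iso.inv_hom_id, Category.comp_id, hc, reassoc_of% (hc f),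
      Iso.inv_hom_id_assoc, h]
  have hs {A B C D : DGModule R 𝒜} {x : A ⟶ B} {y : C ⟶ D} {a : Q.obj A ⟶ Q.obj C}
      {b : Q.obj B ⟶ Q.obj D} (h : Q.map x ≫ b = a ≫ Q.map y) :
      (homologyMap y).toAddMonoidHom.comp (H.map a).hom.toAddMonoidHom =
        AddMonoidHom.comp (H.map b).hom.toAddMonoidHom (homologyMap x).toAddMonoidHom := by
    have := congrArg H.map h
    rw [H.map_comp, H.map_comp, derivedHomology_map, derivedHomology_map] at this
    exact AddMonoidHom.ext fun z => (congr($this z)).symm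
  have hb {A B : DGModule R 𝒜} {a : Q.obj A ⟶ Q.obj B} (h : IsIso a) :
      Function.Bijective (H.map a).hom :=
    (ConcreteCategory.isIso_iff_bijective (H.map a)).1 inferInstance
  have h₄ : IsIso a₄ := IsIso.comp_isIso' inferInstance (IsIso.comp_isIso' inferInstance inferInstance)
  have h₅ : IsIso a₅ := IsIso.comp_isIso' inferInstance (IsIso.comp_isIso' inferInstance inferInstance)
  exact (ConcreteCategory.isIso_iff_bijective _).2
    (AddMonoidHom.bijective_of_surjective_of_bijective_of_bijective_of_injective
      (homologyMap f).toAddMonoidHom (homologyMap (coneTriangle f).mor₂).toAddMonoidHom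
      (homologyMap (coneTriangle f).mor₃).toAddMonoidHom
      (homologyMap ((shiftFunctor' 1).map f)).toAddMonoidHom
      (homologyMap f').toAddMonoidHom (homologyMap (coneTriangle f').mor₂).toAddMonoidHom
      (homologyMap (coneTriangle f').mor₃).toAddMonoidHom
      (homologyMap ((shiftFunctor' 1).map f')).toAddMonoidHom
      (H.map a₁).hom.toAddMonoidHom (H.map a₂).hom.toAddMonoidHom (H.map a₃).hom.toAddMonoidHom
      (H.map a₄).hom.toAddMonoidHom (H.map a₅).hom.toAddMonoidHom
      (hs s₁) (hs s₂) (hs s₃) (hs s₄)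
      (exact_cone₂ f) (exact_cone₃ f) (exact_cone₁ f) (exact_cone₂ f') (exact_cone₃ f')
      (exact_cone₁ f') (hb h₁).2 (hb h₂) (hb h₄) (hb h₅).1)

end

/-- The five lemma for distinguished triangles. -/
lemma isIso_derivedHomology_map {T T' : Triangle (Derived R 𝒜)} (hT : T ∈ distinguished R 𝒜)
    (hT' : T' ∈ distinguished R 𝒜) (φ : T ⟶ T') (h₁ : IsIso φ.hom₁) (h₂ : IsIso φ.hom₂) :
    IsIso ((derivedHomology R 𝒜).map φ.hom₃) := by
  obtain ⟨M, N, f, ⟨e⟩⟩ := hT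
  obtain ⟨M', N', f', ⟨e'⟩⟩ := hT'
  let ψ := e.inv ≫ φ ≫ e'.hom
  have i₁ : IsIso ψ.hom₁ := IsIso.comp_isIso' inferInstance (IsIso.comp_isIso' h₁ inferInstance)
  have i₂ : IsIso ψ.hom₂ := IsIso.comp_isIso' inferInstance (IsIso.comp_isIso' h₂ inferInstance)
  have key := isIso_derivedHomology_map_cone (f := f) (f' := f') i₁ i₂ ψ.comm₁ ψ.comm₂ ψ.comm₃
  have h₃ : φ.hom₃ = e.hom.hom₃ ≫ ψ.hom₃ ≫ e'.inv.hom₃ := by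
    have : φ = e.hom ≫ ψ ≫ e'.inv := by
      change φ = e.hom ≫ (e.inv ≫ φ ≫ e'.hom) ≫ e'.inv
      rw [Category.assoc, Category.assoc, Iso.hom_inv_id_assoc, Iso.hom_inv_id, Category.comp_id]
    exact congrArg TriangleMorphism.hom₃ this
  have h₄ : (derivedHomology R 𝒜).map φ.hom₃ = (derivedHomology R 𝒜).map e.hom.hom₃ ≫
      (derivedHomology R 𝒜).map ψ.hom₃ ≫ (derivedHomology R 𝒜).map e'.inv.hom₃ :=
    (congrArg _ h₃).trans (((derivedHomology R 𝒜).map_comp _ _).trans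
      (congrArg _ ((derivedHomology R 𝒜).map_comp _ _)))
  rw [h₄]
  exact IsIso.comp_isIso' inferInstance (IsIso.comp_isIso' key inferInstance)

end DGModule

/-! ## Zero objects and triangulated subcategories of `D(S ∗ Q)` -/

open Pretriangulated

lemma DGModule.isZero_Q_obj {R : Type u} [Ring R] {𝒜 : ℤ → AddSubgroup R} (Z : DGModule R 𝒜)
    [Subsingleton Z.carrier] : Limits.IsZero ((quasiIso R 𝒜).Q.obj Z) := by
  let Q := (quasiIso R 𝒜).Q
  let z (M : DGModule R 𝒜) : Z ⟶ M := ⟨0, fun _ => zero_mem _, fun _ => (map_zero M.d).symm⟩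
  let w (M : DGModule R 𝒜) : M ⟶ Z := ⟨0, fun _ => zero_mem _, fun _ => (map_zero Z.d).symm⟩
  let c₁ := (Functor.const (DGModule R 𝒜)).obj (Q.obj Z)
  let c₂ := (Functor.const (Derived R 𝒜)).obj (Q.obj Z)
  let _ : Localization.Lifting Q (quasiIso R 𝒜) c₁ c₂ := ⟨Iso.refl _⟩
  let s : c₁ ⟶ Q :=
    { app := fun M => Q.map (z M)
      naturality := fun M N f => by
        have h : z N = z M ≫ f := DGModule.hom_ext fun _ => (map_zero f.toLin).symm
        exact (Category.id_comp (Q.map (z N))).trans ((congrArg Q.map h).trans (Q.map_comp _ _)) }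
  let r : Q ⟶ c₁ :=
    { app := fun M => Q.map (w M)
      naturality := fun M N f => by
        have h : f ≫ w N = w M := DGModule.hom_ext fun _ => rfl
        exact (Q.map_comp _ _).symm.trans
          ((congrArg Q.map h).trans (Category.comp_id (Q.map (w M))).symm) }
  let s' : c₂ ⟶ 𝟭 _ := Localization.liftNatTrans Q (quasiIso R 𝒜) c₁ Q c₂ (𝟭 _) s
  let r' : 𝟭 _ ⟶ c₂ := Localization.liftNatTrans Q (quasiIso R 𝒜) Q c₁ (𝟭 _) c₂ r
  have hz : Q.map (z Z) = 𝟙 _ :=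
    (congrArg Q.map (DGModule.hom_ext fun _ => Subsingleton.elim _ _)).trans (Q.map_id Z)
  have hw : Q.map (w Z) = 𝟙 _ :=
    (congrArg Q.map (DGModule.hom_ext fun _ => Subsingleton.elim _ _)).trans (Q.map_id Z)
  have hs : s'.app (Q.obj Z) = 𝟙 (Q.obj Z) :=
    (Localization.liftNatTrans_app Q (quasiIso R 𝒜) c₁ Q c₂ (𝟭 _) s Z).trans
      ((Category.id_comp _).trans ((Category.comp_id _).trans hz))
  have hr : r'.app (Q.obj Z) = 𝟙 (Q.obj Z) :=
    (Localization.liftNatTrans_app Q (quasiIso R 𝒜) Q c₁ (𝟭 _) c₂ r Z).trans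
      ((Category.id_comp _).trans ((Category.comp_id _).trans hw))
  refine ⟨fun Y => ⟨⟨⟨s'.app Y⟩, fun f => ?_⟩⟩, fun Y => ⟨⟨⟨r'.app Y⟩, fun f => ?_⟩⟩⟩
  · have h : 𝟙 (Q.obj Z) ≫ s'.app Y = s'.app (Q.obj Z) ≫ f := s'.naturality f
    rw [hs, Category.id_comp] at h
    exact (h.trans (Category.id_comp f)).symm
  · have h : f ≫ r'.app (Q.obj Z) = r'.app Y ≫ 𝟙 (Q.obj Z) := r'.naturality f
    rw [hr] at h
    exact (Category.comp_id f).symm.trans (h.trans (Category.comp_id (r'.app Y)))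

/-- The module `H` over `A` is finite over `F` through `φ : F → A`. -/
def FiniteVia {F A : Type*} [Field F] [Ring A] (φ : F →+* A) (H : Type*) [AddCommGroup H]
    [Module A H] : Prop :=
  letI := Module.compHom H φ
  Module.Finite F H

lemma FiniteVia.of_exact {F A : Type*} [Field F] [Ring A] {φ : F →+* A} {X Y Z : Type*}
    [AddCommGroup X] [AddCommGroup Y] [AddCommGroup Z] [Module A X] [Module A Y] [Module A Z]
    {f : X →ₗ[A] Y} {g : Y →ₗ[A] Z} (h : Function.Exact f g) (hX : FiniteVia φ X)
    (hZ : FiniteVia φ Z) : FiniteVia φ Y := by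
  let _ := Module.compHom X φ
  let _ := Module.compHom Y φ
  let _ := Module.compHom Z φ
  let f' : X →ₗ[F] Y := { f with map_smul' := fun r x => map_smul f (φ r) x }
  let g' : Y →ₗ[F] Z := { g with map_smul' := fun r x => map_smul g (φ r) x }
  have : Module.Finite F X := hX
  have : Module.Finite F Z := hZ
  have hr : LinearMap.range f' = LinearMap.ker g' :=
    Submodule.ext fun y => (h y).symm
  have h₁ : (LinearMap.ker g').FG := hr ▸ Module.Finite.iff_fg.1 inferInstance
  have h₂ : (Submodule.map g' ⊤).FG := Module.Finite.iff_fg.1 inferInstance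
  exact ⟨Submodule.fg_of_fg_map_of_fg_inf_ker g' h₂ (by rwa [top_inf_eq])⟩

lemma FiniteVia.of_iso {F A : Type u} [Field F] [Ring A] {φ : F →+* A} {X Y : ModuleCat.{u} A}
    (e : X ≅ Y) (hX : FiniteVia φ X) : FiniteVia φ Y := by
  refine FiniteVia.of_exact (f := e.hom.hom) (g := (0 : Y →ₗ[A] PUnit)) (fun y => ?_) hX ?_
  · exact ⟨fun _ => ⟨e.inv.hom y, congr($(e.inv_hom_id) y)⟩, fun _ => rfl⟩
  · let _ := Module.compHom PUnit φ
    exact Module.Finite.of_finite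

namespace BGG

variable (ρ : Representation F Q V)

/-- The objects of `D(S ∗ Q)` with finite-dimensional total homology. -/
def hasFiniteHomology : ObjectProperty (DSymQ ρ) := fun X =>
  FiniteVia ((symToSymQ ρ).comp (algebraMap F (Sym ρ)))
    ((DGModule.derivedHomology (SymQ ρ) (symQDeg ρ)).obj X)

variable {ρ}

lemma hasFiniteHomology_of_iso {X Y : DSymQ ρ} (e : X ≅ Y) (h : hasFiniteHomology ρ X) :
    hasFiniteHomology ρ Y := FiniteVia.of_iso ((DGModule.derivedHomology _ _).mapIso e) h

lemma symPerfHf_iff (X : DSymQ ρ) : symPerfHf ρ X ↔ symPerf ρ X ∧ hasFiniteHomology ρ X :=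
  ⟨fun ⟨M, hM, hf, ⟨e⟩⟩ => ⟨⟨M, hM, ⟨e⟩⟩, hasFiniteHomology_of_iso e hf⟩,
    fun ⟨⟨M, hM, ⟨e⟩⟩, hf⟩ => ⟨M, hM, hasFiniteHomology_of_iso e.symm hf, ⟨e⟩⟩⟩

variable [Module.Finite F V] [CharP F 2]

lemma shift_d (M : DGSymQ ρ) (n : ℤ) : (M.shift n).d = M.d :=
  LinearMap.ext fun (m : M.carrier) => units_smul_of_charTwo (F := F) n.negOnePow (M.d m)

lemma hasFiniteHomology_shift {X : DSymQ ρ} (n : ℤ) (h : hasFiniteHomology ρ X) :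
    hasFiniteHomology ρ (X⟦n⟧) := by
  have := Localization.essSurj (QSym ρ) (DGModule.quasiIso (SymQ ρ) (symQDeg ρ))
  let M := (QSym ρ).objPreimage X
  let e : (QSym ρ).obj M ≅ X := (QSym ρ).objObjPreimageIso X
  have hM : HasFiniteHomology M := hasFiniteHomology_of_iso e.symm h
  have key (d' : M.carrier →ₗ[(SymQ ρ)ᵐᵒᵖ] M.carrier) (h : d' = M.d) :
      FiniteVia ((symToSymQ ρ).comp (algebraMap F (Sym ρ)))
        (LinearMap.ker d' ⧸ (LinearMap.range d').submoduleOf (LinearMap.ker d')) := by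
    subst h
    exact hM
  exact hasFiniteHomology_of_iso (((QSym ρ).commShiftIso n).app M ≪≫ (shiftFunctor _ n).mapIso e)
    (key _ (shift_d M n))

lemma hasFiniteHomology_cone {T : Triangle (DSymQ ρ)}
    (hT : T ∈ DGModule.distinguished (SymQ ρ) (symQDeg ρ)) (h₁ : hasFiniteHomology ρ T.obj₁)
    (h₂ : hasFiniteHomology ρ T.obj₂) : hasFiniteHomology ρ T.obj₃ := by
  obtain ⟨M, N, f, ⟨e⟩⟩ := hT
  have h₁' : hasFiniteHomology ρ ((QSym ρ).obj M) :=
    hasFiniteHomology_of_iso (Triangle.π₁.mapIso e) h₁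
  have h₂' : hasFiniteHomology ρ ((QSym ρ).obj N) :=
    hasFiniteHomology_of_iso (Triangle.π₂.mapIso e) h₂
  have h₁'' : hasFiniteHomology ρ ((QSym ρ).obj (M.shift 1)) :=
    hasFiniteHomology_of_iso (((QSym ρ).commShiftIso (1 : ℤ)).app M).symm
      (hasFiniteHomology_shift 1 h₁')
  exact hasFiniteHomology_of_iso (X := (QSym ρ).obj (DGModule.cone f)) (Triangle.π₃.mapIso e).symm
    (FiniteVia.of_exact (DGModule.exact_cone₃ f) h₂' h₁'')

lemma symPerf_shift {X : DSymQ ρ} (n : ℤ) (h : symPerf ρ X) : symPerf ρ (X⟦n⟧) := by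
  obtain ⟨M, ⟨m, k, b, hb⟩, ⟨e⟩⟩ := h
  refine ⟨M.shift n, ⟨m, fun i => k i - n, b, fun i => ?_⟩,
    ⟨((QSym ρ).commShiftIso n).app M ≪≫ (shiftFunctor _ n).mapIso e⟩⟩
  change b i ∈ M.deg (k i - n + n)
  rw [sub_add_cancel]
  exact hb i

variable (ρ) in
lemma symPerf_zero : ∃ Z : DSymQ ρ, Limits.IsZero Z ∧ symPerf ρ Z ∧ hasFiniteHomology ρ Z := by
  let Z : DGSymQ ρ :=
    { carrier := PUnit
      deg := fun _ => ⊤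
      isInternal := ⟨fun x y _ => DFinsupp.ext fun i => Subtype.ext (Subsingleton.elim (α := PUnit) _ _),
        fun m => ⟨DirectSum.of (fun _ : ℤ => (⊤ : AddSubgroup PUnit.{u + 1})) 0 ⟨m, trivial⟩, rfl⟩⟩
      smul_mem := fun _ _ => trivial
      d := 0
      d_mem := fun _ => trivial
      d_d := fun _ => rfl }
  have : Subsingleton Z.carrier := inferInstanceAs (Subsingleton PUnit)
  refine ⟨(QSym ρ).obj Z, DGModule.isZero_Q_obj Z, ⟨Z, ⟨0, fun _ => 0, Module.Basis.empty _,
    fun _ => trivial⟩, ⟨Iso.refl _⟩⟩, ?_⟩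
  change FiniteVia _ Z.homology
  let _ := Module.compHom Z.homology ((symToSymQ ρ).comp (algebraMap F (Sym ρ)))
  have : Subsingleton Z.homology := (Submodule.Quotient.mk_surjective _).subsingleton
  exact Module.Finite.of_finite

variable (ρ) [HasDerivedCategory.{w} (ModuleCat.{u} (LamQ ρ)ᵐᵒᵖ)]

/-- The objects on which the unit is an isomorphism are closed under cones. -/
lemma isIso_unit_cone {T : Triangle (DSymQ ρ)}
    (hT : T ∈ DGModule.distinguished (SymQ ρ) (symQDeg ρ))
    (h₁ : IsIso ((derAdj ρ).unit.app T.obj₁)) (h₂ : IsIso ((derAdj ρ).unit.app T.obj₂)) :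
    IsIso ((derAdj ρ).unit.app T.obj₃) := by
  let φ : T ⟶ (rightDer ρ).mapTriangle.obj ((leftDer ρ).mapTriangle.obj T) :=
    (Functor.mapTriangleIdIso _).inv.app T ≫ mapTriangleHom (derAdj ρ).unit T ≫
      (Functor.mapTriangleCompIso _ _).hom.app T
  have hφ₁ : φ.hom₁ = (derAdj ρ).unit.app T.obj₁ := by
    exact (Category.id_comp _).trans (Category.comp_id ((derAdj ρ).unit.app T.obj₁))
  have hφ₂ : φ.hom₂ = (derAdj ρ).unit.app T.obj₂ := by
    exact (Category.id_comp _).trans (Category.comp_id ((derAdj ρ).unit.app T.obj₂))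
  have hφ₃ : φ.hom₃ = (derAdj ρ).unit.app T.obj₃ := by
    exact (Category.id_comp _).trans (Category.comp_id ((derAdj ρ).unit.app T.obj₃))
  have key := DGModule.isIso_derivedHomology_map hT (rightDer_exact ρ _ (leftDer_exact ρ _ hT)) φ
    (hφ₁ ▸ h₁) (hφ₂ ▸ h₂)
  rw [hφ₃] at key
  have := Localization.essSurj (QSym ρ) (DGModule.quasiIso (SymQ ρ) (symQDeg ρ))
  let M := (QSym ρ).objPreimage T.obj₃
  let e : (QSym ρ).obj M ≅ T.obj₃ := (QSym ρ).objObjPreimageIso T.obj₃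
  have hn : (derAdj ρ).unit.app ((QSym ρ).obj M) ≫ (leftDer ρ ⋙ rightDer ρ).map e.hom =
      e.hom ≫ (derAdj ρ).unit.app T.obj₃ := ((derAdj ρ).unit.naturality e.hom).symm
  let H := DGModule.derivedHomology (SymQ ρ) (symQDeg ρ)
  have h₃ : IsIso (H.map ((derAdj ρ).unit.app ((QSym ρ).obj M))) := by
    have h := congrArg H.map hn
    rw [H.map_comp, H.map_comp] at h
    have : IsIso (H.map ((derAdj ρ).unit.app ((QSym ρ).obj M)) ≫
        H.map ((leftDer ρ ⋙ rightDer ρ).map e.hom)) := by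
      rw [h]
      exact IsIso.comp_isIso' inferInstance key
    exact IsIso.of_isIso_comp_right _ (H.map ((leftDer ρ ⋙ rightDer ρ).map e.hom))
  have h₄ : IsIso (H.map ((QSym ρ).map ((finIncl ρ).app ((kos ρ).obj M)))) := by
    have h := congrArg H.map (res_unit ρ M)
    rw [H.map_comp, H.map_comp, H.map_comp] at h
    have : IsIso (H.map ((QSym ρ).map ((finIncl ρ).app ((kos ρ).obj M))) ≫
        H.map ((rightDerIso ρ).hom.app ((kos ρ).obj M))) := by
      rw [← h]
      exact IsIso.comp_isIso' inferInstance (IsIso.comp_isIso' h₃ inferInstance)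
    exact IsIso.of_isIso_comp_right _ (H.map ((rightDerIso ρ).hom.app ((kos ρ).obj M)))
  have h₅ := (isIso_unit_iff ρ M).2 (DGModule.isIso_Q_map_of_isIso_derivedHomology h₄)
  have : IsIso (e.hom ≫ (derAdj ρ).unit.app T.obj₃) := by
    rw [← hn]
    exact IsIso.comp_isIso' h₅ inferInstance
  exact IsIso.of_isIso_comp_left e.hom _

end BGG

/-! ## Finiteness of `Hom_Λ(ε, C)` -/

lemma FiniteVia.of_finite {F A H : Type*} [Field F] [Ring A] {φ : F →+* A} (hA : FiniteVia φ A)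
    [AddCommGroup H] [Module A H] [Module.Finite A H] : FiniteVia φ H := by
  let _ := Module.compHom A φ
  let _ := Module.compHom H φ
  have : Module.Finite F A := hA
  have : IsScalarTower F A H := ⟨fun r a h => mul_smul (φ r) a h⟩
  exact Module.Finite.trans A H

lemma FiniteVia.finite {F A H : Type*} [Field F] [Ring A] {φ : F →+* A} [AddCommGroup H]
    [Module A H] (h : FiniteVia φ H) : Module.Finite A H := by
  let _ := Module.compHom A φ
  let _ := Module.compHom H φ
  have : Module.Finite F H := h
  have : IsScalarTower F A H := ⟨fun r a h => mul_smul (φ r) a h⟩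
  exact Module.Finite.of_restrictScalars_finite F A H

namespace BGG

variable (ρ : Representation F Q V)

/-- The inclusion of the scalars into `(Λ ∗ Q)ᵒᵖ`. -/
def lamField : F →+* (LamQ ρ)ᵐᵒᵖ :=
  (opSingleOne (Lam ρ) Q).comp
    ((algebraMap F (Lam ρ)).op.comp (RingEquiv.toOpposite F).toRingHom)

lemma lamField_apply (r : F) : lamField ρ r = op (single (1 : Q) (algebraMap F (Lam ρ) r)) := rfl

variable {ρ} [Module.Finite F V] [CharP F 2]

lemma finiteVia_lamField [Finite Q] : FiniteVia (lamField ρ) (LamQ ρ)ᵐᵒᵖ := by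
  let _ := Module.compHom (LamQ ρ)ᵐᵒᵖ (lamField ρ)
  have := Fintype.ofFinite Q
  let g : (Q → Lam ρ) →ₗ[F] (LamQ ρ)ᵐᵒᵖ :=
    { toFun := fun c => ∑ q, op (single q (c q))
      map_add' := fun c c' => by
        rw [← Finset.sum_add_distrib]
        exact Finset.sum_congr rfl fun q _ => by
          rw [← MulOpposite.op_add, ← SkewMonoidAlgebra.single_add]; rfl
      map_smul' := fun r c => by
        refine Eq.trans (Finset.sum_congr rfl fun q _ => ?_) (Finset.mul_sum _ _ (lamField ρ r)).symm
        rw [lamField_apply, ← op_mul, SkewMonoidAlgebra.single_mul_single, mul_one,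
          Pi.smul_apply, Algebra.smul_def, Lam.smul_def, AlgHom.commutes, Algebra.commutes] }
  refine Module.Finite.of_surjective g fun r => ⟨fun q => r.unop.coeff q, ?_⟩
  refine MulOpposite.unop_injective ((Finset.unop_sum _ _).trans ?_)
  conv_rhs => rw [← SkewMonoidAlgebra.sum_single r.unop, SkewMonoidAlgebra.sum_def]
  exact (Finsupp.sum_fintype _ (fun q c => single q c) fun q => SkewMonoidAlgebra.single_zero q).symm

variable {C : LamComplex ρ}

lemma finite_tot [Finite Q] {a b : ℤ} (h : ∀ i, i < a ∨ b < i → Limits.IsZero (C.X i))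
    (hC : ∀ i, Module.Finite (LamQ ρ)ᵐᵒᵖ (C.X i)) : Module.Finite F (Tot C) := by
  have : Module.Finite (LamQ ρ)ᵐᵒᵖ (Tot C) := by
    have key : (⊤ : Submodule (LamQ ρ)ᵐᵒᵖ (Tot C)) =
        ⨆ i ∈ Finset.Icc a b, LinearMap.range (Tot.incl C i) := by
      refine (eq_top_iff.2 fun t _ => ?_).symm
      induction t using Tot.induction with
      | zero => exact zero_mem _
      | add x y hx hy => exact add_mem (hx trivial) (hy trivial)
      | hom i x =>
        by_cases hi : i ∈ Finset.Icc a b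
        · exact Submodule.mem_iSup_of_mem i (Submodule.mem_iSup_of_mem hi ⟨x, rfl⟩)
        · have := ModuleCat.subsingleton_of_isZero (h i (by rw [Finset.mem_Icc] at hi; lia))
          rw [Subsingleton.elim x 0, map_zero]
          exact zero_mem _
    refine ⟨key ▸ Submodule.fg_biSup _ _ fun i _ => ?_⟩
    rw [LinearMap.range_eq_map]
    exact Submodule.FG.map _ (hC i).1
  exact FiniteVia.of_finite (φ := lamField ρ) finiteVia_lamField

variable (C) in
/-- The homogeneous parts as vector spaces. -/
def Tot.degF (n : ℤ) : Submodule F (Tot C) where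
  __ := Tot.deg C n
  smul_mem' r _ hx := Tot.smul_mem (lamField ρ r) hx

lemma Tot.isInternal_degF : DirectSum.IsInternal (Tot.degF C) := by
  constructor
  · rw [injective_iff_map_eq_zero]
    intro x hx
    have key (y : ⨁ i, Tot.degF C i) (n : ℤ) :
        Tot.proj C n (DirectSum.coeAddMonoidHom (Tot.degF C) y) = Tot.proj C n (y n : Tot C) := by
      induction y using DirectSum.induction_on with
      | zero => simp
      | add y z hy hz => rw [map_add, map_add, hy, hz, ← map_add]; rfl
      | of m y =>
        rw [DirectSum.coeAddMonoidHom_of]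
        by_cases h : m = n
        · subst h
          rw [DirectSum.of_eq_same]
        · rw [DirectSum.of_eq_of_ne _ _ _ (Ne.symm h)]
          obtain ⟨_, t, rfl⟩ := y
          exact (Tot.proj_incl_ne h t).trans (map_zero _).symm
    ext n : 1
    have h := key x n
    obtain ⟨t, ht⟩ := (x n).2
    have ht : Tot.incl C n t = (x n : Tot C) := ht
    rw [hx, map_zero, ← ht, Tot.proj_incl] at h
    exact Subtype.ext (by rw [← ht, ← h, map_zero]; rfl)
  · intro t
    induction t using Tot.induction with
    | zero => exact ⟨0, map_zero _⟩
    | add x y hx hy =>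
      obtain ⟨⟨a, rfl⟩, b, rfl⟩ := hx, hy
      exact ⟨a + b, map_add _ _ _⟩
    | hom i x => exact ⟨DirectSum.of (fun i => Tot.degF C i) i ⟨Tot.incl C i x, x, rfl⟩,
        DirectSum.coeAddMonoidHom_of _ _ _⟩

lemma isIso_finIncl {a : ℤ} (h : ∀ i < a, Limits.IsZero (C.X i)) : IsIso ((finIncl ρ).app C) := by
  refine DGModule.isIso_of_bijective _ ⟨Submodule.inclusion_injective HomEps.finTotal_le,
    fun ⟨f, hf⟩ => ⟨⟨f, ?_⟩, rfl⟩⟩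
  refine (iSup_le fun n f hf => ?_ : ⨆ n, HomEps.homDeg C n ≤ (HomEps.finTotal C).toAddSubgroup) hf
  refine HomEps.mem_finTotal ⟨hf, a - n, fun i hi e he => ?_⟩
  obtain ⟨x, hx⟩ := hf i e he
  have := ModuleCat.subsingleton_of_isZero (h (i + n) (by lia))
  rw [← hx, Subsingleton.elim x 0]
  exact map_zero (Tot.incl C (i + n))

lemma isSymFree_finEpsObj (h : Module.Finite F (Tot C)) : IsSymFree (finEpsObj C) := by
  classical
  let B := (Tot.isInternal_degF (C := C)).collectedBasis fun n => Module.Basis.ofVectorSpace F (Tot.degF C n)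
  have hB : ∀ i, B i ∈ Tot.deg C i.1 := fun i =>
    (Tot.isInternal_degF (C := C)).collectedBasis_mem
      (fun n => Module.Basis.ofVectorSpace F (Tot.degF C n)) i
  have := Module.Finite.finite_basis B
  have := Fintype.ofFinite (Σ n, Module.Basis.ofVectorSpaceIndex F (Tot.degF C n))
  let e := Fintype.equivFin (Σ n, Module.Basis.ofVectorSpaceIndex F (Tot.degF C n))
  have hc (c : Fin _ → Sym ρ) (a : Mon F V) : finCoord C (∑ i, c i • felem (B (e.symm i)) 1) a =
      ∑ i, scoeff ρ a (c i) • B (e.symm i) := by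
    rw [map_sum, Finsupp.finset_sum_apply]
    exact Finset.sum_congr rfl fun i _ => by
      rw [sym_smul_felem, mul_one]
      exact HomEps.elem_gam _ _ _
  have hli : LinearIndependent (Sym ρ) fun i => felem (B (e.symm i)) (1 : Sym ρ) := by
    rw [Fintype.linearIndependent_iff]
    intro c h0 i
    have h1 (a : Mon F V) : scoeff ρ a (c i) = 0 := by
      have := hc c a
      rw [h0, map_zero] at this
      exact Fintype.linearIndependent_iff.1 (B.reindex e).linearIndependent
        (fun i => scoeff ρ a (c i)) ((Finset.sum_congr rfl fun i _ => by
          rw [B.reindex_apply]).trans this.symm) i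
    rw [sum_scoeff_xmon ρ (c i)]
    exact Finset.sum_eq_zero fun a _ => by rw [h1, zero_smul]
  refine ⟨_, fun i => (e.symm i).1, Module.Basis.mk hli fun f _ => ?_, fun i => ?_⟩
  · induction f using finEps_induction with
    | add f g hf hg => exact add_mem (hf trivial) (hg trivial)
    | elem x a =>
      rw [← mul_one (xmon ρ a), ← sym_smul_felem]
      refine Submodule.smul_mem _ _ ?_
      rw [← (B.reindex e).sum_repr x]
      change felemHom.flip 1 _ ∈ _
      rw [map_sum]
      refine sum_mem fun i _ => ?_
      change felem ((B.reindex e).repr x i • (B.reindex e) i) 1 ∈ _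
      rw [← field_smul_felem, B.reindex_apply]
      exact Submodule.smul_mem _ _ (Submodule.subset_span ⟨i, rfl⟩)
  · rw [Module.Basis.mk_apply]
    exact felem_mem (add_zero _) (hB _) (one_mem_symDeg ρ)

end BGG

/-! ## Graded vector spaces -/

section

variable {F A : Type*} [Field F] [AddCommGroup A] [Module F A] {D : ℤ → Submodule F A}
  (hD : DirectSum.IsInternal D)

/-- The projection onto the homogeneous part of degree `n`. -/
def internalProj (n : ℤ) : A →ₗ[F] A :=
  (D n).subtype ∘ₗ DirectSum.component F ℤ (fun i => D i) n ∘ₗ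
    (LinearEquiv.ofBijective (DirectSum.coeLinearMap D) hD).symm.toLinearMap

lemma internalProj_mem (n : ℤ) (a : A) : internalProj hD n a ∈ D n := Subtype.prop _

lemma internalProj_of_mem {m : ℤ} {a : A} (ha : a ∈ D m) (n : ℤ) :
    internalProj hD n a = if m = n then a else 0 := by
  have h : (LinearEquiv.ofBijective (DirectSum.coeLinearMap D) hD).symm a =
      DirectSum.lof F ℤ (fun i => D i) m ⟨a, ha⟩ := by
    rw [LinearEquiv.symm_apply_eq]
    exact (DirectSum.coeLinearMap_lof D m ⟨a, ha⟩).symm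
  change ((DirectSum.component F ℤ (fun i => D i) n
    ((LinearEquiv.ofBijective (DirectSum.coeLinearMap D) hD).symm a) : D n) : A) = _
  rw [h]
  split_ifs with hmn
  · subst hmn
    rw [DirectSum.component.lof_self]
  · change ((DirectSum.of (fun i => D i) m ⟨a, ha⟩ n : D n) : A) = 0
    rw [DirectSum.of_eq_of_ne _ _ _ (Ne.symm hmn)]
    rfl

lemma internalProj_comm {d : A →ₗ[F] A} (hd : ∀ n, ∀ a ∈ D n, d a ∈ D (n + 1)) (n : ℤ) (a : A) :
    internalProj hD (n + 1) (d a) = d (internalProj hD n a) := by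
  induction a using BGG.internal_induction (dA := fun n => (D n).toAddSubgroup) hD with
  | zero => simp
  | add a b ha hb => simp only [map_add, ha, hb]
  | hom m a ha =>
    rw [internalProj_of_mem hD ha, internalProj_of_mem hD (hd m a ha)]
    simp only [add_left_inj]
    split_ifs
    exacts [rfl, (map_zero d).symm]

lemma exists_bound_of_finite_cycles (hD : DirectSum.IsInternal D) {d : A →ₗ[F] A} (hd : ∀ n, ∀ a ∈ D n, d a ∈ D (n + 1))
    {W : Submodule F A} (hW : W.FG) (h : ∀ z, d z = 0 → ∃ w ∈ W, ∃ y, z = w + d y) :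
    ∃ b : ℤ, ∀ n ≥ b, ∀ z ∈ D n, d z = 0 → ∃ y ∈ D (n - 1), d y = z := by
  have h₁ (a : A) : ∃ b : ℤ, ∀ n ≥ b, internalProj hD n a = 0 := by
    induction a using BGG.internal_induction (dA := fun n => (D n).toAddSubgroup) hD with
    | zero => exact ⟨0, by simp⟩
    | add a b ha hb =>
      obtain ⟨⟨m, hm⟩, k, hk⟩ := ha, hb
      exact ⟨max m k, fun n hn => by rw [map_add, hm n (by lia), hk n (by lia), add_zero]⟩
    | hom m a ha => exact ⟨m + 1, fun n hn => by
        rw [internalProj_of_mem hD ha, if_neg (by lia)]⟩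
  choose β hβ using h₁
  obtain ⟨S, rfl⟩ := hW
  classical
  obtain ⟨b, hb⟩ := (S.image β).exists_le
  have h₂ : ∀ w ∈ Submodule.span F (S : Set A), ∀ n ≥ b, internalProj hD n w = 0 := by
    intro w hw n hn
    refine (Submodule.span_le (p := LinearMap.ker (internalProj hD n))).2 (fun x hx => ?_) hw
    exact hβ x n ((hb _ (Finset.mem_image_of_mem _ hx)).trans hn)
  refine ⟨b, fun n hn z hz hdz => ?_⟩
  obtain ⟨w, hw, y, hy⟩ := h z hdz
  refine ⟨internalProj hD (n - 1) y, internalProj_mem hD _ _, ?_⟩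
  rw [← internalProj_comm hD hd, sub_add_cancel]
  have := congrArg (internalProj hD n) hy
  rw [map_add, h₂ w hw n hn, zero_add, internalProj_of_mem hD hz, if_pos rfl] at this
  exact this.symm

end

namespace BGG

/-! ## Finiteness of homology over `S` -/

section

variable {ρ : Representation F Q V} [Module.Finite F V] [CharP F 2]

lemma xmon_eq_pow_mul (i : Idx F V) {k : ℕ} {a : Mon F V} (h : k ≤ a i) :
    xmon ρ a = xv ρ i ^ k * xmon ρ (a - Finsupp.single i k) := by
  have key (b : Mon F V) : xv ρ i ^ k * xmon ρ b = xmon ρ (b + Finsupp.single i k) := by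
    clear h
    induction k with
    | zero => simp
    | succ k ih => rw [pow_succ', mul_assoc, ih, xv_mul_xmon, add_assoc, ← Finsupp.single_add]
  rw [key, tsub_add_cancel_of_le (Finsupp.single_le_iff.2 h)]

instance : IsNoetherianRing (Sym ρ) := isNoetherianRing_of_ringEquiv _ (symEquiv ρ).symm.toRingEquiv

/-- If powers of the `x_i` annihilate the homology of a finitely generated module with linear
differential, then the homology is finite dimensional. -/
lemma exists_finite_cycles {N : Type*} [AddCommGroup N] [Module (Sym ρ) N] [Module F N]
    [IsScalarTower F (Sym ρ) N] [Module.Finite (Sym ρ) N] (d : N →ₗ[Sym ρ] N) (k : ℕ)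
    (h : ∀ i z, d z = 0 → ∃ y, d y = xv ρ i ^ k • z) :
    ∃ W : Submodule F N, W.FG ∧ ∀ z, d z = 0 → ∃ w ∈ W, ∃ y, z = w + d y := by
  obtain ⟨S, hS⟩ := IsNoetherian.noetherian (LinearMap.ker d)
  have hfin : {a : Mon F V | ∀ i, a i < k}.Finite :=
    (Set.finite_Iic (Finsupp.equivFunOnFinite.symm fun _ => k)).subset fun a ha i => (ha i).le
  let T : Set N := Set.image2 (fun a z => xmon ρ a • z) {a : Mon F V | ∀ i, a i < k} S
  let U := Submodule.span F T ⊔ LinearMap.range (d.restrictScalars F)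
  have hU (s : Sym ρ) (z : N) (hz : z ∈ S) : s • z ∈ U := by
    induction s using Sym.induction_xmon with
    | add a b ha hb => rw [add_smul]; exact add_mem ha hb
    | smul r a ha => rw [smul_assoc]; exact U.smul_mem r ha
    | mon a =>
      by_cases ha : ∀ i, a i < k
      · exact Submodule.mem_sup_left (Submodule.subset_span ⟨a, ha, z, hz, rfl⟩)
      · push Not at ha
        obtain ⟨i, hi⟩ := ha
        have hdz : d z = 0 := by
          have : z ∈ LinearMap.ker d := hS ▸ Submodule.subset_span hz
          exact this
        obtain ⟨y, hy⟩ := h i (xmon ρ (a - Finsupp.single i k) • z) (by rw [map_smul, hdz, smul_zero])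
        rw [xmon_eq_pow_mul i hi, mul_smul]
        exact Submodule.mem_sup_right ⟨y, hy⟩
  refine ⟨Submodule.span F T, Submodule.fg_span (hfin.image2 _ S.finite_toSet), fun z hz => ?_⟩
  replace hz : z ∈ Submodule.span (Sym ρ) (S : Set N) := hS.symm ▸ hz
  have key : ∀ s : Sym ρ, s • z ∈ U := by
    induction hz using Submodule.span_induction with
    | mem z hz => exact fun s => hU s z hz
    | zero => exact fun s => by rw [smul_zero]; exact zero_mem _
    | add a b _ _ ha hb => exact fun s => by rw [smul_add]; exact add_mem (ha s) (hb s)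
    | smul t a _ ha => exact fun s => by rw [← mul_smul]; exact ha _
  have := key 1
  rw [one_smul] at this
  obtain ⟨w, hw, _, ⟨y, rfl⟩, h⟩ := Submodule.mem_sup.1 this
  exact ⟨w, hw, y, h.symm⟩

lemma HasFiniteHomology.exists_finite_cycles {M : DGSymQ ρ} (h : HasFiniteHomology M) :
    ∃ W : Submodule F M.carrier, W.FG ∧ ∀ z, M.d z = 0 → ∃ w ∈ W, ∃ y, z = w + M.d y := by
  let _ : Module F M.homology :=
    Module.compHom M.homology ((symToSymQ ρ).comp (algebraMap F (Sym ρ)))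
  have : Module.Finite F M.homology := h
  let π : LinearMap.ker (linField M.d) →ₗ[F] M.homology :=
    { toFun := fun z => Submodule.Quotient.mk ⟨z.1, z.2⟩
      map_add' := fun _ _ => rfl
      map_smul' := fun _ _ => rfl }
  have hπ : Function.Surjective π := fun x => by
    obtain ⟨z, rfl⟩ := Submodule.Quotient.mk_surjective _ x
    exact ⟨⟨z.1, z.2⟩, rfl⟩
  obtain ⟨s, hs⟩ := π.exists_rightInverse_of_surjective (LinearMap.range_eq_top.2 hπ)
  refine ⟨LinearMap.range ((LinearMap.ker (linField M.d)).subtype ∘ₗ s), ?_, fun z hz => ?_⟩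
  · rw [LinearMap.range_eq_map]
    exact Module.Finite.fg_top.map _
  · have h₁ : π ⟨z, hz⟩ = π (s (π ⟨z, hz⟩)) := (congr($hs (π ⟨z, hz⟩))).symm
    obtain ⟨y, hy⟩ := (Submodule.Quotient.eq _).1 h₁
    exact ⟨_, ⟨π ⟨z, hz⟩, rfl⟩, y, eq_add_of_sub_eq' hy.symm⟩

lemma hasFiniteHomology_of_finite_cycles {M : DGSymQ ρ} {W : Submodule F M.carrier} (hW : W.FG)
    (h : ∀ z, M.d z = 0 → ∃ w ∈ W, ∃ y, z = w + M.d y) : HasFiniteHomology M := by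
  let _ : Module F M.homology :=
    Module.compHom M.homology ((symToSymQ ρ).comp (algebraMap F (Sym ρ)))
  have : Module.Finite F W := Module.Finite.iff_fg.2 hW
  let K := LinearMap.ker (linField M.d ∘ₗ W.subtype)
  let π : K →ₗ[F] M.homology :=
    { toFun := fun z => Submodule.Quotient.mk ⟨z.1.1, z.2⟩
      map_add' := fun _ _ => rfl
      map_smul' := fun _ _ => rfl }
  change Module.Finite F M.homology
  refine Module.Finite.of_surjective π fun x => ?_
  obtain ⟨⟨z, hz⟩, rfl⟩ := Submodule.Quotient.mk_surjective _ x
  obtain ⟨w, hw, y, hy⟩ := h z hz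
  have hz : M.d z = 0 := hz
  refine ⟨⟨⟨w, hw⟩, ?_⟩, (Submodule.Quotient.eq _).2 ⟨-y, ?_⟩⟩
  · change M.d w = 0
    rw [hy, map_add, M.d_d, add_zero] at hz
    exact hz
  · change M.d (-y) = w - z
    rw [hy, map_neg]
    abel

end

end BGG

/-! ## Truncation of complexes -/

lemma FiniteVia.of_injective {F A X Y : Type*} [Field F] [Ring A] {φ : F →+* A} [AddCommGroup X]
    [AddCommGroup Y] [Module A X] [Module A Y] (f : X →ₗ[A] Y) (hf : Function.Injective f)
    (hY : FiniteVia φ Y) : FiniteVia φ X := by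
  let _ := Module.compHom X φ
  let _ := Module.compHom Y φ
  have : Module.Finite F Y := hY
  exact Module.Finite.of_injective
    ({ f with map_smul' := fun r x => map_smul f (φ r) x } : X →ₗ[F] Y) hf

namespace BGG

section

variable {ρ : Representation F Q V} (C : LamComplex ρ)

/-- The subcomplex given by submodules stable under the differential. -/
def subComplex (B : ∀ i, Submodule (LamQ ρ)ᵐᵒᵖ (C.X i)) (hB : ∀ i j, ∀ x ∈ B i, C.d i j x ∈ B j) :
    LamComplex ρ where
  X i := ModuleCat.of _ (B i)
  d i j := ModuleCat.ofHom ((C.d i j).hom.restrict (hB i j))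
  shape i j h := ModuleCat.hom_ext (LinearMap.ext fun x => Subtype.ext congr($(C.shape i j h) x.1))
  d_comp_d' i j k _ _ := ModuleCat.hom_ext (LinearMap.ext fun x =>
    Subtype.ext congr($(C.d_comp_d i j k) x.1))

variable {C}

lemma nonempty_iso_subComplex [HasDerivedCategory.{w} (ModuleCat.{u} (LamQ ρ)ᵐᵒᵖ)]
    {B : ∀ i, Submodule (LamQ ρ)ᵐᵒᵖ (C.X i)} (hB : ∀ i j, ∀ x ∈ B i, C.d i j x ∈ B j)
    (h₁ : ∀ i, ∀ y, C.d (i + -1) i y ∈ B i → ∃ x ∈ B (i + -1), C.d (i + -1) i x = C.d (i + -1) i y)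
    (h₂ : ∀ i, ∀ z : C.X i, C.d i (i + 1) z = 0 → ∃ x ∈ B i, C.d i (i + 1) x = 0 ∧
      ∃ y, C.d (i + -1) i y = x - z) :
    Nonempty (DerivedCategory.Q.obj (subComplex C B hB) ≅ DerivedCategory.Q.obj C) := by
  let ι : subComplex C B hB ⟶ C := { f := fun i => ModuleCat.ofHom (B i).subtype }
  have : QuasiIso ι := ⟨fun i => (quasiIsoAt_iff_elements ι i).2
    ⟨fun x _ ⟨y, hy⟩ => by
      obtain ⟨x', hx', h⟩ := h₁ i y (hy ▸ x.2)
      exact ⟨⟨x', hx'⟩, Subtype.ext (h.trans hy)⟩,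
    fun z hz => by
      obtain ⟨x, hx, hdx, y, hy⟩ := h₂ i z hz
      exact ⟨⟨x, hx⟩, Subtype.ext hdx, y, hy⟩⟩⟩
  exact ⟨asIso (DerivedCategory.Q.map ι)⟩

variable (C) in
/-- The terms of the truncation of a complex in degrees at most `b`. -/
def truncSub (b i : ℤ) : Submodule (LamQ ρ)ᵐᵒᵖ (C.X i) where
  carrier := { x | (b ≤ i → C.d i (i + 1) x = 0) ∧ (b < i → x = 0) }
  zero_mem' := ⟨fun _ => map_zero _, fun _ => rfl⟩
  add_mem' hx hy := ⟨fun h => by rw [map_add, hx.1 h, hy.1 h, add_zero],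
    fun h => by rw [hx.2 h, hy.2 h, add_zero]⟩
  smul_mem' r x hx := ⟨fun h => by rw [map_smul, hx.1 h, smul_zero],
    fun h => by rw [hx.2 h, smul_zero]⟩

lemma truncSub_d (b i j : ℤ) (x : C.X i) (hx : x ∈ truncSub C b i) :
    C.d i j x ∈ truncSub C b j := by
  refine ⟨fun _ => congr($(C.d_comp_d i j (j + 1)) x), fun h => ?_⟩
  by_cases hij : i + 1 = j
  · subst hij
    exact hx.1 (by lia)
  · exact congr($(C.shape i j hij) x)

lemma nonempty_iso_trunc [HasDerivedCategory.{w} (ModuleCat.{u} (LamQ ρ)ᵐᵒᵖ)] {b : ℤ}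
    (h : ∀ i > b, ∀ z : C.X i, C.d i (i + 1) z = 0 → ∃ y, C.d (i + -1) i y = z) :
    Nonempty (DerivedCategory.Q.obj (subComplex C (truncSub C b) (truncSub_d b)) ≅
      DerivedCategory.Q.obj C) := by
  refine nonempty_iso_subComplex _ (fun i y hy => ?_) fun i z hz => ?_
  · by_cases hi : i ≤ b
    · exact ⟨y, ⟨fun h => by lia, fun h => by lia⟩, rfl⟩
    · exact ⟨0, zero_mem _, by rw [map_zero, hy.2 (by lia)]⟩
  · by_cases hi : i ≤ b
    · exact ⟨z, ⟨fun _ => hz, fun h => by lia⟩, hz, 0, by rw [map_zero, sub_self]⟩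
    · obtain ⟨y, hy⟩ := h i (by lia) z hz
      exact ⟨0, zero_mem _, map_zero _, -y, by rw [map_neg, hy, zero_sub]⟩

end

/-! ## The Koszul complex of a finitely generated free module -/

section

variable {ρ : Representation F Q V} [Module.Finite F V] [CharP F 2] (M : DGSymQ ρ)

/-- The homogeneous parts of a dg module as vector spaces. -/
def degF (n : ℤ) : Submodule F M.carrier where
  __ := M.deg n
  smul_mem' r _ hm := field_smul_mem M r hm

lemma isInternal_degF : DirectSum.IsInternal (degF M) := M.isInternal

variable {M}

lemma degF_le_span {n : ℕ} {k : Fin n → ℤ} (b : Module.Basis (Fin n) (Sym ρ) M.carrier)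
    (hb : ∀ i, b i ∈ M.deg (k i)) (m : ℤ) : degF M m ≤ Submodule.span F
      (⋃ i, (fun a => xmon ρ a • b i) '' {a : Mon F V | k i + a.degree = m}) := by
  intro z hz
  rw [← if_pos (c := m = m) (t := z) (e := 0) rfl, ← internalProj_of_mem (isInternal_degF M) hz,
    ← b.sum_repr z, map_sum]
  refine sum_mem fun i _ => ?_
  generalize b.repr z i = s
  induction s using Sym.induction_xmon with
  | add s t hs ht => rw [add_smul, map_add]; exact add_mem hs ht
  | smul r s hs => rw [smul_assoc, map_smul]; exact Submodule.smul_mem _ r hs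
  | mon a =>
    have h : xmon ρ a • b i ∈ degF M (k i + a.degree) := sym_smul_mem M (xmon_mem_symDeg ρ a) (hb i)
    rw [internalProj_of_mem _ h]
    split_ifs with hm
    · exact Submodule.subset_span (Set.mem_iUnion.2 ⟨i, a, hm, rfl⟩)
    · exact zero_mem _

lemma IsSymFree.finite_degF (hM : IsSymFree M) (m : ℤ) : Module.Finite F (degF M m) := by
  obtain ⟨n, k, b, hb⟩ := hM
  have h := Set.finite_iUnion fun i => Set.Finite.image (fun a => xmon ρ a • b i)
    ((Finsupp.finite_of_degree_le (m - k i).toNat).subset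
      fun (a : Mon F V) (ha : k i + a.degree = m) => show a.degree ≤ (m - k i).toNat by lia)
  exact @Submodule.finiteDimensional_of_le F _ _ _ _ _ _ (Module.Finite.iff_fg.2 (Submodule.fg_span h))
    (degF_le_span b hb m)

lemma IsSymFree.exists_deg_eq_bot (hM : IsSymFree M) : ∃ a : ℤ, ∀ m < a, ∀ z ∈ M.deg m, z = 0 := by
  obtain ⟨n, k, b, hb⟩ := hM
  obtain ⟨a, ha⟩ := (Finset.univ.image fun i => -k i).exists_le
  refine ⟨-a, fun m hm z hz => ?_⟩
  have h : (⋃ i, (fun a => xmon ρ a • b i) '' {a : Mon F V | k i + a.degree = m}) = ∅ :=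
    Set.iUnion_eq_empty.2 fun i => (Set.image_eq_empty).2 (Set.eq_empty_of_forall_notMem
      fun c (hc : k i + c.degree = m) => by
        have := ha (-k i) (Finset.mem_image_of_mem _ (Finset.mem_univ i))
        lia)
  have := degF_le_span b hb m hz
  rw [h, Submodule.span_empty] at this
  exact this

variable (M) in
/-- The differential of the Koszul complex as an `S`-linear map. -/
def Kos.dSym : (Lam ρ →ₗ[F] M.carrier) →ₗ[Sym ρ] Lam ρ →ₗ[F] M.carrier where
  toFun φ := (Kos.d M φ).lin
  map_add' φ ψ := congrArg Kos.lin (map_add (Kos.d M) φ ψ)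
  map_smul' s φ := LinearMap.ext fun μ => by
    refine (Kos.d_lin (s • φ : Lam ρ →ₗ[F] M.carrier) μ).trans
      (Eq.trans ?_ (congrArg (s • ·) (Kos.d_lin φ μ)).symm)
    rw [smul_add, Finset.smul_sum]
    exact congrArg₂ _ (d_sym_smul M s _) (Finset.sum_congr rfl fun i _ => smul_comm _ s _)

/-- The Koszul complex of a finitely generated module is exact in large degrees. -/
lemma Kos.exists_bound [Module.Finite (Sym ρ) M.carrier] : ∃ b : ℤ, ∀ n ≥ b, ∀ z ∈ Kos.deg M n,
    Kos.d M z = 0 → ∃ y ∈ Kos.deg M (n - 1), Kos.d M y = z := by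
  have : Module.Finite (Sym ρ) (Lam ρ →ₗ[F] M.carrier) :=
    Module.Finite.equiv ((Module.finBasis F (Lam ρ)).constr (M' := M.carrier) (Sym ρ))
  let h (i : Idx F V) (φ : Kos M) : Kos M := (φ.lin ∘ₗ Lam.pd ρ i : Lam ρ →ₗ[F] _)
  obtain ⟨W, hW, hW'⟩ := BGG.exists_finite_cycles (Kos.dSym M) 1 fun i φ hφ => by
    refine ⟨h i φ, LinearMap.ext fun μ => ?_⟩
    have h₁ : M.d (φ (Lam.pd ρ i μ)) + ∑ j, xv ρ j • φ (yv ρ j * Lam.pd ρ i μ) = 0 :=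
      (Kos.d_lin φ _).symm.trans congr($hφ (Lam.pd ρ i μ))
    refine (Kos.d_lin (h i φ) μ).trans ?_
    change M.d (φ (Lam.pd ρ i μ)) + ∑ j, xv ρ j • φ (Lam.pd ρ i (yv ρ j * μ)) = xv ρ i ^ 1 • φ μ
    simp only [Lam.pd_yv_mul, map_add, smul_add, Finset.sum_add_distrib]
    rw [add_left_comm, h₁, add_zero, pow_one, Finset.sum_eq_single i]
    · rw [if_pos rfl]
    · intro j _ hj
      rw [if_neg (Ne.symm hj), map_zero, smul_zero]
    · exact fun h => absurd (Finset.mem_univ i) h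
  let D (n : ℤ) : Submodule F (Lam ρ →ₗ[F] M.carrier) :=
    { carrier := { φ | ∀ μ, φ μ ∈ M.deg n }
      zero_mem' := fun _ => zero_mem _
      add_mem' := fun hφ hψ μ => add_mem (hφ μ) (hψ μ)
      smul_mem' := fun r φ hφ μ => field_smul_mem M r (hφ μ) }
  exact exists_bound_of_finite_cycles (D := D) (Kos.isInternal M)
    (d := (Kos.dSym M).restrictScalars F) (fun n φ hφ => Kos.d_mem hφ) hW hW'

lemma IsSymFree.finiteVia_kos (hM : IsSymFree M) (n : ℤ) : FiniteVia (lamField ρ) (Kos.deg M n) := by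
  have := hM.finite_degF n
  let _ := Module.compHom (Kos.deg M n) (lamField ρ)
  exact Module.Finite.of_injective
    ({ toFun := fun φ => φ.1.lin.codRestrict (degF M n) φ.2
       map_add' := fun _ _ => rfl
       map_smul' := fun r φ => LinearMap.ext fun μ => Subtype.ext (by
        refine (Kos.smul_lin (algebraMap F (Lam ρ) r) 1 φ.1 μ).trans ?_
        rw [Lam.act_one, AlgHom.id_apply, ← Algebra.smul_def, map_smul]
        exact one_smul _ _) } : Kos.deg M n →ₗ[F] Lam ρ →ₗ[F] degF M n)
    fun φ ψ h => Subtype.ext (Kos.ext fun μ => congrArg Subtype.val congr($h μ))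

end

end BGG

/-! ## Projectivity over `Λ` -/

namespace BGG

variable {ρ : Representation F Q V} [Module.Finite F V]

/-- The module `N` over a ring under `Λᵒᵖ` has operators `∂_i` with `∂_i y_j + y_j ∂_i = δ_{ij}`. -/
def HasContractions {R : Type*} [Ring R] (θ : (Lam ρ)ᵐᵒᵖ →+* R) (N : Type*) [AddCommGroup N]
    [Module R N] : Prop :=
  ∃ D : Idx F V → N →+ N,
    (∀ i (r : F) m, D i (θ (op (algebraMap F _ r)) • m) = θ (op (algebraMap F _ r)) • D i m) ∧
    ∀ i j m, D i (θ (op (yv ρ j)) • m) + θ (op (yv ρ j)) • D i m = if i = j then m else 0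

section

variable {R : Type*} [Ring R] {θ : (Lam ρ)ᵐᵒᵖ →+* R} {N N' : Type*} [AddCommGroup N] [Module R N]
  [AddCommGroup N'] [Module R N']

lemma HasContractions.of_bijective (e : N' →+ N) (he : Function.Bijective e)
    (hl : ∀ a m, e (θ (op a) • m) = θ (op a) • e m) :
    HasContractions θ N → HasContractions θ N' := by
  rintro ⟨D, h₁, h₂⟩
  let E := AddEquiv.ofBijective e he
  have hE (a : Lam ρ) (m : N) : E.symm (θ (op a) • m) = θ (op a) • E.symm m :=
    E.symm_apply_eq.2 ((congrArg _ (E.apply_symm_apply m).symm).trans (hl a _).symm)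
  refine ⟨fun i => E.symm.toAddMonoidHom.comp ((D i).comp e), fun i r m => ?_, fun i j m => ?_⟩
  · change E.symm (D i (e _)) = _ • E.symm (D i (e m))
    rw [hl, h₁, hE]
  · change E.symm (D i (e _)) + _ • E.symm (D i (e m)) = _
    rw [← hE, ← map_add, hl, h₂]
    split_ifs
    exacts [E.symm_apply_apply m, map_zero _]

lemma HasContractions.of_projective [Module.Projective R N] :
    HasContractions θ R → HasContractions θ N := by
  rintro ⟨D, h₁, h₂⟩
  obtain ⟨s, hs⟩ := Module.projective_def'.1 (inferInstance : Module.Projective R N)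
  let p := Finsupp.linearCombination R (id : N → N)
  let E (i) : (N →₀ R) →+ (N →₀ R) := Finsupp.mapRange.addMonoidHom (D i)
  refine ⟨fun i => p.toAddMonoidHom.comp ((E i).comp s.toAddMonoidHom), fun i r m => ?_,
    fun i j m => ?_⟩
  · change p (E i (s _)) = _ • p (E i (s m))
    have : E i (θ (op (algebraMap F _ r)) • s m) = θ (op (algebraMap F _ r)) • E i (s m) :=
      Finsupp.ext fun x => h₁ i r (s m x)
    rw [map_smul s, this, map_smul p]
  · change p (E i (s _)) + _ • p (E i (s m)) = _
    have : E i (θ (op (yv ρ j)) • s m) + θ (op (yv ρ j)) • E i (s m) = if i = j then s m else 0 :=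
      Finsupp.ext fun x => (h₂ i j (s m x)).trans (by split_ifs <;> rfl)
    rw [map_smul s, ← map_smul p, ← map_add p, this]
    split_ifs
    exacts [congr($hs m), map_zero p]

end

variable [CharP F 2]

variable (ρ) in
lemma hasContractions_lam : HasContractions (RingHom.id (Lam ρ)ᵐᵒᵖ) (Lam ρ)ᵐᵒᵖ := by
  refine ⟨fun i => MulOpposite.opAddEquiv.toAddMonoidHom.comp ((Lam.pd ρ i).toAddMonoidHom.comp
    MulOpposite.opAddEquiv.symm.toAddMonoidHom), fun i r m => ?_, fun i j m => ?_⟩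
  · change op (Lam.pd ρ i (m.unop * algebraMap F _ r)) = op (Lam.pd ρ i m.unop * algebraMap F _ r)
    rw [← Algebra.commutes, ← Algebra.smul_def, map_smul, ← Algebra.commutes, ← Algebra.smul_def]
  · change op (Lam.pd ρ i (m.unop * yv ρ j)) + op (Lam.pd ρ i m.unop * yv ρ j) = _
    rw [← MulOpposite.op_add, Lam.pd_mul_yv, add_assoc, add_self_of_charTwo F, add_zero]
    split_ifs <;> rfl

variable (ρ) in
lemma hasContractions_lamQ [Finite Q] : HasContractions (opSingleOne (Lam ρ) Q) (LamQ ρ)ᵐᵒᵖ := by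
  have hsm (q : Q) (a b : Lam ρ) : op (single (1 : Q) b) • op (single q a) =
      op (single q (a * q • b)) := by
    rw [smul_eq_mul, ← op_mul, SkewMonoidAlgebra.single_mul_single, mul_one]
  obtain ⟨D, hD⟩ : ∃ D : Idx F V → (LamQ ρ)ᵐᵒᵖ →+ (LamQ ρ)ᵐᵒᵖ, ∀ i q a,
      D i (op (single q a)) = op (single q (q • Lam.pd ρ i (q⁻¹ • a))) := by
    let δ (i : Idx F V) (q : Q) : Lam ρ →+ (LamQ ρ)ᵐᵒᵖ :=
      AddMonoidHom.mk' (fun a => op (single q (q • Lam.pd ρ i (q⁻¹ • a)))) fun a b => by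
        rw [smul_add, map_add, smul_add, SkewMonoidAlgebra.single_add, MulOpposite.op_add]
    exact ⟨fun i => AddMonoidHom.mk' (fun x => x.unop.coeff.sum fun q a => δ i q a) fun x y => by
      rw [MulOpposite.unop_add, SkewMonoidAlgebra.coeff_add]
      exact Finsupp.sum_add_index' (fun q => map_zero (δ i q)) (fun q => map_add (δ i q)),
      fun i q a => Finsupp.sum_single_index (map_zero (δ i q))⟩
  have ind {p : (LamQ ρ)ᵐᵒᵖ → Prop} (zero : p 0) (h : ∀ q a, p (op (single q a)))
      (add : ∀ x y, p x → p y → p (x + y)) (x) : p x := by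
    induction x using MulOpposite.rec' with
    | h x =>
      induction x using SkewMonoidAlgebra.induction_on with
      | zero => exact zero
      | single q a => exact h q a
      | add x y hx hy => exact add _ _ hx hy
  have hq (q : Q) (r : F) : q • algebraMap F (Lam ρ) r = algebraMap F (Lam ρ) r :=
    (Lam.act ρ q).commutes r
  refine ⟨D, fun i r => ind ?_ (fun q a => ?_) fun x y hx hy => ?_,
    fun i j => ind ?_ (fun q a => ?_) fun x y hx hy => ?_⟩
  · rw [smul_zero, map_zero, smul_zero]
  · change D i (op (single (1 : Q) _) • op (single q a)) = op (single (1 : Q) _) • D i _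
    rw [hsm, hD, hD, hsm, MulOpposite.unop_op, hq, smul_mul', hq, ← Algebra.commutes, ← Algebra.smul_def, map_smul,
      Algebra.smul_def, smul_mul', hq, Algebra.commutes]
  · rw [smul_add, map_add, map_add, smul_add, hx, hy]
  · rw [smul_zero, map_zero, smul_zero, add_zero, ite_self]
  · change D i (op (single (1 : Q) _) • op (single q a)) + op (single (1 : Q) _) • D i _ = _
    rw [hsm, hD, hD, hsm, MulOpposite.unop_op, ← MulOpposite.op_add, ← SkewMonoidAlgebra.single_add, smul_mul',
      inv_smul_smul, Lam.pd_mul_yv, smul_add, smul_mul', add_assoc, add_self_of_charTwo F, add_zero]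
    split_ifs
    · rw [smul_inv_smul]
    · rw [smul_zero, SkewMonoidAlgebra.single_zero]; rfl
  · rw [smul_add, map_add, map_add, smul_add, add_add_add_comm, hx, hy]
    split_ifs
    exacts [rfl, add_zero _]

/-- A `Λ`-module with contractions is projective. -/
lemma HasContractions.projective {N : Type u} [AddCommGroup N] [Module (Lam ρ)ᵐᵒᵖ N] :
    HasContractions (RingHom.id (Lam ρ)ᵐᵒᵖ) N → Module.Projective (Lam ρ)ᵐᵒᵖ N := by
  rintro ⟨D, h₁, h₂⟩
  have h₁ (i) (r : F) (m : N) : D i (op (algebraMap F (Lam ρ) r) • m) =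
    op (algebraMap F (Lam ρ) r) • D i m := h₁ i r m
  have h₂ (i j m) : D i (op (yv ρ j) • m) + op (yv ρ j) • D i m = if i = j then m else 0 := h₂ i j m
  let φ : F →+* (Lam ρ)ᵐᵒᵖ := (algebraMap F (Lam ρ)).op.comp (RingEquiv.toOpposite F).toRingHom
  have h2 {X : Type u} [AddCommGroup X] [Module (Lam ρ)ᵐᵒᵖ X] (x : X) : x + x = 0 := by
    let _ := Module.compHom X φ
    exact add_self_of_charTwo F x
  have hyy {X : Type u} [AddCommGroup X] [Module (Lam ρ)ᵐᵒᵖ X] (i) (x : X) :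
      op (yv ρ i) • op (yv ρ i) • x = 0 := by
    rw [← mul_smul, ← op_mul, ← mul_one (yv ρ i * _), mul_assoc, yv_mul_yv_mul, op_zero, zero_smul]
  have hyc {X : Type u} [AddCommGroup X] [Module (Lam ρ)ᵐᵒᵖ X] (a b : Lam ρ) (x : X) :
      op a • op b • x = op b • op a • x := by
    rw [← mul_smul, ← mul_smul, ← op_mul, ← op_mul, Lam.comm ρ]
  refine Module.Projective.of_lifting_property'' fun p hp => ?_
  have key (T : Finset (Idx F V)) : ∃ s : N →+ (N →₀ (Lam ρ)ᵐᵒᵖ),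
      (∀ m, p (s m) = m) ∧
      (∀ (r : F) m, s (op (algebraMap F (Lam ρ) r) • m) = op (algebraMap F (Lam ρ) r) • s m) ∧
      ∀ j ∈ T, ∀ m, s (op (yv ρ j) • m) = op (yv ρ j) • s m := by
    classical
    induction T using Finset.induction_on with
    | empty =>
      let _ := Module.compHom N φ
      let _ := Module.compHom (N →₀ (Lam ρ)ᵐᵒᵖ) φ
      let p' : (N →₀ (Lam ρ)ᵐᵒᵖ) →ₗ[F] N := { p with map_smul' := fun r m => map_smul p (φ r) m }
      obtain ⟨s, hs⟩ := p'.exists_rightInverse_of_surjective (LinearMap.range_eq_top.2 hp)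
      exact ⟨s.toAddMonoidHom, fun m => congr($hs m), fun r m => s.map_smul' r m, by simp⟩
    | insert i T _ ih =>
      obtain ⟨s, hs, hr, hT⟩ := ih
      refine ⟨AddMonoidHom.mk' (fun m => s (D i (op (yv ρ i) • m)) + op (yv ρ i) • s (D i m))
        fun m m' => ?_, fun m => ?_, fun r m => ?_, fun j hj m => ?_⟩
      · simp only [smul_add, map_add]
        abel
      · change p (s _ + _ • s _) = m
        rw [map_add, map_smul p, hs, hs, h₂, if_pos rfl]
      · change s (D i (_ • _ • m)) + _ • s (D i (_ • m)) = _ • (s _ + _ • s _)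
        rw [hyc, h₁, hr, h₁, hr, hyc, smul_add]
      · change s (D i (_ • _ • m)) + _ • s (D i (_ • m)) = _ • (s _ + _ • s _)
        by_cases hij : i = j
        · subst hij
          rw [hyy, map_zero, map_zero, zero_add, smul_add, hyy, add_zero]
        · have hc (m : N) : D i (op (yv ρ j) • m) = op (yv ρ j) • D i m := by
            have := h₂ i j m
            rw [if_neg hij] at this
            rw [eq_neg_of_add_eq_zero_left this, neg_eq_of_add_eq_zero_left (h2 _)]
          have hj := hT j ((Finset.mem_insert.1 hj).resolve_left (Ne.symm hij))
          rw [hyc, hc, hj, hc, hj, hyc, smul_add]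
  obtain ⟨s, hs, hr, hT⟩ := key Finset.univ
  refine ⟨{ s with map_smul' := fun a m => ?_ }, LinearMap.ext hs⟩
  change s (a • m) = a • s m
  induction a using MulOpposite.rec' with
  | h a =>
    induction a using Lam.induction_yv generalizing m with
    | one r => exact hr r m
    | add a b ha hb => rw [MulOpposite.op_add, add_smul, map_add, ha, hb, add_smul]
    | smul r a ha => rw [Algebra.smul_def, op_mul, mul_smul, mul_smul, ha, hr]
    | yv_mul i a ha => rw [op_mul, mul_smul, mul_smul, ha, hT i (Finset.mem_univ i)]

/-- Maschke's theorem for `Λ ⊂ Λ ∗ Q`, with `Q` of odd order. -/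
lemma projective_lamQ [Finite Q] (hQ : Odd (Nat.card Q)) (N : ModuleCat.{u} (LamQ ρ)ᵐᵒᵖ)
    (hN : Module.Projective (Lam ρ)ᵐᵒᵖ (toLam N)) : Module.Projective (LamQ ρ)ᵐᵒᵖ N := by
  have := Fintype.ofFinite Q
  refine Module.Projective.of_lifting_property'' fun p hp => ?_
  let P := ModuleCat.of (LamQ ρ)ᵐᵒᵖ (N →₀ (LamQ ρ)ᵐᵒᵖ)
  let p' : toLam P →ₗ[(Lam ρ)ᵐᵒᵖ] toLam N :=
    ((ModuleCat.restrictScalars (opSingleOne (Lam ρ) Q)).map (ModuleCat.ofHom p : P ⟶ N)).hom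
  obtain ⟨s', hs'⟩ := Module.projective_lifting_property p' LinearMap.id hp
  let s : N →+ (N →₀ (LamQ ρ)ᵐᵒᵖ) := s'.toAddMonoidHom
  have hs (n : N) : p (s n) = n := congr($hs' n)
  have hl (a : Lam ρ) (n : N) : s (op (single (1 : Q) a) • n) = op (single (1 : Q) a) • s n :=
    s'.map_smul (op a) n
  let t : N →+ (N →₀ (LamQ ρ)ᵐᵒᵖ) := AddMonoidHom.mk'
    (fun n => ∑ q : Q, op (single q⁻¹ (1 : Lam ρ)) • s (op (single q (1 : Lam ρ)) • n)) fun n m => by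
      rw [← Finset.sum_add_distrib]
      exact Finset.sum_congr rfl fun q _ => by rw [smul_add, map_add, smul_add]
  refine ⟨linearMapOfSingle t fun a g n => ?_, LinearMap.ext fun n => ?_⟩
  · change ∑ q : Q, _ = _ • ∑ q : Q, _
    rw [Finset.smul_sum]
    refine Eq.trans (Finset.sum_congr rfl fun q _ => ?_) (Equiv.sum_comp (Equiv.mulLeft g) fun q =>
      op (single g a) • op (single q⁻¹ (1 : Lam ρ)) • s (op (single q (1 : Lam ρ)) • n))
    have h₁ : op (single q (1 : Lam ρ)) • op (single g a) • n =
        op (single (1 : Q) ((g * q)⁻¹ • a)) • op (single (g * q) (1 : Lam ρ)) • n := by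
      rw [← mul_smul, ← mul_smul, ← op_mul, ← op_mul, SkewMonoidAlgebra.single_mul_single,
        SkewMonoidAlgebra.single_mul_single, smul_one, mul_one, mul_one, one_mul, smul_inv_smul]
    rw [h₁, hl, Equiv.coe_mulLeft, ← mul_smul, ← mul_smul, ← op_mul, ← op_mul,
      SkewMonoidAlgebra.single_mul_single, SkewMonoidAlgebra.single_mul_single, one_smul, mul_one,
      one_mul, one_mul, mul_inv_rev, inv_mul_cancel_right]
  · change p (∑ q : Q, _) = n
    rw [map_sum]
    have h (q : Q) : p (op (single q⁻¹ (1 : Lam ρ)) • s (op (single q (1 : Lam ρ)) • n)) = n := by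
      rw [map_smul, hs, ← mul_smul, ← op_mul, SkewMonoidAlgebra.single_mul_single, mul_inv_cancel,
        smul_one, mul_one]
      exact one_smul _ n
    rw [Finset.sum_congr rfl fun q _ => h q, Finset.sum_const, Finset.card_univ,
      ← Nat.card_eq_fintype_card]
    obtain ⟨k, hk⟩ := hQ
    let _ := Module.compHom N (lamField ρ)
    rw [hk, add_smul, one_smul, mul_comm, mul_smul, two_smul, add_self_of_charTwo F, smul_zero,
      zero_add]

end BGG

namespace BGG

variable {ρ : Representation F Q V} [Module.Finite F V] [CharP F 2]

/-! ## Truncations of Koszul complexes -/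

section

variable {M : DGSymQ ρ}

lemma exists_generalized_inverse (M : DGSymQ ρ) (n : ℤ) : ∃ σ : M.carrier →ₗ[F] M.carrier,
    (∀ m, σ m ∈ M.deg n) ∧ ∀ m ∈ M.deg n, M.d (σ (M.d m)) = M.d m := by
  let d := linField M.d
  obtain ⟨r, hr⟩ := d.rangeRestrict.exists_rightInverse_of_surjective d.range_rangeRestrict
  obtain ⟨g, hg⟩ := r.exists_extend
  refine ⟨internalProj (isInternal_degF M) n ∘ₗ g, fun m => internalProj_mem (isInternal_degF M) n _,
    fun m hm => ?_⟩
  have h₁ : d (g (d m)) = d m := by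
    have h : g (d m) = r ⟨d m, m, rfl⟩ := congr($hg ⟨d m, m, rfl⟩)
    rw [h]
    exact congrArg Subtype.val congr($hr ⟨d m, m, rfl⟩)
  have hd : ∀ n, ∀ a ∈ degF M n, d a ∈ degF M (n + 1) := fun n a ha => M.d_mem ha
  change d (internalProj (isInternal_degF M) n (g (d m))) = d m
  rw [← internalProj_comm _ hd, h₁, internalProj_of_mem _ (hd n m hm), if_pos rfl]

lemma Kos.lam_smul_lin (a : Lam ρ) (φ : Kos M) (μ : Lam ρ) :
    (op (single (1 : Q) a) • φ).lin μ = φ.lin (a * μ) := by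
  rw [Kos.smul_lin, Lam.act_one]
  exact one_smul _ _

variable (M) in
/-- The maps of degree `n` to `M`, or to the cycles of `M` if `c` holds. -/
def Kos.cyc (c : Prop) (n : ℤ) : Submodule (LamQ ρ)ᵐᵒᵖ (Kos M) where
  carrier := { φ | φ ∈ Kos.deg M n ∧ (c → ∀ μ, M.d (φ.lin μ) = 0) }
  zero_mem' := ⟨zero_mem _, fun _ _ => map_zero _⟩
  add_mem' hφ hψ := ⟨add_mem hφ.1 hψ.1, fun h μ => by
    rw [Kos.add_lin, map_add, hφ.2 h, hψ.2 h, add_zero]⟩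
  smul_mem' r φ hφ := ⟨Submodule.smul_mem _ r hφ.1, fun h => smul_mem_of_single
    { carrier := { φ : Kos M | ∀ μ, M.d (φ.lin μ) = 0 }
      zero_mem' := fun _ => map_zero _
      add_mem' := fun hφ hψ μ => by rw [Kos.add_lin, map_add, hφ, hψ, add_zero]
      neg_mem' := fun hφ μ => (map_neg M.d _).trans (neg_eq_zero.2 (hφ μ)) }
    (fun a q φ hφ μ => by
      rw [Kos.smul_lin]
      exact (map_smul M.d _ _).trans ((congrArg _ (hφ _)).trans (smul_zero _))) r (hφ.2 h)⟩

lemma Kos.hasContractions_cyc (c : Prop) (n : ℤ) :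
    HasContractions (opSingleOne (Lam ρ) Q) (Kos.cyc M c n) := by
  refine ⟨fun i => AddMonoidHom.mk' (fun φ => ⟨(φ.1.lin ∘ₗ Lam.pd ρ i : Lam ρ →ₗ[F] M.carrier),
    fun μ => φ.2.1 _, fun h μ => φ.2.2 h _⟩) fun _ _ => rfl,
    fun i r φ => Subtype.ext (Kos.ext fun μ => ?_), fun i j φ => Subtype.ext (Kos.ext fun μ => ?_)⟩
  · refine (Kos.lam_smul_lin _ φ.1 _).trans
      (Eq.trans ?_ (Kos.lam_smul_lin (M := M) _ (φ.1.lin ∘ₗ Lam.pd ρ i : Lam ρ →ₗ[F] _) μ).symm)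
    exact congrArg φ.1.lin (by
      rw [MulOpposite.unop_op, ← Algebra.smul_def, ← Algebra.smul_def, map_smul])
  · refine (congrArg₂ (· + ·) (Kos.lam_smul_lin (yv ρ j) φ.1 (Lam.pd ρ i μ)) (Kos.lam_smul_lin
      (M := M) (yv ρ j) (φ.1.lin ∘ₗ Lam.pd ρ i : Lam ρ →ₗ[F] _) μ)).trans ?_
    change φ.1.lin _ + φ.1.lin (Lam.pd ρ i (yv ρ j * μ)) = _
    rw [Lam.pd_yv_mul, map_add, add_left_comm, add_self_of_charTwo F, add_zero]
    split_ifs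
    exacts [rfl, map_zero _]

lemma kosObj_d_apply {i j : ℤ} (h : i + 1 = j) (x : (kosObj M).X i) :
    ((show Kos.deg M j from (kosObj M).d i j x) : Kos M) = Kos.d M (show Kos.deg M i from x).1 :=
  gradedComplex_d_apply (Kos.deg M) (Kos.d M) (fun _ _ => Kos.d_mem) Kos.d_d h x

/-- The cycles of degree `b` of the Koszul complex are projective over `Λ`. -/
lemma Kos.hasContractions_cycles {b : ℤ}
    (hex : ∀ z ∈ M.deg (b + 1), M.d z = 0 → ∃ y ∈ M.deg b, M.d y = z) :
    HasContractions (opSingleOne (Lam ρ) Q) (truncSub (kosObj M) b b) := by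
  obtain ⟨σ, hσ, hdσ⟩ := exists_generalized_inverse M b
  obtain ⟨τ, hτ, hdτ⟩ := exists_generalized_inverse M (b + 1)
  let P (φ : Kos M) (μ : Lam ρ) : M.carrier := ∑ i, xv ρ i • φ.lin (yv ρ i * μ)
  let tw (c : M.carrier →ₗ[F] M.carrier) : Kos M →+ Kos M := AddMonoidHom.mk' (fun φ =>
    (c ∘ₗ ∑ i, symMul M (xv ρ i) ∘ₗ φ.lin ∘ₗ LinearMap.mulLeft F (yv ρ i) : Lam ρ →ₗ[F] _))
    fun φ ψ => Kos.ext fun μ => by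
      change c ((∑ i, symMul M (xv ρ i) ∘ₗ (φ.lin + ψ.lin) ∘ₗ _ : Lam ρ →ₗ[F] _) μ) = c _ + c _
      rw [← map_add]
      simp [LinearMap.sum_apply, smul_add, Finset.sum_add_distrib]
  have htw (c φ μ) : (tw c φ).lin μ = c (P φ μ) := by
    change c ((∑ i, _ : Lam ρ →ₗ[F] _) μ) = _
    simp [LinearMap.sum_apply, P]
  have hnil (c φ) : (tw c)^[Module.finrank F V + 1] φ = 0 :=
    Kos.iterate_eq_zero (tw c) (fun i => (c ∘ₗ symMul M (xv ρ i)).toAddMonoidHom)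
      (fun φ μ => by rw [htw]; exact map_sum c _ _) φ
  have hd (φ : Kos M) (h : Kos.d M φ = 0) (μ) : P φ μ = M.d (φ.lin μ) := by
    have : M.d (φ.lin μ) + P φ μ = 0 := (Kos.d_lin φ μ).symm.trans (by rw [h]; rfl)
    rw [eq_neg_of_add_eq_zero_right this, neg_eq_of_charTwo (F := F)]
  have h2 (m : M.carrier) : m + m = 0 := add_self_of_charTwo F m
  obtain ⟨U, hU₁, hU₂⟩ := exists_inverse_of_locallyNilpotent (A := Kos M)
    (fun φ => Kos.ext fun μ => h2 _) (tw σ) fun φ => ⟨_, hnil σ φ⟩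
  have hT (φ : Kos M) : tw σ φ ∈ Kos.deg M b := fun μ => by rw [htw]; exact hσ _
  let e : truncSub (kosObj M) b b →+ Kos.cyc M True b := AddMonoidHom.mk' (fun φ =>
    ⟨(show Kos.deg M b from φ.1).1 + tw σ (show Kos.deg M b from φ.1).1,
      add_mem (show Kos.deg M b from φ.1).2 (hT _), fun _ μ => by
      rw [Kos.add_lin, map_add, htw, hd _ ((kosObj_d_apply rfl φ.1).symm.trans
        (congrArg Subtype.val (φ.2.1 le_rfl))), hdσ _ ((show Kos.deg M b from φ.1).2 μ), h2]⟩)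
    fun φ ψ => Subtype.ext ((congrArg _ (map_add (tw σ) _ _)).trans (add_add_add_comm _ _ _ _))
  refine HasContractions.of_bijective e ⟨fun φ ψ h => ?_, fun g => ?_⟩ (fun a φ => ?_)
    (Kos.hasContractions_cyc True b)
  · refine Subtype.ext (Subtype.ext ?_)
    rw [← hU₁ (show Kos.deg M b from φ.1).1, ← hU₁ (show Kos.deg M b from ψ.1).1]
    exact congrArg U (congrArg Subtype.val h)
  · have hg := hU₂ g.1
    generalize U g.1 = φ at hg
    have hφ : φ ∈ Kos.deg M b := by
      rw [eq_sub_of_add_eq hg]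
      exact sub_mem g.2.1 (hT φ)
    have h₀ : Kos.d M φ = 0 := by
      have h : tw ((LinearMap.id + linField M.d ∘ₗ σ) ∘ₗ τ) (Kos.d M φ) = Kos.d M φ := by
        refine Kos.ext fun μ => ?_
        rw [htw, hd _ (Kos.d_d φ)]
        have h₁ : M.d (σ ((Kos.d M φ).lin μ)) = 0 := by
          have h₂ : φ.lin μ + σ (P φ μ) = g.1.lin μ := by rw [← hg, Kos.add_lin, htw]
          have h₃ : M.d (φ.lin μ) + M.d (σ (P φ μ)) = 0 := by
            rw [← map_add, h₂, g.2.2 trivial]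
          rw [Kos.d_lin, map_add, map_add, hdσ _ (hφ μ)]
          exact h₃
        have hm := Kos.d_mem hφ μ
        generalize (Kos.d M φ).lin μ = m at h₁ hm
        change τ (M.d m) + M.d (σ (τ (M.d m))) = m
        obtain ⟨y, hy, hz⟩ := hex (m + τ (M.d m)) (add_mem hm (hτ _)) (by
          rw [map_add, hdτ m hm, h2])
        have h₃ := hdσ y hy
        rw [hz, map_add, map_add, h₁, zero_add] at h₃
        rw [h₃, add_left_comm, h2, add_zero]
      rw [← Function.iterate_fixed h (Module.finrank F V + 1)]
      exact hnil _ _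
    refine ⟨⟨(⟨φ, hφ⟩ : Kos.deg M b), fun _ => Subtype.ext ?_, fun h => absurd h (lt_irrefl b)⟩,
      Subtype.ext hg⟩
    exact (kosObj_d_apply rfl _).trans h₀
  · refine Subtype.ext (Kos.ext fun μ => ?_)
    refine Eq.trans ?_ (Kos.lam_smul_lin a _ μ).symm
    change (op (single (1 : Q) a) • (show Kos.deg M b from φ.1).1).lin μ +
      (tw σ (op (single (1 : Q) a) • (show Kos.deg M b from φ.1).1)).lin μ = _ +
      (tw σ (show Kos.deg M b from φ.1).1).lin (a * μ)
    rw [Kos.lam_smul_lin, htw, htw]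
    congr 2
    exact Finset.sum_congr rfl fun i _ => by
      rw [Kos.lam_smul_lin, ← mul_assoc, Lam.comm ρ a, mul_assoc]

lemma IsSymFree.finite (hM : IsSymFree M) : Module.Finite (Sym ρ) M.carrier := by
  obtain ⟨n, k, b, -⟩ := hM
  exact Module.Finite.of_basis b

variable [HasDerivedCategory.{w} (ModuleCat.{u} (LamQ ρ)ᵐᵒᵖ)]

/-- The truncations of the Koszul complex of a finitely generated free module. -/
lemma IsSymFree.exists_trunc (hM : IsSymFree M) : ∃ b₀ : ℤ, ∀ b ≥ b₀,
    IsBounded (subComplex (kosObj M) (truncSub (kosObj M) b) (truncSub_d b)) ∧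
    Nonempty (DerivedCategory.Q.obj (subComplex (kosObj M) (truncSub (kosObj M) b) (truncSub_d b)) ≅
      DerivedCategory.Q.obj (kosObj M)) := by
  have := hM.finite
  obtain ⟨b₀, hb₀⟩ := Kos.exists_bound (M := M)
  obtain ⟨a, ha⟩ := hM.exists_deg_eq_bot
  refine ⟨b₀, fun b hb => ⟨⟨a, b, fun i hi => ?_⟩, nonempty_iso_trunc fun i hi z hz => ?_⟩⟩
  · have : Subsingleton (truncSub (kosObj M) b i) := subsingleton_of_forall_eq 0 fun x => by
      obtain hi | hi := hi
      · exact Subtype.ext (Subtype.ext (Kos.ext fun μ => ha i hi _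
          ((show Kos.deg M i from x.1).2 μ)))
      · exact Subtype.ext (x.2.2 hi)
    exact @ModuleCat.isZero_of_subsingleton _ _ (ModuleCat.of (LamQ ρ)ᵐᵒᵖ
      (truncSub (kosObj M) b i)) this
  · obtain ⟨y, hy, h⟩ := hb₀ i (by lia) (show Kos.deg M i from z).1 (show Kos.deg M i from z).2
      ((kosObj_d_apply rfl z).symm.trans (congrArg Subtype.val hz))
    rw [sub_eq_add_neg] at hy
    exact ⟨(⟨y, hy⟩ : Kos.deg M (i + -1)), Subtype.ext ((kosObj_d_apply (by ring) _).trans h)⟩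

lemma IsSymFree.lamBounded_kos (hM : IsSymFree M) :
    lamBounded ρ (DerivedCategory.Q.obj (kosObj M)) := by
  obtain ⟨b₀, h⟩ := hM.exists_trunc
  refine ⟨_, (h b₀ le_rfl).1, fun i => ?_, (h b₀ le_rfl).2⟩
  exact ((hM.finiteVia_kos i).of_injective (truncSub (kosObj M) b₀ i).subtype
    Subtype.val_injective).finite

lemma IsSymFree.lamPerf_kos (hM : IsSymFree M) (hf : HasFiniteHomology M) :
    lamPerf ρ (DerivedCategory.Q.obj (kosObj M)) := by
  obtain ⟨b₀, h⟩ := hM.exists_trunc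
  obtain ⟨W, hW, hW'⟩ := hf.exists_finite_cycles
  obtain ⟨b₁, hb₁⟩ := exists_bound_of_finite_cycles (isInternal_degF M) (d := linField M.d)
    (fun n a ha => M.d_mem ha) hW hW'
  let b := max b₀ b₁
  have hb := h b (le_max_left _ _)
  have hp (i : ℤ) : HasContractions (opSingleOne (Lam ρ) Q) (truncSub (kosObj M) b i) := by
    obtain hi | rfl | hi := lt_trichotomy i b
    · refine HasContractions.of_bijective (N := Kos.cyc M False i) (AddMonoidHom.mk'
        (fun φ => ⟨(show Kos.deg M i from φ.1).1, (show Kos.deg M i from φ.1).2, False.elim⟩)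
        fun _ _ => rfl) ⟨fun φ ψ h => ?_, fun φ => ?_⟩ (fun _ _ => rfl) (Kos.hasContractions_cyc _ i)
      · exact Subtype.ext (Subtype.ext (congrArg (fun x : Kos.cyc M False i => x.1) h))
      · exact ⟨⟨(⟨φ.1, φ.2.1⟩ : Kos.deg M i), fun h => by lia, fun h => by lia⟩, rfl⟩
    · refine Kos.hasContractions_cycles fun z hz hdz => ?_
      have := hb₁ (b + 1) (by lia) z hz hdz
      rwa [add_sub_cancel_right] at this
    · have hz (x : truncSub (kosObj M) b i) : x = 0 := Subtype.ext (x.2.2 hi)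
      exact ⟨fun _ => 0, fun _ _ _ => (smul_zero _).symm, fun i j m => by
        rw [hz m, ite_self]; exact (zero_add _).trans (smul_zero _)⟩
  refine ⟨_, hb.1, fun i => ⟨?_, HasContractions.projective (hp i)⟩, hb.2⟩
  have := (hM.finiteVia_kos i).of_injective (truncSub (kosObj M) b i).subtype Subtype.val_injective
  exact FiniteVia.finite (H := toLam (ModuleCat.of _ (truncSub (kosObj M) b i)))
    (φ := (algebraMap F (Lam ρ)).op.comp (RingEquiv.toOpposite F).toRingHom) this

end

end BGG

namespace BGG

variable {ρ : Representation F Q V} [Module.Finite F V] [CharP F 2]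

/-! ## Finiteness of the homology of `Hom_Λ(ε, C)` -/

section

variable {C : LamComplex ρ}

lemma hasContractions_tot (h : ∀ i, HasContractions (opSingleOne (Lam ρ) Q) (C.X i)) :
    ∃ D : Idx F V → Tot C →+ Tot C,
      (∀ j k, ∀ x ∈ Tot.deg C k, D j x ∈ Tot.deg C k) ∧
      (∀ j (r : F) x, D j (r • x) = r • D j x) ∧
      ∀ i j x, D i (op (yv ρ j) • x) + op (yv ρ j) • D i x = if i = j then x else 0 := by
  choose D h₁ h₂ using h
  let E (j) : Tot C →+ Tot C :=
    DirectSum.toAddMonoid fun i => (Tot.incl C i).toAddMonoidHom.comp (D i j)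
  have hE (j i) (x : C.X i) : E j (Tot.incl C i x) = Tot.incl C i (D i j x) :=
    DirectSum.toAddMonoid_of _ _ _
  have hl (r : (LamQ ρ)ᵐᵒᵖ) (i) (x : C.X i) : r • Tot.incl C i x = Tot.incl C i (r • x) :=
    (map_smul (Tot.incl C i) r x).symm
  refine ⟨E, ?_, fun j r x => ?_, fun i j x => ?_⟩
  · rintro j k _ ⟨x, rfl⟩
    exact ⟨D k j x, (hE j k x).symm⟩
  · induction x using Tot.induction with
    | zero => rw [smul_zero, map_zero, smul_zero]
    | add x y hx hy => rw [smul_add, map_add, map_add, hx, hy, smul_add]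
    | hom i x =>
      change E j (lamField ρ r • _) = lamField ρ r • _
      rw [hl, hE, hE, hl]
      exact congrArg _ (h₁ i j r x)
  · induction x using Tot.induction with
    | zero => rw [smul_zero, map_zero, smul_zero, ite_self, add_zero]
    | add x y hx hy =>
      rw [smul_add, map_add, map_add, smul_add, add_add_add_comm, hx, hy]
      split_ifs
      exacts [rfl, add_zero _]
    | hom k x =>
      rw [Tot.lam_smul_def, Tot.lam_smul_def, hl, hE, hE, hl, ← map_add]
      refine (congrArg _ (h₂ k i j x)).trans ?_
      split_ifs
      exacts [rfl, map_zero _]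

lemma exists_homotopy_finEps (h : ∀ i, HasContractions (opSingleOne (Lam ρ) Q) (C.X i)) {a b : ℤ}
    (hC : ∀ i, i < a ∨ b < i → Limits.IsZero (C.X i)) (j : Idx F V) :
    ∃ H B : FinEps C →+ FinEps C,
      (∀ z, (finEpsObj C).d (H z) + H ((finEpsObj C).d z) = B z + xv ρ j • z) ∧
      ∀ z, B^[(b - a + 1).toNat] z = 0 := by
  obtain ⟨D, h₀, h₁, h₂⟩ := hasContractions_tot h
  let ν : Tot C →+ Tot C :=
    (Tot.d C).toAddMonoidHom.comp (D j) + (D j).comp (Tot.d C).toAddMonoidHom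
  have hdl (r : F) (x : Tot C) : Tot.d C (r • x) = r • Tot.d C x := map_smul (Tot.d C) (lamField ρ r) x
  have hν (r : F) (x : Tot C) : ν (r • x) = r • ν x := by
    change Tot.d C (D j _) + D j (Tot.d C _) = r • (Tot.d C (D j x) + D j (Tot.d C x))
    rw [h₁, hdl, hdl, h₁, smul_add]
  have hνm (m : ℕ) (k : ℤ) (x : Tot C) (hx : x ∈ Tot.deg C k) : ν^[m] x ∈ Tot.deg C (k + m) := by
    induction m with
    | zero => simpa using hx
    | succ m ih =>
      rw [Function.iterate_succ_apply', Nat.cast_succ, ← add_assoc]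
      exact add_mem (Tot.d_mem (h₀ _ _ _ ih)) (h₀ _ _ _ (Tot.d_mem ih))
  have hν0 (x : Tot C) : ν^[(b - a + 1).toNat] x = 0 := by
    induction x using Tot.induction with
    | zero => exact iterate_map_zero ν _
    | add x y hx hy => rw [iterate_map_add, hx, hy, add_zero]
    | hom i x =>
      by_cases hi : i < a ∨ b < i
      · have := ModuleCat.subsingleton_of_isZero (hC i hi)
        rw [Subsingleton.elim x 0, map_zero, iterate_map_zero]
      · obtain ⟨y, hy⟩ := hνm (b - a + 1).toNat i _ ⟨x, rfl⟩
        have := ModuleCat.subsingleton_of_isZero (hC (i + (b - a + 1).toNat) (by lia))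
        refine hy.symm.trans ?_
        rw [Subsingleton.elim y 0]
        exact map_zero (Tot.incl C _)
  let H := finLift (C := C) (felemHom.comp (D j))
  let B := finLift (C := C) (felemHom.comp ν)
  have hH (x : Tot C) (s : Sym ρ) : H (felem x s) = felem (D j x) s :=
    finLift_felem _ (fun r x s => by
      change felem (D j (r • x)) s = felem (D j x) (r • s)
      rw [h₁, felem_smul_left]) x s
  have hB (x : Tot C) (s : Sym ρ) : B (felem x s) = felem (ν x) s :=
    finLift_felem _ (fun r x s => by
      change felem (ν (r • x)) s = felem (ν x) (r • s)
      rw [hν, felem_smul_left]) x s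
  refine ⟨H, B, fun z => ?_, fun z => ?_⟩
  · induction z using finEps_induction with
    | add f g hf hg =>
      rw [map_add, map_add, map_add, map_add, map_add, add_add_add_comm, hf, hg, smul_add,
        add_add_add_comm]
    | elem x c =>
      rw [hH, d_felem, d_felem, map_add, map_sum, hH, hB, sym_smul_felem, add_add_add_comm,
        ← felem_add_left, ← Finset.sum_add_distrib]
      refine congrArg (felem (ν x) (xmon ρ c) + ·) ?_
      refine (Finset.sum_eq_single j (fun i _ hi => ?_) fun h => (h (Finset.mem_univ j)).elim).trans ?_
      · rw [hH, ← felem_add_left, add_comm, h₂, if_neg (Ne.symm hi)]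
        exact map_zero (felemHom.flip _)
      · rw [hH, ← felem_add_left, add_comm, h₂, if_pos rfl]
  · have hBm (m : ℕ) (x : Tot C) (s : Sym ρ) : B^[m] (felem x s) = felem (ν^[m] x) s := by
      induction m generalizing x with
      | zero => rfl
      | succ m ih => rw [Function.iterate_succ_apply, hB, ih, Function.iterate_succ_apply]
    induction z using finEps_induction with
    | add f g hf hg => rw [iterate_map_add, hf, hg, add_zero]
    | elem x c =>
      rw [hBm, hν0]
      exact map_zero (felemHom.flip _)

/-- If the terms of a bounded finite complex `C` have contractions, then `Hom_Λ(ε, C)` has finite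
dimensional homology. -/
lemma hasFiniteHomology_finEps (h : ∀ i, HasContractions (opSingleOne (Lam ρ) Q) (C.X i))
    (hC : IsBounded C) (hf : Module.Finite F (Tot C)) : HasFiniteHomology (finEpsObj C) := by
  obtain ⟨a, b, hab⟩ := hC
  have := (isSymFree_finEpsObj hf).finite
  let d : FinEps C →ₗ[Sym ρ] FinEps C :=
    { (finEpsObj C).d with map_smul' := fun s m => d_sym_smul _ s m }
  obtain ⟨W, hW, hW'⟩ := exists_finite_cycles d (b - a + 1).toNat fun j z hz => by
    obtain ⟨H, B, h₁, h₂⟩ := exists_homotopy_finEps h hab j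
    have hd (z) : d (d z) = 0 := (finEpsObj C).d_d z
    have h₁ (z) : d (H z) + H (d z) = B z + xv ρ j • z := h₁ z
    have hc (z) (hz : d z = 0) : d (B z) = 0 := by
      have := congrArg d (h₁ z)
      rwa [hz, map_zero, add_zero, hd, map_add, map_smul, hz, smul_zero, add_zero, eq_comm] at this
    have key (m : ℕ) : d (B^[m] z) = 0 ∧ ∃ y, d y = xv ρ j ^ m • z + B^[m] z := by
      induction m with
      | zero => exact ⟨hz, 0, by
          rw [map_zero, pow_zero, one_smul]; exact (add_self_of_charTwo F z).symm⟩
      | succ m ih =>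
        obtain ⟨hm, y, hy⟩ := ih
        have := h₁ (B^[m] z)
        rw [hm, map_zero, add_zero] at this
        refine ⟨by rw [Function.iterate_succ_apply']; exact hc _ hm, xv ρ j • y + H (B^[m] z), ?_⟩
        rw [map_add, map_smul, hy, this, smul_add, ← mul_smul, ← pow_succ',
          Function.iterate_succ_apply', add_assoc, add_left_comm (xv ρ j • B^[m] z),
          add_self_of_charTwo F, add_zero]
    obtain ⟨-, y, hy⟩ := key (b - a + 1).toNat
    exact ⟨y, by rw [hy, h₂, add_zero]⟩
  exact hasFiniteHomology_of_finite_cycles hW hW'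

end

end BGG

lemma exists_fg_map_eq {R M N : Type*} [Ring R] [AddCommGroup M] [AddCommGroup N] [Module R M]
    [Module R N] {f : M →ₗ[R] N} {P : Submodule R N} (hP : P.FG) (h : P ≤ LinearMap.range f) :
    ∃ W : Submodule R M, W.FG ∧ W.map f = P := by
  classical
  obtain ⟨T, rfl⟩ := hP
  have hT : (T : Set N) ⊆ f '' Set.univ := fun x hx => by
    obtain ⟨y, hy⟩ := h (Submodule.subset_span hx)
    exact ⟨y, trivial, hy⟩
  obtain ⟨S, -, rfl⟩ := Finset.subset_set_image_iff.1 hT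
  exact ⟨_, Submodule.fg_span S.finite_toSet, by rw [Submodule.map_span, Finset.coe_image]⟩

lemma FiniteVia.isNoetherianRing {F A : Type*} [Field F] [Ring A] {φ : F →+* A}
    (hA : FiniteVia φ A) : IsNoetherianRing A := by
  let _ := Module.compHom A φ
  have : Module.Finite F A := hA
  have : IsScalarTower F A A := ⟨fun r a h => mul_smul (φ r) a h⟩
  exact isNoetherian_of_tower F inferInstance

namespace BGG

variable {ρ : Representation F Q V}

/-! ## Bounded complexes with finitely generated terms -/

section

variable [HasDerivedCategory.{w} (ModuleCat.{u} (LamQ ρ)ᵐᵒᵖ)]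

/-- The objects isomorphic to bounded complexes with terms satisfying `P`. -/
def boundedWith (P : ModuleCat.{u} (LamQ ρ)ᵐᵒᵖ → Prop) : ObjectProperty (DLamQ ρ) := fun X =>
  ∃ C : LamComplex ρ, IsBounded C ∧ (∀ i, P (C.X i)) ∧
    Nonempty (DerivedCategory.Q.obj C ≅ X)

variable {P P' : ModuleCat.{u} (LamQ ρ)ᵐᵒᵖ → Prop}

lemma boundedWith_mono (h : ∀ N, P N → P' N) (X : DLamQ ρ) : boundedWith P X → boundedWith P' X :=
  fun ⟨C, h₁, h₂, h₃⟩ => ⟨C, h₁, fun i => h _ (h₂ i), h₃⟩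

lemma boundedWith_iso {X Y : DLamQ ρ} (e : X ≅ Y) : boundedWith P X → boundedWith P Y :=
  fun ⟨C, h₁, h₂, ⟨f⟩⟩ => ⟨C, h₁, h₂, ⟨f ≪≫ e⟩⟩

lemma boundedWith_zero (hP : ∀ N : ModuleCat.{u} (LamQ ρ)ᵐᵒᵖ, Subsingleton N → P N) :
    ∃ Z : DLamQ ρ, Limits.IsZero Z ∧ boundedWith P Z := by
  obtain ⟨C, hC⟩ := Limits.HasZeroObject.zero (C := LamComplex ρ)
  have h (i : ℤ) : Limits.IsZero (C.X i) := Functor.map_isZero (HomologicalComplex.eval _ _ i) hC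
  exact ⟨_, Functor.map_isZero DerivedCategory.Q hC, C,
    ⟨0, 0, fun i _ => h i⟩, fun i => hP _ (ModuleCat.subsingleton_of_isZero (h i)), ⟨Iso.refl _⟩⟩

lemma boundedWith_shift (n : ℤ) (X : DLamQ ρ) : boundedWith P X → boundedWith P (X⟦n⟧) := by
  rintro ⟨C, ⟨a, b, hab⟩, h, ⟨e⟩⟩
  exact ⟨C⟦n⟧, ⟨a - n, b - n, fun i hi => hab (i + n) (by lia)⟩, fun i => h (i + n),
    ⟨(DerivedCategory.Q.commShiftIso n).app C ≪≫ (shiftFunctor _ n).mapIso e⟩⟩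

variable {C : LamComplex ρ}

variable (C) in
/-- The homology of a complex as a quotient of the submodule of cycles. -/
def homologyEquiv (i : ℤ) : C.homology i ≅ (C.sc' (i + -1) i (i + 1)).moduleCatLeftHomologyData.H :=
  ShortComplex.homologyMapIso (C.isoSc' (i + -1) i (i + 1) (by simp; ring) (by simp)) ≪≫
    (C.sc' (i + -1) i (i + 1)).moduleCatHomologyIso

lemma FiniteVia.homology (i : ℤ) (h : FiniteVia (lamField ρ) (C.X i)) :
    FiniteVia (lamField ρ) (C.homology i) := by
  refine FiniteVia.of_iso (homologyEquiv C i).symm ?_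
  have h' : FiniteVia (lamField ρ) (LinearMap.ker (C.d i (i + 1)).hom) :=
    h.of_injective (Submodule.subtype _) Subtype.val_injective
  refine FiniteVia.of_exact (g := (0 : _ →ₗ[(LamQ ρ)ᵐᵒᵖ] PUnit))
    (f := (LinearMap.range (C.sc' (i + -1) i (i + 1)).moduleCatToCycles).mkQ) (fun y => ?_) h' ?_
  · exact ⟨fun _ => Submodule.mkQ_surjective _ y, fun _ => rfl⟩
  · let _ := Module.compHom PUnit (lamField ρ)
    exact Module.Finite.of_finite

lemma exists_finite_cycles_of_homology (i : ℤ) (h : FiniteVia (lamField ρ) (C.homology i)) :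
    ∃ W : Submodule (LamQ ρ)ᵐᵒᵖ (C.X i), W.FG ∧ (∀ w ∈ W, C.d i (i + 1) w = 0) ∧
      ∀ z, C.d i (i + 1) z = 0 → ∃ w ∈ W, ∃ y, C.d (i + -1) i y = w - z := by
  let S := C.sc' (i + -1) i (i + 1)
  have := (FiniteVia.of_iso (homologyEquiv C i) h).finite
  have hfin : Module.Finite (LamQ ρ)ᵐᵒᵖ
    (LinearMap.ker S.g.hom ⧸ LinearMap.range S.moduleCatToCycles) := this
  obtain ⟨W, hW, hW'⟩ := exists_fg_map_eq hfin.1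
    (Submodule.range_mkQ (LinearMap.range S.moduleCatToCycles)).ge
  refine ⟨W.map (LinearMap.ker S.g.hom).subtype, hW.map _, ?_, fun z hz => ?_⟩
  · rintro _ ⟨w, -, rfl⟩
    exact w.2
  · obtain ⟨w, hw, h⟩ : Submodule.mkQ _ (⟨z, hz⟩ : LinearMap.ker S.g.hom) ∈
      W.map (LinearMap.range S.moduleCatToCycles).mkQ := hW' ▸ trivial
    obtain ⟨y, hy⟩ := (Submodule.Quotient.eq _).1 h
    exact ⟨w.1, ⟨w, hw, rfl⟩, y, congrArg Subtype.val hy⟩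

variable [Finite Q] [Module.Finite F V] [CharP F 2]

instance : IsNoetherianRing (LamQ ρ)ᵐᵒᵖ := (finiteVia_lamField (ρ := ρ)).isNoetherianRing

lemma exists_fg_submodules (hC : IsBounded C)
    {W : ∀ i, Submodule (LamQ ρ)ᵐᵒᵖ (C.X i)} (hW : ∀ i, (W i).FG)
    (hdW : ∀ i, ∀ w ∈ W i, C.d i (i + 1) w = 0) :
    ∃ B : ∀ i, Submodule (LamQ ρ)ᵐᵒᵖ (C.X i), (∀ i, (B i).FG) ∧ (∀ i, W i ≤ B i) ∧
      ∀ i j, i + 1 = j → (∀ x ∈ B i, C.d i j x ∈ B j) ∧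
        ∀ y, C.d i j y ∈ B j → ∃ x ∈ B i, C.d i j x = C.d i j y := by
  obtain ⟨a, b, hab⟩ := hC
  have h0 (i : ℤ) (hi : i < a ∨ b < i) (x : C.X i) : x = 0 :=
    (ModuleCat.subsingleton_of_isZero (hab i hi)).elim _ _
  have hdW' (i j : ℤ) (hij : i + 1 = j) : ∀ w ∈ W i, C.d i j w = 0 := hij ▸ hdW i
  have key (c : ℤ) (hc : c ≤ b + 1) : ∃ B : ∀ i, Submodule (LamQ ρ)ᵐᵒᵖ (C.X i), (∀ i, (B i).FG) ∧
      (∀ i, c ≤ i → W i ≤ B i) ∧ ∀ i j, c ≤ i → i + 1 = j → (∀ x ∈ B i, C.d i j x ∈ B j) ∧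
        ∀ y, C.d i j y ∈ B j → ∃ x ∈ B i, C.d i j x = C.d i j y := by
    induction c, hc using Int.leInductionDown with
    | base =>
      refine ⟨fun i => ⊥, fun i => Submodule.fg_bot, fun i hi x hx => h0 i (by lia) x,
        fun i j hi hj => ⟨fun x hx => h0 j (by lia) _, fun y _ => ⟨0, zero_mem _, ?_⟩⟩⟩
      rw [h0 i (by lia) y]
    | pred c hc ih =>
      obtain ⟨B, h₁, h₂, h₃⟩ := ih
      obtain ⟨N, hN, hN'⟩ := exists_fg_map_eq ((h₁ c).of_le (inf_le_left :
        B c ⊓ LinearMap.range (C.d (c - 1) c).hom ≤ B c)) inf_le_right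
      refine ⟨Function.update B (c - 1) (W (c - 1) ⊔ N), fun i => ?_, fun i hi => ?_,
        fun i j hi hj => ?_⟩
      · by_cases h : i = c - 1
        · subst h
          rw [Function.update_self]
          exact (hW _).sup hN
        · rw [Function.update_of_ne h]
          exact h₁ i
      · by_cases h : i = c - 1
        · subst h
          rw [Function.update_self]
          exact le_sup_left
        · rw [Function.update_of_ne h]
          exact h₂ i (by lia)
      · rw [Function.update_of_ne (a := j) (by lia)]
        by_cases h : i = c - 1
        · subst h
          obtain rfl : c = j := by lia
          rw [Function.update_self]
          refine ⟨fun x hx => ?_, fun y hy => ?_⟩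
          · obtain ⟨w, hw, n, hn, rfl⟩ := Submodule.mem_sup.1 hx
            have hw' : C.d (c - 1) c w = 0 := hdW' _ _ (by ring) w hw
            have hn : C.d (c - 1) c n ∈ B c ⊓ LinearMap.range (C.d (c - 1) c).hom :=
              hN' ▸ ⟨n, hn, rfl⟩
            rw [map_add, hw', zero_add]
            exact hn.1
          · obtain ⟨n, hn, h⟩ : C.d (c - 1) c y ∈ N.map (C.d (c - 1) c).hom :=
              hN' ▸ ⟨hy, y, rfl⟩
            exact ⟨n, Submodule.mem_sup_right hn, h⟩
        · rw [Function.update_of_ne h]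
          exact h₃ i j (by lia) hj
  obtain ⟨B, h₁, h₂, h₃⟩ := key (min a (b + 1)) (min_le_right _ _)
  refine ⟨B, h₁, fun i => ?_, fun i j hj => ?_⟩
  · by_cases hi : min a (b + 1) ≤ i
    · exact h₂ i hi
    · exact fun x _ => h0 i (by lia) x ▸ zero_mem _
  · by_cases hi : min a (b + 1) ≤ i
    · exact h₃ i j hi hj
    · have h (x : C.X i) : C.d i j x = 0 := by rw [h0 i (by lia) x, map_zero]
      exact ⟨fun x _ => h x ▸ zero_mem _, fun y _ => ⟨0, zero_mem _, by rw [h, h]⟩⟩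

/-- The bounded complexes with finite homology are isomorphic to those with finite terms. -/
lemma lamBounded_iff (X : DLamQ ρ) : lamBounded ρ X ↔ DerivedCategory.TStructure.t.bounded X ∧
    ∀ i, FiniteVia (lamField ρ) ((DerivedCategory.homologyFunctor (ModuleCat.{u} (LamQ ρ)ᵐᵒᵖ) i).obj X) := by
  constructor
  · rintro ⟨C, ⟨a, b, hab⟩, hC, ⟨e⟩⟩
    have : C.IsStrictlyGE a := (C.isStrictlyGE_iff a).2 fun i hi => hab i (Or.inl hi)
    have : C.IsStrictlyLE b := (C.isStrictlyLE_iff b).2 fun i hi => hab i (Or.inr hi)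
    refine ⟨ObjectProperty.prop_of_iso _ e ⟨⟨a, inferInstance⟩, ⟨b, inferInstance⟩⟩, fun i => ?_⟩
    have := hC i
    exact FiniteVia.of_iso (((DerivedCategory.homologyFunctorFactors _ i).app C).symm ≪≫
      (DerivedCategory.homologyFunctor (ModuleCat.{u} (LamQ ρ)ᵐᵒᵖ) i).mapIso e)
      (FiniteVia.homology i (FiniteVia.of_finite finiteVia_lamField))
  · rintro ⟨⟨⟨a, ha⟩, b, hb⟩, h⟩
    obtain ⟨K, hKa, hKb, ⟨e⟩⟩ := X.exists_iso_Q_obj_of_isGE_of_isLE a b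
    have hK : IsBounded K := ⟨a, b, fun i hi => hi.elim (fun h => (K.isStrictlyGE_iff a).1 hKa i h)
      fun h => (K.isStrictlyLE_iff b).1 hKb i h⟩
    choose W hW hdW hW' using fun i => exists_finite_cycles_of_homology i
      (FiniteVia.of_iso ((DerivedCategory.homologyFunctor (ModuleCat.{u} (LamQ ρ)ᵐᵒᵖ) i).mapIso e ≪≫
        (DerivedCategory.homologyFunctorFactors _ i).app K) (h i))
    obtain ⟨B, hB, hWB, hdB⟩ := exists_fg_submodules hK hW hdW
    have hB' (i j : ℤ) (x : K.X i) (hx : x ∈ B i) : K.d i j x ∈ B j := by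
      by_cases hij : i + 1 = j
      · exact (hdB i j hij).1 x hx
      · rw [K.shape i j hij]
        exact zero_mem _
    obtain ⟨f⟩ := nonempty_iso_subComplex hB' (fun i y hy => (hdB _ _ (by ring)).2 y hy)
      fun i z hz => by
        obtain ⟨w, hw, h⟩ := hW' i z hz
        exact ⟨w, hWB i hw, hdW i w hw, h⟩
    refine ⟨_, ?_, fun i => Module.Finite.iff_fg.2 (hB i), ⟨f ≪≫ e.symm⟩⟩
    obtain ⟨a, b, hab⟩ := hK
    refine ⟨a, b, fun i hi => @ModuleCat.isZero_of_subsingleton _ _ (ModuleCat.of _ (B i)) ?_⟩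
    have := ModuleCat.subsingleton_of_isZero (hab i hi)
    exact inferInstanceAs (Subsingleton (B i))

lemma lamBounded_cone {T : Pretriangulated.Triangle (DLamQ ρ)}
    (hT : T ∈ Pretriangulated.distinguishedTriangles) (h₁ : lamBounded ρ T.obj₁)
    (h₂ : lamBounded ρ T.obj₂) : lamBounded ρ T.obj₃ := by
  rw [lamBounded_iff] at h₁ h₂ ⊢
  refine ⟨ObjectProperty.ext_of_isTriangulatedClosed₃ _ T hT h₁.1 h₂.1, fun i => ?_⟩
  exact FiniteVia.of_exact ((ShortComplex.ShortExact.moduleCat_exact_iff_function_exact _).1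
    (DerivedCategory.HomologySequence.exact₃ T hT i (i + 1))) (h₂.2 i) (h₁.2 (i + 1))

end

end BGG

/-- Finite generation descends along restriction of scalars. -/
lemma Module.finite_of_compHom {A B N : Type*} [Ring A] [Ring B] (θ : A →+* B) [AddCommGroup N]
    [Module B N] (h : letI := Module.compHom N θ; Module.Finite A N) : Module.Finite B N := by
  let _ := Module.compHom N θ
  let _ := Module.compHom B θ
  have : IsScalarTower A B N := ⟨fun a b x => mul_smul (θ a) b x⟩
  exact Module.Finite.of_restrictScalars_finite A B N

namespace BGG

/-! ## The equivalences -/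

section

open Pretriangulated

variable {ρ : Representation F Q V} [Module.Finite F V] [CharP F 2] [Finite Q]
  [HasDerivedCategory.{w} (ModuleCat.{u} (LamQ ρ)ᵐᵒᵖ)]

variable (ρ) in
lemma lamBounded_eq : lamBounded ρ = boundedWith fun N => Module.Finite (LamQ ρ)ᵐᵒᵖ N := rfl

variable (ρ) in
lemma lamPerf_eq : lamPerf ρ = boundedWith fun N => Module.Finite (Lam ρ)ᵐᵒᵖ (toLam N) ∧
    Module.Projective (Lam ρ)ᵐᵒᵖ (toLam N) := rfl

variable (ρ) in
lemma lamQPerf_eq : lamQPerf ρ = boundedWith fun N => Module.Finite (LamQ ρ)ᵐᵒᵖ N ∧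
    Module.Projective (LamQ ρ)ᵐᵒᵖ N := rfl

lemma lamBounded_of_lamPerf (X : DLamQ ρ) : lamPerf ρ X → lamBounded ρ X := by
  rw [lamPerf_eq, lamBounded_eq]
  exact boundedWith_mono (fun N hN => Module.finite_of_compHom (opSingleOne (Lam ρ) Q) (N := N) hN.1) X

lemma nonempty_rightDer_iso {C : LamComplex ρ} (hC : IsBounded C) :
    Nonempty ((QSym ρ).obj (finEpsObj C) ≅ (rightDer ρ).obj (DerivedCategory.Q.obj C)) := by
  obtain ⟨a, b, hab⟩ := hC
  have : IsIso ((finIncl ρ).app C) := isIso_finIncl fun i hi => hab i (Or.inl hi)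
  let e := asIso ((finIncl ρ).app C)
  exact ⟨(QSym ρ).mapIso e ≪≫ (rightDerIso ρ).app C⟩

lemma symPerf_rightDer (X : DLamQ ρ) : lamBounded ρ X → symPerf ρ ((rightDer ρ).obj X) := by
  rintro ⟨C, hC, hfin, ⟨e⟩⟩
  obtain ⟨f⟩ := nonempty_rightDer_iso hC
  obtain ⟨a, b, hab⟩ := hC
  exact ⟨finEpsObj C, isSymFree_finEpsObj (finite_tot hab hfin), ⟨f ≪≫ (rightDer ρ).mapIso e⟩⟩

lemma isIso_counit_of_lamBounded (X : DLamQ ρ) : lamBounded ρ X →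
    IsIso ((derAdj ρ).counit.app X) := by
  rintro ⟨C, ⟨a, b, hab⟩, -, ⟨e⟩⟩
  exact (NatTrans.isIso_app_iff_of_iso _ e).1
    (isIso_counit ρ C (isIso_finIncl fun i hi => hab i (Or.inl hi)))

lemma symPerfHf_rightDer (X : DLamQ ρ) (hX : lamPerf ρ X) : symPerfHf ρ ((rightDer ρ).obj X) := by
  refine (symPerfHf_iff _).2 ⟨symPerf_rightDer X (lamBounded_of_lamPerf X hX), ?_⟩
  obtain ⟨C, hC, hfin, ⟨e⟩⟩ := hX
  obtain ⟨f⟩ := nonempty_rightDer_iso hC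
  refine hasFiniteHomology_of_iso (f ≪≫ (rightDer ρ).mapIso e)
    (hasFiniteHomology_finEps (fun i => ?_) hC ?_)
  · have := (hfin i).2
    exact (HasContractions.of_projective (hasContractions_lam ρ) :
      HasContractions (RingHom.id _) (toLam (C.X i)))
  · obtain ⟨a, b, hab⟩ := hC
    exact finite_tot hab fun i =>
      Module.finite_of_compHom (opSingleOne (Lam ρ) Q) (N := C.X i) (hfin i).1

lemma lamBounded_leftDer (X : DSymQ ρ) : symPerf ρ X → lamBounded ρ ((leftDer ρ).obj X) := by
  rintro ⟨M, hM, ⟨e⟩⟩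
  rw [lamBounded_eq]
  exact boundedWith_iso (((leftDerIso ρ).app M).symm ≪≫ (leftDer ρ).mapIso e)
    ((lamBounded_eq ρ).le _ hM.lamBounded_kos)

lemma lamPerf_leftDer (X : DSymQ ρ) : symPerfHf ρ X → lamPerf ρ ((leftDer ρ).obj X) := by
  rintro ⟨M, hM, hf, ⟨e⟩⟩
  rw [lamPerf_eq]
  exact boundedWith_iso (((leftDerIso ρ).app M).symm ≪≫ (leftDer ρ).mapIso e)
    ((lamPerf_eq ρ).le _ (hM.lamPerf_kos hf))

lemma isIso_unit_of_symPerf (X : DSymQ ρ) : symPerf ρ X → IsIso ((derAdj ρ).unit.app X) := by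
  rintro ⟨M, hM, ⟨e⟩⟩
  obtain ⟨a, ha⟩ := hM.exists_deg_eq_bot
  have : IsIso ((finIncl ρ).app ((kos ρ).obj M)) := isIso_finIncl (a := a) fun i hi =>
    @ModuleCat.isZero_of_subsingleton _ _ (ModuleCat.of (LamQ ρ)ᵐᵒᵖ (Kos.deg M i))
      (subsingleton_of_forall_eq 0 fun x => Subtype.ext (Kos.ext fun μ => ha i hi _ (x.2 μ)))
  exact (NatTrans.isIso_app_iff_of_iso _ e).1 ((isIso_unit_iff ρ M).2 inferInstance)

lemma symPerf_iso {X Y : DSymQ ρ} (e : X ≅ Y) : symPerf ρ X → symPerf ρ Y :=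
  fun ⟨M, hM, ⟨f⟩⟩ => ⟨M, hM, ⟨f ≪≫ e⟩⟩

lemma symPerf_cone {T : Triangle (DSymQ ρ)} (hT : T ∈ DGModule.distinguished (SymQ ρ) (symQDeg ρ))
    (h₁ : symPerf ρ T.obj₁) (h₂ : symPerf ρ T.obj₂) : symPerf ρ T.obj₃ := by
  have := isIso_unit_cone ρ hT (isIso_unit_of_symPerf _ h₁) (isIso_unit_of_symPerf _ h₂)
  have h := lamBounded_cone (leftDer_exact ρ T hT) (lamBounded_leftDer _ h₁) (lamBounded_leftDer _ h₂)
  exact symPerf_iso (asIso ((derAdj ρ).unit.app T.obj₃)).symm (symPerf_rightDer _ h)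

lemma symPerfHf_cone {T : Triangle (DSymQ ρ)} (hT : T ∈ DGModule.distinguished (SymQ ρ) (symQDeg ρ))
    (h₁ : symPerfHf ρ T.obj₁) (h₂ : symPerfHf ρ T.obj₂) : symPerfHf ρ T.obj₃ := by
  rw [symPerfHf_iff] at h₁ h₂ ⊢
  exact ⟨symPerf_cone hT h₁.1 h₂.1, hasFiniteHomology_cone hT h₁.2 h₂.2⟩

lemma lamPerf_cone {T : Triangle (DLamQ ρ)} (hT : T ∈ distinguishedTriangles)
    (h₁ : lamPerf ρ T.obj₁) (h₂ : lamPerf ρ T.obj₂) : lamPerf ρ T.obj₃ := by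
  have := isIso_counit_of_lamBounded _
    (lamBounded_cone hT (lamBounded_of_lamPerf _ h₁) (lamBounded_of_lamPerf _ h₂))
  have h := symPerfHf_cone (rightDer_exact ρ T hT) (symPerfHf_rightDer _ h₁) (symPerfHf_rightDer _ h₂)
  rw [lamPerf_eq]
  exact boundedWith_iso (asIso ((derAdj ρ).counit.app T.obj₃))
    ((lamPerf_eq ρ).le _ (lamPerf_leftDer _ h))

lemma isTriangulatedSubcategory_symPerf :
    IsTriangulatedSubcategory (DGModule.distinguished (SymQ ρ) (symQDeg ρ)) (symPerf ρ) where
  iso := ⟨fun e h => symPerf_iso e h⟩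
  zero := (symPerf_zero ρ).imp fun _ h => ⟨h.1, h.2.1⟩
  shift n _ h := symPerf_shift n h
  cone _ hT h₁ h₂ := symPerf_cone hT h₁ h₂

lemma isTriangulatedSubcategory_symPerfHf :
    IsTriangulatedSubcategory (DGModule.distinguished (SymQ ρ) (symQDeg ρ)) (symPerfHf ρ) where
  iso := ⟨fun e ⟨M, hM, hf, ⟨f⟩⟩ => ⟨M, hM, hf, ⟨f ≪≫ e⟩⟩⟩
  zero := (symPerf_zero ρ).imp fun _ h => ⟨h.1, (symPerfHf_iff _).2 h.2⟩
  shift n X h := by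
    rw [symPerfHf_iff] at h ⊢
    exact ⟨symPerf_shift n h.1, hasFiniteHomology_shift n h.2⟩
  cone _ hT h₁ h₂ := symPerfHf_cone hT h₁ h₂

lemma isTriangulatedSubcategory_lamBounded :
    IsTriangulatedSubcategory distinguishedTriangles (lamBounded ρ) where
  iso := lamBounded_eq ρ ▸ ⟨boundedWith_iso⟩
  zero := lamBounded_eq ρ ▸ boundedWith_zero fun N _ =>
    (inferInstance : Module.Finite (LamQ ρ)ᵐᵒᵖ N)
  shift := lamBounded_eq ρ ▸ boundedWith_shift
  cone _ hT h₁ h₂ := lamBounded_cone hT h₁ h₂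

lemma isTriangulatedSubcategory_lamPerf :
    IsTriangulatedSubcategory distinguishedTriangles (lamPerf ρ) where
  iso := lamPerf_eq ρ ▸ ⟨boundedWith_iso⟩
  zero := lamPerf_eq ρ ▸ boundedWith_zero fun N (hN : Subsingleton N) =>
    have : Subsingleton (toLam N) := hN
    ⟨inferInstance, inferInstance⟩
  shift := lamPerf_eq ρ ▸ boundedWith_shift
  cone _ hT h₁ h₂ := lamPerf_cone hT h₁ h₂

variable (ρ) in
lemma restrictsToEquivalence_symPerf : RestrictsToEquivalence (DGModule.distinguished _ _)
    distinguishedTriangles (derAdj ρ) (symPerf ρ) (lamBounded ρ) where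
  left_triangulated := isTriangulatedSubcategory_symPerf
  right_triangulated := isTriangulatedSubcategory_lamBounded
  map_left := lamBounded_leftDer
  map_right := symPerf_rightDer
  isIso_unit := isIso_unit_of_symPerf
  isIso_counit := isIso_counit_of_lamBounded

variable (ρ) in
lemma restrictsToEquivalence_symPerfHf : RestrictsToEquivalence (DGModule.distinguished _ _)
    distinguishedTriangles (derAdj ρ) (symPerfHf ρ) (lamPerf ρ) where
  left_triangulated := isTriangulatedSubcategory_symPerfHf
  right_triangulated := isTriangulatedSubcategory_lamPerf
  map_left := lamPerf_leftDer
  map_right := symPerfHf_rightDer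
  isIso_unit X h := isIso_unit_of_symPerf X ((symPerfHf_iff X).1 h).1
  isIso_counit X h := isIso_counit_of_lamBounded X (lamBounded_of_lamPerf X h)

lemma lamQPerf_eq_lamPerf (hQ : Odd (Nat.card Q)) : lamQPerf ρ = lamPerf ρ := by
  rw [lamQPerf_eq, lamPerf_eq]
  refine funext fun X => propext ⟨boundedWith_mono (fun N hN => ?_) X,
    boundedWith_mono (fun N hN => ?_) X⟩
  · obtain ⟨_, _⟩ := hN
    refine ⟨?_, HasContractions.projective (HasContractions.of_projective (hasContractions_lamQ ρ) :
      HasContractions (opSingleOne (Lam ρ) Q) N)⟩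
    exact FiniteVia.finite (H := toLam N)
      (φ := (algebraMap F (Lam ρ)).op.comp (RingEquiv.toOpposite F).toRingHom)
      (FiniteVia.of_finite finiteVia_lamField : FiniteVia (lamField ρ) N)
  · exact ⟨Module.finite_of_compHom (opSingleOne (Lam ρ) Q) (N := N) hN.1, projective_lamQ hQ N hN.2⟩

end

end BGG

end

theorem mainTheorem2 {F V Q : Type u} [Field F] [CharP F 2] [AddCommGroup V] [Module F V]
    [Module.Finite F V] [Group Q] [Finite Q] (ρ : Representation F Q V)
    [HasDerivedCategory.{w} (ModuleCat.{u} (BGG.LamQ ρ)ᵐᵒᵖ)] :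
    ∃ (L : BGG.DSymQ ρ ⥤ BGG.DLamQ ρ) (R : BGG.DLamQ ρ ⥤ BGG.DSymQ ρ)
      (α : BGG.QSym ρ ⋙ L ⟶ BGG.tensorEps ρ ⋙ DerivedCategory.Q)
      (β : BGG.homEps ρ ⋙ BGG.QSym ρ ⟶ DerivedCategory.Q ⋙ R)
      (adj : L ⊣ R) (_ : L.CommShift ℤ) (_ : R.CommShift ℤ),
      -- `L` and `R` are the derived functors of `- ⊗_S ε` and `Hom_Λ(ε, -)`
      L.IsLeftDerivedFunctor α (DGModule.quasiIso (BGG.SymQ ρ) (BGG.symQDeg ρ)) ∧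
      R.IsRightDerivedFunctor β (HomologicalComplex.quasiIso _ (ComplexShape.up ℤ)) ∧
      -- the counit of the adjunction is induced by evaluation
      (∀ C : CochainComplex (ModuleCat.{u} (BGG.LamQ ρ)ᵐᵒᵖ) ℤ,
        L.map (β.app C) ≫ adj.counit.app (DerivedCategory.Q.obj C) =
          α.app ((BGG.homEps ρ).obj C) ≫ DerivedCategory.Q.map (BGG.evalHom C)) ∧
      -- the adjoint functors are exact functors of triangulated categories
      adj.CommShift ℤ ∧
      BGG.IsExact (DGModule.distinguished _ _) Pretriangulated.distinguishedTriangles L ∧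
      BGG.IsExact Pretriangulated.distinguishedTriangles (DGModule.distinguished _ _) R ∧
      -- the two equivalences
      BGG.RestrictsToEquivalence (DGModule.distinguished _ _)
        Pretriangulated.distinguishedTriangles adj (BGG.symPerf ρ) (BGG.lamBounded ρ) ∧
      BGG.RestrictsToEquivalence (DGModule.distinguished _ _)
        Pretriangulated.distinguishedTriangles adj (BGG.symPerfHf ρ) (BGG.lamPerf ρ) ∧
      -- the second equivalence for `Q` of odd order
      (Odd (Nat.card Q) → BGG.RestrictsToEquivalence (DGModule.distinguished _ _)
        Pretriangulated.distinguishedTriangles adj (BGG.symPerfHf ρ) (BGG.lamQPerf ρ)) := by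
  exact ⟨BGG.leftDer ρ, BGG.rightDer ρ, BGG.leftDerHom ρ, (BGG.rightDerIso ρ).hom, BGG.derAdj ρ,
    inferInstance, inferInstance, inferInstance, inferInstance, BGG.derAdj_counit ρ, inferInstance,
    BGG.leftDer_exact ρ, BGG.rightDer_exact ρ, BGG.restrictsToEquivalence_symPerf ρ,
    BGG.restrictsToEquivalence_symPerfHf ρ, fun hQ => by
      rw [BGG.lamQPerf_eq_lamPerf hQ]
      exact BGG.restrictsToEquivalence_symPerfHf ρ⟩
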